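/- Let $n\in\{2,3\}$, $d\ge 2$, and let $\Omega\subset\mathbb{R}^n$ be a bounded polyhedral domain with Lipschitz boundary, with a fixed conforming partition $P_0$ into (open, nondegenerate) simplices: their closures cover $\overline\Omega$, different simplices are disjoint, and any two closed simplices meet in a common, possibly empty, face. Equip the simplices of $P_0$ with vertex orderings and types, so that newest vertex bisection is defined: for $\tau=(z_0,\dots,z_n)_\gamma$ with $0\le\gamma\le n-1$ and $m=\frac12(z_0+z_n)$, the children are $(z_0,m,z_1,\dots,z_\gamma,z_{\gamma+1},\dots,z_{n-1})_{\gamma'}$ and $(z_n,m,z_1,\dots,z_\gamma,z_{n-1},\dots,z_{\gamma+1})_{\gamma'}$ with $\gamma'=\gamma+1 \bmod n$. Write $P\preceq P'$ if $P'$ is obtained from $P$ by repeatedly replacing simplices by their children, and let $\mathrm{conf}(P_0)$ be the family of conforming partitions $P$ with $P_0\preceq P$. Let $V=H^1_0(\Omega,\mathbb{R}^n)$ with the $H^1$ norm, $Q=\{q\in L^2(\Omega):\int_\Omega q=0\}$ with the $L^2$ norm, $a(u,v)=\int_\Omega\sum_{i,k}\partial_iu_k\,\partial_iv_k$ and $b(u,q)=\int_\Omega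 q\,\nabla\cdot u$. For $P\in\mathrm{conf}(P_0)$ let $S_P^k$ be the space of functions that are polynomials of degree at most $k$ on each $\tau\in P$, and let $V_P=V\cap(S_P^d)^n$ and $Q_P=Q\cap C(\Omega)\cap S_P^{d-1}$. Assume that there is a constant $C_s$ with $$\|q\|_Q\le C_s\sup_{v\in V_P}\frac{b(v,q)}{\|v\|_V}\qquad\text{for all } P\in\mathrm{conf}(P_0),\ q\in Q_P .$$ For $f\in L^2(\Omega,\mathbb{R}^n)$, the Galerkin approximation $(u_P,p_P)\in V_P\times Q_P$ is characterized by $$a(u_P,v)-b(v,p_P)-b(u_P,q)=\int_\Omega f\cdot v\qquad\text{for all }(v,q)\in V_P\times Q_P .$$ For a subset $R\subset P$ let $E_R$ be the set of edges (faces if $n=3$) shared by two simplices of $R$. With $h_\tau=|\tau|^{1/n}$, $h_e=|e|^{1/(n-1)}$, and $[\partial_\nu u_P]$ the jump of the normal derivative of $u_P$ across $e$, let $$\eta_0(P,R)=\sum_{\tau\in R}h_\tau^2\|f+\Delta u_P-\nabla p_P\|_{L^2(\tau)}^2+\sum_{e\in E_R}h_e\|[\partial_\nu u_P]\|_{L^2(e)}^2,$$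 $$\eta_1(P,R)=\eta_0(P,R)+\sum_{\tau\in R}\|\nabla\cdot u_P\|_{L^2(\tau)}^2,\qquad \eta_2(P,R)=\eta_0(P,R)+\sum_{\tau\in R}h_\tau\|(\nabla\cdot u_P)|_\tau\|_{L^2(\partial\tau)}^2 .$$ Then there are constants $C$, $\alpha>0$ and $\beta$, independent of $f$, $P$, $P'$ and $R$, such that for every $f\in L^2(\Omega,\mathbb{R}^n)$: (i) for all $P,P'\in\mathrm{conf}(P_0)$ with $P\preceq P'$, $$\|u_{P'}-u_P\|_V^2+\|p_{P'}-p_P\|_Q^2\le C\,\eta_1(P,P\setminus P');$$ (ii) for all $P\in\mathrm{conf}(P_0)$ and all $R\subset P$, $$\alpha\,\eta_1(P,R)\le\eta_2(P,R)\le\beta\,\eta_1(P,R).$$ -/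

import Mathlib

open MeasureTheory Set Filter Topology
open scoped InnerProductSpace ContDiff

noncomputable section

namespace Stokes

/-- Euclidean space `ℝⁿ`. -/
abbrev E (n : ℕ) : Type := EuclideanSpace ℝ (Fin n)

/-! ### Lipschitz domains -/

/-- A bounded domain (nonempty, open, connected) with Lipschitz boundary: near each boundary point
the set lies strictly above the graph, over the hyperplane orthogonal to some unit vector `e`, of a
Lipschitz function. The function `φ` is defined on all of `ℝⁿ` and constant in the direction `e`,
i.e. it is a function on the hyperplane. -/
structure IsLipschitzDomain {n : ℕ} (Ω : Set (E n)) : Prop where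
  isOpen : IsOpen Ω
  isConnected : IsConnected Ω
  isBounded : Bornology.IsBounded Ω
  lipschitz : ∀ x ∈ frontier Ω, ∃ (r : ℝ) (e : E n) (φ : E n → ℝ) (K : NNReal),
    0 < r ∧ ‖e‖ = 1 ∧ LipschitzWith K φ ∧ (∀ (y : E n) (t : ℝ), φ (y + t • e) = φ y) ∧
      ∀ y ∈ Metric.ball x r, y ∈ Ω ↔ φ y < ⟪e, y⟫_ℝ

/-! ### Tagged simplices and newest vertex bisection -/

/-- An `n`-simplex with an ordering `z₀, …, zₙ` of its vertices and a type `γ ∈ {0, …, n - 1}`.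
The edge `z₀ zₙ` is the refinement edge. -/
structure TaggedSimplex (n : ℕ) where
  vert : Fin (n + 1) → E n
  tag : Fin n

instance (n : ℕ) : DecidableEq (TaggedSimplex n) := Classical.decEq _

namespace TaggedSimplex

variable {n : ℕ}

/-- The closed simplex `τ̄`. -/
def closed (τ : TaggedSimplex n) : Set (E n) := convexHull ℝ (range τ.vert)

/-- The open simplex `τ`. -/
def openHull (τ : TaggedSimplex n) : Set (E n) := interior τ.closed

/-- The midpoint of the refinement edge (the newest vertex of both children). -/
def newVertex (τ : TaggedSimplex n) : E n := midpoint ℝ (τ.vert 0) (τ.vert (Fin.last n))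

/-- The vertex `z_k`, for a natural number `k ≤ n`. -/
def z (τ : TaggedSimplex n) (k : ℕ) : E n := τ.vert (Fin.ofNat (n + 1) k)

/-- The type `γ + 1 mod n` of the children. -/
def nextTag (τ : TaggedSimplex n) : Fin n :=
  ⟨((τ.tag : ℕ) + 1) % n, Nat.mod_lt _ τ.tag.pos⟩

/-- The child `(z₀, m, z₁, …, z_γ, z_{γ+1}, …, z_{n-1})`, with `m` the new vertex. -/
def child₁ (τ : TaggedSimplex n) : TaggedSimplex n where
  vert j := if (j : ℕ) = 0 then τ.z 0 else if (j : ℕ) = 1 then τ.newVertex else τ.z ((j : ℕ) - 1)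
  tag := τ.nextTag

/-- The child `(zₙ, m, z₁, …, z_γ, z_{n-1}, …, z_{γ+1})`, with `m` the new vertex. -/
def child₂ (τ : TaggedSimplex n) : TaggedSimplex n where
  vert j := if (j : ℕ) = 0 then τ.z n else if (j : ℕ) = 1 then τ.newVertex
    else if (j : ℕ) ≤ (τ.tag : ℕ) + 1 then τ.z ((j : ℕ) - 1)
    else τ.z (n + (τ.tag : ℕ) + 1 - (j : ℕ))
  tag := τ.nextTag

/-- The two children of `τ` under newest vertex bisection. -/
def children (τ : TaggedSimplex n) : Finset (TaggedSimplex n) := {τ.child₁, τ.child₂}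

open Classical in
/-- The facets (edges if `n = 2`, faces if `n = 3`) of `τ`, each given by its `n` vertices. -/
def facets (τ : TaggedSimplex n) : Finset (Finset (E n)) :=
  Finset.univ.image fun i => (Finset.univ.erase i).image τ.vert

/-- The local mesh size `h_τ = |τ|^{1/n}`. -/
def size (τ : TaggedSimplex n) : ℝ := (volume.real τ.closed) ^ ((n : ℝ)⁻¹)

/-- The unit normal of the facet `e` of `τ` that points out of `τ`. -/
def outwardNormal (τ : TaggedSimplex n) (e : Finset (E n)) : E n :=
  open Classical in
  if h : ∃ ν : E n, ‖ν‖ = 1 ∧ ∀ x ∈ e, ∀ i, ⟪ν, τ.vert i - x⟫_ℝ ≤ 0 then h.choose else 0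

/-- The trace from inside `τ` of a function on the open simplex `τ`: its extension by continuity
to the closed simplex. -/
def traceFrom {F : Type*} [TopologicalSpace F] (τ : TaggedSimplex n) (g : E n → F) : E n → F :=
  extendFrom τ.openHull g

end TaggedSimplex

variable {n : ℕ}

/-- `P` is a partition of `Ω` into nondegenerate simplices: the closed simplices cover `closure Ω`
and different open simplices are disjoint. -/
structure IsPartition (Ω : Set (E n)) (P : Finset (TaggedSimplex n)) : Prop where
  nondegenerate : ∀ τ ∈ P, AffineIndependent ℝ τ.vert
  cover : closure Ω = ⋃ τ ∈ P, τ.closed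
  disjoint : ∀ τ ∈ P, ∀ σ ∈ P, τ ≠ σ → Disjoint τ.openHull σ.openHull

/-- Conformity: any two closed simplices meet in a common (possibly empty) face, the one spanned by
their common vertices. -/
def IsConforming (P : Finset (TaggedSimplex n)) : Prop :=
  ∀ τ ∈ P, ∀ σ ∈ P, τ.closed ∩ σ.closed = convexHull ℝ (range τ.vert ∩ range σ.vert)

/-- `P'` is obtained from `P` by replacing zero or more simplices by their children. -/
def BisectStep (P P' : Finset (TaggedSimplex n)) : Prop :=
  ∃ R ⊆ P, P' = (P \ R) ∪ R.biUnion TaggedSimplex.children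

/-- `P ⪯ P'`: `P'` is a refinement of `P`. -/
def Refines (P P' : Finset (TaggedSimplex n)) : Prop := Relation.ReflTransGen BisectStep P P'

/-- The conforming refinements of `P₀`. -/
def conf (P₀ : Finset (TaggedSimplex n)) : Set (Finset (TaggedSimplex n)) :=
  {P | Refines P₀ P ∧ IsConforming P}

open Classical in
/-- The interior facets `E_Q` of a set `Q` of simplices: those shared by two simplices of `Q`. -/
def interiorFacets (Q : Finset (TaggedSimplex n)) : Finset (Finset (E n)) :=
  (Q.biUnion TaggedSimplex.facets).filter fun e =>
    ∃ τ ∈ Q, ∃ σ ∈ Q, τ ≠ σ ∧ e ∈ τ.facets ∧ e ∈ σ.facets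

/-- The `(n-1)`-dimensional surface measure on `ℝⁿ`. -/
def surface (n : ℕ) : Measure (E n) := Measure.euclideanHausdorffMeasure (n - 1)

/-- The closed facet with vertex set `e`. -/
def facetHull (e : Finset (E n)) : Set (E n) := convexHull ℝ (e : Set (E n))

/-- The local mesh size `h_e = |e|^{1/(n-1)}`. -/
def facetSize (e : Finset (E n)) : ℝ := ((surface n).real (facetHull e)) ^ (((n : ℝ) - 1)⁻¹)

/-! ### Sobolev spaces -/

/-- The `i`-th standard basis vector. -/
def basisVec (i : Fin n) : E n := EuclideanSpace.single i 1

/-- The classical partial derivative `∂ᵢ v`. -/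
def partialDeriv (i : Fin n) (v : E n → ℝ) (x : E n) : ℝ := fderiv ℝ v x (basisVec i)

/-- `φ ∈ C_c^∞(Ω)`. -/
def IsTestFunction (Ω : Set (E n)) (φ : E n → ℝ) : Prop :=
  ContDiff ℝ ∞ φ ∧ HasCompactSupport φ ∧ tsupport φ ⊆ Ω

/-- `g` is the weak partial derivative `∂ᵢ v` on `Ω`. -/
def IsWeakPartial (Ω : Set (E n)) (i : Fin n) (v g : E n → ℝ) : Prop :=
  LocallyIntegrableOn v Ω volume ∧ LocallyIntegrableOn g Ω volume ∧
    ∀ φ : E n → ℝ, IsTestFunction Ω φ →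
      ∫ x in Ω, v x * partialDeriv i φ x = - ∫ x in Ω, g x * φ x

/-- The weak partial derivative `∂ᵢ v` on `Ω` (unique almost everywhere on `Ω` if it exists). -/
def weakPartial (Ω : Set (E n)) (i : Fin n) (v : E n → ℝ) : E n → ℝ :=
  open Classical in if h : ∃ g, IsWeakPartial Ω i v g then h.choose else 0

/-- `v ∈ H¹(Ω)`. -/
def MemH1 (Ω : Set (E n)) (v : E n → ℝ) : Prop :=
  MemLp v 2 (volume.restrict Ω) ∧
    ∀ i, ∃ g, IsWeakPartial Ω i v g ∧ MemLp g 2 (volume.restrict Ω)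

/-- `‖v‖²` in `H¹(Ω)`. -/
def normSqH1 (Ω : Set (E n)) (v : E n → ℝ) : ℝ :=
  (∫ x in Ω, v x ^ 2) + ∑ i, ∫ x in Ω, weakPartial Ω i v x ^ 2

/-- `v ∈ H¹₀(Ω)`, the closure of `C_c^∞(Ω)` in `H¹(Ω)`. -/
def MemH10 (Ω : Set (E n)) (v : E n → ℝ) : Prop :=
  MemH1 Ω v ∧ ∀ ε > 0, ∃ φ, IsTestFunction Ω φ ∧ normSqH1 Ω (fun x => v x - φ x) < ε

/-- The velocity space `V = H¹₀(Ω, ℝⁿ)`. -/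
def V (Ω : Set (E n)) : Set (E n → E n) := {u | ∀ k, MemH10 Ω fun x => u x k}

/-- `‖u‖_V²`, the squared `H¹` norm of a vector field. -/
def normSqV (Ω : Set (E n)) (u : E n → E n) : ℝ := ∑ k, normSqH1 Ω fun x => u x k

/-- `‖u‖_V`. -/
def normV (Ω : Set (E n)) (u : E n → E n) : ℝ := √(normSqV Ω u)

/-- The pressure space `Q`: square integrable functions of vanishing mean. -/
def Q (Ω : Set (E n)) : Set (E n → ℝ) :=
  {q | MemLp q 2 (volume.restrict Ω) ∧ ∫ x in Ω, q x = 0}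

/-- `‖q‖_Q²`, the squared `L²` norm. -/
def normSqQ (Ω : Set (E n)) (q : E n → ℝ) : ℝ := ∫ x in Ω, q x ^ 2

/-- `‖q‖_Q`. -/
def normQ (Ω : Set (E n)) (q : E n → ℝ) : ℝ := √(normSqQ Ω q)

/-! ### The Stokes problem and its Taylor–Hood discretization -/

/-- `a(u, v) = ∫_Ω ∑_{i,k} ∂ᵢ u_k ∂ᵢ v_k`. -/
def a (Ω : Set (E n)) (u v : E n → E n) : ℝ :=
  ∫ x in Ω, ∑ i, ∑ k, weakPartial Ω i (fun y => u y k) x * weakPartial Ω i (fun y => v y k) x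

/-- `b(u, q) = ∫_Ω q ∑ᵢ ∂ᵢ uᵢ`. -/
def b (Ω : Set (E n)) (u : E n → E n) (q : E n → ℝ) : ℝ :=
  ∫ x in Ω, q x * ∑ i, weakPartial Ω i (fun y => u y i) x

/-- `v ∈ S_P^d`: on every open simplex of `P`, `v` is a polynomial of degree at most `d`
(so that `v` is bounded almost everywhere). Values on the null set outside the open simplices
are arbitrary. -/
def IsPiecewisePoly (P : Finset (TaggedSimplex n)) (d : ℕ) (v : E n → ℝ) : Prop :=
  ∀ τ ∈ P, ∃ r : MvPolynomial (Fin n) ℝ, r.totalDegree ≤ d ∧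
    ∀ x ∈ τ.openHull, v x = MvPolynomial.eval (fun i => x i) r

/-- The discrete velocity space `V_P = V ∩ (S_P^d)ⁿ`. -/
def VP (Ω : Set (E n)) (P : Finset (TaggedSimplex n)) (d : ℕ) : Set (E n → E n) :=
  {u | u ∈ V Ω ∧ ∀ k, IsPiecewisePoly P d fun x => u x k}

/-- The discrete pressure space `Q_P = Q ∩ C(Ω) ∩ S_P^{d-1}`. -/
def QP (Ω : Set (E n)) (P : Finset (TaggedSimplex n)) (d : ℕ) : Set (E n → ℝ) :=
  {q | q ∈ Q Ω ∧ ContinuousOn q Ω ∧ IsPiecewisePoly P (d - 1) q}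

/-- The discrete inf-sup inequality on `P` with constant `C`:
`‖q‖_Q ≤ C sup_{v ∈ V_P} b(v, q) / ‖v‖_V` for all `q ∈ Q_P`. -/
def InfSupStable (Ω : Set (E n)) (d : ℕ) (C : ℝ) (P : Finset (TaggedSimplex n)) : Prop :=
  ∀ q ∈ QP Ω P d, normQ Ω q ≤ C * ⨆ v : VP Ω P d, b Ω v q / normV Ω v

/-- `(u, p) = (u_P, p_P)` is the Galerkin approximation from `V_P × Q_P` of the solution of the
Stokes problem with right hand side `f`. -/
structure IsGalerkin (Ω : Set (E n)) (d : ℕ) (f : E n → E n) (P : Finset (TaggedSimplex n))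
    (u : E n → E n) (p : E n → ℝ) : Prop where
  mem_VP : u ∈ VP Ω P d
  mem_QP : p ∈ QP Ω P d
  eq : ∀ v ∈ VP Ω P d, ∀ q ∈ QP Ω P d,
    a Ω u v - b Ω v p - b Ω u q = ∫ x in Ω, ⟪f x, v x⟫_ℝ

/-! ### A posteriori error estimators -/

/-- The classical divergence `∇ · u`. -/
def divergence (u : E n → E n) (x : E n) : ℝ := ∑ i, (fderiv ℝ u x (basisVec i)) i

/-- The jump `[∂_ν u]` of the normal derivative across the facet `e`: the sum of the outward normal
derivatives of `u` at `e`, taken from the simplices of `P` adjacent to `e`. -/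
def normalJump (P : Finset (TaggedSimplex n)) (u : E n → E n) (e : Finset (E n)) (x : E n) : E n :=
  open Classical in
  ∑ τ ∈ P.filter (fun τ => e ∈ τ.facets), τ.traceFrom (fderiv ℝ u) x (τ.outwardNormal e)

/-- `η₀(P, Q)`, evaluated for the discrete pair `(u, p)` over `P` and data `f`. -/
def eta0 (f : E n → E n) (u : E n → E n) (p : E n → ℝ) (P Q : Finset (TaggedSimplex n)) : ℝ :=
  (∑ τ ∈ Q, τ.size ^ 2 *
    ∫ x in τ.openHull, ‖f x + Laplacian.laplacian u x - gradient p x‖ ^ 2) +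
  ∑ e ∈ interiorFacets Q, facetSize e * ∫ x in facetHull e, ‖normalJump P u e x‖ ^ 2 ∂(surface n)

/-- `η₁(P, Q) = η₀(P, Q) + ∑_{τ ∈ Q} ‖∇·u‖²_{L²(τ)}`. -/
def eta1 (f : E n → E n) (u : E n → E n) (p : E n → ℝ) (P Q : Finset (TaggedSimplex n)) : ℝ :=
  eta0 f u p P Q + ∑ τ ∈ Q, ∫ x in τ.openHull, divergence u x ^ 2

/-- `η₂(P, Q) = η₀(P, Q) + ∑_{τ ∈ Q} h_τ ‖(∇·u)|_τ‖²_{L²(∂τ)}`. -/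
def eta2 (f : E n → E n) (u : E n → E n) (p : E n → ℝ) (P Q : Finset (TaggedSimplex n)) : ℝ :=
  eta0 f u p P Q +
    ∑ τ ∈ Q, τ.size * ∫ x in frontier τ.openHull, τ.traceFrom (divergence u) x ^ 2 ∂(surface n)

end Stokes

end

/-!
Bisection produces only finitely many similarity classes of simplices (`HasFrame.children`), so all
partitions in question are shape regular with one constant (`exists_shapeRegular_of_refines`), and
every constant below depends on that constant, on `Ω` and on the degree only. The simplices at a
vertex have comparable sizes (`IsMesh.exists_size_le`): their number is bounded, and they are
connected through shared edges, since removing a point does not disconnect a Lipschitz domain near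
that point.

A piecewise polynomial function of `H¹₀` has a Lipschitz representative that vanishes off `Ω`
(`MemH10.exists_lipschitz_rep`), and such functions belong to `H¹₀` (`LipschitzWith.memH10`). Thus
the discrete problem is one about Lipschitz functions and their classical derivatives
(`GalerkinRep`), for which integration by parts is the divergence theorem on a simplex.

Reliability. Write `P` for the coarse and `P'` for the fine partition. The error `(e, r)` is
discrete on `P'`, hence `‖r‖` is bounded through the inf-sup condition on `P'`
(`InfSupStable.sqrt_le`) by the momentum residual on fine velocities and by `∇e`. A fine velocity `v`
has a quasi-interpolant on `P` that equals `v` on the simplices of `P ∩ P'`, which leaves the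
residual unchanged and confines the test field to `P \ P'` (`exists_velocity_quasiInterp`). It is
stable by the Poincaré inequality on stars (`IsMesh.exists_star_poincare`). Integration by parts on
each simplex turns the residual into element terms and jumps over facets between two simplices of
`P \ P'` (`GalerkinRep.residual_eq`), and the trace inequality bounds these by `η₀`
(`GalerkinRep.sq_residual_le`). In the same way, a fine pressure may be replaced by its difference
to a quasi-interpolant
on `P` when tested against the divergence of the coarse velocity (`exists_pressure_quasiInterp`,
`exists_divForm_bound`), which yields the divergence terms of `η₁`. Testing the error equations with
`(e, r)`, and the Friedrichs inequality, give `exists_reliability`.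

Equivalence of the estimators holds simplex by simplex (`exists_eta_equivalence`). The boundary
terms are bounded by the interior ones through an inverse trace estimate
(`exists_boundary_le_integral`). Conversely, the coarse divergence on `τ` is orthogonal to the
pressures that vanish off `τ`, up to their mean, which is irrelevant because divergences have mean
zero. So it is orthogonal to its own interpolant at the interior nodes of `τ`, and what remains of it is
determined by its values on the boundary (`exists_integral_divergence_le`).
-/

noncomputable section

namespace Stokes

open Bornology (IsBounded)
open Finset (mem_filter mul_sum single_le_sum sum_add_distrib sum_comm sum_congr sum_const sum_eq_zero sum_le_sum
  sum_mul sum_nonneg sum_smul sum_sub_distrib sum_subset)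
open Metric (ball closedBall mem_ball ball_mem_nhds ball_subset_ball)

set_option linter.unusedSectionVars false

/-! ### Geometry of a simplex -/

/-- A nondegenerate simplex in `ℝⁿ`, as the family of its vertices. -/
abbrev Simplex (n : ℕ) := AffineBasis (Fin (n + 1)) ℝ (E n)

section Geometry

variable {n : ℕ} (b : Simplex n)

/-- The closed simplex spanned by an affine basis of `ℝⁿ`. -/
def simplex : Set (E n) := convexHull ℝ (range b)

/-- The closed facet of the simplex opposite to the vertex `b i`. -/
def facetOf (i : Fin (n + 1)) : Set (E n) := convexHull ℝ (b '' {i}ᶜ)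

/-- The (constant) gradient of the `i`-th barycentric coordinate. -/
def baryGrad (i : Fin (n + 1)) : E n :=
  (InnerProductSpace.toDual ℝ (E n)).symm (LinearMap.toContinuousLinearMap (b.coord i).linear)

/-- The height of the simplex over the facet opposite to `b i`. -/
def height (i : Fin (n + 1)) : ℝ := ‖baryGrad b i‖⁻¹

/-- The outward unit normal of the facet opposite to `b i`. -/
def normal (i : Fin (n + 1)) : E n := -(‖baryGrad b i‖⁻¹ • baryGrad b i)

theorem inner_baryGrad (i : Fin (n + 1)) (v : E n) :
    ⟪baryGrad b i, v⟫_ℝ = (b.coord i).linear v := by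
  simp [baryGrad]

theorem coord_eq_add_inner (i : Fin (n + 1)) (x y : E n) :
    b.coord i x = b.coord i y + ⟪baryGrad b i, x - y⟫_ℝ := by
  rw [inner_baryGrad, ← vsub_eq_sub, AffineMap.linearMap_vsub]
  simp

theorem continuous_coord (i : Fin (n + 1)) : Continuous (b.coord i) :=
  (b.coord i).continuous_of_finiteDimensional

theorem exists_index_ne [NeZero n] (i : Fin (n + 1)) : ∃ j, j ≠ i :=
  have : Nontrivial (Fin (n + 1)) := Fin.nontrivial_iff_two_le.2 (by have := NeZero.pos n; omega)
  exists_ne i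

theorem baryGrad_ne_zero [NeZero n] (i : Fin (n + 1)) : baryGrad b i ≠ 0 := by
  intro h
  obtain ⟨j, hj⟩ := exists_index_ne i
  have := coord_eq_add_inner b i (b i) (b j)
  simp [h, b.coord_apply_ne hj.symm] at this

theorem norm_baryGrad_pos [NeZero n] (i : Fin (n + 1)) : 0 < ‖baryGrad b i‖ :=
  norm_pos_iff.2 (baryGrad_ne_zero b i)

theorem height_pos [NeZero n] (i : Fin (n + 1)) : 0 < height b i :=
  inv_pos.2 (norm_baryGrad_pos b i)

theorem norm_normal [NeZero n] (i : Fin (n + 1)) : ‖normal b i‖ = 1 := by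
  rw [normal, norm_neg, norm_smul, norm_inv, norm_norm,
    inv_mul_cancel₀ (norm_baryGrad_pos b i).ne']

theorem baryGrad_eq_smul_normal [NeZero n] (i : Fin (n + 1)) :
    baryGrad b i = -(‖baryGrad b i‖ • normal b i) := by
  rw [normal, smul_neg, neg_neg, smul_smul, mul_inv_cancel₀ (norm_baryGrad_pos b i).ne', one_smul]

theorem coord_eq_one_sub [NeZero n] (i : Fin (n + 1)) (x : E n) :
    b.coord i x = 1 - (height b i)⁻¹ * ⟪normal b i, x - b i⟫_ℝ := by
  rw [coord_eq_add_inner b i x (b i), baryGrad_eq_smul_normal, inner_neg_left, inner_smul_left,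
    height, inv_inv]
  simp
  ring

theorem mem_simplex {x : E n} : x ∈ simplex b ↔ ∀ i, 0 ≤ b.coord i x := by
  rw [simplex, b.convexHull_eq_nonneg_coord]; rfl

theorem mem_interior_simplex {x : E n} : x ∈ interior (simplex b) ↔ ∀ i, 0 < b.coord i x := by
  rw [simplex, b.interior_convexHull]; rfl

theorem coord_le_one {x : E n} (hx : x ∈ simplex b) (i : Fin (n + 1)) : b.coord i x ≤ 1 := by
  rw [← b.sum_coord_apply_eq_one x]
  exact single_le_sum (f := fun j => b.coord j x) (fun j _ => (mem_simplex b).1 hx j)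
    (Finset.mem_univ i)

theorem isCompact_simplex : IsCompact (simplex b) :=
  (finite_range b).isCompact_convexHull ℝ

theorem convex_simplex : Convex ℝ (simplex b) := convex_convexHull ℝ _

theorem vertex_mem_simplex (i : Fin (n + 1)) : b i ∈ simplex b :=
  subset_convexHull ℝ _ (mem_range_self i)

theorem facetOf_subset (i : Fin (n + 1)) : facetOf b i ⊆ simplex b :=
  convexHull_mono (image_subset_range _ _)

/-- The convex hull of a set of vertices is cut out of the simplex by the vanishing of the
remaining barycentric coordinates. -/
theorem mem_convexHull_image (s : Set (Fin (n + 1))) {x : E n} :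
    x ∈ convexHull ℝ (b '' s) ↔ x ∈ simplex b ∧ ∀ i ∉ s, b.coord i x = 0 := by
  classical
  constructor
  · intro hx
    refine ⟨convexHull_mono (image_subset_range _ _) hx, fun i hi => ?_⟩
    have hc : Convex ℝ (b.coord i ⁻¹' {0}) := (convex_singleton 0).affine_preimage _
    refine convexHull_min ?_ hc hx
    rintro _ ⟨j, hj, rfl⟩
    exact b.coord_apply_ne (fun h => hi (h ▸ hj))
  · rintro ⟨hx, h0⟩
    rw [← b.linear_combination_coord_eq_self x]
    rw [← sum_subset (Finset.subset_univ (Finset.univ.filter (· ∈ s)))]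
    · refine (convex_convexHull ℝ _).sum_mem (fun j _ => (mem_simplex b).1 hx j) ?_ ?_
      · rw [← b.sum_coord_apply_eq_one x]
        exact sum_subset (Finset.subset_univ _) fun j _ hj => h0 j (by simpa using hj)
      · intro j hj
        exact subset_convexHull ℝ _ ⟨j, by simpa using hj, rfl⟩
    · intro j _ hj
      rw [h0 j (by simpa using hj), zero_smul]

theorem mem_facetOf {i : Fin (n + 1)} {x : E n} :
    x ∈ facetOf b i ↔ x ∈ simplex b ∧ b.coord i x = 0 := by
  rw [facetOf, mem_convexHull_image]; simp

theorem isCompact_facetOf (i : Fin (n + 1)) : IsCompact (facetOf b i) :=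
  ((toFinite _).image _).isCompact_convexHull ℝ

theorem interior_simplex_nonempty : (interior (simplex b)).Nonempty := by
  rw [simplex, interior_convexHull_nonempty_iff_affineSpan_eq_top]
  exact b.tot

theorem volume_simplex_pos : 0 < volume.real (simplex b) := by
  refine ENNReal.toReal_pos ?_ (isCompact_simplex b).measure_lt_top.ne
  exact (Measure.measure_pos_of_nonempty_interior _ (interior_simplex_nonempty b)).ne'

theorem volume_frontier_simplex : volume (frontier (simplex b)) = 0 :=
  (convex_simplex b).addHaar_frontier _

theorem interior_ae_eq_simplex : interior (simplex b) =ᵐ[volume] simplex b :=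
  interior_ae_eq_of_null_frontier (volume_frontier_simplex b)

theorem closure_interior_simplex : closure (interior (simplex b)) = simplex b := by
  rw [(convex_simplex b).closure_interior_eq_closure_of_nonempty_interior
    (interior_simplex_nonempty b), (isCompact_simplex b).isClosed.closure_eq]

theorem frontier_simplex : frontier (simplex b) = ⋃ i, facetOf b i := by
  ext x
  rw [(isCompact_simplex b).isClosed.frontier_eq, Set.mem_sdiff, mem_interior_simplex, mem_iUnion]
  simp only [mem_facetOf, not_forall, not_lt]
  exact ⟨fun ⟨h, i, hi⟩ => ⟨i, h, le_antisymm hi ((mem_simplex b).1 h i)⟩,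
    fun ⟨i, h, hi⟩ => ⟨h, i, hi.le⟩⟩

theorem sum_baryGrad : ∑ i, baryGrad b i = 0 := by
  refine ext_inner_right ℝ fun v => ?_
  rw [sum_inner, inner_zero_left]
  have h1 := b.sum_coord_apply_eq_one (b 0 + v)
  have h2 := b.sum_coord_apply_eq_one (b 0)
  simp_rw [coord_eq_add_inner b _ (b 0 + v) (b 0), sum_add_distrib, h2] at h1
  simpa using h1

/-- A vector is recovered from its barycentric components. -/
theorem sum_inner_baryGrad_smul (v : E n) : ∑ i, ⟪baryGrad b i, v⟫_ℝ • b i = v := by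
  have h1 := b.linear_combination_coord_eq_self (b 0 + v)
  have h2 := b.linear_combination_coord_eq_self (b 0)
  simp_rw [coord_eq_add_inner b _ (b 0 + v) (b 0), add_smul, sum_add_distrib, h2] at h1
  simpa using h1

end Geometry

/-! ### The divergence theorem on a simplex -/

open scoped Pointwise

section Cone

variable {n : ℕ} [NeZero n] (b : Simplex n)

/-- The hyperplane of vectors orthogonal to the normal of a facet. -/
abbrev facetDir (i : Fin (n + 1)) : Submodule ℝ (E n) := (ℝ ∙ normal b i)ᗮ

/-- Orthogonal coordinates at the vertex `b i`: the distance along the normal of the opposite facet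
and the component parallel to that facet. -/
def conePt (i : Fin (n + 1)) (p : ℝ × facetDir b i) : E n := b i + p.1 • normal b i + p.2

theorem finrank_facetDir (i : Fin (n + 1)) : Module.finrank ℝ (facetDir b i) = n - 1 := by
  have h1 := (ℝ ∙ normal b i).finrank_add_finrank_orthogonal
  have h2 : normal b i ≠ 0 := by
    intro h; have := norm_normal b i; simp [h] at this
  rw [finrank_span_singleton h2, finrank_euclideanSpace, Fintype.card_fin] at h1
  exact Nat.eq_sub_of_add_eq' h1

theorem continuous_conePt (i : Fin (n + 1)) : Continuous (conePt b i) := by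
  unfold conePt; fun_prop

theorem measurePreserving_conePt (i : Fin (n + 1)) :
    MeasurePreserving (conePt b i) (volume.prod volume) volume := by
  let ℓ := LinearIsometryEquiv.toSpanUnitSingleton (𝕜 := ℝ) (normal b i) (norm_normal b i)
  have h1 : MeasurePreserving ℓ volume volume := ℓ.measurePreserving
  have h2 := (h1.prod (MeasurePreserving.id (volume : Measure (facetDir b i))))
  have h3 := ((ℝ ∙ normal b i).measurePreserving_measurableEquivProd (b i)).symm
  have h4 : (μHE[Module.finrank ℝ (E n)] : Measure (E n)) = volume :=
    InnerProductSpace.euclideanHausdorffMeasure_eq_volume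
  rw [h4] at h3
  have h5 : conePt b i = ((ℝ ∙ normal b i).measurableEquivProd (b i)).symm ∘ Prod.map ℓ id := by
    funext p
    simp [conePt, ℓ, add_assoc, add_comm]
  rw [h5]
  exact h3.comp h2

theorem measurableEmbedding_conePt (i : Fin (n + 1)) : MeasurableEmbedding (conePt b i) := by
  let ℓ := LinearIsometryEquiv.toSpanUnitSingleton (𝕜 := ℝ) (normal b i) (norm_normal b i)
  have h2 := ((ℓ.toHomeomorph.toMeasurableEquiv.prodCongr
    (MeasurableEquiv.refl (facetDir b i))).trans
    ((ℝ ∙ normal b i).measurableEquivProd (b i)).symm).measurableEmbedding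
  have h5 : conePt b i = ((ℓ.toHomeomorph.toMeasurableEquiv.prodCongr
      (MeasurableEquiv.refl (facetDir b i))).trans
      ((ℝ ∙ normal b i).measurableEquivProd (b i)).symm) := by
    funext p
    change _ = ((ℝ ∙ normal b i).measurableEquivProd (b i)).symm (ℓ p.1, p.2)
    simp only [conePt, LinearIsometryEquiv.toSpanUnitSingleton_apply, ℓ,
      Submodule.measurableEquivProd_symm_apply, vadd_eq_add]
    abel
  rw [h5]
  exact h2

theorem coord_conePt (i : Fin (n + 1)) (p : ℝ × facetDir b i) :
    b.coord i (conePt b i p) = 1 - (height b i)⁻¹ * p.1 := by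
  have h : ⟪normal b i, (p.2 : E n)⟫_ℝ = 0 :=
    Submodule.mem_orthogonal_singleton_iff_inner_right.1 p.2.2
  rw [coord_eq_one_sub, conePt, add_assoc, add_sub_cancel_left, inner_add_right, h,
    inner_smul_right, real_inner_self_eq_norm_sq, norm_normal]
  simp

/-- The facet opposite to `b i` in the orthogonal coordinates of `conePt`. -/
def flatFacet (i : Fin (n + 1)) : Set (facetDir b i) :=
  {y | conePt b i (height b i, y) ∈ facetOf b i}

theorem isometry_conePt (i : Fin (n + 1)) (t : ℝ) : Isometry fun y => conePt b i (t, y) := by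
  refine Isometry.of_dist_eq fun x y => ?_
  simp [conePt, dist_eq_norm, Submodule.coe_norm]

theorem isCompact_flatFacet (i : Fin (n + 1)) : IsCompact (flatFacet b i) :=
  (isometry_conePt b i _).isClosedEmbedding.isCompact_preimage (isCompact_facetOf b i)

theorem facetOf_subset_range (i : Fin (n + 1)) :
    facetOf b i ⊆ range fun y => conePt b i (height b i, y) := by
  intro x hx
  have h0 := ((mem_facetOf b).1 hx).2
  rw [coord_eq_one_sub] at h0
  have h1 : ⟪normal b i, x - b i⟫_ℝ = height b i := by
    have := (height_pos b i).ne'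
    field_simp at h0
    linarith
  refine ⟨⟨x - b i - height b i • normal b i, ?_⟩, ?_⟩
  · rw [Submodule.mem_orthogonal_singleton_iff_inner_right, inner_sub_right, h1,
      inner_smul_right, real_inner_self_eq_norm_sq, norm_normal]
    simp
  · simp [conePt]

theorem surface_restrict_facetOf (i : Fin (n + 1)) :
    (surface n).restrict (facetOf b i) = Measure.map (fun y => conePt b i (height b i, y))
        ((volume : Measure (facetDir b i)).restrict (flatFacet b i)) := by
  have h1 := (isometry_conePt b i (height b i)).map_euclideanHausdorffMeasure (d := n - 1)
  have h2 : (μHE[n - 1] : Measure (facetDir b i)) = volume := by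
    rw [← finrank_facetDir b i]
    exact InnerProductSpace.euclideanHausdorffMeasure_eq_volume
  have hm := (isometry_conePt b i (height b i)).isClosedEmbedding.measurableEmbedding
  have : flatFacet b i = (fun y => conePt b i (height b i, y)) ⁻¹' facetOf b i := rfl
  rw [this, ← hm.restrict_map, ← h2, h1, Measure.restrict_restrict
    (isCompact_facetOf b i).measurableSet, inter_eq_left.2 (facetOf_subset_range b i)]
  rfl

theorem setIntegral_facetOf (i : Fin (n + 1)) (g : E n → ℝ) :
    ∫ x in facetOf b i, g x ∂surface n = ∫ y in flatFacet b i, g (conePt b i (height b i, y)) := by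
  rw [surface_restrict_facetOf,
    (isometry_conePt b i (height b i)).isClosedEmbedding.measurableEmbedding.integral_map]

theorem isFiniteMeasure_surface_facetOf (i : Fin (n + 1)) :
    IsFiniteMeasure ((surface n).restrict (facetOf b i)) := by
  rw [surface_restrict_facetOf]
  have : IsFiniteMeasure ((volume : Measure (facetDir b i)).restrict (flatFacet b i)) :=
    ⟨by rw [Measure.restrict_apply_univ]; exact (isCompact_flatFacet b i).measure_lt_top⟩
  infer_instance

theorem conePt_smul (i : Fin (n + 1)) (s : ℝ) (y : facetDir b i) :
    conePt b i (s * height b i, s • y) = b i + s • (conePt b i (height b i, y) - b i) := by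
  simp only [conePt, Submodule.coe_smul]
  module

theorem conePt_smul_mem_simplex (i : Fin (n + 1)) {s : ℝ} (hs : 0 < s) (hs1 : s ≤ 1)
    (y : facetDir b i) :
    conePt b i (s * height b i, s • y) ∈ simplex b ↔ y ∈ flatFacet b i := by
  have hY : b.coord i (conePt b i (height b i, y)) = 0 := by
    rw [coord_conePt, inv_mul_cancel₀ (height_pos b i).ne', sub_self]
  have key : ∀ j, b.coord j (conePt b i (s * height b i, s • y)) =
      (1 - s) * b.coord j (b i) + s * b.coord j (conePt b i (height b i, y)) := by
    intro j
    rw [conePt_smul, coord_eq_add_inner b j _ (b i),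
      coord_eq_add_inner b j (conePt b i (height b i, y)) (b i), add_sub_cancel_left,
      inner_smul_right]
    ring
  rw [flatFacet, mem_ofPred_eq, mem_facetOf, mem_simplex, mem_simplex]
  constructor
  · intro h
    refine ⟨fun j => ?_, hY⟩
    by_cases hj : j = i
    · rw [hj, hY]
    · have := h j
      rw [key, b.coord_apply_ne hj, mul_zero, zero_add] at this
      exact nonneg_of_mul_nonneg_right this hs
  · rintro ⟨h, -⟩ j
    rw [key]
    have h2 : 0 ≤ b.coord j (b i) := (mem_simplex b).1 (vertex_mem_simplex b i) j
    have := h j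
    have : 0 ≤ 1 - s := by linarith
    positivity

/-- Integration over a simplex in polar coordinates at a vertex. -/
theorem setIntegral_simplex (i : Fin (n + 1)) {φ : E n → ℝ} (hφ : Continuous φ) :
    ∫ x in simplex b, φ x = ∫ y in flatFacet b i, ∫ t in Ioc 0 (height b i),
      (t / height b i) ^ (n - 1) *
        φ (b i + (t / height b i) • (conePt b i (height b i, y) - b i)) := by
  set h := height b i with hh
  have hpos : 0 < h := height_pos b i
  have hslice : ∀ t ∈ Ioc 0 h, ∀ y : facetDir b i,
      conePt b i (t, y) ∈ simplex b ↔ y ∈ (t / h) • flatFacet b i := by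
    intro t ht y
    have hs : 0 < t / h := div_pos ht.1 hpos
    have e := conePt_smul_mem_simplex b i hs (by rw [div_le_one hpos]; exact ht.2) ((t / h)⁻¹ • y)
    rw [smul_smul, mul_inv_cancel₀ hs.ne', one_smul, ← hh, div_mul_cancel₀ _ hpos.ne'] at e
    rw [e, mem_smul_set_iff_inv_smul_mem₀ hs.ne']
  have hmeas : MeasurableSet (conePt b i ⁻¹' simplex b) :=
    (continuous_conePt b i).measurable (isCompact_simplex b).measurableSet
  have hint : IntegrableOn (φ ∘ conePt b i) (conePt b i ⁻¹' simplex b) (volume.prod volume) := by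
    have := (measurePreserving_conePt b i).integrableOn_comp_preimage
      (measurableEmbedding_conePt b i) (f := φ) (s := simplex b)
    rw [this]
    exact hφ.continuousOn.integrableOn_compact (isCompact_simplex b)
  rw [← (measurePreserving_conePt b i).setIntegral_preimage_emb (measurableEmbedding_conePt b i),
    ← integral_indicator hmeas, integral_prod _ (by
      rw [integrable_indicator_iff hmeas]; exact hint)]
  have hstep : ∀ t : ℝ, t ≠ 0 → ∫ y, (conePt b i ⁻¹' simplex b).indicator
        (fun p => φ (conePt b i p)) (t, y) =
      (Ioc 0 h).indicator (fun t => ∫ y in flatFacet b i, (t / h) ^ (n - 1) *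
        φ (b i + (t / h) • (conePt b i (h, y) - b i))) t := by
    intro t ht0
    by_cases ht : t ∈ Ioc 0 h
    · rw [indicator_of_mem ht]
      have hs : 0 < t / h := div_pos ht.1 hpos
      have e1 : ∀ y, (conePt b i ⁻¹' simplex b).indicator (fun p => φ (conePt b i p)) (t, y) =
          ((t / h) • flatFacet b i).indicator (fun y => φ (conePt b i (t, y))) y := by
        intro y
        by_cases hy : y ∈ (t / h) • flatFacet b i
        · rw [indicator_of_mem hy, indicator_of_mem]
          exact (hslice t ht y).2 hy
        · rw [indicator_of_notMem hy, indicator_of_notMem]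
          exact fun h' => hy ((hslice t ht y).1 h')
      simp_rw [e1]
      rw [integral_indicator (((isCompact_flatFacet b i).smul (t / h)).measurableSet)]
      have e2 := Measure.setIntegral_comp_smul (volume : Measure (facetDir b i))
        (fun y => φ (conePt b i (t, y))) (flatFacet b i) hs.ne'
      rw [finrank_facetDir, abs_of_pos (by positivity), smul_eq_mul] at e2
      rw [integral_const_mul]
      have e3 : ∀ y, conePt b i (t, (t / h) • y) = b i + (t / h) • (conePt b i (h, y) - b i) := by
        intro y
        rw [← conePt_smul, ← hh, div_mul_cancel₀ _ hpos.ne']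
      simp_rw [e3] at e2
      rw [e2, ← mul_assoc, mul_inv_cancel₀ (by positivity), one_mul]
    · rw [indicator_of_notMem ht]
      rw [← integral_zero (facetDir b i) ℝ (μ := volume)]
      congr 1
      ext y
      rw [indicator_of_notMem]
      intro hmem
      have h1 := (mem_simplex b).1 hmem i
      have h2 := coord_le_one b hmem i
      rw [coord_conePt, ← hh] at h1 h2
      apply ht
      constructor
      · have : 0 ≤ h⁻¹ * t := by linarith
        have : 0 ≤ t := nonneg_of_mul_nonneg_right this (inv_pos.2 hpos)
        exact lt_of_le_of_ne this (Ne.symm ht0)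
      · have : h⁻¹ * t ≤ 1 := by linarith
        rwa [inv_mul_le_iff₀ hpos, mul_one] at this
  have hstep' : (fun t : ℝ => ∫ y, (conePt b i ⁻¹' simplex b).indicator
        (fun p => φ (conePt b i p)) (t, y)) =ᵐ[volume]
      (Ioc 0 h).indicator (fun t => ∫ y in flatFacet b i, (t / h) ^ (n - 1) *
        φ (b i + (t / h) • (conePt b i (h, y) - b i))) := by
    have : ∀ᵐ t : ℝ, t ≠ 0 := by simp [ae_iff]
    filter_upwards [this] with t ht using hstep t ht
  rw [integral_congr_ae hstep', integral_indicator measurableSet_Ioc]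
  rw [integral_integral_swap]
  have hc : Continuous (Function.uncurry fun (t : ℝ) (y : facetDir b i) => (t / h) ^ (n - 1) *
      φ (b i + (t / h) • (conePt b i (h, y) - b i))) := by
    have := continuous_conePt b i
    unfold Function.uncurry
    fun_prop
  have := hc.continuousOn.integrableOn_compact (μ := volume.prod volume)
    ((isCompact_Icc (a := 0) (b := h)).prod (isCompact_flatFacet b i))
  rw [Measure.prod_restrict]
  exact this.mono_set (prod_mono Ioc_subset_Icc_self subset_rfl)

/-- The divergence theorem for the vector field `x ↦ g x • (x - b i)`, whose flux through all
facets but the one opposite to `b i` vanishes. -/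
theorem cone_formula_smooth (i : Fin (n + 1)) {g : E n → ℝ} (hg : ContDiff ℝ 1 g) :
    ∫ x in simplex b, (n * g x + fderiv ℝ g x (x - b i)) =
      height b i * ∫ x in facetOf b i, g x ∂surface n := by
  have hpos : 0 < height b i := height_pos b i
  have hg' : Continuous (fderiv ℝ g) := hg.continuous_fderiv (by norm_num)
  have hgc := hg.continuous
  rw [setIntegral_simplex b i (by fun_prop), setIntegral_facetOf, ← integral_const_mul]
  refine setIntegral_congr_fun (isCompact_flatFacet b i).measurableSet fun y _ => ?_
  set h := height b i
  set v := conePt b i (h, y) - b i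
  have hd : ∀ t : ℝ, HasDerivAt (fun t => h * ((t / h) ^ n * g (b i + (t / h) • v)))
      ((t / h) ^ (n - 1) * (n * g (b i + (t / h) • v) +
        fderiv ℝ g (b i + (t / h) • v) (b i + (t / h) • v - b i))) t := by
    intro t
    have d0 : HasDerivAt (fun t : ℝ => t / h) (1 / h) t := (hasDerivAt_id t).div_const h
    have d1 : HasDerivAt (fun t : ℝ => b i + (t / h) • v) ((1 / h) • v) t :=
      (d0.smul_const v).const_add _
    have d2 := ((hg.differentiable (by norm_num)) (b i + (t / h) • v)).hasFDerivAt.comp_hasDerivAt t d1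
    have d3 := ((d0.pow n).mul d2).const_mul h
    refine HasDerivAt.congr_deriv (f := fun t => h * ((t / h) ^ n * g (b i + (t / h) • v))) d3 ?_
    obtain ⟨m, hm⟩ := Nat.exists_eq_succ_of_ne_zero (NeZero.ne n)
    have : (t / h) ^ n = (t / h) ^ (n - 1) * (t / h) := by
      rw [← pow_succ, hm]; rfl
    change h * (n * (t / h) ^ (n - 1) * (1 / h) * g (b i + (t / h) • v) +
      (t / h) ^ n * fderiv ℝ g (b i + (t / h) • v) ((1 / h) • v)) = _
    rw [this, add_sub_cancel_left, map_smul, map_smul, smul_eq_mul, smul_eq_mul]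
    field_simp
  have hcont : Continuous fun t : ℝ => (t / h) ^ (n - 1) * (n * g (b i + (t / h) • v) +
        fderiv ℝ g (b i + (t / h) • v) (b i + (t / h) • v - b i)) := by fun_prop
  have := intervalIntegral.integral_eq_sub_of_hasDerivAt (a := 0) (b := h)
    (fun t _ => hd t) (hcont.intervalIntegrable _ _)
  rw [intervalIntegral.integral_of_le hpos.le] at this
  rw [this]
  have hn := NeZero.ne n
  simp [hpos.ne', hn, v]

end Cone

/-! ### Mollification of Lipschitz functions -/

section Mollify

variable {n : ℕ}

/-- A smooth bump function supported in the ball of radius `1 / (k + 1)` around the origin. -/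
def bump (n k : ℕ) : ContDiffBump (0 : E n) :=
  ⟨1 / ((k : ℝ) + 1) / 2, 1 / ((k : ℝ) + 1), by positivity, half_lt_self (by positivity)⟩

open scoped Convolution in
/-- Lipschitz functions are uniform limits of smooth functions with the same Lipschitz constant
whose derivatives converge almost everywhere. -/
theorem exists_smooth_approx {w : E n → ℝ} {K : NNReal} (hw : LipschitzWith K w) :
    ∃ φ : ℕ → E n → ℝ, (∀ k, ContDiff ℝ ∞ (φ k)) ∧ (∀ (k : ℕ) x, |φ k x - w x| ≤ K * (1 / ((k : ℝ) + 1))) ∧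
      (∀ k, LipschitzWith K (φ k)) ∧
      (∀ x, Tendsto (fun k => φ k x) atTop (𝓝 (w x))) ∧
      ∀ᵐ x, Tendsto (fun k => fderiv ℝ (φ k) x) atTop (𝓝 (fderiv ℝ w x)) := by
  let ρ : ℕ → E n → ℝ := fun k => (bump n k).normed volume
  have hρc : ∀ k, Continuous (ρ k) := fun k => (bump n k).continuous_normed
  have hρs : ∀ k, HasCompactSupport (ρ k) := fun k => (bump n k).hasCompactSupport_normed
  have hρ0 : ∀ k x, 0 ≤ ρ k x := fun k x => (bump n k).nonneg_normed x
  have hρi : ∀ k, Integrable (ρ k) := fun k => (hρc k).integrable_of_hasCompactSupport (hρs k)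
  have hρ1 : ∀ k, ∫ x, ρ k x = 1 := fun k => (bump n k).integral_normed
  let φ : ℕ → E n → ℝ := fun k => ρ k ⋆[ContinuousLinearMap.lsmul ℝ ℝ, volume] w
  have hφ : ∀ k x, φ k x = ∫ t, ρ k t * w (x - t) := fun k x => rfl
  have hint : ∀ k x, Integrable fun t => ρ k t * w (x - t) := fun k x =>
    ((hρc k).mul (hw.continuous.comp (continuous_const.sub continuous_id))).integrable_of_hasCompactSupport
      ((hρs k).mul_right)
  have hdiff : ∀ᵐ x, DifferentiableAt ℝ w x := hw.ae_differentiableAt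
  have hder : ∀ k x, fderiv ℝ (φ k) x =
      (ρ k ⋆[ContinuousLinearMap.lsmul ℝ ℝ, volume] (fderiv ℝ w)) x := by
    intro k x
    refine HasFDerivAt.fderiv ?_
    have hmeas : Measurable fun t => fderiv ℝ w (x - t) :=
      (measurable_fderiv ℝ w).comp (measurable_const.sub measurable_id)
    refine (hasFDerivAt_integral_of_dominated_loc_of_lip' (F := fun x t => ρ k t * w (x - t))
      (F' := fun t => ρ k t • fderiv ℝ w (x - t)) (bound := fun t => K * ρ k t) univ_mem
      (fun y _ => (hint k y).aestronglyMeasurable) (hint k x) ?_ ?_ ((hρi k).const_mul _) ?_).2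
    · exact ((hρc k).measurable.smul hmeas).aestronglyMeasurable
    · refine Eventually.of_forall fun t y _ => ?_
      rw [← mul_sub, norm_mul, Real.norm_of_nonneg (hρ0 k t)]
      have := hw.dist_le_mul (y - t) (x - t)
      rw [dist_sub_right, dist_eq_norm, dist_eq_norm] at this
      calc ρ k t * ‖w (y - t) - w (x - t)‖ ≤ ρ k t * (K * ‖y - x‖) := by gcongr; exact hρ0 k t
        _ = _ := by ring
    · have := (Measure.measurePreserving_sub_left (volume : Measure (E n)) x).quasiMeasurePreserving.ae hdiff
      filter_upwards [this] with t ht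
      have h1 := ht.hasFDerivAt.comp x ((hasFDerivAt_id x).sub_const t)
      exact (h1.const_mul (ρ k t))
  have hr : Tendsto (fun k => (bump n k).rOut) atTop (𝓝 0) := tendsto_one_div_add_atTop_nhds_zero_nat
  refine ⟨φ, fun k => ?_, fun k x => ?_, fun k => ?_, fun x =>
    ContDiffBump.convolution_tendsto_right_of_continuous hr hw.continuous x, ?_⟩
  · exact (hρs k).contDiff_convolution_left _ (bump n k).contDiff_normed hw.continuous.locallyIntegrable
  · rw [← Real.dist_eq]
    refine (bump n k).dist_normed_convolution_le hw.continuous.aestronglyMeasurable fun y hy => ?_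
    refine (hw.dist_le_mul y x).trans ?_
    gcongr
    exact (mem_ball.1 hy).le
  · refine LipschitzWith.of_dist_le_mul fun x y => ?_
    rw [Real.dist_eq, hφ, hφ, ← integral_sub (hint k x) (hint k y)]
    calc |∫ t, (ρ k t * w (x - t) - ρ k t * w (y - t))| ≤ ∫ t, ρ k t * (K * dist x y) := by
          rw [← Real.norm_eq_abs]
          refine norm_integral_le_of_norm_le ((hρi k).mul_const _) (.of_forall fun t => ?_)
          rw [← mul_sub, norm_mul, Real.norm_of_nonneg (hρ0 k t), ← dist_eq_norm]
          have := hw.dist_le_mul (x - t) (y - t)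
          rw [dist_sub_right] at this
          gcongr
          exact hρ0 k t
      _ = K * dist x y := by rw [integral_mul_const, hρ1, one_mul]
  · have hloc : LocallyIntegrable (fderiv ℝ w) volume := by
      intro x
      refine ⟨ball x 1, ball_mem_nhds x one_pos, ?_⟩
      refine Measure.integrableOn_of_bounded measure_ball_lt_top.ne
        (measurable_fderiv ℝ w).aestronglyMeasurable (M := K) ?_
      exact Eventually.of_forall fun y => norm_fderiv_le_of_lipschitz ℝ hw
    have := ContDiffBump.ae_convolution_tendsto_right_of_locallyIntegrable (μ := volume) (K := 2)
      (φ := bump n) hr (.of_forall fun k => by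
        change 1 / ((k : ℝ) + 1) ≤ 2 * (1 / ((k : ℝ) + 1) / 2); linarith) hloc
    filter_upwards [this] with x hx
    simpa only [hder] using hx

/-- A Lipschitz function has vanishing derivative almost everywhere on its zero set. -/
theorem ae_fderiv_eq_zero_of_eq_zero {w : E n → ℝ} {K : NNReal} (hw : LipschitzWith K w) :
    ∀ᵐ x, w x = 0 → fderiv ℝ w x = 0 := by
  -- `|w|` is differentiable almost everywhere, and has a minimum at every zero of `w`.
  have habs : LipschitzWith K fun x => |w x| := by
    simpa [Function.comp_def] using lipschitzWith_one_norm.comp hw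
  filter_upwards [habs.ae_differentiableAt] with x hx h0
  have hmin : IsLocalMin (fun x => |w x|) x := Eventually.of_forall fun y => by simp [h0]
  have h1 := hmin.fderiv_eq_zero
  have h2 := hx.hasFDerivAt
  rw [h1] at h2
  refine HasFDerivAt.fderiv ?_
  rw [hasFDerivAt_iff_isLittleO] at h2 ⊢
  refine (h2.norm_left.congr_left fun y => ?_).of_norm_left
  simp [h0]

end Mollify

/-! ### Calculus of Lipschitz functions on a simplex -/

section CauchySchwarz

variable {α : Type*} [MeasurableSpace α] {μ : Measure α}

theorem integral_sq_nonneg (f : α → ℝ) : 0 ≤ ∫ x, f x ^ 2 ∂μ := integral_nonneg fun _ => sq_nonneg _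

theorem sq_integral_mul_le {f g : α → ℝ} (hf : MemLp f 2 μ) (hg : MemLp g 2 μ) :
    (∫ x, f x * g x ∂μ) ^ 2 ≤ (∫ x, f x ^ 2 ∂μ) * ∫ x, g x ^ 2 ∂μ := by
  have h1 : Integrable (fun x => f x ^ 2) μ := hf.integrable_sq
  have h2 : Integrable (fun x => g x ^ 2) μ := hg.integrable_sq
  have h3 : Integrable (fun x => f x * g x) μ := hf.integrable_mul hg
  have key : ∀ t : ℝ, 0 ≤ (∫ x, g x ^ 2 ∂μ) * (t * t) + (2 * ∫ x, f x * g x ∂μ) * t +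
      ∫ x, f x ^ 2 ∂μ := by
    intro t
    have : ∫ x, (f x + t * g x) ^ 2 ∂μ = (∫ x, g x ^ 2 ∂μ) * (t * t) +
        (2 * ∫ x, f x * g x ∂μ) * t + ∫ x, f x ^ 2 ∂μ := by
      rw [← integral_mul_const, ← integral_const_mul, ← integral_mul_const, ← integral_add,
        ← integral_add]
      · congr 1; ext x; ring
      · exact (h2.mul_const _).add ((h3.const_mul _).mul_const _)
      · exact h1
      · exact h2.mul_const _
      · exact (h3.const_mul _).mul_const _
    rw [← this]
    exact integral_nonneg fun x => sq_nonneg _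
  have := discrim_le_zero key
  rw [discrim] at this
  nlinarith

theorem sq_integral_le [IsFiniteMeasure μ] {f : α → ℝ} (hf : MemLp f 2 μ) :
    (∫ x, f x ∂μ) ^ 2 ≤ μ.real univ * ∫ x, f x ^ 2 ∂μ := by
  have := sq_integral_mul_le (μ := μ) (memLp_const (1 : ℝ)) hf
  simpa using this

end CauchySchwarz

section Lip

variable {n : ℕ}

theorem _root_.Bornology.IsBounded.isFiniteMeasure {T : Set (E n)} (hT : IsBounded T) :
    IsFiniteMeasure (volume.restrict T) := ⟨by simpa using hT.measure_lt_top⟩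

theorem memLp_fderiv {w : E n → ℝ} {K : NNReal} (hw : LipschitzWith K w) {T : Set (E n)}
    (hT : volume T ≠ ⊤) : MemLp (fderiv ℝ w) 2 (volume.restrict T) := by
  have : IsFiniteMeasure (volume.restrict T) := ⟨by simpa using hT.lt_top⟩
  exact MemLp.of_bound (measurable_fderiv ℝ w).aestronglyMeasurable K
    (.of_forall fun _ => norm_fderiv_le_of_lipschitz ℝ hw)

theorem memLp_of_continuousOn {F : Type*} [NormedAddCommGroup F] {μ : Measure (E n)} {T : Set (E n)}
    [IsFiniteMeasure (μ.restrict T)] {w : E n → F} (hT : IsCompact T) (hw : ContinuousOn w T) :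
    MemLp w 2 (μ.restrict T) := by
  obtain ⟨A, hA⟩ := hT.exists_bound_of_continuousOn hw
  exact MemLp.of_bound (hw.aestronglyMeasurable hT.measurableSet) A
    (ae_restrict_of_forall_mem hT.measurableSet hA)

theorem continuousOn_memLp {w : E n → ℝ} {T : Set (E n)} (hT : IsCompact T)
    (hw : ContinuousOn w T) : MemLp w 2 (volume.restrict T) :=
  have := hT.isBounded.isFiniteMeasure
  memLp_of_continuousOn hT hw

/-- Being Lipschitz on a set, with some constant. -/
def LipOn (w : E n → ℝ) (T : Set (E n)) : Prop := ∃ K, LipschitzOnWith K w T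

theorem LipOn.mul {v w : E n → ℝ} {T : Set (E n)} (hT : IsCompact T) (hv : LipOn v T)
    (hw : LipOn w T) : LipOn (fun x => v x * w x) T := by
  obtain ⟨K, hK⟩ := hv
  obtain ⟨L, hL⟩ := hw
  obtain ⟨A, hA⟩ := hT.exists_bound_of_continuousOn hK.continuousOn
  obtain ⟨B, hB⟩ := hT.exists_bound_of_continuousOn hL.continuousOn
  refine ⟨A.toNNReal * L + B.toNNReal * K, LipschitzOnWith.of_dist_le_mul fun x hx y hy => ?_⟩
  have h1 := hK.dist_le_mul x hx y hy
  have h2 := hL.dist_le_mul x hx y hy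
  have h3 : ‖v x‖ ≤ A.toNNReal := (hA x hx).trans (Real.le_coe_toNNReal A)
  have h4 : ‖w y‖ ≤ B.toNNReal := (hB y hy).trans (Real.le_coe_toNNReal B)
  rw [Real.dist_eq] at h1 h2 ⊢
  rw [Real.norm_eq_abs] at h3 h4
  calc |v x * w x - v y * w y| = |v x * (w x - w y) + (v x - v y) * w y| := by congr 1; ring
    _ ≤ |v x| * |w x - w y| + |v x - v y| * |w y| := by
      rw [← abs_mul, ← abs_mul]; exact abs_add_le _ _
    _ ≤ A.toNNReal * (L * dist x y) + K * dist x y * B.toNNReal := by gcongr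
    _ = _ := by push_cast; ring

theorem LipOn.of_contDiff {w : E n → ℝ} (hw : ContDiff ℝ 1 w) {T : Set (E n)} (hT : IsCompact T) :
    LipOn w T :=
  LocallyLipschitzOn.exists_lipschitzOnWith_of_compact hT hw.locallyLipschitz.locallyLipschitzOn

theorem fderiv_congr_interior {v w : E n → ℝ} {T : Set (E n)} (h : EqOn v w T) {x : E n}
    (hx : x ∈ interior T) : fderiv ℝ v x = fderiv ℝ w x :=
  (h.eventuallyEq_of_mem (mem_interior_iff_mem_nhds.1 hx)).fderiv_eq

theorem LipOn.ae_differentiableAt {w : E n → ℝ} {T : Set (E n)} (hw : LipOn w T) :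
    ∀ᵐ x, x ∈ interior T → DifferentiableAt ℝ w x := by
  obtain ⟨K, hK⟩ := hw
  obtain ⟨g, hg, he⟩ := hK.extend_real
  filter_upwards [hg.ae_differentiableAt] with x hx hxT
  exact hx.congr_of_eventuallyEq (he.eventuallyEq_of_mem (mem_interior_iff_mem_nhds.1 hxT))

end Lip

open scoped Pointwise

section Div

variable {n : ℕ} [NeZero n] (b : Simplex n)

theorem volume_simplex_ne_top : volume (simplex b) ≠ ⊤ := (isCompact_simplex b).measure_lt_top.ne

theorem ae_simplex_mem_interior : ∀ᵐ x ∂volume.restrict (simplex b), x ∈ interior (simplex b) := by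
  rw [← Measure.restrict_congr_set (interior_ae_eq_simplex b)]
  exact ae_restrict_mem isOpen_interior.measurableSet

theorem LipOn.ae_restrict_differentiableAt {w : E n → ℝ} (hw : LipOn w (simplex b)) :
    ∀ᵐ x ∂volume.restrict (simplex b), DifferentiableAt ℝ w x := by
  filter_upwards [ae_restrict_of_ae hw.ae_differentiableAt, ae_simplex_mem_interior b] with x h1 h2
  exact h1 h2

theorem LipOn.memLp_fderiv {w : E n → ℝ} (hw : LipOn w (simplex b)) :
    MemLp (fderiv ℝ w) 2 (volume.restrict (simplex b)) := by
  obtain ⟨K, hK⟩ := hw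
  obtain ⟨g, hg, he⟩ := hK.extend_real
  refine (memLp_congr_ae ?_).2 (Stokes.memLp_fderiv hg (volume_simplex_ne_top b))
  filter_upwards [ae_simplex_mem_interior b] with x hx using fderiv_congr_interior he hx

theorem LipOn.continuousOn {w : E n → ℝ} {T : Set (E n)} (hw : LipOn w T) : ContinuousOn w T := by
  obtain ⟨K, hK⟩ := hw
  exact hK.continuousOn

theorem continuousOn_integrableOn_facetOf {w : E n → ℝ} (i : Fin (n + 1))
    (hw : ContinuousOn w (facetOf b i)) : IntegrableOn w (facetOf b i) (surface n) := by
  have hT := isCompact_facetOf b i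
  obtain ⟨A, hA⟩ := hT.exists_bound_of_continuousOn hw
  have := isFiniteMeasure_surface_facetOf b i
  exact Integrable.of_bound (hw.aestronglyMeasurable hT.measurableSet) A
    ((ae_restrict_mem hT.measurableSet).mono fun x hx => hA x hx)

theorem cone_formula_lipschitz (i : Fin (n + 1)) {g : E n → ℝ} {K : NNReal}
    (hg : LipschitzWith K g) :
    ∫ x in simplex b, (n * g x + fderiv ℝ g x (x - b i)) =
      height b i * ∫ x in facetOf b i, g x ∂surface n := by
  obtain ⟨φ, hsm, hunif, hlip, hφg, hder⟩ := exists_smooth_approx hg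
  have hbd : ∀ k x, |φ k x| ≤ |g x| + K := by
    intro k x
    have h1 := hunif k x
    have h2 : (1 : ℝ) / (k + 1) ≤ 1 := by
      rw [div_le_one (by positivity)]; linarith [(Nat.cast_nonneg k : (0 : ℝ) ≤ k)]
    have h3 : (K : ℝ) * (1 / (k + 1)) ≤ K * 1 := by gcongr
    have := abs_sub_abs_le_abs_sub (φ k x) (g x)
    linarith
  have hT := isCompact_simplex b
  have hF := isCompact_facetOf b i
  have h1 : Tendsto (fun k => ∫ x in simplex b, (n * φ k x + fderiv ℝ (φ k) x (x - b i))) atTop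
      (𝓝 (∫ x in simplex b, (n * g x + fderiv ℝ g x (x - b i)))) := by
    refine tendsto_integral_of_dominated_convergence
      (fun x => n * (|g x| + K) + K * ‖x - b i‖) (fun k => ?_) ?_ (fun k => ?_) ?_
    · have := (hsm k).continuous_fderiv (by norm_num)
      have := (hsm k).continuous
      exact Continuous.aestronglyMeasurable (by fun_prop)
    · have := hg.continuous
      exact ContinuousOn.integrableOn_compact hT (Continuous.continuousOn (by fun_prop))
    · refine Eventually.of_forall fun x => ?_
      refine (norm_add_le _ _).trans (add_le_add ?_ ?_)
      · rw [norm_mul, Real.norm_natCast]; gcongr; exact hbd k x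
      · exact ContinuousLinearMap.le_of_opNorm_le _ (norm_fderiv_le_of_lipschitz ℝ (hlip k)) _
    · filter_upwards [ae_restrict_of_ae hder] with x hx
      exact ((hφg x).const_mul _).add (((ContinuousLinearMap.apply ℝ ℝ (x - b i)).continuous.tendsto
        _).comp hx)
  have h2 : Tendsto (fun k => height b i * ∫ x in facetOf b i, φ k x ∂surface n) atTop
      (𝓝 (height b i * ∫ x in facetOf b i, g x ∂surface n)) := by
    refine Tendsto.const_mul _ (tendsto_integral_of_dominated_convergence
      (fun x => |g x| + K) (fun k => (hsm k).continuous.aestronglyMeasurable) ?_ (fun k =>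
      Eventually.of_forall fun x => hbd k x) (.of_forall hφg))
    have := hg.continuous
    exact continuousOn_integrableOn_facetOf b i (Continuous.continuousOn (by fun_prop))
  refine tendsto_nhds_unique h1 (h2.congr fun k => ?_)
  exact (cone_formula_smooth b i ((hsm k).of_le (by norm_cast))).symm

theorem cone_formula (i : Fin (n + 1)) {g : E n → ℝ} (hg : LipOn g (simplex b)) :
    ∫ x in simplex b, (n * g x + fderiv ℝ g x (x - b i)) =
      height b i * ∫ x in facetOf b i, g x ∂surface n := by
  obtain ⟨K, hK⟩ := hg
  obtain ⟨f, hf, he⟩ := hK.extend_real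
  rw [setIntegral_congr_fun (isCompact_facetOf b i).measurableSet
    (fun x hx => he (facetOf_subset b i hx)), ← cone_formula_lipschitz b i hf]
  refine integral_congr_ae ?_
  filter_upwards [ae_simplex_mem_interior b] with x hx
  rw [he (interior_subset hx), fderiv_congr_interior he hx]

/-- The volume of a simplex in terms of the height and the area of a facet. -/
theorem height_mul_surface (i : Fin (n + 1)) :
    height b i * (surface n).real (facetOf b i) = n * volume.real (simplex b) := by
  have := cone_formula b i (g := fun _ => 1) (LipOn.of_contDiff contDiff_const (isCompact_simplex b))
  simp only [fderiv_fun_const, Pi.zero_apply, _root_.zero_apply] at this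
  simpa [mul_comm] using this.symm

theorem LipOn.integrable_fderiv_apply {g : E n → ℝ} (hg : LipOn g (simplex b)) (c : E n) :
    Integrable (fun x => fderiv ℝ g x (x - c)) (volume.restrict (simplex b)) := by
  have : IsFiniteMeasure (volume.restrict (simplex b)) :=
    ⟨by simpa using (volume_simplex_ne_top b).lt_top⟩
  have hg2 : Integrable (fderiv ℝ g) (volume.restrict (simplex b)) :=
    (hg.memLp_fderiv b).integrable (by norm_num)
  obtain ⟨A, hA⟩ := (isCompact_simplex b).exists_bound_of_continuousOn
    (f := fun x => x - c) (by fun_prop)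
  refine Integrable.mono' (hg2.norm.mul_const A) ?_ ?_
  · exact ContinuousLinearMap.aestronglyMeasurable_comp₂
      (L := (ContinuousLinearMap.id ℝ (E n →L[ℝ] ℝ)))
      hg2.aestronglyMeasurable (Continuous.aestronglyMeasurable (by fun_prop))
  · filter_upwards [ae_restrict_mem (isCompact_simplex b).measurableSet] with x hx
    exact (ContinuousLinearMap.le_opNorm _ _).trans (by gcongr; exact hA x hx)

/-- The divergence theorem on a simplex. -/
theorem divergence_theorem {g : E n → ℝ} (hg : LipOn g (simplex b)) (v : E n) :
    ∫ x in simplex b, fderiv ℝ g x v =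
      ∑ i, ⟪normal b i, v⟫_ℝ * ∫ x in facetOf b i, g x ∂surface n := by
  have hg1 : IntegrableOn g (simplex b) := hg.continuousOn.integrableOn_compact (isCompact_simplex b)
  have hg3 := hg.integrable_fderiv_apply b
  have key : ∀ i, ⟪normal b i, v⟫_ℝ * ∫ x in facetOf b i, g x ∂surface n =
      -(⟪baryGrad b i, v⟫_ℝ * ∫ x in simplex b, (n * g x + fderiv ℝ g x (x - b i))) := by
    intro i
    rw [cone_formula b i hg, normal, inner_neg_left, inner_smul_left, height]
    simp
    ring
  simp_rw [key, Finset.sum_neg_distrib, ← integral_const_mul]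
  rw [← integral_finsetSum Finset.univ (f := fun i x => ⟪baryGrad b i, v⟫_ℝ *
    (n * g x + fderiv ℝ g x (x - b i)))
    (fun i _ => ((hg1.const_mul _).add (hg3 _)).const_mul _), ← integral_neg]
  congr 1
  ext x
  have h1 : ∑ i, ⟪baryGrad b i, v⟫_ℝ = 0 := by rw [← sum_inner, sum_baryGrad, inner_zero_left]
  have h2 : ∑ i, ⟪baryGrad b i, v⟫_ℝ • (x - b i) = -v := by
    simp_rw [smul_sub, sum_sub_distrib, ← sum_smul, h1, sum_inner_baryGrad_smul]
    simp
  simp_rw [mul_add, sum_add_distrib, ← sum_mul, h1]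
  have h3 := congrArg (fderiv ℝ g x) h2
  rw [map_sum, map_neg] at h3
  simp_rw [map_smul, smul_eq_mul] at h3
  rw [h3]
  simp

/-- Trace inequality on a simplex. -/
theorem trace_inequality (i : Fin (n + 1)) {w : E n → ℝ} (hw : LipOn w (simplex b)) {D : ℝ}
    (hD : ∀ x ∈ simplex b, ‖x - b i‖ ≤ D) :
    height b i * ∫ x in facetOf b i, w x ^ 2 ∂surface n ≤
      (n + 1) * (∫ x in simplex b, w x ^ 2) + D ^ 2 * ∫ x in simplex b, ‖fderiv ℝ w x‖ ^ 2 := by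
  have hT := isCompact_simplex b
  have hsq : LipOn (fun x => w x ^ 2) (simplex b) := by
    simpa only [sq] using hw.mul hT hw
  have h1 : IntegrableOn (fun x => w x ^ 2) (simplex b) :=
    hsq.continuousOn.integrableOn_compact hT
  have h2 : Integrable (fun x => ‖fderiv ℝ w x‖ ^ 2) (volume.restrict (simplex b)) :=
    (hw.memLp_fderiv b).norm.integrable_sq
  rw [← cone_formula b i hsq, ← integral_const_mul, ← integral_const_mul,
    ← integral_add (h1.const_mul _) (h2.const_mul _)]
  refine integral_mono_ae ((h1.const_mul _).add (hsq.integrable_fderiv_apply b _))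
    ((h1.const_mul _).add (h2.const_mul _)) ?_
  filter_upwards [hw.ae_restrict_differentiableAt b, ae_restrict_mem hT.measurableSet] with x hx hxT
  have hd : fderiv ℝ (fun x => w x ^ 2) x = (2 * w x) • fderiv ℝ w x := by
    simpa using (hx.hasFDerivAt.pow 2).fderiv
  rw [hd, _root_.smul_apply, smul_eq_mul]
  have h3 : |fderiv ℝ w x (x - b i)| ≤ ‖fderiv ℝ w x‖ * D :=
    (ContinuousLinearMap.le_opNorm (fderiv ℝ w x) _).trans (mul_le_mul_of_nonneg_left (hD x hxT) (norm_nonneg (fderiv ℝ w x)))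
  have h4 : |fderiv ℝ w x (x - b i)| ^ 2 ≤ (‖fderiv ℝ w x‖ * D) ^ 2 := by gcongr
  rw [sq_abs] at h4
  nlinarith [sq_nonneg (w x - fderiv ℝ w x (x - b i))]

/-- The mean of a function over a set. -/
def meanOn (T : Set (E n)) (w : E n → ℝ) : ℝ := (volume.real T)⁻¹ * ∫ x in T, w x

/-- Averaging over the endpoint `y` only, and over the half of each segment that is close to `y`,
keeps the contraction of the change of variables bounded. -/
theorem poincare_half {T : Set (E n)} (hT : IsCompact T) (hc : Convex ℝ T) {φ : E n → ℝ}
    (hφ : ContDiff ℝ 1 φ) {D : ℝ} (hD : ∀ x ∈ T, ∀ y ∈ T, ‖x - y‖ ≤ D) {x : E n} (hx : x ∈ T) :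
    ∫ y in T, (φ y - φ (x + (2⁻¹ : ℝ) • (y - x))) ^ 2 ≤
      D ^ 2 * 2 ^ n / 4 * ∫ y in T, ‖fderiv ℝ φ y‖ ^ 2 := by
  set G : E n → ℝ := fun y => ‖fderiv ℝ φ y‖ ^ 2
  have hφ' : Continuous (fderiv ℝ φ) := hφ.continuous_fderiv (by norm_num)
  have hG : Continuous G := by fun_prop
  have hφc := hφ.continuous
  have hG0 : ∀ y, 0 ≤ G y := fun y => sq_nonneg _
  have hGi : 0 ≤ ∫ y in T, G y := integral_nonneg hG0
  have h1 : ∀ y ∈ T, (φ y - φ (x + (2⁻¹ : ℝ) • (y - x))) ^ 2 ≤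
      D ^ 2 / 2 * ∫ t in Ioc (2⁻¹ : ℝ) 1, G (x + t • (y - x)) := by
    intro y hy
    have hd : ∀ t : ℝ, HasDerivAt (fun t => φ (x + t • (y - x)))
        (fderiv ℝ φ (x + t • (y - x)) (y - x)) t := by
      intro t
      have d1 : HasDerivAt (fun t : ℝ => x + t • (y - x)) ((1 : ℝ) • (y - x)) t :=
        ((hasDerivAt_id t).smul_const _).const_add _
      rw [one_smul] at d1
      exact ((hφ.differentiable (by norm_num)) _).hasFDerivAt.comp_hasDerivAt t d1
    have hcont : Continuous fun t : ℝ => fderiv ℝ φ (x + t • (y - x)) (y - x) := by fun_prop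
    have h2 := intervalIntegral.integral_eq_sub_of_hasDerivAt (a := 2⁻¹) (b := 1)
      (fun t _ => hd t) (hcont.intervalIntegrable _ _)
    rw [intervalIntegral.integral_of_le (by norm_num)] at h2
    simp only [one_smul, add_sub_cancel] at h2
    rw [← h2]
    have h3 : MemLp (fun t : ℝ => fderiv ℝ φ (x + t • (y - x)) (y - x)) 2
        (volume.restrict (Ioc (2⁻¹ : ℝ) 1)) := by
      obtain ⟨A, hA⟩ := (isCompact_Icc (a := (2⁻¹ : ℝ)) (b := 1)).exists_bound_of_continuousOn
        hcont.continuousOn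
      exact MemLp.of_bound hcont.aestronglyMeasurable A ((ae_restrict_mem measurableSet_Ioc).mono
        fun t ht => hA t (Ioc_subset_Icc_self ht))
    refine (sq_integral_le h3).trans ?_
    have h4 : (volume.restrict (Ioc (2⁻¹ : ℝ) 1)).real univ = 1 / 2 := by
      simp [Measure.real]; norm_num
    rw [h4, show D ^ 2 / 2 = 1 / 2 * D ^ 2 by ring, mul_assoc,
      ← integral_const_mul (D ^ 2)]
    have hci : Continuous fun t : ℝ => D ^ 2 * G (x + t • (y - x)) := by fun_prop
    refine mul_le_mul_of_nonneg_left (integral_mono h3.integrable_sq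
      (hci.integrableOn_Icc.mono_set Ioc_subset_Icc_self) fun t => ?_) (by norm_num : (0 : ℝ) ≤ 1 / 2)
    · have h5 := ContinuousLinearMap.le_opNorm (fderiv ℝ φ (x + t • (y - x))) (y - x)
      have h6 := hD y hy x hx
      calc (fderiv ℝ φ (x + t • (y - x)) (y - x)) ^ 2
          = ‖fderiv ℝ φ (x + t • (y - x)) (y - x)‖ ^ 2 := by rw [Real.norm_eq_abs, sq_abs]
        _ ≤ (‖fderiv ℝ φ (x + t • (y - x))‖ * D) ^ 2 := by gcongr; exact h5.trans (by gcongr)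
        _ = _ := by simp only [G]; ring
  have h2 : ∀ t ∈ Ioc (2⁻¹ : ℝ) 1, ∫ y in T, G (x + t • (y - x)) ≤ 2 ^ n * ∫ y in T, G y := by
    intro t ht
    have ht0 : 0 < t := lt_trans (by norm_num) ht.1
    have e := Measure.setIntegral_comp_smul (volume : Measure (E n))
      (fun z => G ((1 - t) • x + z)) T ht0.ne'
    have e1 : ∀ y, G (x + t • (y - x)) = G ((1 - t) • x + t • y) := fun y => by congr 1; module
    simp_rw [e1, e]
    rw [finrank_euclideanSpace, Fintype.card_fin, abs_of_pos (by positivity), smul_eq_mul]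
    have e2 := (measurePreserving_add_left (volume : Measure (E n)) ((1 - t) • x)).setIntegral_preimage_emb
      (measurableEmbedding_addLeft _) G ((fun z => (1 - t) • x + z) '' (t • T))
    rw [preimage_image_eq _ (add_right_injective _)] at e2
    rw [e2]
    have hsub : (fun z => (1 - t) • x + z) '' (t • T) ⊆ T := by
      rintro _ ⟨_, ⟨y, hy, rfl⟩, rfl⟩
      exact hc hx hy (by linarith [ht.2]) ht0.le (by ring)
    gcongr
    · rw [← inv_pow]
      exact pow_le_pow_left₀ (by positivity) (by rw [inv_le_comm₀ ht0 two_pos]; exact ht.1.le) _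
    · exact Eventually.of_forall hG0
    · exact hG.continuousOn.integrableOn_compact hT
  have hint : Continuous (Function.uncurry fun (y : E n) (t : ℝ) => G (x + t • (y - x))) := by
    unfold Function.uncurry; fun_prop
  have hint' : Integrable (Function.uncurry fun (y : E n) (t : ℝ) => G (x + t • (y - x)))
      ((volume.restrict T).prod (volume.restrict (Ioc (2⁻¹ : ℝ) 1))) := by
    rw [Measure.prod_restrict]
    exact (hint.continuousOn.integrableOn_compact (hT.prod isCompact_Icc)).mono_set
      (prod_mono subset_rfl Ioc_subset_Icc_self)
  calc ∫ y in T, (φ y - φ (x + (2⁻¹ : ℝ) • (y - x))) ^ 2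
      ≤ ∫ y in T, D ^ 2 / 2 * ∫ t in Ioc (2⁻¹ : ℝ) 1, G (x + t • (y - x)) := by
        refine setIntegral_mono_on ?_ (hint'.integral_prod_left.const_mul _) hT.measurableSet h1
        exact ContinuousOn.integrableOn_compact hT (Continuous.continuousOn (by fun_prop))
    _ = D ^ 2 / 2 * ∫ t in Ioc (2⁻¹ : ℝ) 1, ∫ y in T, G (x + t • (y - x)) := by
        rw [integral_const_mul, integral_integral_swap hint']
    _ ≤ D ^ 2 / 2 * ∫ t in Ioc (2⁻¹ : ℝ) 1, 2 ^ n * ∫ y in T, G y := by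
        exact mul_le_mul_of_nonneg_left (setIntegral_mono_on hint'.integral_prod_right
          (integrable_const _) measurableSet_Ioc h2) (by positivity)
    _ = _ := by
        rw [setIntegral_const]
        have h4 : volume.real (Ioc (2⁻¹ : ℝ) 1) = 1 / 2 := by simp [Measure.real]; norm_num
        rw [h4, smul_eq_mul]; ring

theorem poincare_half_lipschitz {T : Set (E n)} (hT : IsCompact T) (hc : Convex ℝ T) {w : E n → ℝ}
    {K : NNReal} (hw : LipschitzWith K w) {D : ℝ} (hD : ∀ x ∈ T, ∀ y ∈ T, ‖x - y‖ ≤ D) {x : E n}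
    (hx : x ∈ T) : ∫ y in T, (w y - w (x + (2⁻¹ : ℝ) • (y - x))) ^ 2 ≤
      D ^ 2 * 2 ^ n / 4 * ∫ y in T, ‖fderiv ℝ w y‖ ^ 2 := by
  have := hT.isBounded.isFiniteMeasure
  obtain ⟨φ, hsm, -, hlip, hφw, hder⟩ := exists_smooth_approx hw
  refine le_of_tendsto_of_tendsto' (tendsto_integral_of_dominated_convergence
      (fun y => (K * dist y (x + (2⁻¹ : ℝ) • (y - x))) ^ 2) (fun k => ?_) ?_ (fun k =>
        Eventually.of_forall fun y => ?_) (.of_forall fun y => ((hφw y).sub (hφw _)).pow 2))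
    (Tendsto.const_mul _ (tendsto_integral_of_dominated_convergence (fun _ => (K : ℝ) ^ 2)
      (fun k => ((measurable_fderiv ℝ (φ k)).norm.pow_const 2).aestronglyMeasurable)
      (integrable_const _) (fun k => Eventually.of_forall fun y => ?_) ?_))
    fun k => poincare_half hT hc ((hsm k).of_le (by norm_cast)) hD hx
  · have := (hsm k).continuous
    exact Continuous.aestronglyMeasurable (by fun_prop)
  · exact ContinuousOn.integrableOn_compact hT (Continuous.continuousOn (by fun_prop))
  · rw [norm_pow, ← dist_eq_norm]
    exact pow_le_pow_left₀ dist_nonneg ((hlip k).dist_le_mul _ _) 2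
  · rw [norm_pow, norm_norm]
    exact pow_le_pow_left₀ (norm_nonneg _) (norm_fderiv_le_of_lipschitz ℝ (hlip k)) 2
  · filter_upwards [ae_restrict_of_ae hder] with y hy using hy.norm.pow 2

theorem sq_mul_meanOn_sub_le {T : Set (E n)} (hT : IsCompact T) (hT0 : 0 < volume.real T)
    {φ : E n → ℝ} (hφ : Continuous φ) :
    ∫ x in T, (φ x - meanOn T φ) ^ 2 ≤
      (volume.real T)⁻¹ * ∫ x in T, ∫ y in T, (φ x - φ y) ^ 2 := by
  have := hT.isBounded.isFiniteMeasure
  have hi : ∀ {f : E n → ℝ}, Continuous f → IntegrableOn f T := fun hf =>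
    hf.continuousOn.integrableOn_compact hT
  have hcc : Continuous (Function.uncurry fun x y : E n => (φ x - φ y) ^ 2) := by
    unfold Function.uncurry; fun_prop
  have hprod : Integrable (Function.uncurry fun x y : E n => (φ x - φ y) ^ 2)
      ((volume.restrict T).prod (volume.restrict T)) := by
    rw [Measure.prod_restrict]
    exact hcc.continuousOn.integrableOn_compact (hT.prod hT)
  rw [← integral_const_mul]
  refine integral_mono (hi (by fun_prop)) (hprod.integral_prod_left.const_mul _) fun x => ?_
  have h1 : φ x - meanOn T φ = (volume.real T)⁻¹ * ∫ y in T, (φ x - φ y) := by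
    rw [integral_sub (integrable_const _) (hi hφ), setIntegral_const, smul_eq_mul, mul_sub,
      ← mul_assoc, inv_mul_cancel₀ hT0.ne', one_mul, meanOn]
  have h2 := sq_integral_le (μ := volume.restrict T) (f := fun y => φ x - φ y)
    (continuousOn_memLp hT (by fun_prop))
  have h3 : (volume.restrict T).real univ = volume.real T := by simp [Measure.real]
  rw [h3] at h2
  simp only [h1]
  rw [mul_pow, sq (volume.real T)⁻¹, mul_assoc]
  refine mul_le_mul_of_nonneg_left ?_ (by positivity)
  calc (volume.real T)⁻¹ * (∫ y in T, (φ x - φ y)) ^ 2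
      ≤ (volume.real T)⁻¹ * (volume.real T * ∫ y in T, (φ x - φ y) ^ 2) := by gcongr
    _ = _ := by rw [← mul_assoc, inv_mul_cancel₀ hT0.ne', one_mul]

/-- The Poincaré inequality on a convex compact set. -/
theorem poincare {T : Set (E n)} (hT : IsCompact T) (hc : Convex ℝ T)
    (hT0 : 0 < volume.real T) {φ : E n → ℝ} {K : NNReal}
    (hφ : LipschitzWith K φ) {D : ℝ} (hD : ∀ x ∈ T, ∀ y ∈ T, ‖x - y‖ ≤ D) :
    ∫ x in T, (φ x - meanOn T φ) ^ 2 ≤ D ^ 2 * 2 ^ n * ∫ y in T, ‖fderiv ℝ φ y‖ ^ 2 := by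
  have hφc := hφ.continuous
  have := hT.isBounded.isFiniteMeasure
  set X := ∫ y in T, ‖fderiv ℝ φ y‖ ^ 2
  set m : E n → E n → ℝ := fun x y => (φ y - φ (x + (2⁻¹ : ℝ) • (y - x))) ^ 2 with hm
  have hmc : Continuous (Function.uncurry m) := by
    simp only [hm]; unfold Function.uncurry; fun_prop
  have hprod : ∀ {f : E n → E n → ℝ}, Continuous (Function.uncurry f) →
      Integrable (Function.uncurry f) ((volume.restrict T).prod (volume.restrict T)) := by
    intro f hf
    rw [Measure.prod_restrict]
    exact hf.continuousOn.integrableOn_compact (hT.prod hT)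
  have h1 : ∫ x in T, ∫ y in T, m x y ≤ volume.real T * (D ^ 2 * 2 ^ n / 4 * X) := by
    calc ∫ x in T, ∫ y in T, m x y ≤ ∫ x in T, D ^ 2 * 2 ^ n / 4 * X :=
          setIntegral_mono_on (hprod hmc).integral_prod_left (integrable_const _) hT.measurableSet
            fun x hx => poincare_half_lipschitz hT hc hφ hD hx
      _ = _ := by rw [setIntegral_const, smul_eq_mul]
  have h2 : ∫ x in T, ∫ y in T, m y x = ∫ x in T, ∫ y in T, m x y :=
    (integral_integral_swap (hprod hmc)).symm
  have hmc' : Continuous (Function.uncurry fun x y => m y x) :=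
    hmc.comp continuous_swap
  have hdc : Continuous (Function.uncurry fun x y : E n => (φ x - φ y) ^ 2) := by
    unfold Function.uncurry; fun_prop
  have h3 : ∫ x in T, ∫ y in T, (φ x - φ y) ^ 2 ≤
      ∫ x in T, ((2 * ∫ y in T, m y x) + 2 * ∫ y in T, m x y) := by
    refine integral_mono (hprod hdc).integral_prod_left
      (((hprod hmc').integral_prod_left.const_mul _).add
        ((hprod hmc).integral_prod_left.const_mul _)) fun x => ?_
    have i1 : Integrable (fun y => m y x) (volume.restrict T) :=
      (hmc'.comp (Continuous.prodMk_right x)).continuousOn.integrableOn_compact hT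
    have i2 : Integrable (fun y => m x y) (volume.restrict T) :=
      (hmc.comp (Continuous.prodMk_right x)).continuousOn.integrableOn_compact hT
    dsimp only
    rw [← integral_const_mul, ← integral_const_mul, ← integral_add (i1.const_mul _) (i2.const_mul _)]
    refine integral_mono ((hdc.comp (Continuous.prodMk_right x)).continuousOn.integrableOn_compact hT)
      ((i1.const_mul _).add (i2.const_mul _)) fun y => ?_
    have e : y + (2⁻¹ : ℝ) • (x - y) = x + (2⁻¹ : ℝ) • (y - x) := by module
    simp only [hm, e]
    nlinarith [sq_nonneg (φ x + φ y - 2 * φ (x + (2⁻¹ : ℝ) • (y - x)))]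
  have h4 : ∫ x in T, ((2 * ∫ y in T, m y x) + 2 * ∫ y in T, m x y) =
      4 * ∫ x in T, ∫ y in T, m x y := by
    have e := integral_add ((hprod hmc').integral_prod_left.const_mul 2)
        ((hprod hmc).integral_prod_left.const_mul 2)
    rw [integral_const_mul, integral_const_mul] at e
    refine e.trans ?_
    change 2 * (∫ x in T, ∫ y in T, m y x) + 2 * (∫ x in T, ∫ y in T, m x y) = _
    rw [h2]; ring
  refine (sq_mul_meanOn_sub_le hT hT0 hφc).trans ?_
  calc (volume.real T)⁻¹ * ∫ x in T, ∫ y in T, (φ x - φ y) ^ 2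
      ≤ (volume.real T)⁻¹ * (4 * (volume.real T * (D ^ 2 * 2 ^ n / 4 * X))) := by
        gcongr; linarith
    _ = _ := by field_simp

theorem mul_sq_meanOn_sub_le {A T : Set (E n)} (hAT : A ⊆ T) (hT : IsCompact T)
    (hA0 : 0 < volume.real A) {v : E n → ℝ} (hv : Continuous v) (m : ℝ) :
    volume.real A * (meanOn A v - m) ^ 2 ≤ ∫ x in T, (v x - m) ^ 2 := by
  have hfin : volume A ≠ ⊤ := (measure_mono hAT).trans_lt hT.measure_lt_top |>.ne
  have : IsFiniteMeasure (volume.restrict A) := ⟨by simpa using hfin.lt_top⟩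
  have hi : IntegrableOn v A := (hv.continuousOn.integrableOn_compact hT).mono_set hAT
  have hL : MemLp (fun x => v x - m) 2 (volume.restrict T) :=
    continuousOn_memLp hT (by fun_prop)
  have h1 := sq_integral_le (hL.mono_measure (Measure.restrict_mono hAT le_rfl))
  rw [integral_sub hi (integrable_const m), integral_const, measureReal_restrict_apply_univ,
    smul_eq_mul] at h1
  have h2 : ∫ x in A, (v x - m) ^ 2 ≤ ∫ x in T, (v x - m) ^ 2 :=
    setIntegral_mono_set hL.integrable_sq (.of_forall fun x => sq_nonneg _)
      hAT.eventuallyLE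
  have h3 : ∫ x in A, v x = volume.real A * meanOn A v := by
    rw [meanOn, ← mul_assoc, mul_inv_cancel₀ hA0.ne', one_mul]
  rw [h3, ← mul_sub, mul_pow, sq, mul_assoc, mul_le_mul_iff_right₀ hA0] at h1
  exact h1.trans h2

/-- On a convex set, the mean over a large part is close to the mean over the whole set. -/
theorem mul_sq_meanOn_sub_meanOn_le {A T : Set (E n)} (hAT : A ⊆ T) (hT : IsCompact T)
    (hc : Convex ℝ T) {a : ℝ} (ha : 0 < a) (haA : a ≤ volume.real A) {w : E n → ℝ} {K : NNReal}
    (hw : LipschitzWith K w) {D : ℝ} (hD : ∀ x ∈ T, ∀ y ∈ T, ‖x - y‖ ≤ D) :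
    a * (meanOn A w - meanOn T w) ^ 2 ≤ D ^ 2 * 2 ^ n * ∫ y in T, ‖fderiv ℝ w y‖ ^ 2 :=
  (mul_le_mul_of_nonneg_right haA (sq_nonneg _)).trans
    ((mul_sq_meanOn_sub_le hAT hT (ha.trans_le haA) hw.continuous _).trans
      (poincare hT hc ((ha.trans_le haA).trans_le (measureReal_mono hAT hT.measure_lt_top.ne)) hw hD))

end Div

/-! ### Weak derivatives and the space `H¹₀` -/

section Sobolev

variable {n : ℕ} {Ω : Set (E n)}

theorem sum_sq_apply_basisVec (L : E n →L[ℝ] ℝ) : ∑ i, L (basisVec i) ^ 2 = ‖L‖ ^ 2 := by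
  obtain ⟨y, rfl⟩ := (InnerProductSpace.toDual ℝ (E n)).surjective L
  rw [LinearIsometryEquiv.norm_map, EuclideanSpace.norm_sq_eq]
  refine sum_congr rfl fun i _ => ?_
  rw [InnerProductSpace.toDual_apply_apply, basisVec, EuclideanSpace.inner_single_right]
  simp

theorem IsTestFunction.partialDeriv_eq_zero {φ : E n → ℝ} {x : E n} (i : Fin n)
    (hx : x ∉ tsupport φ) : partialDeriv i φ x = 0 := by
  rw [partialDeriv, fderiv_of_notMem_tsupport ℝ hx]; rfl

theorem continuous_partialDeriv {φ : E n → ℝ} (hφ : ContDiff ℝ ∞ φ) (i : Fin n) :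
    Continuous (partialDeriv i φ) := by
  have := hφ.continuous_fderiv (by norm_num)
  unfold partialDeriv
  fun_prop

theorem integrableOn_mul_of_locallyIntegrableOn {v ψ : E n → ℝ} {S : Set (E n)}
    (hv : LocallyIntegrableOn v Ω) (hS : IsCompact S) (hSΩ : S ⊆ Ω) (hψ : Continuous ψ)
    (h0 : ∀ x ∉ S, ψ x = 0) : IntegrableOn (fun x => v x * ψ x) Ω := by
  have h1 : IntegrableOn v S := hv.integrableOn_compact_subset hSΩ hS
  have h2 : IntegrableOn (fun x => v x * ψ x) S := h1.mul_continuousOn hψ.continuousOn hS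
  refine ((integrableOn_iff_integrable_of_support_subset ?_).1 h2).integrableOn
  intro x hx
  by_contra hxS
  exact hx (by simp [h0 x hxS])

theorem setIntegral_eq_of_subset {f : E n → ℝ} {U V : Set (E n)} (hUV : U ⊆ V)
    (hf : ∀ x ∉ U, f x = 0) : ∫ x in V, f x = ∫ x in U, f x := by
  rw [setIntegral_eq_integral_of_forall_compl_eq_zero fun x hx => hf x hx,
    setIntegral_eq_integral_of_forall_compl_eq_zero fun x hx => hf x fun h => hx (hUV h)]

theorem IsTestFunction.eq_zero {φ : E n → ℝ} (hφ : IsTestFunction Ω φ) {x : E n} (hx : x ∉ Ω) :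
    φ x = 0 := image_eq_zero_of_notMem_tsupport fun h => hx (hφ.2.2 h)

theorem IsTestFunction.mono {U : Set (E n)} {φ : E n → ℝ} (hφ : IsTestFunction U φ) (h : U ⊆ Ω) :
    IsTestFunction Ω φ := ⟨hφ.1, hφ.2.1, hφ.2.2.trans h⟩

theorem IsTestFunction.integrableOn_mul {v φ : E n → ℝ} (hv : LocallyIntegrableOn v Ω)
    (hφ : IsTestFunction Ω φ) : IntegrableOn (fun x => v x * φ x) Ω :=
  integrableOn_mul_of_locallyIntegrableOn hv hφ.2.1 hφ.2.2 hφ.1.continuous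
    fun _ hx => image_eq_zero_of_notMem_tsupport hx

theorem IsTestFunction.integrableOn_mul_partialDeriv {v φ : E n → ℝ}
    (hv : LocallyIntegrableOn v Ω) (hφ : IsTestFunction Ω φ) (i : Fin n) :
    IntegrableOn (fun x => v x * partialDeriv i φ x) Ω :=
  integrableOn_mul_of_locallyIntegrableOn hv hφ.2.1 hφ.2.2 (continuous_partialDeriv hφ.1 i)
    fun _ hx => IsTestFunction.partialDeriv_eq_zero i hx

theorem IsWeakPartial.mono {U : Set (E n)} {i : Fin n} {v g : E n → ℝ}
    (h : IsWeakPartial Ω i v g) (hU : U ⊆ Ω) : IsWeakPartial U i v g := by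
  refine ⟨h.1.mono_set hU, h.2.1.mono_set hU, fun φ hφ => ?_⟩
  have := h.2.2 φ (hφ.mono hU)
  rwa [setIntegral_eq_of_subset hU fun x hx => by
      rw [IsTestFunction.partialDeriv_eq_zero i fun h => hx (hφ.2.2 h), mul_zero],
    setIntegral_eq_of_subset hU fun x hx => by rw [hφ.eq_zero hx, mul_zero]] at this

/-- Weak derivatives are unique almost everywhere. -/
theorem IsWeakPartial.ae_eq (hΩ : IsOpen Ω) {i : Fin n} {v v' g g' : E n → ℝ}
    (h : IsWeakPartial Ω i v g) (h' : IsWeakPartial Ω i v' g')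
    (hv : v =ᵐ[volume.restrict Ω] v') : g =ᵐ[volume.restrict Ω] g' := by
  have key := hΩ.ae_eq_zero_of_integral_contDiff_smul_eq_zero (μ := volume)
    (f := fun x => g x - g' x) (h.2.1.sub h'.2.1) (by
    intro φ h1 h2 h3
    have hφ : IsTestFunction Ω φ := ⟨h1, h2, h3⟩
    rw [← setIntegral_eq_integral_of_forall_compl_eq_zero (s := Ω)
      fun x hx => by rw [hφ.eq_zero hx, zero_smul]]
    have e : ∀ x, φ x • (g x - g' x) = g x * φ x - g' x * φ x := fun x => by
      rw [smul_eq_mul]; ring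
    simp_rw [e]
    rw [integral_sub (hφ.integrableOn_mul h.2.1) (hφ.integrableOn_mul h'.2.1)]
    have e1 := h.2.2 φ hφ
    have e2 := h'.2.2 φ hφ
    have e3 : ∫ x in Ω, v x * partialDeriv i φ x = ∫ x in Ω, v' x * partialDeriv i φ x :=
      integral_congr_ae (by filter_upwards [hv] with x hx; rw [hx])
    linarith)
  rw [Filter.EventuallyEq, ae_restrict_iff' hΩ.measurableSet]
  filter_upwards [key] with x hx hxΩ
  exact sub_eq_zero.1 (hx hxΩ)

theorem isWeakPartial_weakPartial {i : Fin n} {v g : E n → ℝ} (h : IsWeakPartial Ω i v g) :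
    IsWeakPartial Ω i v (weakPartial Ω i v) := by
  have hex : ∃ g, IsWeakPartial Ω i v g := ⟨g, h⟩
  rw [weakPartial, dif_pos hex]
  exact hex.choose_spec

theorem IsWeakPartial.weakPartial_ae_eq (hΩ : IsOpen Ω) {i : Fin n} {v v' g : E n → ℝ}
    (h : IsWeakPartial Ω i v g) (hv : v =ᵐ[volume.restrict Ω] v') :
    weakPartial Ω i v' =ᵐ[volume.restrict Ω] g := by
  have h' : IsWeakPartial Ω i v' g := by
    refine ⟨h.1.congr hv, h.2.1, fun φ hφ => ?_⟩
    rw [← h.2.2 φ hφ]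
    exact integral_congr_ae (by filter_upwards [hv] with x hx; rw [hx])
  exact (isWeakPartial_weakPartial h').ae_eq hΩ h' (ae_eq_refl _)

theorem _root_.LipschitzWith.isWeakPartial {w : E n → ℝ} {K : NNReal} (hw : LipschitzWith K w)
    (Ω : Set (E n)) (i : Fin n) : IsWeakPartial Ω i w fun x => fderiv ℝ w x (basisVec i) := by
  have hmeas : Measurable fun x => fderiv ℝ w x (basisVec i) := measurable_fderiv_apply_const ℝ w _
  have hloc : LocallyIntegrable (fun x => fderiv ℝ w x (basisVec i)) volume := by
    intro x
    refine ⟨ball x 1, ball_mem_nhds x one_pos, ?_⟩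
    refine Measure.integrableOn_of_bounded measure_ball_lt_top.ne hmeas.aestronglyMeasurable
      (M := K * ‖(basisVec i : E n)‖) (.of_forall fun y => ?_)
    exact ContinuousLinearMap.le_of_opNorm_le _ (norm_fderiv_le_of_lipschitz ℝ hw) _
  refine ⟨hw.continuous.locallyIntegrable.locallyIntegrableOn _, hloc.locallyIntegrableOn _,
    fun φ hφ => ?_⟩
  obtain ⟨C, hC⟩ := ContDiff.lipschitzWith_of_hasCompactSupport hφ.2.1 hφ.1 (by simp)
  have key := LipschitzWith.integral_lineDeriv_mul_eq (μ := volume) hw hC hφ.2.1 (basisVec i)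
  rw [setIntegral_eq_integral_of_forall_compl_eq_zero fun x hx => by
      rw [IsTestFunction.partialDeriv_eq_zero i fun h => hx (hφ.2.2 h), mul_zero],
    setIntegral_eq_integral_of_forall_compl_eq_zero fun x hx => by rw [hφ.eq_zero hx, mul_zero]]
  have e1 : ∫ x, fderiv ℝ w x (basisVec i) * φ x = ∫ x, lineDeriv ℝ w x (basisVec i) * φ x := by
    refine integral_congr_ae ?_
    filter_upwards [hw.ae_differentiableAt] with x hx
    rw [hx.lineDeriv_eq_fderiv]
  rw [e1, key, ← integral_neg]
  congr 1
  ext x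
  rw [((hφ.1.differentiable (by simp)) x).lineDeriv_eq_fderiv, partialDeriv, map_neg]
  ring

theorem weakPartial_ae_eq_fderiv (hΩ : IsOpen Ω) {v w : E n → ℝ} {K : NNReal}
    (hw : LipschitzWith K w) (hv : v =ᵐ[volume.restrict Ω] w) (i : Fin n) :
    weakPartial Ω i v =ᵐ[volume.restrict Ω] fun x => fderiv ℝ w x (basisVec i) :=
  (hw.isWeakPartial Ω i).weakPartial_ae_eq hΩ hv.symm

theorem memLp_of_continuousOn_closure (hb : IsBounded Ω) {q : E n → ℝ}
    (hq : ContinuousOn q (closure Ω)) : MemLp q 2 (volume.restrict Ω) :=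
  (continuousOn_memLp hb.isCompact_closure hq).mono_measure (Measure.restrict_mono subset_closure le_rfl)

theorem memLp_of_continuous (hb : IsBounded Ω) {w : E n → ℝ} (hw : Continuous w) :
    MemLp w 2 (volume.restrict Ω) := memLp_of_continuousOn_closure hb hw.continuousOn

theorem _root_.LipschitzWith.memLp_fderiv_apply (hb : IsBounded Ω) {w : E n → ℝ} {K : NNReal}
    (hw : LipschitzWith K w) (v : E n) : MemLp (fun x => fderiv ℝ w x v) 2 (volume.restrict Ω) :=
  (ContinuousLinearMap.apply ℝ ℝ v).comp_memLp' (memLp_fderiv hw hb.measure_lt_top.ne)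

theorem _root_.LipschitzWith.memH1 (hb : IsBounded Ω) {w : E n → ℝ}
    {K : NNReal} (hw : LipschitzWith K w) : MemH1 Ω w := by
  exact ⟨memLp_of_continuous hb hw.continuous, fun i => ⟨_, hw.isWeakPartial Ω i, hw.memLp_fderiv_apply hb _⟩⟩

/-- The squared `H¹` norm of a function that agrees almost everywhere with a Lipschitz function. -/
theorem normSqH1_eq (hΩ : IsOpen Ω) (hb : IsBounded Ω) {v w : E n → ℝ} {K : NNReal}
    (hw : LipschitzWith K w) (hv : v =ᵐ[volume.restrict Ω] w) :
    normSqH1 Ω v = (∫ x in Ω, w x ^ 2) + ∫ x in Ω, ‖fderiv ℝ w x‖ ^ 2 := by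
  rw [normSqH1]
  congr 1
  · exact integral_congr_ae (by filter_upwards [hv] with x hx; rw [hx])
  · rw [← integral_congr_ae (.of_forall fun x => sum_sq_apply_basisVec (fderiv ℝ w x)),
      integral_finsetSum]
    · refine sum_congr rfl fun i _ => integral_congr_ae ?_
      filter_upwards [weakPartial_ae_eq_fderiv hΩ hw hv i] with x hx
      rw [hx]
    · exact fun i _ => (hw.memLp_fderiv_apply hb _).integrable_sq

theorem tendsto_normSq_of_lipschitz (hb : IsBounded Ω) {g : ℕ → E n → ℝ} {L : NNReal} {M : ℝ}
    (hg : ∀ k, LipschitzWith L (g k)) (hM : ∀ k x, |g k x| ≤ M)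
    (h0 : ∀ x, Tendsto (fun k => g k x) atTop (𝓝 0))
    (h1 : ∀ᵐ x, Tendsto (fun k => fderiv ℝ (g k) x) atTop (𝓝 0)) :
    Tendsto (fun k => (∫ x in Ω, g k x ^ 2) + ∫ x in Ω, ‖fderiv ℝ (g k) x‖ ^ 2) atTop (𝓝 0) := by
  have := hb.isFiniteMeasure
  rw [show (0 : ℝ) = (∫ x in Ω, (0 : ℝ) ^ 2) + ∫ x in Ω, ‖(0 : E n →L[ℝ] ℝ)‖ ^ 2 by simp]
  refine (tendsto_integral_of_dominated_convergence (fun _ => M ^ 2)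
    (fun k => ((hg k).continuous.pow 2).aestronglyMeasurable) (integrable_const _)
    (fun k => Eventually.of_forall fun x => ?_) (.of_forall fun x => (h0 x).pow 2)).add
    (tendsto_integral_of_dominated_convergence (fun _ => (L : ℝ) ^ 2)
    (fun k => ((measurable_fderiv ℝ _).norm.pow_const 2).aestronglyMeasurable) (integrable_const _)
    (fun k => Eventually.of_forall fun x => ?_) ?_)
  · exact (norm_pow (g k x) 2).trans_le (pow_le_pow_left₀ (norm_nonneg _) (hM k x) 2)
  · rw [norm_pow, norm_norm]
    exact pow_le_pow_left₀ (norm_nonneg _) (norm_fderiv_le_of_lipschitz ℝ (hg k)) 2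
  · filter_upwards [ae_restrict_of_ae h1] with x hx using hx.norm.pow 2

/-- A Lipschitz function `w` that vanishes off a bounded open set `Ω` belongs to `H¹₀(Ω)`: the
mollifications of `w` are truncated smoothly at small values, which makes their support a compact
subset of `Ω`. The gradients converge because `∇w = 0` almost everywhere on `{w = 0}`. -/
theorem _root_.LipschitzWith.memH10 (hΩ : IsOpen Ω) (hb : IsBounded Ω) {w : E n → ℝ}
    {K : NNReal} (hw : LipschitzWith K w) (h0 : ∀ x ∉ Ω, w x = 0) : MemH10 Ω w := by
  refine ⟨hw.memH1 hb, fun δ hδ => ?_⟩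
  obtain ⟨φ, hsm, hunif, hlip, hφw, hder⟩ := exists_smooth_approx hw
  -- `β` is smooth, `β t = t` for `|t| ≤ 2` and `β t = 0` for `|t| ≥ 3`
  let η : ContDiffBump (0 : ℝ) := ⟨2, 3, two_pos, by norm_num⟩
  set β : ℝ → ℝ := fun t => t * η t with hβ
  have hβs : ContDiff ℝ ∞ β := contDiff_id.mul η.contDiff
  have hβ0 : ∀ t, 3 ≤ |t| → β t = 0 := fun t ht => by
    rw [hβ]; dsimp only
    rw [η.zero_of_le_dist (by rwa [dist_zero_right]), mul_zero]
  obtain ⟨C, hC⟩ : ∃ C, LipschitzWith C β :=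
    ContDiff.lipschitzWith_of_hasCompactSupport (𝕂 := ℝ) η.hasCompactSupport.mul_left
    hβs (by simp)
  have hβ3 : ∀ t, |β t| ≤ 3 := fun t => by
    rcases le_total 3 |t| with ht | ht
    · simp [hβ0 t ht]
    · rw [abs_mul, abs_of_nonneg (η.nonneg' t)]
      nlinarith [η.le_one (x := t), abs_nonneg t, η.nonneg' t]
  set ε : ℕ → ℝ := fun k => (K + 1) * (1 / ((k : ℝ) + 1)) with hεd
  have hε : ∀ k, 0 < ε k := fun k => by positivity
  have hεt : Tendsto ε atTop (𝓝 0) := by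
    simpa [hεd] using (tendsto_one_div_add_atTop_nhds_zero_nat (𝕜 := ℝ)).const_mul ((K : ℝ) + 1)
  have hφε : ∀ k x, |φ k x - w x| ≤ ε k := fun k x =>
    (hunif k x).trans (mul_le_mul_of_nonneg_right (by linarith) (by positivity))
  have hε1 : ∀ k, ε k ≤ K + 1 := fun k => mul_le_of_le_one_right (by positivity) (by
    rw [div_le_one (by positivity)]; linarith [(Nat.cast_nonneg k : (0 : ℝ) ≤ k)])
  set ζ : ℕ → E n → ℝ := fun k x => ε k * β ((ε k)⁻¹ * φ k x)
  have hζl : ∀ k, LipschitzWith (C * K) (ζ k) := fun k => LipschitzWith.of_dist_le_mul fun x y => by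
    have h1 := hC.dist_le_mul ((ε k)⁻¹ * φ k x) ((ε k)⁻¹ * φ k y)
    have h2 := (hlip k).dist_le_mul x y
    rw [Real.dist_eq] at h1 h2 ⊢
    rw [← mul_sub, abs_mul, abs_of_pos (hε k)]
    rw [Real.dist_eq, ← mul_sub, abs_mul, abs_of_pos (inv_pos.2 (hε k))] at h1
    calc _ ≤ ε k * (C * ((ε k)⁻¹ * (K * dist x y))) := by
          have := (hε k).le; gcongr; exact h1.trans (by gcongr)
      _ = _ := by have := (hε k).ne'; push_cast; field_simp
  have hζε : ∀ k x, |ζ k x| ≤ ε k * 3 := fun k x => by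
    rw [abs_mul, abs_of_pos (hε k)]
    exact mul_le_mul_of_nonneg_left (hβ3 _) (hε k).le
  have hζs : ∀ k, ContDiff ℝ ∞ (ζ k) := fun k =>
    contDiff_const.mul (hβs.comp (contDiff_const.mul (hsm k)))
  have hζd : ∀ k x, fderiv ℝ (ζ k) x = deriv β ((ε k)⁻¹ * φ k x) • fderiv ℝ (φ k) x := fun k x => by
    have h1 := (hβs.differentiable (by simp) ((ε k)⁻¹ * φ k x)).hasDerivAt.comp_hasFDerivAt x
      (((hsm k).differentiable (by simp) x).hasFDerivAt.const_mul (ε k)⁻¹)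
    refine (h1.const_mul (ε k)).fderiv.trans ?_
    rw [smul_smul, smul_smul, mul_right_comm,
      mul_inv_cancel₀ (hε k).ne', one_mul]
  have hlim := tendsto_normSq_of_lipschitz (g := fun k x => w x - (φ k x - ζ k x)) hb
    (fun k => hw.sub ((hlip k).sub (hζl k))) (M := (K + 1) * 4) (fun k x => ?_) (fun x => ?_) ?_
  · obtain ⟨k, hk⟩ := (hlim.eventually_lt_const hδ).exists
    -- the truncated function vanishes where `|w| < ε k`
    have hts : tsupport (fun x => φ k x - ζ k x) ⊆ {x | ε k ≤ |w x|} := by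
      refine closure_minimal (fun x hx => ?_) (isClosed_le continuous_const hw.continuous.abs)
      by_contra hlt
      refine hx ?_
      have h2 : ‖(ε k)⁻¹ * φ k x‖ ≤ 2 := by
        rw [norm_mul, norm_inv, Real.norm_of_nonneg (hε k).le, inv_mul_le_iff₀ (hε k), Real.norm_eq_abs]
        have := abs_sub_abs_le_abs_sub (φ k x) (w x)
        have := hφε k x
        have : |w x| < ε k := not_le.1 hlt
        linarith
      simp only [ζ, hβ]
      rw [η.one_of_mem_closedBall (mem_closedBall_zero_iff.2 h2), mul_one,
        mul_inv_cancel_left₀ (hε k).ne', sub_self]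
    have htΩ : {x | ε k ≤ |w x|} ⊆ Ω := fun x hx => by
      by_contra h
      have : ε k ≤ |w x| := hx
      rw [h0 x h, abs_zero] at this
      exact this.not_gt (hε k)
    refine ⟨_, ⟨(hsm k).sub (hζs k), Metric.isCompact_of_isClosed_isBounded (isClosed_tsupport _)
      (hb.subset (hts.trans htΩ)), hts.trans htΩ⟩, ?_⟩
    rwa [normSqH1_eq hΩ hb (hw.sub ((hlip k).sub (hζl k))) (ae_eq_refl _)]
  · have h1 := abs_sub_comm (w x) (φ k x) ▸ hφε k x
    have h2 := abs_add_le (w x - φ k x) (ζ k x)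
    rw [show w x - φ k x + ζ k x = w x - (φ k x - ζ k x) by ring] at h2
    linarith [hζε k x, hε1 k]
  · simpa using (hφw x).const_sub (w x) |>.add (squeeze_zero_norm (fun k => hζε k x)
      (by simpa using hεt.mul_const 3)) |>.congr fun k => by ring
  · filter_upwards [hder, hw.ae_differentiableAt, ae_fderiv_eq_zero_of_eq_zero hw] with x hx hd hz
    have h1 : ∀ k, fderiv ℝ (fun x => w x - (φ k x - ζ k x)) x =
        fderiv ℝ w x - fderiv ℝ (φ k) x + fderiv ℝ (ζ k) x := fun k => by
      rw [fderiv_fun_sub hd (((hsm k).sub (hζs k)).differentiable (by simp) x), fderiv_fun_sub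
        ((hsm k).differentiable (by simp) x) ((hζs k).differentiable (by simp) x), sub_add]
    simp_rw [h1, hζd]
    have h2 : Tendsto (fun k => deriv β ((ε k)⁻¹ * φ k x) • fderiv ℝ (φ k) x) atTop (𝓝 0) := by
      by_cases hwx : w x = 0
      · rw [hz hwx] at hx
        refine squeeze_zero_norm (fun k => (norm_smul (deriv β _) (fderiv ℝ (φ k) x)).trans_le
          (mul_le_mul_of_nonneg_right (norm_deriv_le_of_lipschitz hC) (norm_nonneg _))) ?_
        simpa using hx.norm.const_mul (C : ℝ)
      · refine tendsto_const_nhds.congr' ?_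
        filter_upwards [hεt.eventually_lt_const (show 0 < |w x| / 5 by positivity)] with k hk
        have h3 : 3 < |(ε k)⁻¹ * φ k x| := by
          rw [abs_mul, abs_inv, abs_of_pos (hε k), lt_inv_mul_iff₀ (hε k)]
          have := abs_sub_abs_le_abs_sub (w x) (φ k x)
          have := abs_sub_comm (w x) (φ k x) ▸ hφε k x
          linarith [hε k]
        have h4 : β =ᶠ[𝓝 ((ε k)⁻¹ * φ k x)] fun _ => 0 := by
          filter_upwards [continuous_abs.continuousAt.eventually (lt_mem_nhds h3)] with t ht
          exact hβ0 t ht.le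
        rw [h4.deriv_eq, deriv_const, zero_smul]
    simpa using (hx.const_sub (fderiv ℝ w x)).add h2

theorem IsWeakPartial.sub {i : Fin n} {v v' g g' : E n → ℝ} (h : IsWeakPartial Ω i v g)
    (h' : IsWeakPartial Ω i v' g') :
    IsWeakPartial Ω i (fun x => v x - v' x) (fun x => g x - g' x) := by
  refine ⟨h.1.sub h'.1, h.2.1.sub h'.2.1, fun φ hφ => ?_⟩
  simp_rw [sub_mul]
  rw [integral_sub (hφ.integrableOn_mul_partialDeriv h.1 i)
      (hφ.integrableOn_mul_partialDeriv h'.1 i),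
    integral_sub (hφ.integrableOn_mul h.2.1) (hφ.integrableOn_mul h'.2.1), h.2.2 φ hφ, h'.2.2 φ hφ]
  ring

theorem MemH1.isWeakPartial {v : E n → ℝ} (hv : MemH1 Ω v) (i : Fin n) :
    IsWeakPartial Ω i v (weakPartial Ω i v) := by
  obtain ⟨g, hg, -⟩ := hv.2 i
  exact isWeakPartial_weakPartial hg

theorem MemH1.memLp_weakPartial (hΩ : IsOpen Ω) {v : E n → ℝ} (hv : MemH1 Ω v) (i : Fin n) :
    MemLp (weakPartial Ω i v) 2 (volume.restrict Ω) := by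
  obtain ⟨g, hg, hm⟩ := hv.2 i
  exact (memLp_congr_ae ((isWeakPartial_weakPartial hg).ae_eq hΩ hg (ae_eq_refl _))).2 hm

theorem IsTestFunction.lipschitz {φ : E n → ℝ} (hφ : IsTestFunction Ω φ) :
    ∃ K, LipschitzWith K φ := ContDiff.lipschitzWith_of_hasCompactSupport hφ.2.1 hφ.1 (by simp)

theorem IsTestFunction.integral_partialDeriv_eq_zero {ψ : E n → ℝ} (hψ : IsTestFunction Ω ψ)
    (i : Fin n) : ∫ x in Ω, partialDeriv i ψ x = 0 := by
  simpa using ((LipschitzWith.const (1 : ℝ)).isWeakPartial Ω i).2.2 ψ hψ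

/-- Functions in `H¹₀` may be integrated by parts against smooth functions that do not vanish at the
boundary. -/
theorem MemH10.integral_eq_zero (hΩ : IsOpen Ω) (hb : IsBounded Ω) {v φ : E n → ℝ}
    (hv : MemH10 Ω v) (hφ : ContDiff ℝ ∞ φ) (i : Fin n) :
    ∫ x in Ω, (v x * partialDeriv i φ x + weakPartial Ω i v x * φ x) = 0 := by
  have hm1 := memLp_of_continuous hb (continuous_partialDeriv hφ i)
  have hm2 := memLp_of_continuous hb hφ.continuous
  have hg := hv.1.memLp_weakPartial hΩ i
  set X := ∫ x in Ω, (v x * partialDeriv i φ x + weakPartial Ω i v x * φ x)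
  set A := ∫ x in Ω, partialDeriv i φ x ^ 2
  set B := ∫ x in Ω, φ x ^ 2
  have hA : 0 ≤ A := integral_sq_nonneg _
  have hB : 0 ≤ B := integral_sq_nonneg _
  have key : ∀ ε > 0, X ^ 2 ≤ (2 * A + 2 * B) * ε := by
    intro ε hε
    obtain ⟨ψ, hψ, hlt⟩ := hv.2 ε hε
    obtain ⟨K, hK⟩ := hψ.lipschitz
    have hψm := memLp_of_continuous hb hψ.1.continuous
    have hψm' := memLp_of_continuous hb (continuous_partialDeriv hψ.1 i)
    have hwp : weakPartial Ω i (fun x => v x - ψ x) =ᵐ[volume.restrict Ω]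
        fun x => weakPartial Ω i v x - partialDeriv i ψ x :=
      ((hv.1.isWeakPartial i).sub (hK.isWeakPartial Ω i)).weakPartial_ae_eq hΩ (ae_eq_refl _)
    have hprod : IsTestFunction Ω fun x => ψ x * φ x :=
      ⟨hψ.1.mul hφ, hψ.2.1.mul_right, (tsupport_mul_subset_left).trans hψ.2.2⟩
    have h0' : ∫ x in Ω, (ψ x * partialDeriv i φ x + partialDeriv i ψ x * φ x) = 0 := by
      rw [← hprod.integral_partialDeriv_eq_zero i]
      congr 1
      ext x
      have e := fderiv_fun_mul (hψ.1.differentiable (by simp) x) (hφ.differentiable (by simp) x)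
      rw [partialDeriv, partialDeriv, partialDeriv, e, _root_.add_apply, _root_.smul_apply,
        _root_.smul_apply, smul_eq_mul, smul_eq_mul]
      ring
    have hX : X = (∫ x in Ω, (v x - ψ x) * partialDeriv i φ x) +
        ∫ x in Ω, (weakPartial Ω i v x - partialDeriv i ψ x) * φ x := by
      have i1 : Integrable (fun x => (v x - ψ x) * partialDeriv i φ x) (volume.restrict Ω) :=
        (hv.1.1.sub hψm).integrable_mul hm1
      have i2 : Integrable (fun x => (weakPartial Ω i v x - partialDeriv i ψ x) * φ x)
        (volume.restrict Ω) := (hg.sub hψm').integrable_mul hm2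
      have i3 : Integrable (fun x => v x * partialDeriv i φ x + weakPartial Ω i v x * φ x)
        (volume.restrict Ω) := (hv.1.1.integrable_mul hm1).add (hg.integrable_mul hm2)
      have i4 : Integrable (fun x => ψ x * partialDeriv i φ x + partialDeriv i ψ x * φ x)
        (volume.restrict Ω) := (hψm.integrable_mul hm1).add (hψm'.integrable_mul hm2)
      rw [← integral_add i1 i2, ← sub_zero X, ← h0', ← integral_sub i3 i4]
      congr 1
      ext x
      ring
    have c1 := sq_integral_mul_le (hv.1.1.sub hψm) hm1
    have c2 := sq_integral_mul_le (hg.sub hψm') hm2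
    simp only [Pi.sub_apply] at c1 c2
    have n0 : 0 ≤ ∫ x in Ω, (v x - ψ x) ^ 2 := integral_sq_nonneg _
    have n1 : ∫ x in Ω, (weakPartial Ω i v x - partialDeriv i ψ x) ^ 2 ≤
        ∑ j, ∫ x in Ω, weakPartial Ω j (fun x => v x - ψ x) x ^ 2 := by
      rw [integral_congr_ae (g := fun x => weakPartial Ω i (fun x => v x - ψ x) x ^ 2)
        (by filter_upwards [hwp] with x hx; rw [hx])]
      exact single_le_sum (f := fun j => ∫ x in Ω, weakPartial Ω j (fun x => v x - ψ x) x ^ 2)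
        (fun j _ => integral_sq_nonneg _) (Finset.mem_univ i)
    have n2 : 0 ≤ ∫ x in Ω, (weakPartial Ω i v x - partialDeriv i ψ x) ^ 2 :=
      integral_sq_nonneg _
    rw [normSqH1] at hlt
    have b1 : ∫ x in Ω, (v x - ψ x) ^ 2 ≤ ε := by linarith
    have b2 : ∫ x in Ω, (weakPartial Ω i v x - partialDeriv i ψ x) ^ 2 ≤ ε := by linarith
    have c1' := c1.trans (mul_le_mul_of_nonneg_right b1 hA)
    have c2' := c2.trans (mul_le_mul_of_nonneg_right b2 hB)
    rw [hX]
    nlinarith [sq_nonneg ((∫ x in Ω, (v x - ψ x) * partialDeriv i φ x) -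
        ∫ x in Ω, (weakPartial Ω i v x - partialDeriv i ψ x) * φ x)]
  have hle : X ^ 2 ≤ 0 := by
    refine le_of_forall_pos_le_add fun δ hδ => ?_
    have hAB : 0 < 2 * A + 2 * B + 1 := by positivity
    have := key (δ / (2 * A + 2 * B + 1)) (by positivity)
    rw [zero_add]
    refine this.trans ?_
    rw [mul_div_assoc', div_le_iff₀ hAB]
    nlinarith
  nlinarith [sq_nonneg X]

/-- On an open set where a function is smooth, its weak derivative is the classical one. -/
theorem weakPartial_ae_eq_of_contDiff {U : Set (E n)} (hU : IsOpen U) (hUΩ : U ⊆ Ω)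
    {v r : E n → ℝ} (hv : MemH1 Ω v) (hr : ContDiff ℝ 1 r) (hb : IsBounded U)
    (hvr : ∀ x ∈ U, v x = r x) (i : Fin n) :
    weakPartial Ω i v =ᵐ[volume.restrict U] fun x => fderiv ℝ r x (basisVec i) := by
  obtain ⟨R, hR⟩ := hb.subset_closedBall 0
  obtain ⟨K, hK⟩ := LipOn.of_contDiff hr (isCompact_closedBall (0 : E n) R)
  obtain ⟨g, hg, he⟩ := hK.extend_real
  have h1 := ((hv.isWeakPartial i).mono hUΩ).ae_eq hU (hg.isWeakPartial U i) (by
    filter_upwards [ae_restrict_mem hU.measurableSet] with x hx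
    rw [hvr x hx, he (hR hx)])
  filter_upwards [h1, ae_restrict_mem hU.measurableSet] with x h2 hx
  rw [h2, fderiv_congr_interior (fun y hy => (he (hR hy)).symm) (hU.interior_eq.symm ▸ hx)]

/-- The Friedrichs inequality. -/
theorem friedrichs [NeZero n] (hb : IsBounded Ω) :
    ∃ C : ℝ, 0 ≤ C ∧ ∀ (w : E n → ℝ) (K : NNReal), LipschitzWith K w → (∀ x ∉ Ω, w x = 0) →
      ∫ x in Ω, w x ^ 2 ≤ C * ∫ x in Ω, ‖fderiv ℝ w x‖ ^ 2 := by
  obtain ⟨R, hR0, hR⟩ := hb.exists_pos_norm_le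
  set T := closedBall (0 : E n) (R + 2)
  have hT : IsCompact T := isCompact_closedBall _ _
  have := hT.isBounded.isFiniteMeasure
  have hΩT : Ω ⊆ T := fun x hx => mem_closedBall_zero_iff.2 ((hR x hx).trans (by linarith))
  -- a ball in `T` that does not meet `Ω`
  set p : E n := (R + 1) • basisVec 0
  have hp : ‖p‖ = R + 1 := by
    rw [norm_smul, Real.norm_of_nonneg (by positivity)]; simp [basisVec]
  set A := ball p 1
  have hA0 : 0 < volume.real A := ENNReal.toReal_pos (Metric.measure_ball_pos volume _ one_pos).ne'
    measure_ball_lt_top.ne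
  have hAT : A ⊆ T := fun x hx => mem_closedBall_zero_iff.2 (by
    have := norm_le_norm_add_norm_sub' x p
    have h1 := mem_ball_iff_norm.1 hx
    linarith)
  have hAΩ : ∀ x ∈ A, x ∉ Ω := fun x hx h => by
    have := norm_le_norm_add_norm_sub' p x
    have h1 := mem_ball_iff_norm'.1 hx
    linarith [hR x h]
  set c : ℝ := (R + 2 + (R + 2)) ^ 2 * 2 ^ n
  refine ⟨2 * c * (1 + volume.real T / volume.real A), by positivity, fun w K hw h0 => ?_⟩
  have hD : ∀ x ∈ T, ∀ y ∈ T, ‖x - y‖ ≤ R + 2 + (R + 2) := fun x hx y hy =>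
    (norm_sub_le _ _).trans (add_le_add (mem_closedBall_zero_iff.1 hx) (mem_closedBall_zero_iff.1 hy))
  have h1 := mul_sq_meanOn_sub_meanOn_le hAT hT (convex_closedBall _ _) hA0 le_rfl hw hD
  have h2 := poincare hT (convex_closedBall _ _)
    (hA0.trans_le (measureReal_mono hAT hT.measure_lt_top.ne)) hw hD
  have h3 : meanOn A w = 0 := by
    rw [meanOn, setIntegral_congr_fun (g := fun _ => 0) Metric.isOpen_ball.measurableSet
      fun z hz => h0 z (hAΩ z hz)]
    simp
  have h4 : ∫ y in T, ‖fderiv ℝ w y‖ ^ 2 = ∫ y in Ω, ‖fderiv ℝ w y‖ ^ 2 := by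
    refine setIntegral_eq_of_subset_of_ae_sdiff_eq_zero hT.measurableSet.nullMeasurableSet hΩT ?_
    filter_upwards [ae_fderiv_eq_zero_of_eq_zero hw] with x hx hxT
    rw [hx (h0 x hxT.2)]; simp
  set m := meanOn T w
  have hi : IntegrableOn (fun x => (w x - m) ^ 2) T := by
    have := hw.continuous
    exact Continuous.continuousOn (by fun_prop) |>.integrableOn_compact hT
  have h5 : ∫ x in Ω, w x ^ 2 ≤ ∫ x in T, (2 * (w x - m) ^ 2 + 2 * m ^ 2) :=
    (setIntegral_mono_set ((hw.continuous.pow 2).continuousOn.integrableOn_compact hT)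
      (.of_forall fun x => sq_nonneg _) hΩT.eventuallyLE).trans
    (integral_mono ((hw.continuous.pow 2).continuousOn.integrableOn_compact hT)
      ((hi.const_mul _).add (integrable_const _)) fun x => by
        dsimp only [Pi.pow_apply]; nlinarith [sq_nonneg (w x - 2 * m)])
  rw [integral_add (hi.const_mul _) (integrable_const _), integral_const_mul, setIntegral_const,
    smul_eq_mul] at h5
  rw [h3, zero_sub, neg_sq, h4, mul_comm, ← le_div_iff₀ hA0] at h1
  rw [h4] at h2
  have h6 := mul_le_mul_of_nonneg_left h1 (measureReal_nonneg (μ := volume) (s := T))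
  calc _ ≤ 2 * (c * ∫ y in Ω, ‖fderiv ℝ w y‖ ^ 2) +
        2 * (volume.real T * (c * (∫ y in Ω, ‖fderiv ℝ w y‖ ^ 2) / volume.real A)) := by linarith
    _ = _ := by ring

end Sobolev

/-! ### Newest vertex bisection -/

section Frames

open TaggedSimplex

variable {n : ℕ}

/-- The vertices, relative to the first one, of the simplex of type `γ` with frame `w`: bisection
acts on frames by halving, permutations and changes of sign only. -/
def frameVert (γ : Fin n) (w : Fin n → E n) (j : Fin (n + 1)) : E n :=
  if (j : ℕ) = 0 then 0
  else if (j : ℕ) ≤ γ then (1 / 2 : ℝ) • ∑ i : Fin n, if (i : ℕ) < n - γ + j then w i else 0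
  else ∑ i : Fin n, if (i : ℕ) < j - γ then w i else 0

/-- `τ` has, up to a power of two, a frame that arises from `v` by a substitution of indices and
changes of sign. -/
def HasFrame (v : Fin n → E n) (τ : TaggedSimplex n) : Prop :=
  ∃ (k : ℕ) (ε : Fin n → ℤˣ) (π : Fin n → Fin n), ∀ j, τ.vert j =
    τ.vert 0 + ((1 / 2 : ℝ) ^ k) • frameVert τ.tag (fun i => ((ε i : ℤ) : ℝ) • v (π i)) j

theorem exists_hasFrame (hn : n = 2 ∨ n = 3) (τ : TaggedSimplex n) : ∃ v, HasFrame v τ := by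
  suffices h : ∃ v : Fin n → E n, ∀ j, τ.vert j = τ.vert 0 + frameVert τ.tag v j by
    obtain ⟨v, hv⟩ := h
    exact ⟨v, 0, 1, id, by simpa using hv⟩
  obtain ⟨z, γ⟩ := τ
  rcases hn with rfl | rfl
  · fin_cases γ
    · refine ⟨![z 1 - z 0, z 2 - z 1], fun j => ?_⟩
      fin_cases j <;> simp [frameVert, Fin.sum_univ_succ]
    · refine ⟨![z 2 - z 0, (2 : ℝ) • (z 1 - z 0) - (z 2 - z 0)], fun j => ?_⟩
      fin_cases j <;> simp [frameVert, Fin.sum_univ_succ]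
  · fin_cases γ
    · refine ⟨![z 1 - z 0, z 2 - z 1, z 3 - z 2], fun j => ?_⟩
      fin_cases j <;> simp [frameVert, Fin.sum_univ_succ]
    · refine ⟨![z 2 - z 0, z 3 - z 2, (2 : ℝ) • (z 1 - z 0) - (z 3 - z 0)], fun j => ?_⟩
      fin_cases j <;> simp [frameVert, Fin.sum_univ_succ]
      module
    · refine ⟨![z 3 - z 0, (2 : ℝ) • (z 1 - z 0) - (z 3 - z 0), (2 : ℝ) • (z 2 - z 1)], fun j => ?_⟩
      fin_cases j <;> simp [frameVert, Fin.sum_univ_succ]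
      module

theorem HasFrame.children (hn : n = 2 ∨ n = 3) {v : Fin n → E n} {τ : TaggedSimplex n}
    (h : HasFrame v τ) : HasFrame v τ.child₁ ∧ HasFrame v τ.child₂ := by
  obtain ⟨k, ε, π, h⟩ := h
  have key : ∀ (σ : TaggedSimplex n) (l : ℕ) (δ : Fin n → ℤˣ) (ρ : Fin n → Fin n),
      (∀ w : Fin n → E n, (∀ j, τ.vert j = τ.vert 0 + frameVert τ.tag w j) → ∀ j, σ.vert j =
        σ.vert 0 + ((1 / 2 : ℝ) ^ l) • frameVert σ.tag (fun i => ((δ i : ℤ) : ℝ) • w (ρ i)) j) →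
      HasFrame v σ := by
    intro σ l δ ρ hw
    have hs : ∀ (γ : Fin n) (c : ℝ) (w : Fin n → E n) (j : Fin (n + 1)),
        frameVert γ (fun i => c • w i) j = c • frameVert γ w j := by
      intro γ c w j
      simp only [frameVert]
      split_ifs
      · simp
      · rw [smul_comm c, Finset.smul_sum (r := c)]; simp only [smul_ite, smul_zero]
      · rw [Finset.smul_sum]; simp only [smul_ite, smul_zero]
    refine ⟨l + k, fun i => δ i * ε (ρ i), fun i => π (ρ i), fun j => ?_⟩
    rw [hw (fun i => ((1 / 2 : ℝ) ^ k) • ((ε i : ℤ) : ℝ) • v (π i))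
      (fun j => by rw [hs]; exact h j) j, pow_add, mul_smul, ← hs _ ((1 / 2 : ℝ) ^ k)]
    congr 3
    funext i
    push_cast
    module
  obtain ⟨x, γ⟩ := τ
  have h1 := key (child₁ ⟨x, γ⟩)
  have h2 := key (child₂ ⟨x, γ⟩)
  clear key h
  rcases hn with rfl | rfl <;> fin_cases γ
  on_goal 5 => refine ⟨h1 1 1 id ?_, h2 1 ![-1, 1, 1] id ?_⟩
  on_goal 4 => refine ⟨h1 0 1 id ?_, h2 0 ![-1, -1, 1] ![1, 0, 2] ?_⟩
  on_goal 3 => refine ⟨h1 0 1 id ?_, h2 0 (fun _ => -1) ![2, 1, 0] ?_⟩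
  on_goal 2 => refine ⟨h1 1 1 id ?_, h2 1 ![-1, 1] id ?_⟩
  on_goal 1 => refine ⟨h1 0 1 id ?_, h2 0 (fun _ => -1) ![1, 0] ?_⟩
  all_goals
    intro w hw j
    have e1 := hw 1
    have e2 := hw 2
    have e3 := hw (Fin.last _)
    simp [frameVert, Fin.sum_univ_succ] at e1 e2 e3
    fin_cases j <;> simp [frameVert, Fin.sum_univ_succ, child₁, child₂, z, nextTag, newVertex,
      midpoint_eq_smul_add, e3] <;>
      first | module | (change x 1 = _; rw [e1]; try module) | (change x 2 = _; rw [e2]; try module)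

/-- Shape regularity of a simplex, with constant `κ`. -/
def ShapeRegular (κ : ℝ) (τ : TaggedSimplex n) : Prop :=
  (∀ i j, dist (τ.vert i) (τ.vert j) ≤ κ * τ.size) ∧
    ∀ b : Simplex n, ⇑b = τ.vert → ∀ i, ‖baryGrad b i‖ * τ.size ≤ κ

theorem inner_baryGrad_vertex_sub (b : Simplex n) (i j k : Fin (n + 1)) :
    ⟪baryGrad b i, b j - b k⟫_ℝ = (if i = j then 1 else 0) - if i = k then 1 else 0 := by
  have := coord_eq_add_inner b i (b j) (b k)
  rw [b.coord_apply, b.coord_apply] at this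
  linarith

/-- Gradients of barycentric coordinates scale inversely to the simplex. -/
theorem baryGrad_homothety {b b' : Simplex n} {a : E n} {t : ℝ}
    (ht : 0 < t) (h : ∀ j, b j = a + t • b' j) (i : Fin (n + 1)) :
    baryGrad b i = t⁻¹ • baryGrad b' i := by
  refine ext_inner_right ℝ fun v => ?_
  have h1 : t • v = ∑ j, ⟪baryGrad b' j, v⟫_ℝ • (b j - b i) := by
    simp_rw [smul_sub, sum_sub_distrib, ← sum_smul, ← sum_inner, sum_baryGrad, h,
      smul_add, sum_add_distrib, ← sum_smul, ← sum_inner, sum_baryGrad,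
      smul_comm _ t, ← Finset.smul_sum, sum_inner_baryGrad_smul]
    simp
  have h2 : t * ⟪baryGrad b i, v⟫_ℝ = ⟪baryGrad b' i, v⟫_ℝ := by
    rw [← real_inner_smul_right, h1, inner_sum]
    simp_rw [real_inner_smul_right, inner_baryGrad_vertex_sub, mul_sub, mul_ite, mul_one, mul_zero,
      sum_sub_distrib]
    simp [← sum_inner, sum_baryGrad]
  rw [real_inner_smul_left, ← h2]
  field_simp

open scoped Pointwise in
theorem volume_convexHull_homothety {w z : Fin (n + 1) → E n} {a : E n} {t : ℝ} (ht : 0 < t)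
    (h : ∀ j, z j = a + t • w j) :
    volume.real (convexHull ℝ (range z)) = t ^ n * volume.real (convexHull ℝ (range w)) := by
  have h1 : range z = a +ᵥ (t • range w) := by
    rw [← image_smul, ← range_comp, ← image_vadd, ← range_comp]
    congr 1
    funext j
    simp [h]
  rw [h1, convexHull_vadd, convexHull_smul, measureReal_def, measure_vadd, Measure.addHaar_smul]
  simp [abs_of_pos ht, measureReal_def, ENNReal.toReal_ofReal (pow_nonneg ht.le n)]

theorem size_pos {τ : TaggedSimplex n} (b : Simplex n)
    (hb : ⇑b = τ.vert) : 0 < τ.size := by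
  have := volume_simplex_pos b
  rw [simplex, hb] at this
  exact Real.rpow_pos_of_pos this _

/-- All simplices similar to a given one are uniformly shape regular. -/
theorem exists_shapeRegular (hn : n ≠ 0) (w : Fin (n + 1) → E n) : ∃ κ : ℝ, ∀ τ : TaggedSimplex n,
    AffineIndependent ℝ τ.vert → ∀ (a : E n) (t : ℝ), 0 < t → (∀ j, τ.vert j = a + t • w j) →
      ShapeRegular κ τ := by
  by_cases hw : AffineIndependent ℝ w
  · let b' : Simplex n :=
      ⟨w, hw, hw.affineSpan_eq_top_iff_card_eq_finrank_add_one.2 (by simp)⟩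
    set S : ℝ := volume.real (convexHull ℝ (range w)) ^ ((n : ℝ)⁻¹) with hS
    have hS0 : 0 < S := Real.rpow_pos_of_pos (volume_simplex_pos b') _
    set κ₁ : ℝ := ∑ i, ∑ j, dist (w i) (w j) / S
    set κ₂ : ℝ := ∑ i, ‖baryGrad b' i‖ * S
    have h1 : 0 ≤ κ₁ := by positivity
    have h2 : 0 ≤ κ₂ := by positivity
    refine ⟨κ₁ + κ₂, fun τ hτ a t ht h => ?_⟩
    have hsize : τ.size = t * S := by
      rw [size, closed, volume_convexHull_homothety ht h,
        Real.mul_rpow (by positivity) (by positivity), ← Real.rpow_natCast,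
        ← Real.rpow_mul ht.le, mul_inv_cancel₀ (by exact_mod_cast hn), Real.rpow_one]
    constructor
    · intro i j
      have h3 : dist (w i) (w j) / S ≤ κ₁ :=
        (single_le_sum (f := fun j => dist (w i) (w j) / S) (fun _ _ => by positivity)
          (Finset.mem_univ j)).trans
        (single_le_sum (f := fun i => ∑ j, dist (w i) (w j) / S) (fun _ _ => by positivity)
          (Finset.mem_univ i))
      rw [h, h, dist_add_left, dist_smul₀, Real.norm_of_nonneg ht.le, hsize]
      rw [div_le_iff₀ hS0] at h3
      calc t * dist (w i) (w j) ≤ t * (κ₁ * S) := by gcongr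
        _ ≤ t * ((κ₁ + κ₂) * S) := by gcongr; linarith
        _ = _ := by ring
    · intro b hb i
      have h3 : ‖baryGrad b' i‖ * S ≤ κ₂ :=
        single_le_sum (f := fun i => ‖baryGrad b' i‖ * S) (fun _ _ => by positivity)
          (Finset.mem_univ i)
      rw [baryGrad_homothety (b' := b') ht (fun j => by rw [hb]; exact h j), norm_smul, norm_inv,
        Real.norm_of_nonneg ht.le, hsize]
      calc t⁻¹ * ‖baryGrad b' i‖ * (t * S) = ‖baryGrad b' i‖ * S := by field_simp
        _ ≤ _ := by linarith
  · refine ⟨0, fun τ hτ a t ht h => (hw ?_).elim⟩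
    have h1 : τ.vert = (AffineMap.const ℝ (E n) a + (t • (LinearMap.id : E n →ₗ[ℝ] E n)).toAffineMap) ∘ w := by
      funext j
      simp [h]
    rw [h1] at hτ
    exact hτ.of_comp _

/-- Bisection generates finitely many similarity classes only. -/
theorem HasFrame.exists_shapeRegular (hn : n ≠ 0) (v : Fin n → E n) :
    ∃ κ : ℝ, ∀ τ : TaggedSimplex n, AffineIndependent ℝ τ.vert → HasFrame v τ →
      ShapeRegular κ τ := by
  choose κ hκ using fun s : Fin n × (Fin n → ℤˣ) × (Fin n → Fin n) =>
    Stokes.exists_shapeRegular hn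
      (frameVert s.1 fun i => ((s.2.1 i : ℤ) : ℝ) • v (s.2.2 i))
  refine ⟨∑ s, |κ s|, fun τ hτ ⟨k, ε, π, h⟩ => ?_⟩
  have h1 := hκ (τ.tag, ε, π) τ hτ _ _ (by positivity) h
  have h2 : κ (τ.tag, ε, π) ≤ ∑ s, |κ s| := (le_abs_self _).trans
    (single_le_sum (f := fun s => |κ s|) (fun _ _ => abs_nonneg _) (Finset.mem_univ _))
  refine ⟨fun i j => (h1.1 i j).trans ?_, fun b hb i => (h1.2 b hb i).trans h2⟩
  have : 0 ≤ τ.size := Real.rpow_nonneg measureReal_nonneg _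
  gcongr

end Frames

section Children

open TaggedSimplex

variable {n : ℕ}

/-- The affine basis formed by the vertices of a nondegenerate simplex. -/
def TaggedSimplex.basis (τ : TaggedSimplex n) (h : AffineIndependent ℝ τ.vert) :
    Simplex n :=
  ⟨τ.vert, h, h.affineSpan_eq_top_iff_card_eq_finrank_add_one.2 (by simp)⟩

@[simp]
theorem TaggedSimplex.coe_basis (τ : TaggedSimplex n) (h : AffineIndependent ℝ τ.vert) :
    ⇑(τ.basis h) = τ.vert := rfl

theorem TaggedSimplex.simplex_basis (τ : TaggedSimplex n) (h : AffineIndependent ℝ τ.vert) :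
    simplex (τ.basis h) = τ.closed := rfl

theorem TaggedSimplex.z_val (τ : TaggedSimplex n) (j : Fin (n + 1)) : τ.z j = τ.vert j := by
  simp [z]

theorem TaggedSimplex.range_child₁ (hn : n ≠ 0) (τ : TaggedSimplex n) :
    range τ.child₁.vert = insert τ.newVertex (τ.vert '' {Fin.last n}ᶜ) := by
  have hz : ∀ k < n, τ.z k ∈ τ.vert '' {Fin.last n}ᶜ := fun k hk =>
    ⟨⟨k, by omega⟩, by simp [Fin.ext_iff]; omega, (τ.z_val ⟨k, by omega⟩).symm⟩
  refine Subset.antisymm ?_ ?_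
  · rintro _ ⟨j, rfl⟩
    simp only [child₁]
    split_ifs with h0 h1
    · exact Or.inr (hz 0 (by omega))
    · exact Or.inl rfl
    · exact Or.inr (hz _ (by omega))
  · rintro _ (rfl | ⟨j, hj, rfl⟩)
    · exact ⟨⟨1, by omega⟩, by simp [child₁]⟩
    · have hj' : (j : ℕ) < n := by
        have : (j : ℕ) ≠ n := fun h => hj (Fin.ext h)
        omega
      rcases Nat.eq_zero_or_pos (j : ℕ) with h0 | h0
      · refine ⟨0, ?_⟩
        simp [child₁, ← τ.z_val j, h0]
      · refine ⟨⟨j + 1, by omega⟩, ?_⟩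
        simp [child₁, ← τ.z_val j, h0.ne']

theorem TaggedSimplex.range_child₂ (τ : TaggedSimplex n) :
    range τ.child₂.vert = insert τ.newVertex (τ.vert '' {0}ᶜ) := by
  have hz : ∀ k, 0 < k → k ≤ n → τ.z k ∈ τ.vert '' {0}ᶜ := fun k hk hk' =>
    ⟨⟨k, by omega⟩, by simp [Fin.ext_iff]; omega, (τ.z_val ⟨k, by omega⟩).symm⟩
  have hγ := τ.tag.isLt
  refine Subset.antisymm ?_ ?_
  · rintro _ ⟨j, rfl⟩
    simp only [child₂]
    split_ifs with h0 h1
    · exact Or.inr (hz n (by omega) le_rfl)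
    · exact Or.inl rfl
    · exact Or.inr (hz _ (by omega) (by omega))
    · exact Or.inr (hz _ (by omega) (by omega))
  · rintro _ (rfl | ⟨j, hj, rfl⟩)
    · exact ⟨⟨1, by omega⟩, by simp [child₂]⟩
    · have h0 : (j : ℕ) ≠ 0 := fun h => hj (Fin.ext h)
      rw [← τ.z_val j]
      rcases Nat.lt_or_ge (j : ℕ) n with h1 | h1
      · rcases Nat.lt_or_ge (τ.tag : ℕ) (j : ℕ) with h2 | h2
        · refine ⟨⟨n + τ.tag + 1 - j, by omega⟩, ?_⟩
          simp only [child₂]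
          rw [if_neg (by omega), if_neg (by omega), if_neg (by omega)]
          congr 1; omega
        · refine ⟨⟨j + 1, by omega⟩, ?_⟩
          simp only [child₂]
          rw [if_neg (by omega), if_neg (by omega), if_pos (by omega)]
          congr 1
      · refine ⟨0, ?_⟩
        simp only [child₂]
        rw [if_pos (by simp)]
        congr 1; omega

/-- Cutting a simplex at the midpoint of an edge. -/
theorem convexHull_insert_midpoint (b : Simplex n) {i j : Fin (n + 1)}
    (hij : i ≠ j) : convexHull ℝ (insert (midpoint ℝ (b i) (b j)) (b '' {j}ᶜ)) =
      {x | x ∈ simplex b ∧ b.coord j x ≤ b.coord i x} := by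
  refine Subset.antisymm (convexHull_min ?_ ?_) ?_
  · rintro _ (rfl | ⟨k, hk, rfl⟩)
    · refine ⟨(convex_simplex b).midpoint_mem (vertex_mem_simplex b i) (vertex_mem_simplex b j), ?_⟩
      rw [AffineMap.map_midpoint, AffineMap.map_midpoint]
      simp [b.coord_apply, hij, hij.symm, midpoint_eq_smul_add]
    · refine ⟨vertex_mem_simplex b k, ?_⟩
      rw [b.coord_apply_ne (Ne.symm hk), b.coord_apply]
      split_ifs <;> norm_num
  · have : {x | x ∈ simplex b ∧ b.coord j x ≤ b.coord i x} =
        simplex b ∩ (b.coord i - b.coord j) ⁻¹' Ici 0 := by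
      ext x; simp
    rw [this]
    exact (convex_simplex b).inter ((convex_Ici 0).affine_preimage _)
  · rintro x ⟨hx, hle⟩
    have h0 := (mem_simplex b).1 hx
    set m := midpoint ℝ (b i) (b j)
    set c := fun k => b.coord k x
    have hs : ∑ k, (c k + ((if k = j then c j else 0) - if k = i then c j else 0)) = 1 := by
      rw [sum_add_distrib, sum_sub_distrib]
      simp [c]
    have hp : x = ∑ k, (c k + ((if k = j then c j else 0) - if k = i then c j else 0)) •
        (if k = j then m else b k) := by
      have : ∀ k, (c k + ((if k = j then c j else 0) - if k = i then c j else 0)) •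
          (if k = j then m else b k) = c k • b k +
            ((if k = j then c j • b i else 0) - if k = i then c j • b i else 0) := by
        intro k
        rcases eq_or_ne k j with rfl | hk
        · simp only [if_true, hij.symm, if_false, m, midpoint_eq_smul_add, invOf_eq_inv]
          module
        · rcases eq_or_ne k i with rfl | hk'
          · simp only [hk, if_false, if_true]; module
          · simp [hk, hk']
      simp_rw [this, sum_add_distrib, sum_sub_distrib]
      simp [c]
    rw [hp]
    refine (convex_convexHull ℝ _).sum_mem (fun k _ => ?_) hs fun k _ => ?_
    · have := h0 k
      have := h0 j
      change b.coord j x ≤ b.coord i x at hle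
      rcases eq_or_ne k i with rfl | hk
      · simp only [hij, if_false, if_true, c]; linarith
      · simp only [hk, if_false, c]; split_ifs <;> linarith
    · split_ifs with hk
      · exact subset_convexHull ℝ _ (mem_insert _ _)
      · exact subset_convexHull ℝ _ (mem_insert_of_mem _ ⟨k, hk, rfl⟩)

theorem affineIndependent_of_range_eq (b : Simplex n) {i j : Fin (n + 1)}
    (hij : i ≠ j) {w : Fin (n + 1) → E n}
    (hw : range w = insert (midpoint ℝ (b i) (b j)) (b '' {j}ᶜ)) : AffineIndependent ℝ w := by
  rw [affineIndependent_iff_finrank_vectorSpan_eq ℝ w (n := n) (by simp)]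
  suffices h : affineSpan ℝ (range w) = ⊤ by
    rw [(AffineSubspace.affineSpan_eq_top_iff_vectorSpan_eq_top_of_nonempty ℝ (E n) (E n)
      (range_nonempty w)).1 h]
    simp
  rw [eq_top_iff, ← b.tot, affineSpan_le]
  have hm : ∀ y ∈ insert (midpoint ℝ (b i) (b j)) (b '' {j}ᶜ), y ∈ affineSpan ℝ (range w) :=
    fun y hy => subset_affineSpan ℝ _ (hw ▸ hy)
  rintro _ ⟨k, rfl⟩
  rcases eq_or_ne k j with rfl | hk
  · have h1 := AffineMap.lineMap_mem (2 : ℝ) (hm (b i) (mem_insert_of_mem _ ⟨i, hij, rfl⟩))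
      (hm _ (mem_insert _ _))
    have h2 : b k = AffineMap.lineMap (b i) (midpoint ℝ (b i) (b k)) (2 : ℝ) := by
      simp [AffineMap.lineMap_apply, midpoint_eq_smul_add, invOf_eq_inv]
      module
    rwa [SetLike.mem_coe, h2]
  · exact hm _ (mem_insert_of_mem _ ⟨k, hk, rfl⟩)

variable {Ω : Set (E n)} {P P' P₀ : Finset (TaggedSimplex n)}

theorem TaggedSimplex.affineIndependent_children (hn : n ≠ 0) {τ : TaggedSimplex n}
    (h : AffineIndependent ℝ τ.vert) {σ : TaggedSimplex n} (hσ : σ ∈ τ.children) :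
    AffineIndependent ℝ σ.vert := by
  have h0 : (0 : Fin (n + 1)) ≠ Fin.last n := by simp [Fin.ext_iff]; omega
  rcases Finset.mem_insert.1 hσ with rfl | hσ
  · exact affineIndependent_of_range_eq (τ.basis h) h0 (τ.range_child₁ hn)
  · rw [Finset.mem_singleton.1 hσ]
    refine affineIndependent_of_range_eq (τ.basis h) h0.symm ?_
    rw [τ.range_child₂, midpoint_comm]; rfl

theorem TaggedSimplex.closed_child₁ (hn : n ≠ 0) {τ : TaggedSimplex n}
    (h : AffineIndependent ℝ τ.vert) : τ.child₁.closed =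
      {x | x ∈ τ.closed ∧ (τ.basis h).coord (Fin.last n) x ≤ (τ.basis h).coord 0 x} := by
  have h0 : (0 : Fin (n + 1)) ≠ Fin.last n := by simp [Fin.ext_iff]; omega
  rw [closed, τ.range_child₁ hn]
  exact convexHull_insert_midpoint (τ.basis h) h0

theorem TaggedSimplex.closed_child₂ (hn : n ≠ 0) {τ : TaggedSimplex n}
    (h : AffineIndependent ℝ τ.vert) : τ.child₂.closed =
      {x | x ∈ τ.closed ∧ (τ.basis h).coord 0 x ≤ (τ.basis h).coord (Fin.last n) x} := by
  have h0 : (0 : Fin (n + 1)) ≠ Fin.last n := by simp [Fin.ext_iff]; omega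
  rw [closed, τ.range_child₂, newVertex, midpoint_comm]
  exact convexHull_insert_midpoint (τ.basis h) h0.symm

theorem TaggedSimplex.closed_eq_children (hn : n ≠ 0) {τ : TaggedSimplex n}
    (h : AffineIndependent ℝ τ.vert) : τ.closed = ⋃ σ ∈ τ.children, σ.closed := by
  simp only [children, Finset.mem_insert, Finset.mem_singleton, iUnion_iUnion_eq_or_left,
    iUnion_iUnion_eq_left, closed_child₁ hn h, closed_child₂ hn h]
  ext x
  simp only [mem_union, mem_ofPred_eq, ← and_or_left]
  exact ⟨fun hx => ⟨hx, le_total _ _⟩, fun hx => hx.1⟩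

theorem TaggedSimplex.openHull_child_subset (hn : n ≠ 0) {τ : TaggedSimplex n}
    (h : AffineIndependent ℝ τ.vert) {σ : TaggedSimplex n} (hσ : σ ∈ τ.children) :
    σ.openHull ⊆ τ.openHull := by
  refine interior_mono ?_
  rw [closed_eq_children hn h]
  exact subset_biUnion_of_mem (u := fun σ : TaggedSimplex n => σ.closed) hσ

theorem TaggedSimplex.disjoint_children (hn : n ≠ 0) {τ : TaggedSimplex n}
    (h : AffineIndependent ℝ τ.vert) : Disjoint τ.child₁.openHull τ.child₂.openHull := by
  have h0 : (0 : Fin (n + 1)) ≠ Fin.last n := by simp [Fin.ext_iff]; omega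
  rw [openHull, openHull, disjoint_iff_inter_eq_empty, ← interior_inter,
    eq_empty_iff_forall_notMem]
  intro x hx
  set b := τ.basis h
  -- the difference of two barycentric coordinates would vanish on an open set
  have h1 : ∀ y ∈ τ.child₁.closed ∩ τ.child₂.closed,
      ⟪baryGrad b 0 - baryGrad b (Fin.last n), y⟫_ℝ =
        b.coord (Fin.last n) x - b.coord 0 x +
          ⟪baryGrad b 0 - baryGrad b (Fin.last n), x⟫_ℝ := by
    intro y hy
    rw [closed_child₁ hn h, closed_child₂ hn h] at hy
    have e1 := le_antisymm hy.1.2 hy.2.2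
    change b.coord _ y = b.coord _ y at e1
    rw [coord_eq_add_inner b _ y x, coord_eq_add_inner b 0 y x, inner_sub_right, inner_sub_right] at e1
    rw [inner_sub_left, inner_sub_left]
    linarith
  obtain ⟨r, hr, hball⟩ := Metric.isOpen_iff.1 isOpen_interior x hx
  set v := b 0 - b (Fin.last n)
  have hc : Tendsto (fun t : ℝ => x + t • v) (𝓝[>] 0) (𝓝 x) := by
    have : ContinuousAt (fun t : ℝ => x + t • v) 0 := by fun_prop
    simpa [ContinuousAt] using this.tendsto.mono_left nhdsWithin_le_nhds
  obtain ⟨t, ht1, ht2⟩ := ((hc.eventually (ball_mem_nhds x hr)).and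
    self_mem_nhdsWithin).exists
  have e1 := h1 _ (interior_subset (hball ht1))
  have e2 := h1 x (interior_subset hx)
  have e3 : ⟪baryGrad b 0 - baryGrad b (Fin.last n), v⟫_ℝ = 2 := by
    rw [inner_sub_left, inner_baryGrad_vertex_sub, inner_baryGrad_vertex_sub]
    simp only [h0, h0.symm, if_true, if_false]
    norm_num
  rw [inner_add_right, real_inner_smul_right, e3] at e1
  have : (0 : ℝ) < t := ht2
  linarith

theorem BisectStep.exists_parent (h : BisectStep P P') {σ : TaggedSimplex n} (hσ : σ ∈ P') :
    ∃ τ ∈ P, σ = τ ∨ σ ∈ τ.children := by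
  obtain ⟨R, hR, rfl⟩ := h
  rcases Finset.mem_union.1 hσ with hσ | hσ
  · exact ⟨σ, (Finset.mem_sdiff.1 hσ).1, Or.inl rfl⟩
  · obtain ⟨τ, hτ, h⟩ := Finset.mem_biUnion.1 hσ
    exact ⟨τ, hR hτ, Or.inr h⟩

theorem BisectStep.isPartition (hn : n ≠ 0) (h : BisectStep P P') (hP : IsPartition Ω P) :
    IsPartition Ω P' := by
  obtain ⟨R, hR, rfl⟩ := h
  have hsub : ∀ σ ∈ (P \ R) ∪ R.biUnion children, (σ ∈ P ∧ σ ∉ R) ∨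
      ∃ τ ∈ R, σ ∈ τ.children := by
    intro σ hσ
    rcases Finset.mem_union.1 hσ with hσ | hσ
    · exact Or.inl (Finset.mem_sdiff.1 hσ)
    · exact Or.inr (Finset.mem_biUnion.1 hσ)
  have hch : ∀ τ ∈ R, ∀ σ ∈ τ.children, σ.openHull ⊆ τ.openHull := fun τ hτ σ hσ =>
    openHull_child_subset hn (hP.nondegenerate τ (hR hτ)) hσ
  refine ⟨fun σ hσ => ?_, ?_, fun σ hσ ρ hρ hne => ?_⟩
  · rcases hsub σ hσ with hσ | ⟨τ, hτ, h⟩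
    · exact hP.nondegenerate σ hσ.1
    · exact affineIndependent_children hn (hP.nondegenerate τ (hR hτ)) h
  · rw [hP.cover]
    ext x
    simp only [mem_iUnion, exists_prop]
    constructor
    · rintro ⟨τ, hτ, hx⟩
      by_cases hτR : τ ∈ R
      · rw [closed_eq_children hn (hP.nondegenerate τ hτ)] at hx
        obtain ⟨σ, hσ, hx⟩ := mem_iUnion₂.1 hx
        exact ⟨σ, Finset.mem_union_right _ (Finset.mem_biUnion.2 ⟨τ, hτR, hσ⟩), hx⟩
      · exact ⟨τ, Finset.mem_union_left _ (Finset.mem_sdiff.2 ⟨hτ, hτR⟩), hx⟩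
    · rintro ⟨σ, hσ, hx⟩
      rcases hsub σ hσ with hσ | ⟨τ, hτ, h⟩
      · exact ⟨σ, hσ.1, hx⟩
      · refine ⟨τ, hR hτ, ?_⟩
        rw [closed_eq_children hn (hP.nondegenerate τ (hR hτ))]
        exact mem_iUnion₂.2 ⟨σ, h, hx⟩
  · rcases hsub σ hσ with hσ | ⟨τ, hτ, h⟩ <;> rcases hsub ρ hρ with hρ | ⟨τ', hτ', h'⟩
    · exact hP.disjoint σ hσ.1 ρ hρ.1 hne
    · exact (hP.disjoint σ hσ.1 τ' (hR hτ') fun h => hσ.2 (h ▸ hτ')).mono_right (hch τ' hτ' ρ h')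
    · exact (hP.disjoint τ (hR hτ) ρ hρ.1 fun h => hρ.2 (h ▸ hτ)).mono_left (hch τ hτ σ h)
    · rcases eq_or_ne τ τ' with rfl | hτne
      · have hd := disjoint_children hn (hP.nondegenerate τ (hR hτ))
        simp only [children, Finset.mem_insert, Finset.mem_singleton] at h h'
        rcases h with rfl | rfl <;> rcases h' with rfl | rfl
        · exact (hne rfl).elim
        · exact hd
        · exact hd.symm
        · exact (hne rfl).elim
      · exact (hP.disjoint τ (hR hτ) τ' (hR hτ') hτne).mono (hch τ hτ σ h) (hch τ' hτ' ρ h')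

theorem Refines.isPartition (hn : n ≠ 0) (h : Refines P P') (hP : IsPartition Ω P) :
    IsPartition Ω P' := by
  induction h with
  | refl => exact hP
  | tail _ hs ih => exact hs.isPartition hn ih

/-- Every simplex of a refinement lies in a simplex of the original partition. -/
theorem Refines.exists_ancestor (hn : n ≠ 0) (h : Refines P P') (hP : IsPartition Ω P) :
    ∀ σ ∈ P', ∃ τ ∈ P, σ.openHull ⊆ τ.openHull := by
  induction h with
  | refl => exact fun σ hσ => ⟨σ, hσ, Subset.rfl⟩
  | tail h hs ih =>
    intro σ hσ
    obtain ⟨ρ, hρ, h1⟩ := hs.exists_parent hσ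
    obtain ⟨τ, hτ, h2⟩ := ih ρ hρ
    refine ⟨τ, hτ, Subset.trans ?_ h2⟩
    rcases h1 with rfl | h1
    · exact Subset.rfl
    · exact openHull_child_subset hn
        ((Refines.isPartition hn h hP).nondegenerate ρ hρ) h1

/-- Newest vertex bisection preserves shape regularity, uniformly in the number of bisections. -/
theorem exists_shapeRegular_of_refines (hn : n = 2 ∨ n = 3) (hP₀ : IsPartition Ω P₀) :
    ∃ κ : ℝ, 1 ≤ κ ∧ ∀ P, Refines P₀ P → ∀ τ ∈ P, ShapeRegular κ τ := by
  have hn0 : n ≠ 0 := by omega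
  choose v hv using fun τ : TaggedSimplex n => exists_hasFrame hn τ
  choose κ hκ using fun τ : TaggedSimplex n => HasFrame.exists_shapeRegular hn0 (v τ)
  have hfr : ∀ P, Refines P₀ P → ∀ τ ∈ P, ∃ τ₀ ∈ P₀, HasFrame (v τ₀) τ := by
    intro P hP
    induction hP with
    | refl => exact fun τ hτ => ⟨τ, hτ, hv τ⟩
    | tail _ hs ih =>
      intro σ hσ
      obtain ⟨ρ, hρ, h1⟩ := hs.exists_parent hσ
      obtain ⟨τ, hτ, h2⟩ := ih ρ hρ
      refine ⟨τ, hτ, ?_⟩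
      rcases h1 with rfl | h1
      · exact h2
      · rcases Finset.mem_insert.1 h1 with rfl | h1
        · exact (h2.children hn).1
        · rw [Finset.mem_singleton.1 h1]
          exact (h2.children hn).2
  refine ⟨1 + ∑ τ ∈ P₀, |κ τ|, by
    have := sum_nonneg fun τ (_ : τ ∈ P₀) => abs_nonneg (κ τ); linarith, fun P hP τ hτ => ?_⟩
  obtain ⟨τ₀, hτ₀, h⟩ := hfr P hP τ hτ
  have h1 := hκ τ₀ τ ((hP.isPartition hn0 hP₀).nondegenerate τ hτ) h
  have h2 := single_le_sum (f := fun τ => |κ τ|) (fun _ _ => abs_nonneg _) hτ₀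
  have h3 : κ τ₀ ≤ 1 + ∑ τ ∈ P₀, |κ τ| := by have := le_abs_self (κ τ₀); linarith
  refine ⟨fun i j => (h1.1 i j).trans ?_, fun b hb i => (h1.2 b hb i).trans h3⟩
  have : 0 ≤ τ.size := Real.rpow_nonneg measureReal_nonneg _
  gcongr

end Children

/-! ### Lipschitz domains and Lipschitz functions on finite closed covers -/

section Domain

variable {n : ℕ} {Ω : Set (E n)}

/-- Near a boundary point, two points of the domain are joined by going up in the direction of the
graph, across, and down again. -/
theorem IsLipschitzDomain.exists_path_of_frontier (hΩ : IsLipschitzDomain Ω) {x : E n}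
    (hx : x ∈ frontier Ω) : ∃ r > 0, ∃ L : ℝ, 0 ≤ L ∧ ∀ y ∈ ball x r, ∀ z ∈ ball x r,
      y ∈ Ω → z ∈ Ω → ∃ v : E n, ‖v‖ ≤ L * dist y z ∧ segment ℝ y (y + v) ⊆ Ω ∧
        segment ℝ (y + v) (z + v) ⊆ Ω ∧ segment ℝ (z + v) z ⊆ Ω := by
  obtain ⟨r, e, φ, K, hr, he, hφ, hφe, hgr⟩ := hΩ.lipschitz x hx
  have hK : (0 : ℝ) ≤ K := K.2
  refine ⟨r / (2 * K + 3), by positivity, K + 1, by positivity, fun y hy z hz hyΩ hzΩ => ?_⟩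
  set s := r / (2 * K + 3) with hs
  have hs0 : 0 < s := by positivity
  have hsr : (2 * K + 3) * s = r := by rw [hs]; field_simp
  have hd : dist y z < 2 * s := by
    have := dist_triangle_right y z x
    rw [mem_ball] at hy hz; linarith
  set t := (K + 1) * dist y z with ht
  have ht0 : 0 ≤ t := by positivity
  have hyb : y ∈ ball x r := ball_subset_ball (by nlinarith) hy
  have hzb : z ∈ ball x r := ball_subset_ball (by nlinarith) hz
  have hey := (hgr y hyb).1 hyΩ
  have hez := (hgr z hzb).1 hzΩ
  have hball : ∀ p ∈ segment ℝ y z, ∀ u, 0 ≤ u → u ≤ t → p + u • e ∈ ball x r := by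
    intro p hp u hu0 hut
    have h1 : p ∈ ball x s := (convex_ball x s).segment_subset hy hz hp
    rw [mem_ball] at h1 ⊢
    calc dist (p + u • e) x ≤ dist (p + u • e) p + dist p x := dist_triangle _ _ _
      _ < u + s := by
          have : dist (p + u • e) p = u := by
            rw [dist_eq_norm, add_sub_cancel_left, norm_smul, he, mul_one, Real.norm_of_nonneg hu0]
          linarith
      _ ≤ r := by nlinarith
  have hee : ⟪e, e⟫_ℝ = 1 := by rw [real_inner_self_eq_norm_sq, he, one_pow]
  have hup : ∀ p ∈ segment ℝ y z, φ p < ⟪e, p⟫_ℝ → segment ℝ p (p + t • e) ⊆ Ω := by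
    intro p hp hφp q hq
    rw [segment_eq_image'] at hq
    obtain ⟨θ, hθ, rfl⟩ := hq
    rw [add_sub_cancel_left]
    dsimp only
    rw [smul_smul]
    have hθt : 0 ≤ θ * t := mul_nonneg hθ.1 ht0
    refine (hgr _ (hball p hp _ hθt (mul_le_of_le_one_left ht0 hθ.2))).2 ?_
    rw [hφe, inner_add_right, real_inner_smul_right, hee]
    linarith
  refine ⟨t • e, by rw [norm_smul, he, mul_one, Real.norm_of_nonneg ht0],
    hup y (left_mem_segment ℝ y z) hey, ?_, ?_⟩
  · intro q hq
    rw [segment_eq_image'] at hq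
    obtain ⟨θ, hθ, rfl⟩ := hq
    have hp : y + θ • (z - y) ∈ segment ℝ y z := by
      rw [segment_eq_image']; exact ⟨θ, hθ, rfl⟩
    have e1 : y + t • e + θ • (z + t • e - (y + t • e)) = y + θ • (z - y) + t • e := by
      rw [add_sub_add_right_eq_sub]; abel
    dsimp only
    rw [e1]
    refine (hgr _ (hball _ hp t ht0 le_rfl)).2 ?_
    rw [hφe, inner_add_right, real_inner_smul_right, hee]
    set p := y + θ • (z - y) with hpdef
    have hpy : dist p y ≤ dist y z := by
      rw [hpdef, dist_eq_norm, add_sub_cancel_left, norm_smul, Real.norm_of_nonneg hθ.1,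
        dist_comm, dist_eq_norm]
      exact mul_le_of_le_one_left (norm_nonneg _) hθ.2
    have h1 := hφ.dist_le_mul p y
    rw [Real.dist_eq] at h1
    have h2 := (le_abs_self _).trans h1
    have h3 : ⟪e, y⟫_ℝ - ⟪e, p⟫_ℝ ≤ dist p y := by
      rw [← inner_sub_right, dist_comm, dist_eq_norm]
      simpa [he] using real_inner_le_norm e (y - p)
    rcases eq_or_lt_of_le (dist_nonneg (x := y) (y := z)) with h0 | h0
    · rw [← h0] at hpy ht
      have : p = y := dist_le_zero.1 hpy
      rw [this]; simp at ht; linarith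
    · nlinarith
  · rw [segment_symm]
    exact hup z (right_mem_segment ℝ y z) hez

/-- Lipschitz domains are locally quasiconvex, uniformly up to the boundary: nearby points are
joined by a polygon of three segments of comparable length. -/
theorem IsLipschitzDomain.exists_path (hΩ : IsLipschitzDomain Ω) : ∃ r > 0, ∃ L : ℝ, 0 ≤ L ∧
    ∀ y ∈ Ω, ∀ z ∈ Ω, dist y z < r → ∃ v : E n, ‖v‖ ≤ L * dist y z ∧ segment ℝ y (y + v) ⊆ Ω ∧
        segment ℝ (y + v) (z + v) ⊆ Ω ∧ segment ℝ (z + v) z ⊆ Ω := by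
  have key : ∃ r > 0, ∃ L : ℝ, 0 ≤ L ∧
      ∀ y ∈ closure Ω, y ∈ Ω → ∀ z ∈ Ω, dist y z < r → ∃ v : E n, ‖v‖ ≤ L * dist y z ∧
        segment ℝ y (y + v) ⊆ Ω ∧ segment ℝ (y + v) (z + v) ⊆ Ω ∧ segment ℝ (z + v) z ⊆ Ω := by
    refine hΩ.isBounded.isCompact_closure.induction_on (p := fun S => ∃ r > 0, ∃ L : ℝ, 0 ≤ L ∧
      ∀ y ∈ S, y ∈ Ω → ∀ z ∈ Ω, dist y z < r → ∃ v : E n, ‖v‖ ≤ L * dist y z ∧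
        segment ℝ y (y + v) ⊆ Ω ∧ segment ℝ (y + v) (z + v) ⊆ Ω ∧ segment ℝ (z + v) z ⊆ Ω)
      ⟨1, one_pos, 0, le_rfl, by simp⟩ ?_ ?_ ?_
    · rintro S T hST ⟨r, hr, L, hL, h⟩
      exact ⟨r, hr, L, hL, fun y hy => h y (hST hy)⟩
    · rintro S T ⟨r, hr, L, hL, h⟩ ⟨r', hr', L', hL', h'⟩
      refine ⟨min r r', lt_min hr hr', max L L', le_max_of_le_left hL, fun y hy hyΩ z hz hd => ?_⟩
      rcases hy with hy | hy
      · obtain ⟨v, hv, h1⟩ := h y hy hyΩ z hz (hd.trans_le (min_le_left _ _))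
        exact ⟨v, hv.trans (by gcongr; exact le_max_left _ _), h1⟩
      · obtain ⟨v, hv, h1⟩ := h' y hy hyΩ z hz (hd.trans_le (min_le_right _ _))
        exact ⟨v, hv.trans (by gcongr; exact le_max_right _ _), h1⟩
    · intro x hx
      by_cases hxΩ : x ∈ Ω
      · obtain ⟨r, hr, hb⟩ := Metric.isOpen_iff.1 hΩ.isOpen x hxΩ
        refine ⟨ball x (r / 2), mem_nhdsWithin_of_mem_nhds (ball_mem_nhds x (by positivity)),
          r / 2, by positivity, 0, le_rfl, fun y hy hyΩ z hz hd => ⟨0, by simp, ?_, ?_, ?_⟩⟩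
        · simpa using hyΩ
        · rw [add_zero, add_zero]
          refine ((convex_ball x r).segment_subset ?_ ?_).trans hb
          · exact ball_subset_ball (by linarith) hy
          · rw [mem_ball] at hy ⊢
            have := dist_triangle_left z x y
            linarith
        · simpa using hz
      · have hxf : x ∈ frontier Ω := by
          rw [hΩ.isOpen.frontier_eq]; exact ⟨hx, hxΩ⟩
        obtain ⟨r, hr, L, hL, h⟩ := hΩ.exists_path_of_frontier hxf
        refine ⟨ball x (r / 2), mem_nhdsWithin_of_mem_nhds (ball_mem_nhds x (by positivity)),
          r / 2, by positivity, L, hL, fun y hy hyΩ z hz hd =>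
            h y (ball_subset_ball (by linarith) hy) z ?_ hyΩ hz⟩
        rw [mem_ball] at hy ⊢
        have := dist_triangle_left z x y
        linarith
  obtain ⟨r, hr, L, hL, h⟩ := key
  exact ⟨r, hr, L, hL, fun y hy => h y (subset_closure hy) hy⟩

/-- The complement of a Lipschitz domain contains, near each boundary point and at each small
scale, a ball of comparable radius. -/
theorem IsLipschitzDomain.exists_exterior_ball (hΩ : IsLipschitzDomain Ω) : ∃ r > 0, ∃ c > 0,
    ∀ x ∈ frontier Ω, ∀ ρ, 0 < ρ → ρ < r →
      ∃ y, ball y (c * ρ) ⊆ ball x ρ ∧ Disjoint (ball y (c * ρ)) Ω := by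
  have hc : IsCompact (frontier Ω) := hΩ.isBounded.isCompact_closure.of_isClosed_subset
    isClosed_frontier frontier_subset_closure
  refine hc.induction_on (p := fun S => ∃ r > 0, ∃ c > 0, ∀ x ∈ S, ∀ ρ, 0 < ρ → ρ < r →
      ∃ y, ball y (c * ρ) ⊆ ball x ρ ∧ Disjoint (ball y (c * ρ)) Ω)
      ⟨1, one_pos, 1, one_pos, by simp⟩ ?_ ?_ ?_
  · rintro S T hST ⟨r, hr, c, hc, h⟩
    exact ⟨r, hr, c, hc, fun y hy => h y (hST hy)⟩
  · rintro S T ⟨r, hr, c, hc, h⟩ ⟨r', hr', c', hc', h'⟩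
    refine ⟨min r r', lt_min hr hr', min c c', lt_min hc hc', fun x hx ρ h0 hρ => ?_⟩
    rcases hx with hx | hx
    · obtain ⟨y, h1, h2⟩ := h x hx ρ h0 (hρ.trans_le (min_le_left _ _))
      have : ball y (min c c' * ρ) ⊆ ball y (c * ρ) :=
        ball_subset_ball (by gcongr; exact min_le_left _ _)
      exact ⟨y, this.trans h1, h2.mono_left this⟩
    · obtain ⟨y, h1, h2⟩ := h' x hx ρ h0 (hρ.trans_le (min_le_right _ _))
      have : ball y (min c c' * ρ) ⊆ ball y (c' * ρ) :=
        ball_subset_ball (by gcongr; exact min_le_right _ _)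
      exact ⟨y, this.trans h1, h2.mono_left this⟩
  · intro x hx
    obtain ⟨r, e, φ, K, hr, he, hφ, hφe, hgr⟩ := hΩ.lipschitz x hx
    have hK : (0 : ℝ) ≤ K := K.2
    refine ⟨ball x (r / 2) ∩ frontier Ω, inter_mem (mem_nhdsWithin_of_mem_nhds
      (ball_mem_nhds x (by positivity))) self_mem_nhdsWithin, r / 2, by positivity,
      1 / (2 * (K + 2)), by positivity, fun p hp ρ h0 hρ => ?_⟩
    obtain ⟨hpx, hpf⟩ := hp
    rw [mem_ball] at hpx
    have hpr : p ∈ ball x r := by rw [mem_ball]; linarith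
    have hpΩ : ⟪e, p⟫_ℝ ≤ φ p := by
      have : p ∉ Ω := by rw [hΩ.isOpen.frontier_eq] at hpf; exact hpf.2
      rw [hgr p hpr] at this
      linarith
    set s := 1 / (2 * (K + 2)) * ρ with hs
    have hs0 : 0 < s := by positivity
    have hsρ : 2 * (K + 2) * s = ρ := by rw [hs]; field_simp
    have hee : ⟪e, e⟫_ℝ = 1 := by rw [real_inner_self_eq_norm_sq, he, one_pow]
    have hsub : ball (p - (ρ / 2) • e) s ⊆ ball p ρ := by
      intro q hq
      rw [mem_ball] at hq ⊢
      have h1 : dist (p - (ρ / 2) • e) p = ρ / 2 := by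
        rw [dist_eq_norm, sub_sub_cancel_left, norm_neg, norm_smul, he, mul_one,
          Real.norm_of_nonneg (by positivity)]
      have := dist_triangle q (p - (ρ / 2) • e) p
      nlinarith
    refine ⟨p - (ρ / 2) • e, hsub, disjoint_left.2 fun q hq hqΩ => ?_⟩
    have hqx : q ∈ ball x r := by
      have h1 := hsub hq
      rw [mem_ball] at h1 ⊢
      have := dist_triangle q p x
      linarith
    have h1 := (hgr q hqx).1 hqΩ
    rw [mem_ball, dist_eq_norm] at hq
    set w := q - (p - (ρ / 2) • e) with hw
    have hq' : q = p + w + (-(ρ / 2)) • e := by rw [hw]; module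
    rw [hq', hφe, inner_add_right, inner_add_right, real_inner_smul_right, hee] at h1
    have h2 := hφ.dist_le_mul p (p + w)
    rw [Real.dist_eq, dist_self_add_right] at h2
    have h3 := (le_abs_self _).trans h2
    have h4 : ⟪e, w⟫_ℝ ≤ ‖w‖ := by simpa [he] using real_inner_le_norm e w
    nlinarith

theorem IsLipschitzDomain.closure_subset_closure_compl (hΩ : IsLipschitzDomain Ω) {x : E n}
    (hx : x ∉ Ω) : x ∈ closure (closure Ω)ᶜ := by
  by_cases hxc : x ∈ closure Ω
  · obtain ⟨r, hr, c, hc, h⟩ := hΩ.exists_exterior_ball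
    have hxf : x ∈ frontier Ω := by rw [hΩ.isOpen.frontier_eq]; exact ⟨hxc, hx⟩
    refine Metric.mem_closure_iff.2 fun ε hε => ?_
    obtain ⟨y, h1, h2⟩ := h x hxf (min ε (r / 2)) (lt_min hε (by positivity))
      ((min_le_right _ _).trans_lt (by linarith))
    have hy : y ∈ ball y (c * min ε (r / 2)) :=
      Metric.mem_ball_self (mul_pos hc (lt_min hε (by positivity)))
    refine ⟨y, fun hyc => ?_, ?_⟩
    · exact (h2.closure_right Metric.isOpen_ball).le_bot ⟨hy, hyc⟩
    · rw [dist_comm]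
      exact (mem_ball.1 (h1 hy)).trans_le (min_le_left _ _)
  · exact subset_closure hxc

theorem IsLipschitzDomain.interior_closure (hΩ : IsLipschitzDomain Ω) :
    interior (closure Ω) = Ω := by
  refine Subset.antisymm (fun x hx => ?_) (interior_maximal subset_closure hΩ.isOpen)
  by_contra h
  have := hΩ.closure_subset_closure_compl h
  rw [closure_compl] at this
  exact this hx

end Domain

section Cover

/-- A function on an interval that is Lipschitz on each of finitely many closed sets covering the
interval is Lipschitz: leave each set for good at the last point of the interval that it
contains. -/
theorem dist_le_of_closed_cover {ι : Type*} {g : ℝ → ℝ} {K : ℝ} (C : ι → Set ℝ) (s : Finset ι)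
    (hC : ∀ i, IsClosed (C i)) (hg : ∀ i, ∀ x ∈ C i, ∀ y ∈ C i, dist (g x) (g y) ≤ K * dist x y) :
    ∀ {p q : ℝ}, p ≤ q → Icc p q ⊆ ⋃ i ∈ s, C i → dist (g p) (g q) ≤ K * (q - p) := by
  classical
  induction s using Finset.strongInduction with
  | H s ih =>
    intro p q hpq hs
    obtain ⟨i, hi, hpi⟩ := mem_iUnion₂.1 (hs (left_mem_Icc.2 hpq))
    have hcomp : IsCompact (C i ∩ Icc p q) := isCompact_Icc.inter_left (hC i)
    have hne : (C i ∩ Icc p q).Nonempty := ⟨p, hpi, left_mem_Icc.2 hpq⟩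
    set t := sSup (C i ∩ Icc p q)
    have ht : t ∈ C i ∩ Icc p q := hcomp.sSup_mem hne
    have h1 : dist (g p) (g t) ≤ K * (t - p) := by
      have := hg i p hpi t ht.1
      rwa [dist_comm p t, Real.dist_eq t p, abs_of_nonneg (sub_nonneg.2 ht.2.1)] at this
    rcases eq_or_lt_of_le ht.2.2 with h | h
    · rwa [h] at h1
    · have h2 : Ioc t q ⊆ ⋃ j ∈ s.erase i, C j := by
        intro y hy
        obtain ⟨j, hj, hyj⟩ := mem_iUnion₂.1 (hs ⟨ht.2.1.trans hy.1.le, hy.2⟩)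
        refine mem_iUnion₂.2 ⟨j, Finset.mem_erase.2 ⟨?_, hj⟩, hyj⟩
        rintro rfl
        exact absurd (le_csSup hcomp.bddAbove ⟨hyj, ht.2.1.trans hy.1.le, hy.2⟩) (not_le.2 hy.1)
      have h3 : Icc t q ⊆ ⋃ j ∈ s.erase i, C j := by
        rw [← closure_Ioc h.ne]
        exact closure_minimal h2 ((s.erase i).finite_toSet.isClosed_biUnion fun j _ => hC j)
      have h4 := ih (s.erase i) (Finset.erase_ssubset hi) h.le h3
      have := dist_triangle (g p) (g t) (g q)
      linarith

variable {n : ℕ} {Ω : Set (E n)} {ι : Type*} {s : Finset ι} {D : ι → Set (E n)} {g : E n → ℝ}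
  {K : NNReal}

theorem dist_le_of_segment_subset (hD : ∀ i ∈ s, IsClosed (D i))
    (hg : ∀ i ∈ s, LipschitzOnWith K g (D i)) {x y : E n} (h : segment ℝ x y ⊆ ⋃ i ∈ s, D i) :
    dist (g x) (g y) ≤ K * dist x y := by
  have h1 := dist_le_of_closed_cover (g := g ∘ AffineMap.lineMap x y) (K := K * dist x y)
    (fun i : s => AffineMap.lineMap x y ⁻¹' D i) Finset.univ
    (fun i => (hD i i.2).preimage (AffineMap.lineMap_continuous)) (fun i a ha b hb => by
      refine ((hg i i.2).dist_le_mul _ ha _ hb).trans ?_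
      rw [dist_lineMap_lineMap]
      exact le_of_eq (by ring)) zero_le_one (by
      intro t ht
      have : AffineMap.lineMap x y t ∈ segment ℝ x y := by
        rw [segment_eq_image_lineMap]; exact ⟨t, ht, rfl⟩
      obtain ⟨i, hi, h⟩ := mem_iUnion₂.1 (h this)
      exact mem_iUnion₂.2 ⟨⟨i, hi⟩, Finset.mem_univ _, h⟩)
  simpa using h1

theorem lipschitzWith_of_closed_cover (hD : ∀ i ∈ s, IsClosed (D i))
    (hg : ∀ i ∈ s, LipschitzOnWith K g (D i)) (h : ⋃ i ∈ s, D i = univ) : LipschitzWith K g :=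
  LipschitzWith.of_dist_le_mul fun _ _ => dist_le_of_segment_subset hD hg (h ▸ subset_univ _)

/-- Piecewise Lipschitz functions on a Lipschitz domain are Lipschitz at small distances. -/
theorem dist_le_of_path {r L : ℝ}
    (hΩ : ∀ y ∈ Ω, ∀ z ∈ Ω, dist y z < r → ∃ v : E n, ‖v‖ ≤ L * dist y z ∧
      segment ℝ y (y + v) ⊆ Ω ∧ segment ℝ (y + v) (z + v) ⊆ Ω ∧ segment ℝ (z + v) z ⊆ Ω)
    (hD : ∀ i ∈ s, IsClosed (D i)) (hg : ∀ i ∈ s, LipschitzOnWith K g (D i))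
    (h : Ω ⊆ ⋃ i ∈ s, D i) {y z : E n} (hy : y ∈ Ω) (hz : z ∈ Ω) (hyz : dist y z < r) :
    dist (g y) (g z) ≤ K * (2 * L + 1) * dist y z := by
  obtain ⟨v, hv, h1, h2, h3⟩ := hΩ y hy z hz hyz
  have e1 := dist_le_of_segment_subset hD hg (h1.trans h)
  have e2 := dist_le_of_segment_subset hD hg (h2.trans h)
  have e3 := dist_le_of_segment_subset hD hg (h3.trans h)
  rw [dist_self_add_right] at e1
  rw [dist_self_add_left] at e3
  rw [dist_add_right] at e2
  have e4 := dist_triangle4 (g y) (g (y + v)) (g (z + v)) (g z)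
  have e5 : K * ‖v‖ ≤ K * (L * dist y z) := by gcongr
  linarith

end Cover

/-! ### Conforming partitions -/

section Mesh

variable {n : ℕ} {Ω : Set (E n)} {P : Finset (TaggedSimplex n)} {τ σ : TaggedSimplex n}

namespace TaggedSimplex

/-- The barycentric coordinate of `τ` that belongs to the vertex `z`, and zero if `z` is not a vertex
of `τ`. Indexing by points of space makes coordinates of different simplices comparable. -/
def bary (τ : TaggedSimplex n) (z : E n) : E n →ᵃ[ℝ] ℝ :=
  open Classical in
  if h : AffineIndependent ℝ τ.vert ∧ z ∈ range τ.vert then (τ.basis h.1).coord h.2.choose else 0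

theorem bary_vert (h : AffineIndependent ℝ τ.vert) (i : Fin (n + 1)) :
    τ.bary (τ.vert i) = (τ.basis h).coord i := by
  have h' : AffineIndependent ℝ τ.vert ∧ τ.vert i ∈ range τ.vert := ⟨h, mem_range_self i⟩
  rw [bary, dif_pos h']
  congr 1
  exact h.injective h'.2.choose_spec

theorem bary_of_notMem {z : E n} (hz : z ∉ range τ.vert) : τ.bary z = 0 := by
  rw [bary, dif_neg fun h => hz h.2]

open Classical in
theorem bary_apply_vertex (h : AffineIndependent ℝ τ.vert) (z : E n) {w : E n}
    (hw : w ∈ range τ.vert) : τ.bary z w = if z = w then 1 else 0 := by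
  obtain ⟨j, rfl⟩ := hw
  by_cases hz : z ∈ range τ.vert
  · obtain ⟨i, rfl⟩ := hz
    rw [bary_vert h, ← τ.coe_basis h, (τ.basis h).coord_apply]
    simp [h.injective.eq_iff]
  · rw [bary_of_notMem hz, if_neg (by rintro rfl; exact hz (mem_range_self j))]
    rfl

theorem continuous_bary (z : E n) : Continuous (τ.bary z) :=
  (τ.bary z).continuous_of_finiteDimensional

theorem mem_closed_iff (h : AffineIndependent ℝ τ.vert) {x : E n} :
    x ∈ τ.closed ↔ ∀ z, 0 ≤ τ.bary z x := by
  rw [← τ.simplex_basis h, mem_simplex]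
  refine ⟨fun hx z => ?_, fun hx i => bary_vert h i ▸ hx (τ.vert i)⟩
  by_cases hz : z ∈ range τ.vert
  · obtain ⟨i, rfl⟩ := hz
    rw [bary_vert h]; exact hx i
  · rw [bary_of_notMem hz]; exact le_rfl

theorem mem_openHull_iff (h : AffineIndependent ℝ τ.vert) {x : E n} :
    x ∈ τ.openHull ↔ ∀ i, 0 < τ.bary (τ.vert i) x := by
  rw [openHull, ← τ.simplex_basis h, mem_interior_simplex]
  simp_rw [bary_vert h]

theorem isCompact_closed : IsCompact τ.closed := (finite_range _).isCompact_convexHull ℝ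

instance : IsFiniteMeasure (volume.restrict τ.closed) := isCompact_closed.isBounded.isFiniteMeasure

theorem isClosed_closed : IsClosed τ.closed := isCompact_closed.isClosed

theorem convex_closed : Convex ℝ τ.closed := convex_convexHull ℝ _

theorem vert_mem_closed (i : Fin (n + 1)) : τ.vert i ∈ τ.closed :=
  subset_convexHull ℝ _ (mem_range_self i)

theorem openHull_subset_closed : τ.openHull ⊆ τ.closed := interior_subset

theorem closure_openHull (h : AffineIndependent ℝ τ.vert) : closure τ.openHull = τ.closed := by
  rw [openHull, ← τ.simplex_basis h]
  exact closure_interior_simplex _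

theorem mem_range_of_bary_pos {z x : E n} (hz : 0 < τ.bary z x) : z ∈ range τ.vert := by
  by_contra h
  rw [bary_of_notMem h] at hz
  exact lt_irrefl _ hz

theorem sum_bary (h : AffineIndependent ℝ τ.vert) (x : E n) :
    ∑ i, τ.bary (τ.vert i) x = 1 := by
  simp_rw [bary_vert h]
  exact (τ.basis h).sum_coord_apply_eq_one x

theorem sum_bary_smul (h : AffineIndependent ℝ τ.vert) (x : E n) :
    ∑ i, τ.bary (τ.vert i) x • τ.vert i = x := by
  simp_rw [bary_vert h]
  exact (τ.basis h).linear_combination_coord_eq_self x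

theorem bary_add (h : AffineIndependent ℝ τ.vert) (i : Fin (n + 1)) (x v : E n) :
    τ.bary (τ.vert i) (x + v) = τ.bary (τ.vert i) x + ⟪baryGrad (τ.basis h) i, v⟫_ℝ := by
  rw [bary_vert h, coord_eq_add_inner _ i (x + v) x, add_sub_cancel_left]

theorem mem_closed_of_face (hτ : AffineIndependent ℝ τ.vert) {x : E n} (hx : x ∈ τ.closed)
    (h : ∀ z, 0 < τ.bary z x → z ∈ range σ.vert) : x ∈ σ.closed := by
  have h1 : x ∈ convexHull ℝ (τ.basis hτ '' {i | τ.vert i ∈ range σ.vert}) := by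
    rw [mem_convexHull_image]
    refine ⟨hx, fun i hi => ?_⟩
    by_contra h0
    refine hi (h _ ?_)
    have := (mem_closed_iff hτ).1 hx (τ.vert i)
    rw [bary_vert hτ] at this ⊢
    exact lt_of_le_of_ne this (Ne.symm h0)
  refine convexHull_mono ?_ h1
  rintro _ ⟨i, hi, rfl⟩
  exact hi

open Classical in
theorem mem_facets_of_subset (hσ : AffineIndependent ℝ σ.vert) {e : Finset (E n)} (he : e.card = n)
    (h : ∀ z ∈ e, z ∈ range σ.vert) : e ∈ σ.facets := by
  set s : Finset (Fin (n + 1)) := Finset.univ.filter fun j => σ.vert j ∈ e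
  have hs : s.image σ.vert = e := by
    ext z
    simp only [s, Finset.mem_image, mem_filter, Finset.mem_univ, true_and]
    constructor
    · rintro ⟨j, hj, rfl⟩; exact hj
    · intro hz
      obtain ⟨j, rfl⟩ := h z hz
      exact ⟨j, hz, rfl⟩
  have hcard : s.card = n := by
    have := Finset.card_image_of_injective s hσ.injective
    rw [hs] at this
    omega
  have hcompl : sᶜ.card = 1 := by
    rw [Finset.card_compl, hcard, Fintype.card_fin]; omega
  obtain ⟨k, hk⟩ := Finset.card_eq_one.1 hcompl
  refine Finset.mem_image.2 ⟨k, Finset.mem_univ _, ?_⟩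
  rw [← hs]
  congr 1
  rw [← compl_compl s, hk]
  ext j; simp

end TaggedSimplex

open TaggedSimplex

/-- The barycentric coordinates of two simplices of a conforming partition agree on their
intersection. -/
theorem IsConforming.bary_eq (hc : IsConforming P) (hP : IsPartition Ω P) (hτ : τ ∈ P) (hσ : σ ∈ P)
    {x : E n} (h1 : x ∈ τ.closed) (h2 : x ∈ σ.closed) (z : E n) : τ.bary z x = σ.bary z x := by
  classical
  have hx : x ∈ convexHull ℝ (range τ.vert ∩ range σ.vert) := hc τ hτ σ hσ ▸ ⟨h1, h2⟩
  have hconv : Convex ℝ ((τ.bary z - σ.bary z) ⁻¹' {0}) := (convex_singleton 0).affine_preimage _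
  have := convexHull_min (fun w hw => ?_) hconv hx
  · simpa [sub_eq_zero] using this
  · simp [bary_apply_vertex (hP.nondegenerate τ hτ) z hw.1,
      bary_apply_vertex (hP.nondegenerate σ hσ) z hw.2]

theorem IsPartition.closed_subset (hP : IsPartition Ω P) (hτ : τ ∈ P) : τ.closed ⊆ closure Ω := by
  rw [hP.cover]
  exact subset_biUnion_of_mem (u := fun τ : TaggedSimplex n => τ.closed) hτ

theorem IsPartition.exists_mem (hP : IsPartition Ω P) {x : E n} (hx : x ∈ closure Ω) :
    ∃ τ ∈ P, x ∈ τ.closed := by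
  rw [hP.cover] at hx
  simpa using hx

theorem IsPartition.openHull_subset (hP : IsPartition Ω P) (hΩ : IsLipschitzDomain Ω) (hτ : τ ∈ P) :
    τ.openHull ⊆ Ω := by
  rw [← hΩ.interior_closure]
  exact interior_mono (hP.closed_subset hτ)

/-- Near a point, only the simplices that contain it are met. -/
theorem eventually_mem_closed (P : Finset (TaggedSimplex n)) (x : E n) :
    ∀ᶠ y in 𝓝 x, ∀ τ ∈ P, y ∈ τ.closed → x ∈ τ.closed := by
  rw [Filter.eventually_all_finset]
  intro τ _
  by_cases hx : x ∈ τ.closed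
  · exact Eventually.of_forall fun _ _ => hx
  · filter_upwards [(isClosed_closed (τ := τ)).isOpen_compl.mem_nhds hx] with y hy h
    exact (hy h).elim

/-- The relative interior of a face of a conforming partition lies either in the domain or on its
boundary. -/
theorem IsConforming.mem_of_same_face (hc : IsConforming P) (hP : IsPartition Ω P)
    (hΩ : IsLipschitzDomain Ω) (hτ : τ ∈ P) {x x' : E n} (hx : x ∈ τ.closed) (hx' : x' ∈ τ.closed)
    (hface : ∀ z, 0 < τ.bary z x → 0 < τ.bary z x') (hface' : ∀ z, 0 < τ.bary z x' → 0 < τ.bary z x)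
    (hxΩ : x ∈ Ω) : x' ∈ Ω := by
  rw [← hΩ.interior_closure, mem_interior_iff_mem_nhds]
  have hmap : Tendsto (fun y => x + (y - x')) (𝓝 x') (𝓝 x) := by
    have : ContinuousAt (fun y => x + (y - x')) x' := by fun_prop
    simpa [ContinuousAt] using this.tendsto
  have hpos : ∀ᶠ y in 𝓝 x', ∀ σ ∈ P, ∀ i, 0 < σ.bary (σ.vert i) x' → 0 < σ.bary (σ.vert i) y := by
    rw [Filter.eventually_all_finset]
    intro σ _
    rw [Filter.eventually_all]
    intro i
    by_cases h : 0 < σ.bary (σ.vert i) x'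
    · filter_upwards [(continuous_bary (σ.vert i)).continuousAt.eventually (lt_mem_nhds h)] with y hy _
      exact hy
    · exact Eventually.of_forall fun _ h' => (h h').elim
  filter_upwards [hmap.eventually (hΩ.isOpen.mem_nhds hxΩ),
    hmap.eventually (eventually_mem_closed P x), hpos] with y hy1 hy2 hy3
  obtain ⟨σ, hσ, hyσ⟩ := hP.exists_mem (subset_closure hy1)
  have hxσ := hy2 σ hσ hyσ
  have hs := hP.nondegenerate σ hσ
  -- the face of `τ` containing `x` in its relative interior is also a face of `σ`
  have hx'σ : x' ∈ σ.closed := by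
    refine mem_closed_of_face (hP.nondegenerate τ hτ) hx' fun z hz => ?_
    have h := hface' z hz
    rw [hc.bary_eq hP hτ hσ hx hxσ] at h
    exact mem_range_of_bary_pos h
  refine hP.closed_subset hσ ((mem_closed_iff hs).2 fun z => ?_)
  by_cases hz : z ∈ range σ.vert
  · obtain ⟨i, rfl⟩ := hz
    by_cases h0 : 0 < σ.bary (σ.vert i) x'
    · exact (hy3 σ hσ i h0).le
    · have h1 : σ.bary (σ.vert i) x' = 0 := le_antisymm (not_lt.1 h0) ((mem_closed_iff hs).1 hx'σ _)
      have h2 : σ.bary (σ.vert i) x = 0 := by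
        refine le_antisymm (not_lt.1 fun h => h0 ?_) ((mem_closed_iff hs).1 hxσ _)
        rw [← hc.bary_eq hP hτ hσ hx hxσ] at h
        rw [← hc.bary_eq hP hτ hσ hx' hx'σ]
        exact hface _ h
      have h3 := (mem_closed_iff hs).1 hyσ (σ.vert i)
      rw [bary_add hs, h2] at h3
      have h4 := bary_add hs i x' (y - x')
      rw [add_sub_cancel, h1] at h4
      rw [h4]; exact h3
  · rw [bary_of_notMem hz]; exact le_rfl

open Classical in
/-- A facet that belongs to only one simplex lies on the boundary of the domain. -/
theorem IsConforming.facet_subset_compl [NeZero n] (hc : IsConforming P) (hP : IsPartition Ω P)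
    (hΩ : IsLipschitzDomain Ω) (hτ : τ ∈ P) (i : Fin (n + 1))
    (h : ∀ σ ∈ P, (Finset.univ.erase i).image τ.vert ∈ σ.facets → σ = τ) {x : E n}
    (hx : x ∈ facetOf (τ.basis (hP.nondegenerate τ hτ)) i) : x ∉ Ω := by
  have ht := hP.nondegenerate τ hτ
  set b := τ.basis ht with hb
  have hmain : ∀ x, b.coord i x = 0 → (∀ j ≠ i, 0 < b.coord j x) → x ∉ Ω := by
    intro x hxi hxj hxΩ
    have hxτ : x ∈ τ.closed := by
      rw [← τ.simplex_basis ht, mem_simplex]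
      intro j
      rcases eq_or_ne j i with rfl | hj
      · exact hxi.ge
      · exact (hxj j hj).le
    -- step across the facet
    have hlim : Tendsto (fun t : ℝ => x - t • baryGrad b i) (𝓝[>] 0) (𝓝 x) := by
      have : ContinuousAt (fun t : ℝ => x - t • baryGrad b i) 0 := by fun_prop
      simpa [ContinuousAt] using this.tendsto.mono_left nhdsWithin_le_nhds
    obtain ⟨t, ⟨h1, h2⟩, h3⟩ := (((hlim.eventually (hΩ.isOpen.mem_nhds hxΩ)).and
      (hlim.eventually (eventually_mem_closed P x))).and self_mem_nhdsWithin).exists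
    have ht0 : 0 < t := h3
    obtain ⟨σ, hσ, hyσ⟩ := hP.exists_mem (subset_closure h1)
    have hxσ := h2 σ hσ hyσ
    have hne : σ ≠ τ := by
      rintro rfl
      have h4 := (mem_simplex b).1 hyσ i
      rw [coord_eq_add_inner b i _ x, hxi, sub_sub_cancel_left, inner_neg_right,
        real_inner_smul_right, real_inner_self_eq_norm_sq] at h4
      have := norm_baryGrad_pos b i
      have : 0 < t * ‖baryGrad b i‖ ^ 2 := by positivity
      linarith
    refine hne (h σ hσ (mem_facets_of_subset (hP.nondegenerate σ hσ) ?_ fun z hz => ?_))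
    · rw [Finset.card_image_of_injective _ ht.injective, Finset.card_erase_of_mem (Finset.mem_univ _)]
      simp
    · obtain ⟨j, hj, rfl⟩ := Finset.mem_image.1 hz
      have h5 := hxj j (Finset.ne_of_mem_erase hj)
      rw [← bary_vert ht, hc.bary_eq hP hτ hσ hxτ hxσ] at h5
      exact mem_range_of_bary_pos h5
  obtain ⟨hx1, hx0⟩ := (mem_facetOf b).1 hx
  obtain ⟨c, hcint⟩ := interior_simplex_nonempty b
  rw [mem_interior_simplex] at hcint
  obtain ⟨j, hj⟩ := exists_index_ne i
  have hci : b.coord i c < 1 := by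
    have h1 := b.sum_coord_apply_eq_one c
    rw [← Finset.add_sum_erase _ _ (Finset.mem_univ i)] at h1
    have h2 : 0 < ∑ k ∈ Finset.univ.erase i, b.coord k c :=
      Finset.sum_pos (fun k _ => hcint k) ⟨j, by simpa using hj⟩
    linarith
  set s := 1 / (1 - b.coord i c) with hs
  have hs0 : 0 < s := one_div_pos.2 (by linarith)
  -- a point in the relative interior of the facet
  set p := AffineMap.lineMap (b i) c s with hp
  have hpi : b.coord i p = 0 := by
    rw [hp, AffineMap.apply_lineMap, b.coord_apply_eq, AffineMap.lineMap_apply]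
    simp only [vsub_eq_sub, smul_eq_mul, vadd_eq_add, hs]
    have : 1 - b.coord i c ≠ 0 := by linarith
    field_simp
    ring
  have hpj : ∀ k ≠ i, 0 < b.coord k p := by
    intro k hk
    rw [hp, AffineMap.apply_lineMap, b.coord_apply_ne hk, AffineMap.lineMap_apply]
    simp only [vsub_eq_sub, smul_eq_mul, vadd_eq_add, sub_zero, add_zero]
    exact mul_pos hs0 (hcint k)
  intro hxΩ
  have hlim : Tendsto (fun t : ℝ => AffineMap.lineMap x p t) (𝓝[>] 0) (𝓝 x) := by
    have : ContinuousAt (fun t : ℝ => AffineMap.lineMap x p t) 0 :=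
      AffineMap.lineMap_continuous.continuousAt
    simpa [ContinuousAt] using this.tendsto.mono_left nhdsWithin_le_nhds
  obtain ⟨t, h1, h2⟩ := ((hlim.eventually (hΩ.isOpen.mem_nhds hxΩ)).and
    (Ioo_mem_nhdsGT (zero_lt_one' ℝ))).exists
  refine hmain _ ?_ (fun k hk => ?_) h1
  · rw [AffineMap.apply_lineMap, hpi, hx0]; simp
  · rw [AffineMap.apply_lineMap, AffineMap.lineMap_apply]
    simp only [vsub_eq_sub, smul_eq_mul, vadd_eq_add]
    have h3 := (mem_simplex b).1 hx1 k
    have h4 := hpj k hk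
    have h5 : 0 < t := h2.1
    have h6 : t < 1 := h2.2
    nlinarith [mul_nonneg (sub_nonneg.2 h6.le) h3]

end Mesh

/-! ### Stars of vertices -/

section Star

variable {n : ℕ} {Ω : Set (E n)} {P : Finset (TaggedSimplex n)} {τ σ : TaggedSimplex n} {κ : ℝ}

open TaggedSimplex

/-- A shape regular conforming partition. -/
structure IsMesh (Ω : Set (E n)) (κ : ℝ) (P : Finset (TaggedSimplex n)) : Prop extends
    IsPartition Ω P where
  conforming : IsConforming P
  one_le : 1 ≤ κ
  regular : ∀ τ ∈ P, ShapeRegular κ τ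

namespace IsMesh

theorem size_pos (h : IsMesh Ω κ P) (hτ : τ ∈ P) : 0 < τ.size :=
  Stokes.size_pos (τ.basis (h.nondegenerate τ hτ)) rfl

theorem dist_le (h : IsMesh Ω κ P) (hτ : τ ∈ P) {x y : E n} (hx : x ∈ τ.closed) (hy : y ∈ τ.closed) :
    dist x y ≤ κ * τ.size := by
  obtain ⟨_, ⟨i, rfl⟩, _, ⟨j, rfl⟩, h1⟩ := convexHull_exists_dist_ge2 hx hy
  exact h1.trans ((h.regular τ hτ).1 i j)

theorem norm_baryGrad_le (h : IsMesh Ω κ P) (hτ : τ ∈ P) (i : Fin (n + 1)) :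
    ‖baryGrad (τ.basis (h.nondegenerate τ hτ)) i‖ ≤ κ / τ.size :=
  (le_div_iff₀ (h.size_pos hτ)).2 ((h.regular τ hτ).2 _ rfl i)

theorem size_le_dist (h : IsMesh Ω κ P) (hτ : τ ∈ P) {i j : Fin (n + 1)} (hij : i ≠ j) :
    τ.size ≤ κ * dist (τ.vert i) (τ.vert j) := by
  have h1 := inner_baryGrad_vertex_sub (τ.basis (h.nondegenerate τ hτ)) i i j
  rw [if_pos rfl, if_neg hij, sub_zero] at h1
  have h2 := real_inner_le_norm (baryGrad (τ.basis (h.nondegenerate τ hτ)) i)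
    (τ.vert i - τ.vert j)
  rw [τ.coe_basis] at h1
  rw [h1, ← dist_eq_norm] at h2
  have h3 := h2.trans (mul_le_mul_of_nonneg_right (h.norm_baryGrad_le hτ i) dist_nonneg)
  rw [div_mul_eq_mul_div, le_div_iff₀ (h.size_pos hτ), one_mul] at h3
  exact h3

theorem size_pow (hn : n ≠ 0) (τ : TaggedSimplex n) : τ.size ^ n = volume.real τ.closed := by
  rw [TaggedSimplex.size, ← Real.rpow_natCast, ← Real.rpow_mul measureReal_nonneg,
    inv_mul_cancel₀ (by exact_mod_cast hn), Real.rpow_one]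

/-- Simplices that share an edge have comparable size. -/
theorem size_le_of_shared_edge (h : IsMesh Ω κ P) (hτ : τ ∈ P) (hσ : σ ∈ P) {z w : E n} (hzw : z ≠ w)
    (hz : z ∈ range τ.vert ∩ range σ.vert) (hw : w ∈ range τ.vert ∩ range σ.vert) :
    σ.size ≤ κ ^ 2 * τ.size := by
  obtain ⟨⟨i, rfl⟩, ⟨i', hi'⟩⟩ := hz
  obtain ⟨⟨j, rfl⟩, ⟨j', hj'⟩⟩ := hw
  have h1 := h.size_le_dist hσ (i := i') (j := j') (fun e => hzw (by rw [← hi', ← hj', e]))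
  rw [hi', hj'] at h1
  have h2 := (h.regular τ hτ).1 i j
  have := h.one_le
  calc σ.size ≤ κ * (κ * τ.size) := h1.trans (by gcongr)
    _ = _ := by ring

theorem volume_inter_closedBall (hn : n ≠ 0) (h : IsMesh Ω κ P) (hτ : τ ∈ P) {x : E n}
    (hx : x ∈ τ.closed) {ρ : ℝ} (h0 : 0 < ρ) (hρ : ρ ≤ κ * τ.size) :
    (ρ / κ) ^ n ≤ volume.real (τ.closed ∩ closedBall x ρ) := by
  have hs := h.size_pos hτ
  have hκ := h.one_le
  have hκs : 0 < κ * τ.size := by positivity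
  set t := ρ / (κ * τ.size) with ht
  have ht0 : 0 < t := by positivity
  have ht1 : t ≤ 1 := (div_le_one hκs).2 hρ
  have h1 : AffineMap.homothety x t '' τ.closed ⊆ τ.closed ∩ closedBall x ρ := by
    rintro _ ⟨y, hy, rfl⟩
    constructor
    · exact convex_closed.lineMap_mem hx hy ⟨ht0.le, ht1⟩
    · rw [Metric.mem_closedBall, AffineMap.homothety_apply, dist_eq_norm, vadd_eq_add, vsub_eq_sub,
        add_sub_cancel_right, norm_smul, Real.norm_of_nonneg ht0.le, ← dist_eq_norm]
      calc t * dist y x ≤ t * (κ * τ.size) := by gcongr; exact h.dist_le hτ hy hx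
        _ = ρ := by rw [ht]; field_simp
  have h2 : volume.real (AffineMap.homothety x t '' τ.closed) = (ρ / κ) ^ n := by
    rw [measureReal_def, Measure.addHaar_image_homothety, ENNReal.toReal_mul, ← measureReal_def,
      ← size_pow hn, finrank_euclideanSpace_fin, ENNReal.toReal_ofReal (abs_nonneg _),
      abs_of_nonneg (by positivity), ← mul_pow, ht]
    congr 1
    field_simp
  rw [← h2]
  exact measureReal_mono h1
    ((isCompact_closed.inter_right Metric.isClosed_closedBall).measure_lt_top.ne)

theorem ae_disjoint (h : IsMesh Ω κ P) (hτ : τ ∈ P) (hσ : σ ∈ P) (hne : τ ≠ σ) :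
    AEDisjoint volume τ.closed σ.closed := by
  have h1 : ∀ ρ ∈ P, ρ.openHull =ᵐ[volume] ρ.closed := fun ρ hρ =>
    interior_ae_eq_simplex (ρ.basis (h.nondegenerate ρ hρ))
  exact (h.disjoint τ hτ σ hσ hne).aedisjoint.congr (h1 τ hτ).symm (h1 σ hσ).symm

open Classical in
/-- The number of simplices at a point is bounded, since each of them fills a fixed part of a small
ball. -/
theorem card_star_le (hn : n ≠ 0) (h : IsMesh Ω κ P) (x : E n) :
    ((P.filter fun τ => x ∈ τ.closed).card : ℝ) ≤
      κ ^ n * volume.real (closedBall (0 : E n) 1) := by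
  set S := P.filter fun τ => x ∈ τ.closed with hS
  have hκ := h.one_le
  rcases S.eq_empty_or_nonempty with he | hne
  · rw [he]; simp; positivity
  obtain ⟨τ₀, hτ₀, hmin⟩ := S.exists_min_image (fun τ => τ.size) hne
  have hmem : ∀ τ ∈ S, τ ∈ P ∧ x ∈ τ.closed := fun τ hτ => mem_filter.1 hτ
  set ρ := τ₀.size
  have hρ : 0 < ρ := h.size_pos (hmem τ₀ hτ₀).1
  have h1 : ∑ τ ∈ S, volume.real (τ.closed ∩ closedBall x ρ) ≤
      volume.real (closedBall x ρ) := by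
    have hfin : volume (closedBall x ρ) ≠ ⊤ := measure_closedBall_lt_top.ne
    rw [← measureReal_biUnion_finset₀]
    · exact measureReal_mono (iUnion₂_subset fun τ _ => inter_subset_right) hfin
    · intro τ hτ σ hσ hne
      exact (h.ae_disjoint (hmem τ hτ).1 (hmem σ hσ).1 hne).mono inter_subset_left inter_subset_left
    · exact fun τ _ => (isClosed_closed.inter Metric.isClosed_closedBall).measurableSet.nullMeasurableSet
  have h2 : ∑ τ ∈ S, (ρ / κ) ^ n ≤ ∑ τ ∈ S, volume.real (τ.closed ∩ closedBall x ρ) := by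
    refine sum_le_sum fun τ hτ => h.volume_inter_closedBall hn (hmem τ hτ).1 (hmem τ hτ).2 hρ ?_
    have := hmin τ hτ
    have h3 := h.size_pos (hmem τ hτ).1
    nlinarith
  rw [sum_const, nsmul_eq_mul] at h2
  have h3 : volume.real (closedBall x ρ) = ρ ^ n * volume.real (closedBall (0 : E n) 1) := by
    rw [measureReal_def, Measure.addHaar_closedBall' _ _ hρ.le, ENNReal.toReal_mul,
      ENNReal.toReal_ofReal (by positivity), finrank_euclideanSpace_fin, measureReal_def]
  have h4 := h2.trans (h1.trans h3.le)
  rw [div_pow] at h4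
  have h5 : 0 < ρ ^ n / κ ^ n := by positivity
  rw [← le_div_iff₀ h5] at h4
  refine h4.trans (le_of_eq ?_)
  field_simp

/-- Near a point, a Lipschitz domain cannot be disconnected by removing the point. -/
theorem _root_.Stokes.IsLipschitzDomain.exists_preconnected (hΩ : IsLipschitzDomain Ω) (hn : 1 < n)
    (x : E n) {U : Set (E n)} (hU : U ∈ 𝓝 x) : ∃ W ∈ 𝓝 x, ∀ y ∈ W, ∀ z ∈ W, y ∈ Ω → z ∈ Ω →
      y ≠ x → z ≠ x → ∃ C ⊆ Ω ∩ U, IsPreconnected C ∧ y ∈ C ∧ z ∈ C ∧ x ∉ C := by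
  by_cases hx : x ∈ Ω
  · obtain ⟨r, hr, hball⟩ := Metric.mem_nhds_iff.1 (inter_mem (hΩ.isOpen.mem_nhds hx) hU)
    refine ⟨ball x r, ball_mem_nhds x hr, fun y hy z hz _ _ hyx hzx =>
      ⟨ball x r \ {x}, sdiff_subset.trans hball, ?_, ⟨hy, hyx⟩, ⟨hz, hzx⟩, by simp⟩⟩
    have hrank : 1 < Module.rank ℝ (E n) := by
      rw [← Module.finrank_eq_rank, finrank_euclideanSpace_fin]; exact_mod_cast hn
    have h1 := (isConnected_compl_singleton_of_one_lt_rank hrank (0 : E n)).isPreconnected.image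
      (OpenPartialHomeomorph.univBall x r) (OpenPartialHomeomorph.continuous_univBall x r).continuousOn
    convert h1 using 1
    set Φ := OpenPartialHomeomorph.univBall x r
    have hΦ0 : Φ 0 = x := OpenPartialHomeomorph.univBall_apply_zero x r
    have hsrc : ∀ w, w ∈ Φ.source := fun w => by simp [Φ]
    have htgt : Φ.target = ball x r := OpenPartialHomeomorph.univBall_target x hr
    ext w
    constructor
    · rintro ⟨hw, hwx⟩
      rw [← htgt] at hw
      refine ⟨Φ.symm w, fun h0 => hwx ?_, Φ.right_inv hw⟩
      rw [mem_singleton_iff] at h0 ⊢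
      rw [← Φ.right_inv hw, h0, hΦ0]
    · rintro ⟨v, hv, rfl⟩
      refine ⟨htgt ▸ Φ.map_source (hsrc v), fun h0 => hv ?_⟩
      rw [mem_singleton_iff, ← hΦ0] at h0
      exact Φ.injOn (hsrc v) (hsrc 0) h0
  · obtain ⟨r, hr, L, hL, hpath⟩ := hΩ.exists_path
    obtain ⟨ε, hε, hball⟩ := Metric.mem_nhds_iff.1 hU
    set δ := min (r / 2) (ε / (2 * L + 2))
    have hδ : 0 < δ := lt_min (by positivity) (by positivity)
    refine ⟨ball x δ, ball_mem_nhds x hδ, fun y hy z hz hyΩ hzΩ _ _ => ?_⟩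
    rw [mem_ball] at hy hz
    have hd : dist y z < 2 * δ := by have := dist_triangle_right y z x; linarith
    have hδr : 2 * δ ≤ r := by have := min_le_left (r / 2) (ε / (2 * L + 2)); linarith
    have hδε : (2 * L + 2) * δ ≤ ε := by
      have := min_le_right (r / 2) (ε / (2 * L + 2))
      rwa [le_div_iff₀' (by positivity)] at this
    obtain ⟨v, hv, h1, h2, h3⟩ := hpath y hyΩ z hzΩ (hd.trans_le hδr)
    have hvε : ‖v‖ ≤ 2 * L * δ := hv.trans (by nlinarith)
    have hmem : ∀ w, dist w x < δ → w ∈ ball x ε ∧ w + v ∈ ball x ε := by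
      intro w hw
      constructor
      · rw [mem_ball]; nlinarith
      · rw [mem_ball]
        have e1 : dist (w + v) x ≤ dist (w + v) w + dist w x := dist_triangle _ _ _
        rw [dist_self_add_left] at e1
        nlinarith
    have hc := convex_ball x ε
    refine ⟨segment ℝ y (y + v) ∪ segment ℝ (y + v) (z + v) ∪ segment ℝ (z + v) z, ?_, ?_, ?_, ?_, ?_⟩
    · refine subset_inter (union_subset (union_subset h1 h2) h3) (Subset.trans ?_ hball)
      exact union_subset (union_subset (hc.segment_subset (hmem y hy).1 (hmem y hy).2)
        (hc.segment_subset (hmem y hy).2 (hmem z hz).2))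
        (hc.segment_subset (hmem z hz).2 (hmem z hz).1)
    · have hs : ∀ p q : E n, IsPreconnected (segment ℝ p q) := fun p q =>
        (convex_segment p q).isPreconnected
      exact ((hs _ _).union (y + v) (right_mem_segment ℝ _ _) (left_mem_segment ℝ _ _) (hs _ _)).union
        (z + v) (Or.inr (right_mem_segment ℝ _ _)) (left_mem_segment ℝ _ _) (hs _ _)
    · exact Or.inl (Or.inl (left_mem_segment ℝ _ _))
    · exact Or.inr (right_mem_segment ℝ _ _)
    · rintro ((h | h) | h)
      · exact hx (h1 h)
      · exact hx (h2 h)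
      · exact hx (h3 h)

/-- The simplices at a point are connected through shared edges. -/
theorem star_connected (hΩ : IsLipschitzDomain Ω) (hn : 1 < n) (h : IsMesh Ω κ P) {x : E n}
    (K : Set (TaggedSimplex n)) (hτ : τ ∈ P) (hxτ : x ∈ τ.closed) (hτK : τ ∈ K)
    (hK : ∀ ρ ∈ P, ∀ σ ∈ P, x ∈ ρ.closed → x ∈ σ.closed → ρ ∈ K → (∃ y ≠ x, y ∈ ρ.closed ∩ σ.closed) →
      σ ∈ K) (hσ : σ ∈ P) (hxσ : x ∈ σ.closed) : σ ∈ K := by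
  classical
  by_contra hσK
  set A : Set (E n) := ⋃ ρ ∈ P.filter (fun ρ => x ∈ ρ.closed ∧ ρ ∈ K), ρ.closed
  set B : Set (E n) := ⋃ ρ ∈ P.filter (fun ρ => x ∈ ρ.closed ∧ ρ ∉ K), ρ.closed
  have hA : IsClosed A := isClosed_biUnion_finset fun _ _ => isClosed_closed
  have hB : IsClosed B := isClosed_biUnion_finset fun _ _ => isClosed_closed
  obtain ⟨W, hW, hC⟩ := hΩ.exists_preconnected hn x (eventually_mem_closed P x)
  have hpt : ∀ ρ ∈ P, x ∈ ρ.closed → ∃ y ∈ W, y ∈ Ω ∧ y ≠ x ∧ y ∈ ρ.closed := by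
    intro ρ hρ hxρ
    have hx : x ∈ closure ρ.openHull := by rwa [closure_openHull (h.nondegenerate ρ hρ)]
    have : (𝓝[≠] x).NeBot := by
      have : Nonempty (Fin n) := ⟨⟨0, by omega⟩⟩
      exact Module.punctured_nhds_neBot ℝ (E n) x
    by_cases hxo : x ∈ ρ.openHull
    · have h1 : ρ.openHull ∈ 𝓝 x := isOpen_interior.mem_nhds hxo
      obtain ⟨y, ⟨hy1, hy2⟩, hy3⟩ := ((show ∀ᶠ y in 𝓝[≠] x, y ∈ W ∩ ρ.openHull from
        nhdsWithin_le_nhds (inter_mem hW h1)).and self_mem_nhdsWithin).exists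
      exact ⟨y, hy1, h.openHull_subset hΩ hρ hy2, hy3, interior_subset hy2⟩
    · obtain ⟨y, hy1, hy2⟩ := mem_closure_iff_nhds.1 hx W hW
      exact ⟨y, hy1, h.openHull_subset hΩ hρ hy2, fun e => hxo (e ▸ hy2), interior_subset hy2⟩
  obtain ⟨y, hyW, hyΩ, hyx, hyτ⟩ := hpt τ hτ hxτ
  obtain ⟨z, hzW, hzΩ, hzx, hzσ⟩ := hpt σ hσ hxσ
  obtain ⟨C, hCΩ, hCc, hyC, hzC, hxC⟩ := hC y hyW z hzW hyΩ hzΩ hyx hzx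
  have hcov : C ⊆ A ∪ B := by
    intro w hw
    obtain ⟨ρ, hρ, hwρ⟩ := h.exists_mem (subset_closure (hCΩ hw).1)
    have hxρ := (hCΩ hw).2 ρ hρ hwρ
    by_cases hρK : ρ ∈ K
    · exact Or.inl (mem_iUnion₂.2 ⟨ρ, mem_filter.2 ⟨hρ, hxρ, hρK⟩, hwρ⟩)
    · exact Or.inr (mem_iUnion₂.2 ⟨ρ, mem_filter.2 ⟨hρ, hxρ, hρK⟩, hwρ⟩)
  obtain ⟨w, hwC, hwA, hwB⟩ := isPreconnected_closed_iff.1 hCc A B hA hB hcov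
    ⟨y, hyC, mem_iUnion₂.2 ⟨τ, mem_filter.2 ⟨hτ, hxτ, hτK⟩, hyτ⟩⟩
    ⟨z, hzC, mem_iUnion₂.2 ⟨σ, mem_filter.2 ⟨hσ, hxσ, hσK⟩, hzσ⟩⟩
  obtain ⟨ρ, hρ, hwρ⟩ := mem_iUnion₂.1 hwA
  obtain ⟨ρ', hρ', hwρ'⟩ := mem_iUnion₂.1 hwB
  obtain ⟨hρ, hxρ, hρK⟩ := mem_filter.1 hρ
  obtain ⟨hρ', hxρ', hρK'⟩ := mem_filter.1 hρ'
  exact hρK' (hK ρ hρ ρ' hρ' hxρ hxρ' hρK ⟨w, fun e => hxC (e ▸ hwC), hwρ, hwρ'⟩)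

/-- All simplices at a vertex have comparable size: their number is bounded, so that a short geometric
progression contains a gap between their sizes, which no shared edge can bridge. -/
theorem exists_size_le (hΩ : IsLipschitzDomain Ω) (hn : 1 < n) (hκ : 1 ≤ κ) :
    ∃ M : ℝ, 1 ≤ M ∧ ∀ P, IsMesh Ω κ P → ∀ {τ σ : TaggedSimplex n} {x : E n}, τ ∈ P → σ ∈ P →
      x ∈ range τ.vert → x ∈ range σ.vert → σ.size ≤ M * τ.size := by
  classical
  obtain ⟨N, hN⟩ := exists_nat_ge (κ ^ n * volume.real (closedBall (0 : E n) 1))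
  have hκ2 : 1 ≤ κ ^ 2 := one_le_pow₀ hκ
  refine ⟨(κ ^ 2) ^ N, one_le_pow₀ hκ2, fun P h τ σ x hτ hσ hxτ hxσ => ?_⟩
  have hs := h.size_pos hτ
  set S := P.filter fun τ => x ∈ τ.closed with hS
  have hcl : ∀ {ρ : TaggedSimplex n}, x ∈ range ρ.vert → x ∈ ρ.closed := fun hx =>
    subset_convexHull ℝ _ hx
  obtain ⟨j, hj, hgap⟩ : ∃ j < N + 1, ∀ ρ ∈ S, ρ.size ≤ (κ ^ 2) ^ (j + 1) * τ.size →
      ρ.size ≤ (κ ^ 2) ^ j * τ.size := by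
    by_contra! hcon
    have : Nonempty (TaggedSimplex n) := ⟨τ⟩
    choose! f hfS hf hf' using hcon
    have hlt : ∀ i j, i < j → j < N + 1 → f i ≠ f j := fun i j hij hj he => by
      have h1 := (hf i (hij.trans hj)).trans (mul_le_mul_of_nonneg_right
        (pow_le_pow_right₀ hκ2 hij) hs.le)
      exact (hf' j hj).not_ge (he ▸ h1)
    have h1 := Finset.card_le_card_of_injOn (s := Finset.range (N + 1)) (t := S) f
      (fun j hj => hfS j (Finset.mem_range.1 hj)) fun i hi j hj he => by
        rw [Finset.coe_range] at hi hj
        by_contra hij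
        rcases lt_or_gt_of_ne hij with h2 | h2
        · exact hlt i j h2 hj he
        · exact hlt j i h2 hi he.symm
    have h2 : S.card ≤ N := by exact_mod_cast (h.card_star_le (by omega) x).trans hN
    rw [Finset.card_range] at h1
    omega
  suffices hσj : σ.size ≤ (κ ^ 2) ^ j * τ.size from
    hσj.trans (mul_le_mul_of_nonneg_right (pow_le_pow_right₀ hκ2 (by omega)) hs.le)
  refine h.star_connected hΩ hn {ρ | ρ.size ≤ (κ ^ 2) ^ j * τ.size} hτ (hcl hxτ)
    (le_mul_of_one_le_left hs.le (one_le_pow₀ hκ2)) ?_ hσ (hcl hxσ)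
  rintro ρ hρ σ hσ hxρ hxσ hρK ⟨y, hyx, hy⟩
  -- `x` is a common vertex, and there is another one
  have hv : ∀ {ρ : TaggedSimplex n}, ρ ∈ P → x ∈ ρ.closed → x ∈ range ρ.vert := by
    intro ρ hρ hxρ
    have h1 := h.conforming.bary_eq h.toIsPartition hτ hρ (hcl hxτ) hxρ x
    rw [bary_apply_vertex (h.nondegenerate τ hτ) x hxτ, if_pos rfl] at h1
    exact mem_range_of_bary_pos (h1 ▸ one_pos)
  have hw : ∃ w ∈ range ρ.vert ∩ range σ.vert, w ≠ x := by
    by_contra! hcon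
    rw [h.conforming ρ hρ σ hσ] at hy
    have := convexHull_mono (s := range ρ.vert ∩ range σ.vert) (t := {x})
      (fun w hw => hcon w hw) hy
    rw [convexHull_singleton] at this
    exact hyx this
  obtain ⟨w, hw, hwx⟩ := hw
  have h1 := h.size_le_of_shared_edge hρ hσ hwx hw ⟨hv hρ hxρ, hv hσ hxσ⟩
  refine hgap σ (mem_filter.2 ⟨hσ, hxσ⟩) (h1.trans ?_)
  rw [pow_succ' (κ ^ 2) j, mul_assoc]
  exact mul_le_mul_of_nonneg_left hρK (by positivity)

end IsMesh
end Star

/-! ### Poincaré inequalities on stars -/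

section StarPoincare

variable {n : ℕ} {Ω : Set (E n)} {P : Finset (TaggedSimplex n)} {τ σ : TaggedSimplex n} {κ : ℝ}

open TaggedSimplex

open Classical in
/-- The Dirichlet energy of `v` on the star of the vertex `x`. -/
def starEnergy (P : Finset (TaggedSimplex n)) (x : E n) (v : E n → ℝ) : ℝ :=
  ∑ σ ∈ P.filter (fun σ => x ∈ range σ.vert), ∫ y in σ.closed, ‖fderiv ℝ v y‖ ^ 2

theorem starEnergy_nonneg (x : E n) (v : E n → ℝ) : 0 ≤ starEnergy P x v :=
  sum_nonneg fun _ _ => integral_sq_nonneg _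

theorem le_starEnergy {x : E n} (hσ : σ ∈ P) (hx : x ∈ range σ.vert) (v : E n → ℝ) :
    ∫ y in σ.closed, ‖fderiv ℝ v y‖ ^ 2 ≤ starEnergy P x v := by
  classical
  exact single_le_sum (f := fun σ : TaggedSimplex n => ∫ y in σ.closed, ‖fderiv ℝ v y‖ ^ 2)
    (fun _ _ => integral_sq_nonneg _) (mem_filter.2 ⟨hσ, hx⟩)

namespace IsMesh

theorem poincare_le (h : IsMesh Ω κ P) (hτ : τ ∈ P) {w : E n → ℝ} {K : NNReal} (hw : LipschitzWith K w) :
    ∫ y in τ.closed, (w y - meanOn τ.closed w) ^ 2 ≤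
      (κ * τ.size) ^ 2 * 2 ^ n * ∫ y in τ.closed, ‖fderiv ℝ w y‖ ^ 2 := by
  have : NeZero n := ⟨τ.tag.pos.ne'⟩
  exact poincare isCompact_closed convex_closed (volume_simplex_pos (τ.basis (h.nondegenerate τ hτ))) hw
    fun y hy z hz => dist_eq_norm y z ▸ h.dist_le hτ hy hz

theorem size_le_of_bounded (hΩ : IsLipschitzDomain Ω) (h : IsMesh Ω κ P) (hτ : τ ∈ P) :
    τ.size ≤ (volume.real (closure Ω)) ^ ((n : ℝ)⁻¹) :=
  Real.rpow_le_rpow measureReal_nonneg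
    (measureReal_mono (h.closed_subset hτ) hΩ.isBounded.isCompact_closure.measure_lt_top.ne)
    (by positivity)

/-- The hat function of a vertex is Lipschitz, with a constant controlled by the sizes in the star;
hence the star contains the points of the domain in a ball of that size. -/
theorem exists_ball_subset_star (hΩ : IsLipschitzDomain Ω) (hκ : 1 ≤ κ) : ∃ c > 0, ∀ P, IsMesh Ω κ P →
    ∀ τ ∈ P, ∀ x ∈ range τ.vert, ∀ s > 0, (∀ σ ∈ P, x ∈ range σ.vert → s ≤ σ.size) →
      ∀ y ∈ Ω, dist y x < c * s → ∃ σ ∈ P, x ∈ range σ.vert ∧ y ∈ σ.closed := by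
  classical
  obtain ⟨r, hr, L, hL, hpath⟩ := hΩ.exists_path
  set S := (volume.real (closure Ω)) ^ ((n : ℝ)⁻¹) with hS
  have hS0 : 0 ≤ S := Real.rpow_nonneg measureReal_nonneg _
  refine ⟨min (r / (S + 1)) (1 / (2 * (κ * (2 * L + 1)))), lt_min (by positivity) (by positivity),
    fun P h τ hτ x hxτ s hs hmin y hy hyx => ?_⟩
  set c := min (r / (S + 1)) (1 / (2 * (κ * (2 * L + 1))))
  have hc1 : c * (S + 1) ≤ r := by
    rw [← le_div_iff₀ (by positivity)]; exact min_le_left _ _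
  have hc2 : κ * (2 * L + 1) * c ≤ 1 / 2 := by
    have h1 : c ≤ 1 / (2 * (κ * (2 * L + 1))) := min_le_right _ _
    rw [le_div_iff₀ (by positivity)] at h1
    linarith
  have hc0 : 0 < c := lt_min (by positivity) (by positivity)
  have hsS : s ≤ S := (hmin τ hτ hxτ).trans (h.size_le_of_bounded hΩ hτ)
  have hpos : 0 ≤ κ / s := by positivity
  -- the hat function
  set g : E n → ℝ := fun y => if hy : ∃ τ ∈ P, y ∈ τ.closed then hy.choose.bary x y else 0 with hg
  have hgσ : ∀ σ ∈ P, ∀ y ∈ σ.closed, g y = σ.bary x y := by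
    intro σ hσ y hy
    have hex : ∃ τ ∈ P, y ∈ τ.closed := ⟨σ, hσ, hy⟩
    rw [hg]
    simp only
    rw [dif_pos hex]
    exact h.conforming.bary_eq h.toIsPartition hex.choose_spec.1 hσ hex.choose_spec.2 hy x
  have hlip : ∀ σ ∈ P, LipschitzOnWith (κ / s).toNNReal g σ.closed := by
    intro σ hσ
    refine LipschitzOnWith.of_dist_le_mul fun y hy z hz => ?_
    rw [hgσ σ hσ y hy, hgσ σ hσ z hz, Real.coe_toNNReal _ hpos]
    by_cases hx : x ∈ range σ.vert
    · obtain ⟨i, hi⟩ := hx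
      have h1 := h.nondegenerate σ hσ
      rw [← hi, bary_vert h1, coord_eq_add_inner _ i y z, Real.dist_eq, add_sub_cancel_left, dist_eq_norm]
      refine (abs_real_inner_le_norm _ _).trans ?_
      gcongr
      refine (h.norm_baryGrad_le hσ i).trans ?_
      gcongr
      exact hmin σ hσ ⟨i, hi⟩
    · rw [bary_of_notMem hx]
      simp; positivity
  have hcover : Ω ⊆ ⋃ σ ∈ P, σ.closed := fun y hy => by
    obtain ⟨σ, hσ, h⟩ := h.exists_mem (subset_closure hy)
    exact mem_iUnion₂.2 ⟨σ, hσ, h⟩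
  have hxc : x ∈ closure τ.openHull := by
    rw [closure_openHull (h.nondegenerate τ hτ)]
    exact subset_convexHull ℝ _ hxτ
  have hx1 : τ.bary x x = 1 := by
    rw [bary_apply_vertex (h.nondegenerate τ hτ) x hxτ, if_pos rfl]
  have hev : ∀ᶠ u in 𝓝 x, dist u y < c * s ∧ 1 / 2 < τ.bary x u := by
    refine Filter.Eventually.and ?_ ?_
    · have : ContinuousAt (fun u => dist u y) x := by fun_prop
      exact this.eventually (gt_mem_nhds (by dsimp only; rwa [dist_comm]))
    · exact (continuous_bary x).continuousAt.eventually (lt_mem_nhds (by rw [hx1]; norm_num))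
  obtain ⟨u, hu, huτ⟩ := mem_closure_iff_nhds.1 hxc _ hev
  have h1 := dist_le_of_path hpath (fun σ _ => isClosed_closed (τ := σ)) hlip hcover
    (h.openHull_subset hΩ hτ huτ) hy (hu.1.trans_le (by nlinarith))
  rw [hgσ τ hτ u (interior_subset huτ), Real.coe_toNNReal _ hpos, Real.dist_eq] at h1
  have h2 : κ / s * (2 * L + 1) * dist u y ≤ 1 / 2 := by
    calc κ / s * (2 * L + 1) * dist u y ≤ κ / s * (2 * L + 1) * (c * s) := by gcongr; exact hu.1.le
      _ = κ * (2 * L + 1) * c := by field_simp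
      _ ≤ _ := hc2
  have h3 := (le_abs_self _).trans (h1.trans h2)
  have h4 : 0 < g y := by have := hu.2; linarith
  obtain ⟨σ, hσ, hyσ⟩ := h.exists_mem (subset_closure hy)
  rw [hgσ σ hσ y hyσ] at h4
  exact ⟨σ, hσ, mem_range_of_bary_pos h4, hyσ⟩

/-- The energy of a function on a set that meets the domain only in the star of `x`. -/
theorem setIntegral_le_starEnergy {x : E n} {v : E n → ℝ} {K : NNReal}
    (hv : LipschitzWith K v) (hv0 : ∀ y ∉ Ω, v y = 0) {B : Set (E n)} (hBc : IsCompact B)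
    (hB : ∀ y ∈ B, y ∈ Ω → ∃ σ ∈ P, x ∈ range σ.vert ∧ y ∈ σ.closed) :
    ∫ y in B, ‖fderiv ℝ v y‖ ^ 2 ≤ starEnergy P x v := by
  classical
  have hint : ∀ T : Set (E n), volume T ≠ ⊤ → IntegrableOn (fun y => ‖fderiv ℝ v y‖ ^ 2) T :=
    fun T hT => (memLp_fderiv hv hT).norm.integrable_sq
  have hsum : starEnergy P x v = ∫ y, ∑ σ ∈ P.filter (fun σ => x ∈ range σ.vert),
      σ.closed.indicator (fun y => ‖fderiv ℝ v y‖ ^ 2) y := by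
    rw [integral_finsetSum _ fun σ _ => (hint σ.closed isCompact_closed.measure_lt_top.ne).integrable_indicator
      isClosed_closed.measurableSet]
    exact sum_congr rfl fun σ _ => (integral_indicator isClosed_closed.measurableSet).symm
  rw [hsum, ← integral_indicator hBc.measurableSet]
  refine integral_mono_ae ((hint B hBc.measure_lt_top.ne).integrable_indicator hBc.measurableSet)
    (integrable_finsetSum _ fun σ _ => (hint σ.closed isCompact_closed.measure_lt_top.ne).integrable_indicator
      isClosed_closed.measurableSet) ?_
  filter_upwards [ae_fderiv_eq_zero_of_eq_zero hv] with y hy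
  have hnn : ∀ σ : TaggedSimplex n, 0 ≤ σ.closed.indicator (fun y => ‖fderiv ℝ v y‖ ^ 2) y :=
    fun σ => indicator_nonneg (fun _ _ => sq_nonneg _) y
  by_cases hyB : y ∈ B
  · rw [indicator_of_mem hyB]
    by_cases hyΩ : y ∈ Ω
    · obtain ⟨σ, hσ, hxσ, hyσ⟩ := hB y hyB hyΩ
      have := single_le_sum (f := fun σ : TaggedSimplex n =>
        σ.closed.indicator (fun y => ‖fderiv ℝ v y‖ ^ 2) y) (fun σ _ => hnn σ)
        (s := P.filter fun σ => x ∈ range σ.vert) (mem_filter.2 ⟨hσ, hxσ⟩)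
      simp only [indicator_of_mem hyσ] at this
      exact this
    · rw [hy (hv0 y hyΩ)]
      simpa using sum_nonneg fun σ _ => hnn σ
  · rw [indicator_of_notMem hyB]
    exact sum_nonneg fun σ _ => hnn σ

set_option maxHeartbeats 800000 in
/-- Mean values over the simplices at a vertex are close to each other, and to zero if the vertex
lies on the boundary. They are compared with the mean value over a ball around the vertex; the
function is extended by zero, so that the ball may leave the domain. -/
theorem exists_star_poincare (hΩ : IsLipschitzDomain Ω) (hn : 1 < n) (hκ : 1 ≤ κ) : ∃ C, 0 ≤ C ∧
    ∀ P, IsMesh Ω κ P → ∀ τ ∈ P, ∀ σ ∈ P, ∀ x ∈ range τ.vert, x ∈ range σ.vert →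
      ∀ (v : E n → ℝ) (K : NNReal), LipschitzWith K v → (∀ y ∉ Ω, v y = 0) →
        τ.size ^ n * (meanOn τ.closed v - meanOn σ.closed v) ^ 2 ≤
          C * τ.size ^ 2 * starEnergy P x v ∧
        (x ∉ Ω → τ.size ^ n * meanOn τ.closed v ^ 2 ≤ C * τ.size ^ 2 * starEnergy P x v) := by
  classical
  have : NeZero n := ⟨by omega⟩
  obtain ⟨c₁, hc₁, hball⟩ := exists_ball_subset_star hΩ hκ
  obtain ⟨r, hr, c₂, hc₂, hext⟩ := hΩ.exists_exterior_ball
  set S := (volume.real (closure Ω)) ^ ((n : ℝ)⁻¹) with hS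
  have hS0 : 0 ≤ S := Real.rpow_nonneg measureReal_nonneg _
  obtain ⟨M, hM1, hM⟩ := exists_size_le hΩ hn hκ
  -- the radius of the ball, relative to the smallest simplex of the star
  set c := min (1 / 2) (min (c₁ / 2) (r / (S + 1))) with hc
  have hc0 : 0 < c := lt_min (by norm_num) (lt_min (by positivity) (by positivity))
  have hchalf : c ≤ 1 / 2 := min_le_left _ _
  have hcc₁ : c ≤ c₁ / 2 := (min_le_right _ _).trans (min_le_left _ _)
  have hcr : c * (S + 1) ≤ r := by
    rw [← le_div_iff₀ (by positivity)]
    exact (min_le_right _ _).trans (min_le_right _ _)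
  set Vb := volume.real (ball (0 : E n) 1) with hVb
  have hVb0 : 0 < Vb := ENNReal.toReal_pos (Metric.measure_ball_pos volume _ one_pos).ne'
    measure_ball_lt_top.ne
  set A := (c / (κ * M)) ^ n with hA
  have hA0 : 0 < A := by positivity
  set C₁ := 2 * (κ ^ 2 + 1) * 2 ^ n / A with hC₁
  set A₂ := Vb * (c₂ * c / M) ^ n with hA₂
  have hA₂0 : 0 < A₂ := by positivity
  set C₂ := 2 ^ n / A₂ with hC₂
  have hC₁0 : 0 ≤ C₁ := by positivity
  have hC₂0 : 0 ≤ C₂ := by positivity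
  -- comparison with the ball
  have key : ∀ P, IsMesh Ω κ P → ∀ x, ∀ τ₀ ∈ P, x ∈ range τ₀.vert →
      (∀ σ ∈ P, x ∈ range σ.vert → τ₀.size ≤ σ.size) →
      ∀ (v : E n → ℝ) (K : NNReal), LipschitzWith K v → (∀ y ∉ Ω, v y = 0) →
      ∀ τ ∈ P, x ∈ range τ.vert →
      τ.size ^ n * (meanOn τ.closed v - meanOn (closedBall x (c * τ₀.size)) v) ^ 2 ≤
        C₁ * τ.size ^ 2 * starEnergy P x v ∧
      (x ∉ Ω → τ.size ^ n * meanOn (closedBall x (c * τ₀.size)) v ^ 2 ≤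
        C₂ * τ.size ^ 2 * starEnergy P x v) := by
    intro P h x τ₀ hτ₀ hxτ₀ hmin v K hv hv0 τ hτ hxτ
    set s := τ₀.size
    have hs : 0 < s := h.size_pos hτ₀
    have hsτ : s ≤ τ.size := hmin τ hτ hxτ
    have hτs : τ.size ≤ M * s := hM P h hτ₀ hτ hxτ₀ hxτ
    have hτ0 : 0 < τ.size := h.size_pos hτ
    set ρ := c * s with hρ
    have hρ0 : 0 < ρ := by positivity
    set B := closedBall x ρ
    have hBc : IsCompact B := isCompact_closedBall x ρ
    have hxcl : x ∈ τ.closed := subset_convexHull ℝ _ hxτ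
    set G := starEnergy P x v
    have hGB : ∫ y in B, ‖fderiv ℝ v y‖ ^ 2 ≤ G := by
      refine setIntegral_le_starEnergy hv hv0 hBc fun y hyB hyΩ =>
        hball P h τ hτ x hxτ s hs hmin y hyΩ ?_
      have : dist y x ≤ c * s := hyB
      nlinarith
    have hDB : ∀ y ∈ B, ∀ z ∈ B, ‖y - z‖ ≤ τ.size := fun y hy z hz => by
      rw [← dist_eq_norm]
      have := dist_triangle_right y z x
      have h1 : dist y x ≤ ρ := hy
      have h2 : dist z x ≤ ρ := hz
      nlinarith
    have hB : τ.size ^ 2 * 2 ^ n * ∫ y in B, ‖fderiv ℝ v y‖ ^ 2 ≤ τ.size ^ 2 * 2 ^ n * G := by gcongr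
    constructor
    · set D := τ.closed ∩ B
      have hD : A * τ.size ^ n ≤ volume.real D := by
        refine le_trans ?_ (h.volume_inter_closedBall (by omega) hτ hxcl hρ0 ?_)
        · rw [hA, ← mul_pow]
          gcongr
          rw [hρ, div_mul_eq_mul_div, div_le_div_iff₀ (by positivity) (by positivity)]
          calc c * τ.size * κ ≤ c * (M * s) * κ := by gcongr
            _ = _ := by ring
        · nlinarith
      have hAτ : 0 < A * τ.size ^ n := by positivity
      have e1 := mul_sq_meanOn_sub_meanOn_le (inter_subset_left : D ⊆ τ.closed) isCompact_closed
        convex_closed hAτ hD hv (D := κ * τ.size) fun y hy z hz => by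
          rw [← dist_eq_norm]; exact h.dist_le hτ hy hz
      have e2 := (mul_sq_meanOn_sub_meanOn_le (inter_subset_right : D ⊆ B) hBc
        (convex_closedBall x ρ) hAτ hD hv hDB).trans hB
      have e3 : (κ * τ.size) ^ 2 * 2 ^ n * ∫ y in τ.closed, ‖fderiv ℝ v y‖ ^ 2 ≤
          (κ * τ.size) ^ 2 * 2 ^ n * G := by gcongr; exact le_starEnergy hτ hxτ v
      have e4 : C₁ * τ.size ^ 2 * G =
          (2 * ((κ * τ.size) ^ 2 * 2 ^ n * G) + 2 * (τ.size ^ 2 * 2 ^ n * G)) / A := by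
        rw [hC₁]; ring
      rw [e4, le_div_iff₀ hA0]
      nlinarith [mul_nonneg hAτ.le
        (sq_nonneg (meanOn D v - meanOn τ.closed v + (meanOn D v - meanOn B v)))]
    · intro hxΩ
      have hxf : x ∈ frontier Ω := by
        rw [hΩ.isOpen.frontier_eq]; exact ⟨h.closed_subset hτ hxcl, hxΩ⟩
      obtain ⟨y, hy1, hy2⟩ := hext x hxf ρ hρ0 (by
        have : s ≤ S := h.size_le_of_bounded hΩ hτ₀
        nlinarith)
      set F := ball y (c₂ * ρ)
      have hFv : volume.real F = Vb * (c₂ * ρ) ^ n := by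
        rw [measureReal_def, Measure.addHaar_ball _ _ (by positivity), ENNReal.toReal_mul,
          ENNReal.toReal_ofReal (by positivity), finrank_euclideanSpace_fin, mul_comm]
        rfl
      have e2 : meanOn F v = 0 := by
        rw [meanOn, setIntegral_congr_fun (g := fun _ => 0) Metric.isOpen_ball.measurableSet
          (fun z hz => hv0 z (disjoint_left.1 hy2 hz))]
        simp
      have e3 : A₂ * τ.size ^ n ≤ volume.real F := by
        rw [hFv, hA₂, mul_assoc, ← mul_pow]
        refine mul_le_mul_of_nonneg_left (pow_le_pow_left₀ (by positivity) ?_ n) hVb0.le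
        rw [div_mul_eq_mul_div, div_le_iff₀ (by positivity), hρ]
        calc c₂ * c * τ.size ≤ c₂ * c * (M * s) := by gcongr
          _ = _ := by ring
      have e1 := (mul_sq_meanOn_sub_meanOn_le (hy1.trans Metric.ball_subset_closedBall : F ⊆ B) hBc
        (convex_closedBall x ρ) (by positivity) e3 hv hDB).trans hB
      rw [e2, zero_sub, neg_sq] at e1
      have e4 : C₂ * τ.size ^ 2 * G = (τ.size ^ 2 * 2 ^ n * G) / A₂ := by rw [hC₂]; ring
      rw [e4, le_div_iff₀ hA₂0]
      linarith
  refine ⟨2 * C₁ + 2 * (M ^ n * M ^ 2) * C₁ + 2 * C₂, by positivity,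
    fun P h τ hτ σ hσ x hxτ hxσ v K hv hv0 => ?_⟩
  obtain ⟨τ₀, hτ₀, hmin⟩ := (P.filter fun σ => x ∈ range σ.vert).exists_min_image
    (fun τ => τ.size) ⟨τ, mem_filter.2 ⟨hτ, hxτ⟩⟩
  obtain ⟨hτ₀, hxτ₀⟩ := mem_filter.1 hτ₀
  have hk := key P h x τ₀ hτ₀ hxτ₀ (fun σ hσ hx => hmin σ (mem_filter.2 ⟨hσ, hx⟩)) v K hv hv0
  obtain ⟨h1, h1'⟩ := hk τ hτ hxτ
  obtain ⟨h2, -⟩ := hk σ hσ hxσ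
  set G := starEnergy P x v
  have hG : 0 ≤ G := starEnergy_nonneg x v
  set m := meanOn (closedBall x (c * τ₀.size)) v
  have hτ0 := h.size_pos hτ
  have hσ0 := h.size_pos hσ
  have hTG : 0 ≤ τ.size ^ 2 * G := by positivity
  have e0 : 0 ≤ C₁ * (τ.size ^ 2 * G) := by positivity
  have e0' : 0 ≤ C₂ * (τ.size ^ 2 * G) := by positivity
  have e0'' : 0 ≤ M ^ n * M ^ 2 * (C₁ * (τ.size ^ 2 * G)) := by positivity
  have hsum : (2 * C₁ + 2 * (M ^ n * M ^ 2) * C₁ + 2 * C₂) * τ.size ^ 2 * G =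
      2 * (C₁ * τ.size ^ 2 * G) + 2 * (M ^ n * M ^ 2 * (C₁ * (τ.size ^ 2 * G))) +
        2 * (C₂ * τ.size ^ 2 * G) := by ring
  rw [← mul_assoc] at e0 e0'
  constructor
  · have h3 : τ.size ^ n * (meanOn σ.closed v - m) ^ 2 ≤ M ^ n * M ^ 2 * (C₁ * (τ.size ^ 2 * G)) := by
      have hs1 : τ.size ≤ M * σ.size := hM P h hσ hτ hxσ hxτ
      have hs2 : σ.size ≤ M * τ.size := hM P h hτ hσ hxτ hxσ
      calc τ.size ^ n * (meanOn σ.closed v - m) ^ 2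
          ≤ (M * σ.size) ^ n * (meanOn σ.closed v - m) ^ 2 := by gcongr
        _ = M ^ n * (σ.size ^ n * (meanOn σ.closed v - m) ^ 2) := by rw [mul_pow]; ring
        _ ≤ M ^ n * (C₁ * σ.size ^ 2 * G) := by gcongr
        _ ≤ M ^ n * (C₁ * (M * τ.size) ^ 2 * G) := by gcongr
        _ = _ := by ring
    have h4 := mul_nonneg (pow_nonneg hτ0.le n)
      (sq_nonneg (meanOn τ.closed v - m + (meanOn σ.closed v - m)))
    rw [hsum]
    nlinarith
  · intro hx
    have h4 := mul_nonneg (pow_nonneg hτ0.le n) (sq_nonneg (meanOn τ.closed v - m - m))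
    have := h1' hx
    rw [hsum]
    nlinarith

end IsMesh
end StarPoincare

/-! ### Polynomials and Lagrange interpolation on a simplex -/

section Lagrange

variable {n m : ℕ}

/-- Polynomial functions of degree at most `m`. -/
def IsPoly (m : ℕ) (p : E n → ℝ) : Prop :=
  ∃ r : MvPolynomial (Fin n) ℝ, r.totalDegree ≤ m ∧ ∀ x, p x = MvPolynomial.eval (fun i => x i) r

namespace IsPoly

theorem const (c : ℝ) (m : ℕ) : IsPoly m fun _ : E n => c :=
  ⟨MvPolynomial.C c, by simp, by simp⟩

theorem add {p q : E n → ℝ} (hp : IsPoly m p) (hq : IsPoly m q) : IsPoly m fun x => p x + q x := by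
  obtain ⟨r, h1, h2⟩ := hp
  obtain ⟨s, h3, h4⟩ := hq
  exact ⟨r + s, (MvPolynomial.totalDegree_add _ _).trans (max_le h1 h3), fun x => by simp [h2, h4]⟩

theorem mul {m' : ℕ} {p q : E n → ℝ} (hp : IsPoly m p) (hq : IsPoly m' q) :
    IsPoly (m + m') fun x => p x * q x := by
  obtain ⟨r, h1, h2⟩ := hp
  obtain ⟨s, h3, h4⟩ := hq
  exact ⟨r * s, (MvPolynomial.totalDegree_mul _ _).trans (add_le_add h1 h3), fun x => by simp [h2, h4]⟩

theorem const_mul {p : E n → ℝ} (c : ℝ) (hp : IsPoly m p) : IsPoly m fun x => c * p x := by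
  simpa using (const c 0).mul hp

theorem sub {p q : E n → ℝ} (hp : IsPoly m p) (hq : IsPoly m q) : IsPoly m fun x => p x - q x := by
  simpa [sub_eq_add_neg] using hp.add (hq.const_mul (-1))

theorem sum {ι : Type*} (s : Finset ι) {p : ι → E n → ℝ} (h : ∀ i ∈ s, IsPoly m (p i)) :
    IsPoly m fun x => ∑ i ∈ s, p i x := by
  classical
  induction s using Finset.induction_on with
  | empty => simpa using const 0 m
  | insert i s hi ih =>
    simp_rw [Finset.sum_insert hi]
    exact (h i (Finset.mem_insert_self _ _)).add (ih fun j hj => h j (Finset.mem_insert_of_mem hj))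

theorem prod {ι : Type*} (s : Finset ι) {d : ι → ℕ} {p : ι → E n → ℝ} (h : ∀ i ∈ s, IsPoly (d i) (p i)) :
    IsPoly (∑ i ∈ s, d i) fun x => ∏ i ∈ s, p i x := by
  classical
  induction s using Finset.induction_on with
  | empty => simpa using const 1 0
  | insert i s hi ih =>
    simp_rw [Finset.prod_insert hi, Finset.sum_insert hi]
    exact (h i (Finset.mem_insert_self _ _)).mul (ih fun j hj => h j (Finset.mem_insert_of_mem hj))

theorem coordinate (i : Fin n) : IsPoly 1 fun x : E n => x i :=
  ⟨MvPolynomial.X i, (MvPolynomial.totalDegree_X i).le, by simp⟩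

theorem _root_.Stokes.sum_smul_basisVec (x : E n) : ∑ i, x i • basisVec i = x := by
  simpa [basisVec] using (EuclideanSpace.basisFun (Fin n) ℝ).sum_repr x

theorem affine (f : E n →ᵃ[ℝ] ℝ) : IsPoly 1 f := by
  have h : ∀ x : E n, f x = f 0 + ∑ i, f.linear (basisVec i) * x i := by
    intro x
    have h3 : f x = f.linear x + f 0 := congrFun f.decomp x
    have h4 : f.linear x = ∑ i, f.linear (basisVec i) * x i := by
      conv_lhs => rw [← sum_smul_basisVec x]
      rw [map_sum]
      exact sum_congr rfl fun i _ => by rw [map_smul, smul_eq_mul, mul_comm]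
    rw [h3, h4, add_comm]
  have h2 := (const (n := n) (f 0) 1).add (sum Finset.univ fun i _ => (coordinate i).const_mul (f.linear (basisVec i)))
  rwa [← funext h] at h2

theorem contDiff {p : E n → ℝ} (h : IsPoly m p) {k : WithTop ℕ∞} : ContDiff ℝ k p := by
  obtain ⟨r, -, h2⟩ := h
  rw [funext h2]
  clear h2
  induction r using MvPolynomial.induction_on with
  | C a => simpa using contDiff_const
  | add p q hp hq => simpa using hp.add hq
  | mul_X p i hp =>
    simp only [map_mul, MvPolynomial.eval_X]
    exact hp.mul (EuclideanSpace.proj (𝕜 := ℝ) i).contDiff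

theorem continuous {p : E n → ℝ} (hp : IsPoly m p) : Continuous p := (hp.contDiff (k := 0)).continuous

end IsPoly

/-- Multi-indices of length `m` over the vertices of a simplex. -/
def multiIndex (n m : ℕ) : Finset (Fin (n + 1) → ℕ) := Finset.univ.piAntidiag m

theorem mem_multiIndex {α : Fin (n + 1) → ℕ} : α ∈ multiIndex n m ↔ ∑ i, α i = m := by
  simp [multiIndex, Finset.mem_piAntidiag]

/-- The Lagrange polynomial, in barycentric coordinates, of the node with barycentric coordinates
`α i / m`. -/
def lagrange (m : ℕ) (α : Fin (n + 1) → ℕ) (t : Fin (n + 1) → ℝ) : ℝ :=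
  ∏ i, ∏ k ∈ Finset.range (α i), (m * t i - k) / (k + 1)

theorem lagrange_eq_zero {α : Fin (n + 1) → ℕ} {t : Fin (n + 1) → ℝ} {i : Fin (n + 1)} (hα : α i ≠ 0)
    (ht : t i = 0) : lagrange m α t = 0 :=
  Finset.prod_eq_zero (Finset.mem_univ i)
    (Finset.prod_eq_zero (Finset.mem_range.2 (Nat.pos_of_ne_zero hα)) (by simp [ht]))

theorem lagrange_node (hm : m ≠ 0) {α β : Fin (n + 1) → ℕ} (hα : α ∈ multiIndex n m)
    (hβ : β ∈ multiIndex n m) : lagrange m α (fun i => (β i : ℝ) / m) = if β = α then 1 else 0 := by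
  have hm' : (m : ℝ) ≠ 0 := by exact_mod_cast hm
  have e : ∀ i, (m : ℝ) * (β i / m) = β i := fun i => by field_simp
  simp only [lagrange, e]
  split_ifs with h
  · subst h
    refine Finset.prod_eq_one fun i _ => ?_
    rw [Finset.prod_div_distrib, div_eq_one_iff_eq
      (Finset.prod_ne_zero_iff.2 fun k _ => by positivity), ← Finset.prod_range_reflect]
    refine Finset.prod_congr rfl fun k hk => ?_
    have hk := Finset.mem_range.1 hk
    rw [Nat.sub_sub, Nat.cast_sub (by omega)]
    push_cast; ring
  · -- some index of `β` is smaller, since the sums are equal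
    have : ∃ i, β i < α i := by
      by_contra! hcon
      refine h (funext fun i => ?_)
      rw [mem_multiIndex] at hα hβ
      exact ((Finset.sum_eq_sum_iff_of_le fun i _ => hcon i).1 (hα.trans hβ.symm) i (Finset.mem_univ i)).symm
    obtain ⟨i, hi⟩ := this
    exact Finset.prod_eq_zero (Finset.mem_univ i)
      (Finset.prod_eq_zero (Finset.mem_range.2 hi) (by simp))

theorem contDiff_lagrange (α : Fin (n + 1) → ℕ) {k : WithTop ℕ∞} : ContDiff ℝ k (lagrange m α) := by
  unfold lagrange
  fun_prop

variable (b : Simplex n)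

/-- The barycentric coordinates of a point. -/
def coords (x : E n) : Fin (n + 1) → ℝ := fun i => b.coord i x

/-- The interpolation nodes of degree `m` in the simplex. -/
def node (m : ℕ) (α : Fin (n + 1) → ℕ) : E n := ∑ i, ((α i : ℝ) / m) • b i

theorem coords_combination {w : Fin (n + 1) → ℝ} (hw : ∑ i, w i = 1) : coords b (∑ i, w i • b i) = w := by
  funext j
  have h := coord_eq_add_inner b j (∑ i, w i • b i) (b j)
  have e : ∑ i, w i • b i - b j = ∑ i, w i • (b i - b j) := by
    simp_rw [smul_sub, sum_sub_distrib, ← sum_smul, hw, one_smul]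
  rw [e, inner_sum] at h
  simp_rw [real_inner_smul_right, inner_baryGrad_vertex_sub] at h
  rw [coords, h, b.coord_apply_eq]
  simp [mul_sub, sum_sub_distrib, hw]

theorem sum_node (hm : m ≠ 0) {α : Fin (n + 1) → ℕ} (hα : α ∈ multiIndex n m) :
    ∑ i, ((α i : ℝ) / m) = 1 := by
  rw [← Finset.sum_div, ← Nat.cast_sum, mem_multiIndex.1 hα, div_self (by exact_mod_cast hm)]

theorem coords_node (hm : m ≠ 0) {α : Fin (n + 1) → ℕ} (hα : α ∈ multiIndex n m) :
    coords b (node b m α) = fun i => (α i : ℝ) / m :=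
  coords_combination b (sum_node hm hα)

theorem isPoly_lagrange {α : Fin (n + 1) → ℕ} (hα : α ∈ multiIndex n m) :
    IsPoly m fun x => lagrange m α (coords b x) := by
  have h : ∀ i, IsPoly (∑ k ∈ Finset.range (α i), 1) fun x =>
      ∏ k ∈ Finset.range (α i), (m * b.coord i x - k) / (k + 1) := fun i =>
    IsPoly.prod _ fun k _ => by
      have := (((IsPoly.affine (b.coord i)).const_mul m).sub (IsPoly.const k 1)).const_mul (((k : ℝ) + 1)⁻¹)
      convert this using 2
      ring
  have := IsPoly.prod Finset.univ fun i _ => h i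
  simp only [sum_const, Finset.card_range, smul_eq_mul, mul_one, mem_multiIndex.1 hα] at this
  exact this

/-- Homogeneous polynomials of degree `m` in the barycentric coordinates. -/
def baryPoly (m : ℕ) : Submodule ℝ (E n → ℝ) :=
  Submodule.span ℝ (range fun β : multiIndex n m => fun x => ∏ i, b.coord i x ^ (β : _ → ℕ) i)

theorem coord_mul_mem_baryPoly (i : Fin (n + 1)) {f : E n → ℝ} (hf : f ∈ baryPoly b m) :
    (fun x => b.coord i x * f x) ∈ baryPoly b (m + 1) := by
  refine Submodule.span_induction (p := fun f _ => (fun x => b.coord i x * f x) ∈ baryPoly b (m + 1))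
    ?_ ?_ ?_ ?_ hf
  · rintro _ ⟨⟨β, hβ⟩, rfl⟩
    refine Submodule.subset_span ⟨⟨β + Pi.single i 1, ?_⟩, ?_⟩
    · rw [mem_multiIndex] at hβ ⊢
      simp [sum_add_distrib, hβ]
    · funext x
      have e : ∏ j, b.coord j x ^ (Pi.single i 1 : Fin (n + 1) → ℕ) j = b.coord i x := by
        rw [Finset.prod_eq_single i (fun j _ hj => by rw [Pi.single_eq_of_ne hj, pow_zero])
          fun h => absurd (Finset.mem_univ i) h, Pi.single_eq_same, pow_one]
      simp only [Pi.add_apply, pow_add, Finset.prod_mul_distrib]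
      rw [e, mul_comm]
  · have : (fun x => b.coord i x * (0 : E n → ℝ) x) = 0 := by funext x; simp
    rw [this]
    exact Submodule.zero_mem _
  · intro f g _ _ hf hg
    simpa [mul_add] using! Submodule.add_mem _ hf hg
  · intro c f _ hf
    have := Submodule.smul_mem _ c hf
    convert this using 2
    simp; ring

theorem affine_mul_mem_baryPoly (f : E n →ᵃ[ℝ] ℝ) {g : E n → ℝ} (hg : g ∈ baryPoly b m) :
    (fun x => f x * g x) ∈ baryPoly b (m + 1) := by
  have h : ∀ x, f x = ∑ i, f (b i) * b.coord i x := by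
    intro x
    have h1 := b.affineCombination_coord_eq_self x
    have hs : ∑ i, b.coord i x = 1 := b.sum_coord_apply_eq_one x
    conv_lhs => rw [← h1, Finset.map_affineCombination _ _ _ hs,
      Finset.affineCombination_eq_linear_combination _ _ _ hs]
    exact sum_congr rfl fun i _ => by simp [mul_comm]
  have h2 : (fun x => f x * g x) = ∑ i, f (b i) • fun x => b.coord i x * g x := by
    funext x
    rw [h, sum_mul]
    simp [mul_assoc]
  rw [h2]
  exact Submodule.sum_mem _ fun i _ => Submodule.smul_mem _ _ (coord_mul_mem_baryPoly b i hg)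

theorem pow_mul_mem_baryPoly (f : E n →ᵃ[ℝ] ℝ) (k : ℕ) {g : E n → ℝ} (hg : g ∈ baryPoly b m) :
    (fun x => f x ^ k * g x) ∈ baryPoly b (m + k) := by
  induction k with
  | zero => simpa using hg
  | succ k ih =>
    have := affine_mul_mem_baryPoly b f ih
    rw [← add_assoc]
    simpa [pow_succ', mul_assoc] using this

theorem const_mem_baryPoly (c : ℝ) : ∀ m, (fun _ => c) ∈ baryPoly b m
  | 0 => by
    have h : (fun _ : E n => (1 : ℝ)) ∈ baryPoly b 0 :=
      Submodule.subset_span ⟨⟨0, by simp [mem_multiIndex]⟩, by funext; simp⟩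
    have h2 := Submodule.smul_mem _ c h
    have e : c • (fun _ : E n => (1 : ℝ)) = fun _ => c := by funext x; simp
    rwa [e] at h2
  | m + 1 => by
    simpa using affine_mul_mem_baryPoly b (AffineMap.const ℝ (E n) 1) (const_mem_baryPoly c m)

theorem baryPoly_mono {m' : ℕ} (h : m ≤ m') : baryPoly b m ≤ baryPoly b m' := by
  induction h with
  | refl => exact le_rfl
  | step _ ih =>
    refine ih.trans fun f hf => ?_
    simpa using affine_mul_mem_baryPoly b (AffineMap.const ℝ (E n) 1) hf

theorem IsPoly.mem_baryPoly {p : E n → ℝ} (hp : IsPoly m p) : p ∈ baryPoly b m := by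
  obtain ⟨r, h1, h2⟩ := hp
  have h3 : p = ∑ s ∈ r.support, r.coeff s • fun x : E n => s.prod fun i k => x i ^ k := by
    funext x
    rw [h2, MvPolynomial.eval_eq]
    simp [Finsupp.prod]
  rw [h3]
  refine Submodule.sum_mem _ fun s hs => Submodule.smul_mem _ _ ?_
  have hdeg : (s.sum fun _ k => k) ≤ m := (MvPolynomial.le_totalDegree hs).trans h1
  refine baryPoly_mono b hdeg ?_
  clear h3 hs hdeg
  induction s using Finsupp.induction with
  | zero => simpa using const_mem_baryPoly b 1 0
  | single_add i k s hi hk ih =>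
    have e1 : ((Finsupp.single i k + s).sum fun _ k => k) = (s.sum fun _ k => k) + k := by
      rw [Finsupp.sum_add_index' (fun _ => rfl) fun _ _ _ => rfl, Finsupp.sum_single_index rfl, add_comm]
    have e2 : (fun x : E n => (Finsupp.single i k + s).prod fun i k => x i ^ k) =
        fun x => (EuclideanSpace.proj (𝕜 := ℝ) i).toLinearMap.toAffineMap x ^ k *
          s.prod fun i k => x i ^ k := by
      funext x
      rw [Finsupp.prod_add_index' (fun _ => pow_zero _) fun _ _ _ => pow_add _ _ _,
        Finsupp.prod_single_index (h := fun j k => x j ^ k) (pow_zero _)]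
      rfl
    rw [e1, e2]
    exact pow_mul_mem_baryPoly b _ k ih

theorem lagrange_reproduction (hm : m ≠ 0) {p : E n → ℝ} (hp : IsPoly m p) (x : E n) :
    p x = ∑ α ∈ multiIndex n m, p (node b m α) * lagrange m α (coords b x) := by
  -- evaluation of homogeneous polynomials at the nodes is onto, hence one-to-one
  let Ψ : (multiIndex n m → ℝ) →ₗ[ℝ] (E n → ℝ) :=
    Fintype.linearCombination ℝ fun β : multiIndex n m => fun x => ∏ i, b.coord i x ^ (β : _ → ℕ) i
  let Φ : (E n → ℝ) →ₗ[ℝ] (multiIndex n m → ℝ) := LinearMap.pi fun α => LinearMap.proj (node b m α)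
  have hΨ : ∀ f ∈ baryPoly b m, ∃ c, Ψ c = f := by
    intro f hf
    have : f ∈ LinearMap.range Ψ := by
      rw [Fintype.range_linearCombination]; exact hf
    exact this
  have hsurj : Function.Surjective (Φ ∘ₗ Ψ) := by
    intro c
    obtain ⟨d, hd⟩ := hΨ _ (IsPoly.mem_baryPoly b (IsPoly.sum Finset.univ fun (α : multiIndex n m) _ =>
      (isPoly_lagrange b α.2).const_mul (c α)))
    refine ⟨d, ?_⟩
    funext β
    rw [LinearMap.comp_apply, hd]
    simp only [Φ, LinearMap.pi_apply, LinearMap.proj_apply]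
    simp_rw [coords_node b hm β.2, lagrange_node hm (Subtype.prop _) β.2]
    simp [Subtype.ext_iff.symm]
  have hinj := (LinearMap.injective_iff_surjective (f := Φ ∘ₗ Ψ)).2 hsurj
  have hq := hp.sub (IsPoly.sum (multiIndex n m) fun α hα => (isPoly_lagrange b hα).const_mul (p (node b m α)))
  obtain ⟨d, hd⟩ := hΨ _ (hq.mem_baryPoly b)
  have hd0 : (Φ ∘ₗ Ψ) d = 0 := by
    funext β
    rw [LinearMap.comp_apply, hd]
    simp only [Φ, LinearMap.pi_apply, LinearMap.proj_apply, Pi.zero_apply]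
    rw [sum_congr rfl fun α hα => by
      rw [coords_node b hm β.2, lagrange_node hm hα β.2]]
    simp
  have := hinj (hd0.trans (map_zero _).symm)
  rw [this, map_zero] at hd
  have := congrFun hd x
  simp only [Pi.zero_apply] at this
  linarith

end Lagrange

/-! ### Scaling of polynomials on simplices and their facets -/

section Scaling

variable {n m : ℕ}

theorem hasFDerivAt_coords (b : Simplex n) (x : E n) :
    HasFDerivAt (coords b) (ContinuousLinearMap.pi fun i => innerSL ℝ (baryGrad b i)) x := by
  rw [hasFDerivAt_pi]
  intro i
  have h : (fun y => coords b y i) = fun y => b.coord i x + innerSL ℝ (baryGrad b i) (y - x) := by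
    funext y
    rw [coords, coord_eq_add_inner b i y x, innerSL_apply_apply]
  have h2 := ((innerSL ℝ (baryGrad b i)).hasFDerivAt (x := x)).add_const (b.coord i x - ⟪baryGrad b i, x⟫_ℝ)
  rw [h]
  refine h2.congr_of_eventuallyEq (.of_forall fun y => ?_)
  simp only [innerSL_apply_apply, inner_sub_right]
  ring

theorem contDiff_coords (b : Simplex n) {k : WithTop ℕ∞} :
    ContDiff ℝ k (coords b) :=
  contDiff_pi.2 fun i => (IsPoly.affine (b.coord i)).contDiff

theorem sum_coords (b : Simplex n) (x : E n) : ∑ i, coords b x i = 1 :=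
  b.sum_coord_apply_eq_one x

theorem combination_coords (b : Simplex n) (x : E n) :
    ∑ i, coords b x i • b i = x := by
  have h1 := b.affineCombination_coord_eq_self x
  rwa [Finset.affineCombination_eq_linear_combination _ _ _ (b.sum_coord_apply_eq_one x)] at h1

theorem continuous_coords (b : Simplex n) : Continuous (coords b) :=
  continuous_pi fun i => continuous_coord b i

/-- The average over a simplex of a function of the barycentric coordinates does not depend on the
simplex. -/
theorem integral_coords (b b' : Simplex n) (H : (Fin (n + 1) → ℝ) → ℝ) :
    volume.real (simplex b) * ∫ x in simplex b', H (coords b' x) =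
      volume.real (simplex b') * ∫ x in simplex b, H (coords b x) := by
  set φ : E n → E n := fun x => ∑ i, coords b x i • b' i
  have hφ : ∀ x, coords b' (φ x) = coords b x := fun x => coords_combination b' (sum_coords b x)
  set L : E n →L[ℝ] E n := ∑ i, (innerSL ℝ (baryGrad b i)).smulRight (b' i)
  have hd : ∀ x, HasFDerivAt φ L x := fun x =>
    HasFDerivAt.fun_sum fun i _ => ((hasFDerivAt_pi.1 (hasFDerivAt_coords b x)) i).smul_const (b' i)
  have himg : φ '' simplex b = simplex b' := by
    ext y
    constructor
    · rintro ⟨x, hx, rfl⟩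
      rw [mem_simplex] at hx ⊢
      intro i
      have := congrFun (hφ x) i
      simp only [coords] at this
      rw [this]; exact hx i
    · intro hy
      have h1 : coords b (∑ i, coords b' y i • b i) = coords b' y := coords_combination b (sum_coords b' y)
      refine ⟨∑ i, coords b' y i • b i, ?_, ?_⟩
      · rw [mem_simplex] at hy ⊢
        intro i
        exact (congrFun h1 i).ge.trans' (hy i)
      · simp only [φ, h1]
        exact combination_coords b' y
  have hinj : InjOn φ (simplex b) := by
    intro x _ y _ hxy
    rw [← combination_coords b x, ← combination_coords b y, ← hφ x, ← hφ y, hxy]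
  have key : ∀ H : (Fin (n + 1) → ℝ) → ℝ, ∫ x in simplex b', H (coords b' x) =
      |L.det| * ∫ x in simplex b, H (coords b x) := by
    intro H
    rw [← himg, integral_image_eq_integral_abs_det_fderiv_smul volume
      (isCompact_simplex b).measurableSet (fun x _ => (hd x).hasFDerivWithinAt) hinj]
    simp only [hφ, smul_eq_mul]
    rw [integral_const_mul]
  have h1 := key fun _ => 1
  simp only [integral_const, MeasurableSet.univ, measureReal_restrict_apply, univ_inter, smul_eq_mul,
    mul_one] at h1
  rw [key, h1]
  ring

/-- The average over a facet of a function of the barycentric coordinates does not depend on the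
simplex. -/
theorem facet_integral_coords [NeZero n] (b b' : Simplex n) (i : Fin (n + 1))
    {H : (Fin (n + 1) → ℝ) → ℝ} (hH : ContDiff ℝ 1 H) :
    volume.real (simplex b) * (height b' i * ∫ x in facetOf b' i, H (coords b' x) ∂surface n) =
      volume.real (simplex b') * (height b i * ∫ x in facetOf b i, H (coords b x) ∂surface n) := by
  have key : ∀ b : Simplex n,
      height b i * ∫ x in facetOf b i, H (coords b x) ∂surface n =
        ∫ x in simplex b, (fun t => n * H t + fderiv ℝ H t (t - Pi.single i 1)) (coords b x) := by
    intro b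
    have hc : ContDiff ℝ 1 fun x => H (coords b x) :=
      hH.comp (contDiff_coords b)
    rw [← cone_formula b i (LipOn.of_contDiff hc (isCompact_simplex b))]
    refine integral_congr_ae (.of_forall fun x => ?_)
    have h1 := ((hH.differentiable one_ne_zero (coords b x)).hasFDerivAt.comp x (hasFDerivAt_coords b x))
    have h2 : (ContinuousLinearMap.pi fun i => innerSL ℝ (baryGrad b i)) (x - b i) =
        coords b x - Pi.single i 1 := by
      funext j
      have := coord_eq_add_inner b j x (b i)
      rw [b.coord_apply] at this
      simp only [ContinuousLinearMap.pi_apply, innerSL_apply_apply, Pi.sub_apply, coords, this,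
        Pi.single_apply]
      ring
    have h3 := h1.fderiv
    simp only [Function.comp_def] at h3
    simp only [h3, ContinuousLinearMap.comp_apply, h2]
  rw [key, key]
  exact integral_coords b b' fun t => n * H t + fderiv ℝ H t (t - Pi.single i 1)

/-- A positive definite quadratic form is bounded below by the sum of the squares. -/
theorem exists_sum_sq_le_integral {X ι : Type*} [MeasurableSpace X] {μ : Measure X} [Fintype ι]
    {f : ι → X → ℝ} (hf : ∀ i j, Integrable (fun x => f i x * f j x) μ)
    (hpos : ∀ c : ι → ℝ, ∫ x, (∑ i, c i * f i x) ^ 2 ∂μ = 0 → c = 0) :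
    ∃ C : ℝ, 0 ≤ C ∧ ∀ c : ι → ℝ, ∑ i, c i ^ 2 ≤ C * ∫ x, (∑ i, c i * f i x) ^ 2 ∂μ := by
  set q : (ι → ℝ) → ℝ := fun c => ∫ x, (∑ i, c i * f i x) ^ 2 ∂μ
  have hq : ∀ c, q c = ∑ i, ∑ j, c i * c j * ∫ x, f i x * f j x ∂μ := by
    intro c
    simp only [q, sq, Finset.sum_mul_sum]
    have hij : ∀ i j, Integrable (fun x => c i * f i x * (c j * f j x)) μ := fun i j => by
      have := (hf i j).const_mul (c i * c j)
      convert this using 2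
      ring
    rw [integral_finsetSum _ fun i _ => integrable_finsetSum _ fun j _ => hij i j]
    refine sum_congr rfl fun i _ => ?_
    rw [integral_finsetSum _ fun j _ => hij i j]
    refine sum_congr rfl fun j _ => ?_
    rw [← integral_const_mul]
    congr 1
    funext x; ring
  have hqc : Continuous q := by
    rw [funext hq]
    fun_prop
  have hq0 : ∀ c, 0 ≤ q c := fun c => integral_sq_nonneg _
  have hqs : ∀ (t : ℝ) c, q (t • c) = t ^ 2 * q c := by
    intro t c
    simp only [q]
    rw [← integral_const_mul]
    congr 1
    funext x
    simp only [Pi.smul_apply, smul_eq_mul, mul_assoc, ← mul_sum]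
    ring
  rcases (Metric.sphere (0 : ι → ℝ) 1).eq_empty_or_nonempty with he | hne
  · refine ⟨0, le_rfl, fun c => ?_⟩
    have : c = 0 := by
      by_contra hc
      have : ‖c‖⁻¹ • c ∈ Metric.sphere (0 : ι → ℝ) 1 := by
        rw [mem_sphere_zero_iff_norm, norm_smul, norm_inv, norm_norm,
          inv_mul_cancel₀ (norm_ne_zero_iff.2 hc)]
      rw [he] at this
      exact this
    simp [this]
  · obtain ⟨c₀, hc₀, hmin⟩ := (isCompact_sphere (0 : ι → ℝ) 1).exists_isMinOn hne hqc.continuousOn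
    have hc₀' : 0 < q c₀ := by
      refine lt_of_le_of_ne (hq0 c₀) fun h => ?_
      have := hpos c₀ h.symm
      rw [this] at hc₀
      simp at hc₀
    refine ⟨Fintype.card ι / q c₀, by positivity, fun c => ?_⟩
    have h1 : ∑ i, c i ^ 2 ≤ Fintype.card ι * ‖c‖ ^ 2 := by
      calc ∑ i, c i ^ 2 ≤ ∑ _i : ι, ‖c‖ ^ 2 := sum_le_sum fun i _ => by
            rw [← sq_abs]
            exact pow_le_pow_left₀ (abs_nonneg _) (norm_le_pi_norm c i) 2
        _ = _ := by simp
    have h2 : ‖c‖ ^ 2 * q c₀ ≤ q c := by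
      by_cases hc : c = 0
      · simpa [hc] using hq0 0
      have hn : ‖c‖ ≠ 0 := norm_ne_zero_iff.2 hc
      have h3 : ‖c‖⁻¹ • c ∈ Metric.sphere (0 : ι → ℝ) 1 := by
        rw [mem_sphere_zero_iff_norm, norm_smul, norm_inv, norm_norm, inv_mul_cancel₀ hn]
      have h4 : q c₀ ≤ q (‖c‖⁻¹ • c) := hmin h3
      rw [hqs] at h4
      calc ‖c‖ ^ 2 * q c₀ ≤ ‖c‖ ^ 2 * (‖c‖⁻¹ ^ 2 * q c) := by gcongr
        _ = q c := by field_simp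
    calc ∑ i, c i ^ 2 ≤ Fintype.card ι * ‖c‖ ^ 2 := h1
      _ = Fintype.card ι / q c₀ * (‖c‖ ^ 2 * q c₀) := by field_simp
      _ ≤ _ := by gcongr

theorem eqOn_zero_of_integral_sq_eq_zero {X : Type*} [TopologicalSpace X] [MeasurableSpace X]
    [BorelSpace X] {μ : Measure X} [μ.IsOpenPosMeasure] {K : Set X} (hK : K ⊆ closure (interior K))
    {f : X → ℝ} (hf : ContinuousOn f K) (hint : IntegrableOn (fun x => f x ^ 2) K μ)
    (h : ∫ x in K, f x ^ 2 ∂μ = 0) : EqOn f 0 K := by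
  have h1 := (integral_eq_zero_iff_of_nonneg (fun x => sq_nonneg (f x)) hint).1 h
  refine Measure.eqOn_of_ae_eq (μ := μ) ?_ hf continuousOn_const hK
  exact h1.mono fun x hx => by simpa using hx

/-- The coefficients of a polynomial are controlled by its mean square. -/
theorem exists_sum_sq_node_le (n : ℕ) (hm : m ≠ 0) :
    ∃ C : ℝ, 0 ≤ C ∧ ∀ (b : Simplex n) (p : E n → ℝ), IsPoly m p →
      (∑ α ∈ multiIndex n m, p (node b m α) ^ 2) * volume.real (simplex b) ≤
        C * ∫ x in simplex b, p x ^ 2 := by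
  rcases isEmpty_or_nonempty (Simplex n) with he | hne
  · exact ⟨0, le_rfl, fun b => (he.false b).elim⟩
  have b₀ := hne.some
  have hc : ∀ α : multiIndex n m, Continuous fun x => lagrange m (α : _ → ℕ) (coords b₀ x) := fun α =>
    (contDiff_lagrange (k := 0) _).continuous.comp (continuous_coords b₀)
  have hint : ∀ α β : multiIndex n m, Integrable (fun x => lagrange m (α : _ → ℕ) (coords b₀ x) *
      lagrange m (β : _ → ℕ) (coords b₀ x)) (volume.restrict (simplex b₀)) := fun α β =>
    ((hc α).mul (hc β)).continuousOn.integrableOn_compact (isCompact_simplex b₀)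
  have hlow := exists_sum_sq_le_integral hint ?_
  · obtain ⟨C, hC0, hC⟩ := hlow
    have hv := volume_simplex_pos b₀
    refine ⟨C * volume.real (simplex b₀), by positivity, fun b p hp => ?_⟩
    have h1 := hC fun α => p (node b m α)
    have h2 := integral_coords b₀ b fun t => (∑ α : multiIndex n m, p (node b m α) * lagrange m (α : _ → ℕ) t) ^ 2
    have h3 : ∀ x, ∑ α : multiIndex n m, p (node b m α) * lagrange m (α : _ → ℕ) (coords b x) = p x := by
      intro x
      rw [lagrange_reproduction b hm hp x, Finset.sum_coe_sort _ fun α => p (node b m α) * lagrange m α (coords b x)]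
    simp only [h3] at h2
    rw [Finset.sum_coe_sort _ fun α => p (node b m α) ^ 2] at h1
    calc _ ≤ (C * ∫ x in simplex b₀, (∑ α : multiIndex n m, p (node b m α) * lagrange m (α : _ → ℕ) (coords b₀ x)) ^ 2) *
          volume.real (simplex b) := by gcongr
      _ = C * (volume.real (simplex b₀) * ∫ x in simplex b, p x ^ 2) := by rw [h2]; ring
      _ = _ := by ring
  · intro c h
    have hcont : Continuous fun x => ∑ α : multiIndex n m, c α * lagrange m (α : _ → ℕ) (coords b₀ x) :=
      continuous_finsetSum _ fun α _ => continuous_const.mul (hc α)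
    have h0 := eqOn_zero_of_integral_sq_eq_zero (closure_interior_simplex b₀).ge hcont.continuousOn
      ((hcont.pow 2).continuousOn.integrableOn_compact (isCompact_simplex b₀)) h
    funext β
    have h1 := h0 (x := node b₀ m β) (by
      rw [mem_simplex]
      intro i
      have := congrFun (coords_node b₀ hm β.2) i
      simp only [coords] at this
      rw [this]; positivity)
    simp only [coords_node b₀ hm β.2, lagrange_node hm (Subtype.prop _) β.2] at h1
    simpa [Subtype.ext_iff.symm] using h1

theorem node_mem_facetOf [NeZero n] (b : Simplex n) (hm : m ≠ 0)
    {α : Fin (n + 1) → ℕ} (hα : α ∈ multiIndex n m) {i : Fin (n + 1)} (hi : α i = 0) :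
    node b m α ∈ facetOf b i := by
  have := coords_node b hm hα
  rw [mem_facetOf, mem_simplex]
  refine ⟨fun j => ?_, ?_⟩
  · have := congrFun this j
    simp only [coords] at this
    rw [this]; positivity
  · have := congrFun this i
    simp only [coords] at this
    rw [this]; simp [hi]

theorem closure_interior_flatFacet [NeZero n] (b : Simplex n) (i : Fin (n + 1)) :
    closure (interior (flatFacet b i)) = flatFacet b i := by
  have hconv : Convex ℝ (flatFacet b i) := by
    intro y hy z hz s t hs ht hst
    have h : conePt b i (height b i, s • y + t • z) =
        s • conePt b i (height b i, y) + t • conePt b i (height b i, z) := by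
      obtain rfl : t = 1 - s := by linarith
      simp only [conePt, Submodule.coe_add, Submodule.coe_smul]
      module
    have := (convex_convexHull ℝ (b '' {i}ᶜ)) hy hz hs ht hst
    simp only [flatFacet, Set.mem_ofPred_eq, h]
    exact this
  have hne : (interior (flatFacet b i)).Nonempty := by
    have hn : (0 : ℝ) < n := by exact_mod_cast NeZero.pos n
    set w : Fin (n + 1) → ℝ := fun j => if j = i then 0 else (n : ℝ)⁻¹
    have hw : ∑ j, w j = 1 := by
      simp only [w]
      rw [Finset.sum_ite, Finset.sum_const_zero, zero_add, sum_const, Finset.filter_ne',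
        Finset.card_erase_of_mem (Finset.mem_univ _)]
      simp [hn.ne']
    have hx := coords_combination b hw
    set x := ∑ j, w j • b j
    have hxi : ∀ j, b.coord j x = w j := fun j => congrFun hx j
    have hxF : x ∈ facetOf b i := by
      rw [mem_facetOf, mem_simplex]
      refine ⟨fun j => ?_, ?_⟩
      · rw [hxi]; simp only [w]; split_ifs <;> positivity
      · rw [hxi]; simp [w]
    obtain ⟨y, hy⟩ := facetOf_subset_range b i hxF
    simp only at hy
    refine ⟨y, mem_interior_iff_mem_nhds.2 ?_⟩
    have hc : Continuous fun y => conePt b i (height b i, y) := (isometry_conePt b i _).continuous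
    have hev : ∀ᶠ z in 𝓝 y, ∀ j ∈ Finset.univ.erase i, 0 < b.coord j (conePt b i (height b i, z)) := by
      rw [Filter.eventually_all_finset]
      intro j hj
      refine ((continuous_coord b j).comp hc).continuousAt.eventually (lt_mem_nhds ?_)
      simp only [Function.comp, hy, hxi, w, Finset.ne_of_mem_erase hj, if_false]
      positivity
    filter_upwards [hev] with z hz
    have h0 : b.coord i (conePt b i (height b i, z)) = 0 := by
      rw [coord_conePt, inv_mul_cancel₀ (height_pos b i).ne', sub_self]
    change conePt b i (height b i, z) ∈ facetOf b i
    rw [mem_facetOf, mem_simplex]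
    refine ⟨fun j => ?_, h0⟩
    rcases eq_or_ne j i with rfl | hj
    · exact h0.ge
    · exact (hz j (Finset.mem_erase.2 ⟨hj, Finset.mem_univ _⟩)).le
  rw [hconv.closure_interior_eq_closure_of_nonempty_interior hne, (isCompact_flatFacet b i).isClosed.closure_eq]

theorem eqOn_zero_of_facet_integral_eq_zero [NeZero n] (b : Simplex n)
    (i : Fin (n + 1)) {f : E n → ℝ} (hf : Continuous f)
    (h : ∫ x in facetOf b i, f x ^ 2 ∂surface n = 0) : EqOn f 0 (facetOf b i) := by
  have hc : Continuous fun y => conePt b i (height b i, y) := (isometry_conePt b i _).continuous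
  rw [setIntegral_facetOf b i fun x => f x ^ 2] at h
  have h1 := eqOn_zero_of_integral_sq_eq_zero (closure_interior_flatFacet b i).ge
    (f := fun y => f (conePt b i (height b i, y))) (hf.comp hc).continuousOn
    (((hf.comp hc).pow 2).continuousOn.integrableOn_compact (isCompact_flatFacet b i)) h
  intro x hx
  obtain ⟨y, rfl⟩ := facetOf_subset_range b i hx
  exact h1 hx

/-- The coefficients of a polynomial at the nodes on a facet are controlled by its mean square over
the facet. -/
theorem exists_sum_sq_node_facet_le (n : ℕ) [NeZero n] (hm : m ≠ 0) :
    ∃ C : ℝ, 0 ≤ C ∧ ∀ (b : Simplex n) (i : Fin (n + 1)) (p : E n → ℝ), IsPoly m p →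
      (∑ α ∈ multiIndex n m with α i = 0, p (node b m α) ^ 2) * volume.real (simplex b) ≤
        C * (height b i * ∫ x in facetOf b i, p x ^ 2 ∂surface n) := by
  rcases isEmpty_or_nonempty (Simplex n) with he | hne
  · exact ⟨0, le_rfl, fun b => (he.false b).elim⟩
  have b₀ := hne.some
  have key : ∀ i, ∃ C : ℝ, 0 ≤ C ∧ ∀ (b : Simplex n) (p : E n → ℝ), IsPoly m p →
      (∑ α ∈ multiIndex n m with α i = 0, p (node b m α) ^ 2) * volume.real (simplex b) ≤
        C * (height b i * ∫ x in facetOf b i, p x ^ 2 ∂surface n) := by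
    intro i
    set S := (multiIndex n m).filter fun α => α i = 0
    have hS : ∀ α : S, (α : _ → ℕ) ∈ multiIndex n m := fun α => (mem_filter.1 α.2).1
    have hS' : ∀ α : S, (α : _ → ℕ) i = 0 := fun α => (mem_filter.1 α.2).2
    have hc : ∀ α : S, Continuous fun x => lagrange m (α : _ → ℕ) (coords b₀ x) := fun α =>
      (contDiff_lagrange (k := 0) _).continuous.comp (continuous_coords b₀)
    have hint : ∀ α β : S, Integrable (fun x => lagrange m (α : _ → ℕ) (coords b₀ x) *
        lagrange m (β : _ → ℕ) (coords b₀ x)) ((surface n).restrict (facetOf b₀ i)) := fun α β =>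
      continuousOn_integrableOn_facetOf b₀ i ((hc α).mul (hc β)).continuousOn
    have hlow := exists_sum_sq_le_integral hint ?_
    · obtain ⟨C, hC0, hC⟩ := hlow
      have hv := volume_simplex_pos b₀
      have hh := height_pos b₀ i
      refine ⟨C * (volume.real (simplex b₀) / height b₀ i), by positivity, fun b p hp => ?_⟩
      have h1 := hC fun α => p (node b m α)
      have h2 := facet_integral_coords b₀ b i (H := fun t => (∑ α : S, p (node b m α) * lagrange m (α : _ → ℕ) t) ^ 2)
        ((ContDiff.sum fun α _ => contDiff_const.mul (contDiff_lagrange _)).pow 2)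
      have h3 : ∀ x ∈ facetOf b i, ∑ α : S, p (node b m α) * lagrange m (α : _ → ℕ) (coords b x) = p x := by
        intro x hx
        rw [lagrange_reproduction b hm hp x, Finset.sum_coe_sort _ fun α => p (node b m α) * lagrange m α (coords b x)]
        refine sum_subset (Finset.filter_subset _ _) fun α hα hα' => ?_
        rw [lagrange_eq_zero (i := i) (fun h => hα' (mem_filter.2 ⟨hα, h⟩)) ((mem_facetOf b).1 hx).2, mul_zero]
      have h4 : ∫ x in facetOf b i, (∑ α : S, p (node b m α) * lagrange m (α : _ → ℕ) (coords b x)) ^ 2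
          ∂surface n = ∫ x in facetOf b i, p x ^ 2 ∂surface n :=
        setIntegral_congr_fun (isCompact_facetOf b i).measurableSet fun x hx =>
          congrArg (· ^ 2) (h3 x hx)
      rw [h4] at h2
      rw [Finset.sum_coe_sort _ fun α => p (node b m α) ^ 2] at h1
      set I₀ := ∫ x in facetOf b₀ i, (∑ α : S, p (node b m α) * lagrange m (α : _ → ℕ) (coords b₀ x)) ^ 2 ∂surface n
      calc _ ≤ (C * I₀) * volume.real (simplex b) := by gcongr
        _ = C / height b₀ i * (volume.real (simplex b) * (height b₀ i * I₀)) := by field_simp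
        _ = _ := by rw [← h2]; ring
    · intro c h
      have hcont : Continuous fun x => ∑ α : S, c α * lagrange m (α : _ → ℕ) (coords b₀ x) :=
        continuous_finsetSum _ fun α _ => continuous_const.mul (hc α)
      have h0 := eqOn_zero_of_facet_integral_eq_zero b₀ i hcont h
      funext β
      have h1 := h0 (node_mem_facetOf b₀ hm (hS β) (hS' β))
      simp only [coords_node b₀ hm (hS β), lagrange_node hm (hS _) (hS β)] at h1
      simpa [Subtype.ext_iff.symm] using h1
  choose C hC0 hC using key
  refine ⟨∑ i, C i, sum_nonneg fun i _ => hC0 i, fun b i p hp => (hC i b p hp).trans ?_⟩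
  have hle : C i ≤ ∑ i, C i := single_le_sum (fun j _ => hC0 j) (Finset.mem_univ i)
  have h0 : 0 ≤ height b i * ∫ x in facetOf b i, p x ^ 2 ∂surface n :=
    mul_nonneg (height_pos b i).le (integral_sq_nonneg _)
  exact mul_le_mul_of_nonneg_right hle h0

/-- Lagrange polynomials and their gradients are bounded on the simplex. -/
theorem exists_lagrange_bound (n m : ℕ) : ∃ C : ℝ, 0 ≤ C ∧ ∀ (b : Simplex n),
    ∀ α ∈ multiIndex n m, ∀ x ∈ simplex b, |lagrange m α (coords b x)| ≤ C ∧
      ‖fderiv ℝ (fun x => lagrange m α (coords b x)) x‖ ≤ C * ∑ i, ‖baryGrad b i‖ := by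
  have hK : IsCompact (Set.Icc (0 : Fin (n + 1) → ℝ) 1) := isCompact_Icc
  have key : ∀ α : Fin (n + 1) → ℕ, ∃ C : ℝ, 0 ≤ C ∧ ∀ t ∈ Set.Icc (0 : Fin (n + 1) → ℝ) 1,
      |lagrange m α t| ≤ C ∧ ‖fderiv ℝ (lagrange m α) t‖ ≤ C := by
    intro α
    have h : ContDiff ℝ 1 (lagrange m α) := contDiff_lagrange α
    obtain ⟨A, hA⟩ := hK.exists_bound_of_continuousOn h.continuous.continuousOn
    obtain ⟨B, hB⟩ := hK.exists_bound_of_continuousOn (h.continuous_fderiv one_ne_zero).continuousOn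
    exact ⟨max (max A B) 0, le_max_right _ _, fun t ht =>
      ⟨(hA t ht).trans ((le_max_left _ _).trans (le_max_left _ _)),
        (hB t ht).trans ((le_max_right _ _).trans (le_max_left _ _))⟩⟩
  choose C hC0 hC using key
  refine ⟨∑ α ∈ multiIndex n m, C α, sum_nonneg fun α _ => hC0 α, fun b α hα x hx => ?_⟩
  have hle : C α ≤ ∑ α ∈ multiIndex n m, C α := single_le_sum (f := C) (fun j _ => hC0 j) hα
  have ht : coords b x ∈ Set.Icc (0 : Fin (n + 1) → ℝ) 1 :=
    ⟨fun i => (mem_simplex b).1 hx i, fun i => coord_le_one b hx i⟩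
  obtain ⟨h1, h2⟩ := hC α _ ht
  refine ⟨h1.trans hle, ?_⟩
  have h3 := (((contDiff_lagrange (m := m) (k := 1) α).differentiable one_ne_zero
    (coords b x)).hasFDerivAt.comp x (hasFDerivAt_coords b x)).fderiv
  simp only [Function.comp_def] at h3
  rw [h3]
  refine (ContinuousLinearMap.opNorm_comp_le _ _).trans (mul_le_mul (h2.trans hle) ?_ (norm_nonneg _)
    (sum_nonneg fun α _ => hC0 α))
  refine ContinuousLinearMap.opNorm_le_bound _ (sum_nonneg fun i _ => norm_nonneg _) fun v => ?_
  refine (pi_norm_le_iff_of_nonneg (by positivity)).2 fun i => ?_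
  simp only [ContinuousLinearMap.pi_apply, innerSL_apply_apply]
  refine (norm_inner_le_norm _ _).trans ?_
  gcongr
  exact single_le_sum (f := fun i => ‖baryGrad b i‖) (fun j _ => norm_nonneg _) (Finset.mem_univ i)

end Scaling

/-! ### Conforming piecewise polynomials -/

section Spline

open TaggedSimplex

variable {n m : ℕ} {Ω : Set (E n)} {P : Finset (TaggedSimplex n)} {τ σ : TaggedSimplex n}

/-- A point of a closed simplex lies in the open set `Ω` as soon as some point of a subface of its
carrier does. -/
theorem IsConforming.mem_of_face (hc : IsConforming P) (hP : IsPartition Ω P)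
    (hΩ : IsLipschitzDomain Ω) (hτ : τ ∈ P) {x x' : E n} (hx : x ∈ τ.closed) (hx' : x' ∈ τ.closed)
    (hface : ∀ z, 0 < τ.bary z x → 0 < τ.bary z x') (hxΩ : x ∈ Ω) : x' ∈ Ω := by
  have ht := hP.nondegenerate τ hτ
  have hcont : ContinuousAt (fun ε : ℝ => AffineMap.lineMap x x' ε) 0 := by fun_prop
  have hev : ∀ᶠ ε : ℝ in 𝓝[>] 0, AffineMap.lineMap x x' ε ∈ Ω :=
    nhdsWithin_le_nhds (hcont.eventually_mem (hΩ.isOpen.mem_nhds (by simpa using hxΩ)))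
  obtain ⟨ε, h1, h2⟩ := (hev.and (Ioo_mem_nhdsGT (zero_lt_one' ℝ))).exists
  have hb : ∀ z, τ.bary z (AffineMap.lineMap x x' ε) = (1 - ε) * τ.bary z x + ε * τ.bary z x' := by
    intro z
    rw [AffineMap.apply_lineMap, AffineMap.lineMap_apply_ring']
    ring
  have h0 := (mem_closed_iff ht).1 hx
  have h0' := (mem_closed_iff ht).1 hx'
  refine hc.mem_of_same_face hP hΩ hτ ?_ hx' (fun z hz => ?_) (fun z hz => ?_) h1
  · rw [mem_closed_iff ht]
    intro z
    rw [hb]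
    have := h0 z
    have := h0' z
    have := h2.1.le
    have := sub_nonneg.2 h2.2.le
    positivity
  · by_contra hcon
    have e1 : τ.bary z x' = 0 := le_antisymm (not_lt.1 hcon) (h0' z)
    have e2 : τ.bary z x = 0 := le_antisymm (not_lt.1 fun h => hcon (hface z h)) (h0 z)
    rw [hb, e1, e2] at hz
    simp at hz
  · rw [hb]
    have := mul_nonneg (sub_nonneg.2 h2.2.le) (h0 z)
    have := mul_pos h2.1 hz
    linarith

/-- The function that equals `g τ` on each closed simplex `τ`, and `0` outside of the partition. -/
def glue (P : Finset (TaggedSimplex n)) (g : TaggedSimplex n → E n → ℝ) (x : E n) : ℝ :=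
  open Classical in if h : ∃ τ ∈ P, x ∈ τ.closed then g h.choose x else 0

theorem glue_eq {g : TaggedSimplex n → E n → ℝ}
    (hg : ∀ τ ∈ P, ∀ σ ∈ P, ∀ x ∈ τ.closed, x ∈ σ.closed → g τ x = g σ x) (hτ : τ ∈ P) {x : E n}
    (hx : x ∈ τ.closed) : glue P g x = g τ x := by
  have h : ∃ τ ∈ P, x ∈ τ.closed := ⟨τ, hτ, hx⟩
  rw [glue, dif_pos h]
  exact hg _ h.choose_spec.1 _ hτ x h.choose_spec.2 hx

theorem glue_eq_zero {g : TaggedSimplex n → E n → ℝ}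
    (hg : ∀ τ ∈ P, ∀ x ∈ τ.closed, x ∉ Ω → g τ x = 0) {x : E n} (hx : x ∉ Ω) : glue P g x = 0 := by
  rw [glue]
  split_ifs with h
  · exact hg _ h.choose_spec.1 x h.choose_spec.2 hx
  · rfl

/-- A function that is Lipschitz on each simplex and vanishes off `Ω` is Lipschitz. -/
theorem IsPartition.exists_lipschitzWith (hP : IsPartition Ω P) (hΩ : IsOpen Ω) {w : E n → ℝ}
    (hw : ∀ τ ∈ P, LipOn w τ.closed) (h0 : ∀ x ∉ Ω, w x = 0) : ∃ K, LipschitzWith K w := by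
  classical
  choose! K hK using hw
  set D : Option (TaggedSimplex n) → Set (E n) := fun o => o.elim Ωᶜ closed
  set s : Finset (Option (TaggedSimplex n)) := Finset.insertNone P
  refine ⟨∑ τ ∈ P, K τ, lipschitzWith_of_closed_cover (D := D) (s := s) ?_ ?_ ?_⟩
  · rintro (_ | τ) hτ
    · exact hΩ.isClosed_compl
    · exact isClosed_closed
  · rintro (_ | τ) hτ
    · refine LipschitzOnWith.of_dist_le_mul fun x hx y hy => ?_
      rw [h0 x hx, h0 y hy, dist_self]
      positivity
    · have hτ : τ ∈ P := by simpa [s] using hτ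
      exact (hK τ hτ).weaken (single_le_sum (f := K) (fun _ _ => bot_le) hτ)
  · refine eq_univ_of_forall fun x => ?_
    by_cases hx : x ∈ Ω
    · obtain ⟨τ, hτ, hxτ⟩ := hP.exists_mem (subset_closure hx)
      exact mem_biUnion (show some τ ∈ s by simpa [s] using hτ) hxτ
    · exact mem_biUnion (show none ∈ s by simp [s]) hx

/-- Functions that are polynomials of degree at most `m` on each closed simplex of `P`. -/
def IsSpline (P : Finset (TaggedSimplex n)) (m : ℕ) (g : E n → ℝ) : Prop :=
  ∀ τ ∈ P, ∃ p, IsPoly m p ∧ EqOn g p τ.closed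

theorem IsSpline.lipOn {g : E n → ℝ} (h : IsSpline P m g) (hτ : τ ∈ P) : LipOn g τ.closed := by
  obtain ⟨p, hp, he⟩ := h τ hτ
  obtain ⟨K, hK⟩ := LipOn.of_contDiff hp.contDiff (isCompact_closed (τ := τ))
  exact ⟨K, fun x hx y hy => by rw [he hx, he hy]; exact hK hx hy⟩

theorem IsPiecewisePoly.exists_isPoly {g : E n → ℝ} (h : IsPiecewisePoly P m g) (hτ : τ ∈ P) :
    ∃ p, IsPoly m p ∧ EqOn g p τ.openHull := by
  obtain ⟨r, h1, h2⟩ := h τ hτ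
  exact ⟨fun x => MvPolynomial.eval (fun i => x i) r, ⟨r, h1, fun _ => rfl⟩, h2⟩

theorem IsPoly.isPiecewisePoly {g : E n → ℝ} (h : ∀ τ ∈ P, ∃ p, IsPoly m p ∧ EqOn g p τ.openHull) :
    IsPiecewisePoly P m g := by
  intro τ hτ
  obtain ⟨p, ⟨r, h1, h2⟩, he⟩ := h τ hτ
  exact ⟨r, h1, fun x hx => (he hx).trans (h2 x)⟩

theorem IsSpline.isPiecewisePoly {g : E n → ℝ} (h : IsSpline P m g) : IsPiecewisePoly P m g :=
  IsPoly.isPiecewisePoly fun τ hτ => by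
    obtain ⟨p, hp, he⟩ := h τ hτ
    exact ⟨p, hp, he.mono openHull_subset_closed⟩

end Spline

/-! ### Interpolation of nodal values -/

section Interpolation

open TaggedSimplex

variable {n m : ℕ} {Ω : Set (E n)} {P : Finset (TaggedSimplex n)} {τ σ : TaggedSimplex n}

/-- The polynomial of degree `m` with the values of `c` at the nodes of the simplex. -/
def lagrangeInterp (b : Simplex n) (m : ℕ) (c : E n → ℝ) (x : E n) : ℝ :=
  ∑ α ∈ multiIndex n m, c (node b m α) * lagrange m α (coords b x)

theorem isPoly_lagrangeInterp (b : Simplex n) (c : E n → ℝ) :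
    IsPoly m (lagrangeInterp b m c) :=
  IsPoly.sum _ fun _ hα => (isPoly_lagrange b hα).const_mul _

theorem lagrangeInterp_node (b : Simplex n) (hm : m ≠ 0) (c : E n → ℝ)
    {α : Fin (n + 1) → ℕ} (hα : α ∈ multiIndex n m) :
    lagrangeInterp b m c (node b m α) = c (node b m α) := by
  rw [lagrangeInterp, sum_congr rfl fun β hβ => by
    rw [coords_node b hm hα, lagrange_node hm hβ hα]]
  simp [hα]

theorem lagrangeInterp_eq_self (b : Simplex n) (hm : m ≠ 0) {p c : E n → ℝ}
    (hp : IsPoly m p) (h : ∀ α ∈ multiIndex n m, c (node b m α) = p (node b m α)) (x : E n) :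
    lagrangeInterp b m c x = p x := by
  rw [lagrange_reproduction b hm hp x]
  exact sum_congr rfl fun α hα => by rw [h α hα]

theorem node_mem_simplex (b : Simplex n) (hm : m ≠ 0)
    {α : Fin (n + 1) → ℕ} (hα : α ∈ multiIndex n m) : node b m α ∈ simplex b := by
  rw [mem_simplex]
  intro i
  refine le_of_le_of_eq ?_ (congrFun (coords_node b hm hα) i).symm
  positivity

namespace TaggedSimplex

open Classical in
/-- The polynomial of degree `m` with the values of `c` at the nodes of a tagged simplex. -/
def interp (τ : TaggedSimplex n) (m : ℕ) (c : E n → ℝ) : E n → ℝ :=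
  if h : AffineIndependent ℝ τ.vert then lagrangeInterp (τ.basis h) m c else 0

theorem interp_eq (h : AffineIndependent ℝ τ.vert) (c : E n → ℝ) :
    τ.interp m c = lagrangeInterp (τ.basis h) m c := dif_pos h

theorem coords_basis (h : AffineIndependent ℝ τ.vert) (x : E n) (i : Fin (n + 1)) :
    coords (τ.basis h) x i = τ.bary (τ.vert i) x := by rw [bary_vert h]; rfl

theorem node_mem_closed (h : AffineIndependent ℝ τ.vert) (hm : m ≠ 0) {α : Fin (n + 1) → ℕ}
    (hα : α ∈ multiIndex n m) : node (τ.basis h) m α ∈ τ.closed :=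
  τ.simplex_basis h ▸ node_mem_simplex (τ.basis h) hm hα

theorem bary_node (h : AffineIndependent ℝ τ.vert) (hm : m ≠ 0) {α : Fin (n + 1) → ℕ}
    (hα : α ∈ multiIndex n m) (i : Fin (n + 1)) :
    τ.bary (τ.vert i) (node (τ.basis h) m α) = α i / m := by
  rw [← coords_basis h, coords_node _ hm hα]

/-- The nodes of a simplex are the points whose barycentric coordinates are multiples of `1 / m`. -/
theorem exists_node_eq (h : AffineIndependent ℝ τ.vert) (hm : m ≠ 0) {y : E n}
    (hy : ∀ z, ∃ k : ℕ, τ.bary z y = k / m) : ∃ α ∈ multiIndex n m, node (τ.basis h) m α = y := by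
  choose k hk using hy
  have hm' : (m : ℝ) ≠ 0 := by exact_mod_cast hm
  refine ⟨fun i => k (τ.vert i), ?_, ?_⟩
  · have h1 := sum_bary h y
    simp_rw [hk, ← Finset.sum_div, div_eq_one_iff_eq hm'] at h1
    rw [mem_multiIndex]
    exact_mod_cast h1
  · rw [node]
    simp_rw [← hk]
    exact sum_bary_smul h y

end TaggedSimplex

theorem IsConforming.interp_eq_interp (hc : IsConforming P) (hP : IsPartition Ω P) (hm : m ≠ 0)
    (c : E n → ℝ) (hτ : τ ∈ P) (hσ : σ ∈ P) {x : E n} (hx : x ∈ τ.closed) (hx' : x ∈ σ.closed) :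
    τ.interp m c x = σ.interp m c x := by
  have ht := hP.nondegenerate τ hτ
  have hs := hP.nondegenerate σ hσ
  rw [interp_eq ht, interp_eq hs,
    lagrange_reproduction (τ.basis ht) hm (isPoly_lagrangeInterp (τ.basis ht) c) x,
    lagrange_reproduction (τ.basis ht) hm (isPoly_lagrangeInterp (σ.basis hs) c) x]
  refine sum_congr rfl fun α hα => ?_
  by_cases hα0 : ∃ i, α i ≠ 0 ∧ coords (τ.basis ht) x i = 0
  · obtain ⟨i, h1, h2⟩ := hα0
    rw [lagrange_eq_zero h1 h2, mul_zero, mul_zero]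
  · -- the node lies on the common face, so it is a node of both simplices
    push Not at hα0
    set y := node (τ.basis ht) m α with hy
    have hyτ : y ∈ τ.closed := node_mem_closed ht hm hα
    have hyσ : y ∈ σ.closed := by
      refine mem_closed_of_face ht hyτ fun z hz => ?_
      obtain ⟨i, rfl⟩ := mem_range_of_bary_pos hz
      rw [hy, bary_node ht hm hα] at hz
      have hi : α i ≠ 0 := by rintro h; simp [h] at hz
      have h1 := hα0 i hi
      rw [coords_basis ht, hc.bary_eq hP hτ hσ hx hx'] at h1
      by_contra h2
      exact h1 (by rw [bary_of_notMem h2]; rfl)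
    obtain ⟨β, hβ, hβy⟩ := exists_node_eq hs hm (y := y) fun z => by
      rw [← hc.bary_eq hP hτ hσ hyτ hyσ]
      by_cases hz : z ∈ range τ.vert
      · obtain ⟨i, rfl⟩ := hz
        exact ⟨α i, bary_node ht hm hα i⟩
      · exact ⟨0, by simp [bary_of_notMem hz]⟩
    rw [lagrangeInterp_node _ hm c hα, ← hy, ← hβy, lagrangeInterp_node _ hm c hβ]

/-- The conforming piecewise polynomial of degree `m` with the values of `c` at the nodes. -/
def interp (P : Finset (TaggedSimplex n)) (m : ℕ) (c : E n → ℝ) : E n → ℝ :=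
  glue P fun τ => τ.interp m c

theorem IsConforming.eqOn_interp (hc : IsConforming P) (hP : IsPartition Ω P) (hm : m ≠ 0)
    (c : E n → ℝ) (hτ : τ ∈ P) : EqOn (interp P m c) (lagrangeInterp (τ.basis (hP.nondegenerate τ hτ)) m c)
      τ.closed := fun x hx => by
  rw [interp, glue_eq (g := fun τ => τ.interp m c) (fun τ hτ σ hσ x hx hx' => hc.interp_eq_interp hP hm c hτ hσ hx hx') hτ hx,
    interp_eq (hP.nondegenerate τ hτ)]

theorem IsConforming.isSpline_interp (hc : IsConforming P) (hP : IsPartition Ω P) (hm : m ≠ 0)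
    (c : E n → ℝ) : IsSpline P m (interp P m c) := fun _ hτ =>
  ⟨_, isPoly_lagrangeInterp _ c, hc.eqOn_interp hP hm c hτ⟩

/-- A node with a nonvanishing Lagrange polynomial at `x` lies in a subface of the carrier of `x`,
so it is off `Ω` if `x` is. -/
theorem IsConforming.interp_eq_zero (hc : IsConforming P) (hP : IsPartition Ω P)
    (hΩ : IsLipschitzDomain Ω) (hm : m ≠ 0) {c : E n → ℝ} (h0 : ∀ x ∉ Ω, c x = 0) {x : E n}
    (hx : x ∉ Ω) : interp P m c x = 0 := by
  refine glue_eq_zero (fun τ hτ x hxτ hx => ?_) hx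
  have ht := hP.nondegenerate τ hτ
  rw [interp_eq ht]
  refine sum_eq_zero fun α hα => ?_
  by_cases hα0 : ∃ i, α i ≠ 0 ∧ coords (τ.basis ht) x i = 0
  · obtain ⟨i, h1, h2⟩ := hα0
    rw [lagrange_eq_zero h1 h2, mul_zero]
  · push Not at hα0
    rw [h0 _ fun hy => hx ?_, zero_mul]
    refine hc.mem_of_face hP hΩ hτ (node_mem_closed ht hm hα) hxτ (fun z hz => ?_) hy
    obtain ⟨i, rfl⟩ := mem_range_of_bary_pos hz
    rw [bary_node ht hm hα] at hz
    have hi : α i ≠ 0 := by rintro h; simp [h] at hz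
    have h1 := hα0 i hi
    rw [coords_basis ht] at h1
    exact lt_of_le_of_ne ((mem_closed_iff ht).1 hxτ _) (Ne.symm h1)

end Interpolation

/-! ### Continuous representatives of discrete functions -/

section Representatives

open TaggedSimplex

variable {n m : ℕ} {Ω : Set (E n)} {P : Finset (TaggedSimplex n)} {τ σ : TaggedSimplex n}

theorem IsPartition.ae_mem_openHull (hP : IsPartition Ω P) (hΩ : IsOpen Ω) :
    ∀ᵐ x ∂volume.restrict Ω, ∃ τ ∈ P, x ∈ τ.openHull := by
  have h1 : ∀ᵐ x : E n, ∀ τ ∈ P, x ∉ frontier τ.closed := by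
    rw [Filter.eventually_all_finset]
    intro τ hτ
    have := volume_frontier_simplex (τ.basis (hP.nondegenerate τ hτ))
    rw [τ.simplex_basis] at this
    exact measure_eq_zero_iff_ae_notMem.1 this
  rw [ae_restrict_iff' hΩ.measurableSet]
  filter_upwards [h1] with x hx hxΩ
  obtain ⟨τ, hτ, hxτ⟩ := hP.exists_mem (subset_closure hxΩ)
  refine ⟨τ, hτ, ?_⟩
  by_contra h
  exact hx τ hτ ⟨subset_closure hxτ, h⟩

theorem IsPartition.exists_weakPartial_bound (hP : IsPartition Ω P) (hΩ : IsLipschitzDomain Ω)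
    {v : E n → ℝ} (hv : MemH1 Ω v) (hp : IsPiecewisePoly P m v) (i : Fin n) :
    ∃ K, 0 ≤ K ∧ ∀ᵐ x ∂volume.restrict Ω, |weakPartial Ω i v x| ≤ K := by
  have key : ∀ τ ∈ P, ∃ K, 0 ≤ K ∧ ∀ᵐ x, x ∈ τ.openHull → |weakPartial Ω i v x| ≤ K := by
    intro τ hτ
    obtain ⟨p, hpp, he⟩ := hp.exists_isPoly hτ
    have hsm : ContDiff ℝ 1 p := hpp.contDiff
    have hcl := isCompact_closed (τ := τ)
    have h1 := weakPartial_ae_eq_of_contDiff isOpen_interior (hP.openHull_subset hΩ hτ) hv hsm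
      (hcl.isBounded.subset openHull_subset_closed) he i
    have hc : Continuous fun x => fderiv ℝ p x (basisVec i) :=
      (hsm.continuous_fderiv one_ne_zero).clm_apply continuous_const
    obtain ⟨K, hK⟩ := hcl.exists_bound_of_continuousOn hc.continuousOn
    refine ⟨max K 0, le_max_right _ _, ?_⟩
    filter_upwards [(ae_restrict_iff' isOpen_interior.measurableSet).1 h1] with x hx hxτ
    rw [hx hxτ]
    exact (hK x (interior_subset hxτ)).trans (le_max_left _ _)
  choose! K hK0 hK using key
  refine ⟨∑ τ ∈ P, K τ, sum_nonneg hK0, ?_⟩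
  filter_upwards [hP.ae_mem_openHull hΩ.isOpen, ae_restrict_of_ae ((Filter.eventually_all_finset P).2 hK)]
    with x ⟨τ, hτ, hx⟩ h
  exact (h τ hτ hx).trans (single_le_sum (f := K) hK0 hτ)

open scoped Convolution in
/-- If the weak gradient of a function of `H¹₀` is bounded, the mollifications of its extension by
zero are uniformly Lipschitz, as the extension has a weak gradient on the whole space. -/
theorem MemH10.lipschitzOnWith_continuityPoints (hΩ : IsOpen Ω) (hb : IsBounded Ω) {v : E n → ℝ}
    (hv : MemH10 Ω v) {K : Fin n → ℝ} (hK0 : ∀ i, 0 ≤ K i)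
    (hK : ∀ i, ∀ᵐ x ∂volume.restrict Ω, |weakPartial Ω i v x| ≤ K i) :
    LipschitzOnWith (∑ i, K i).toNNReal (Ω.indicator v) {x | ContinuousAt (Ω.indicator v) x} := by
  have := hb.isFiniteMeasure
  set v₀ := Ω.indicator v with hv₀
  have hvi : IntegrableOn v Ω := hv.1.1.integrable one_le_two
  have hv₀i : Integrable v₀ := hvi.integrable_indicator hΩ.measurableSet
  let ρ : ℕ → E n → ℝ := fun k => (bump n k).normed volume
  have hρ : ∀ k, ContDiff ℝ ∞ (ρ k) := fun k => (bump n k).contDiff_normed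
  have hρs : ∀ k, HasCompactSupport (ρ k) := fun k => (bump n k).hasCompactSupport_normed
  have hρ0 : ∀ k x, 0 ≤ ρ k x := fun k x => (bump n k).nonneg_normed x
  have hρi : ∀ k, Integrable (ρ k) := fun k => (hρ k).continuous.integrable_of_hasCompactSupport (hρs k)
  have hρ1 : ∀ k, ∫ x, ρ k x = 1 := fun k => (bump n k).integral_normed
  let φ : ℕ → E n → ℝ := fun k => ρ k ⋆[ContinuousLinearMap.lsmul ℝ ℝ, volume] v₀
  set D : ℕ → E n → (E n →L[ℝ] ℝ) := fun k x =>
    (fderiv ℝ (ρ k) ⋆[(ContinuousLinearMap.lsmul ℝ ℝ).precompL (E n), volume] v₀) x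
  have hder : ∀ k x, HasFDerivAt (φ k) (D k x) x := fun k x =>
    (hρs k).hasFDerivAt_convolution_left _ ((hρ k).of_le (by simp)) hv₀i.locallyIntegrable x
  have hDi : ∀ k x i, |D k x (basisVec i)| ≤ K i := by
    intro k x i
    have hex := ((hρs k).fderiv (𝕜 := ℝ)).convolutionExists_left
      ((ContinuousLinearMap.lsmul ℝ ℝ).precompL (E n) : (E n →L[ℝ] ℝ) →L[ℝ] ℝ →L[ℝ] (E n →L[ℝ] ℝ))
      ((hρ k).continuous_fderiv (by simp)) hv₀i.locallyIntegrable x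
    have h1 : D k x (basisVec i) = ∫ y, fderiv ℝ (ρ k) (x - y) (basisVec i) * v₀ y := by
      simp only [D, convolution]
      rw [ContinuousLinearMap.integral_apply hex,
        ← integral_sub_left_eq_self (fun y => fderiv ℝ (ρ k) (x - y) (basisVec i) * v₀ y) volume x]
      refine integral_congr_ae (.of_forall fun t => ?_)
      simp [ContinuousLinearMap.precompL_apply]
    set ψ : E n → ℝ := fun y => ρ k (x - y)
    have hψ : ContDiff ℝ ∞ ψ := (hρ k).comp (contDiff_const.sub contDiff_id)
    have hψd : ∀ y, partialDeriv i ψ y = -fderiv ℝ (ρ k) (x - y) (basisVec i) := by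
      intro y
      have h := ((hρ k).differentiable (by simp) (x - y)).hasFDerivAt.comp y
        ((hasFDerivAt_id y).const_sub x)
      have h' : fderiv ℝ ψ y = _ := h.fderiv
      rw [partialDeriv, h']
      simp
    have h2 := hv.integral_eq_zero hΩ hb hψ i
    have hgm := hv.1.memLp_weakPartial hΩ i
    have hi1 : Integrable (fun y => v y * partialDeriv i ψ y) (volume.restrict Ω) :=
      hv.1.1.integrable_mul (memLp_of_continuous hb (continuous_partialDeriv hψ i))
    have hi2 : Integrable (fun y => weakPartial Ω i v y * ψ y) (volume.restrict Ω) :=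
      hgm.integrable_mul (memLp_of_continuous hb hψ.continuous)
    rw [integral_add hi1 hi2] at h2
    have h3 : D k x (basisVec i) = ∫ y in Ω, weakPartial Ω i v y * ψ y := by
      have : D k x (basisVec i) = -∫ y in Ω, v y * partialDeriv i ψ y := by
        rw [h1, ← integral_neg, ← integral_indicator hΩ.measurableSet]
        congr 1
        funext y
        by_cases hy : y ∈ Ω
        · simp [v₀, hy, hψd]; ring
        · simp [v₀, hy]
      linarith
    have hψi : Integrable ψ := (hρi k).comp_sub_left x
    have hψ1 : ∫ y, ψ y = 1 := by rw [← hρ1 k]; exact integral_sub_left_eq_self (ρ k) volume x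
    rw [h3, ← Real.norm_eq_abs]
    calc ‖∫ y in Ω, weakPartial Ω i v y * ψ y‖ ≤ ∫ y in Ω, K i * ψ y := by
          refine norm_integral_le_of_norm_le (hψi.integrableOn.const_mul _) ?_
          filter_upwards [hK i] with y hy
          rw [norm_mul, Real.norm_eq_abs, Real.norm_of_nonneg (hρ0 k _)]
          exact mul_le_mul_of_nonneg_right hy (hρ0 k _)
      _ ≤ ∫ y, K i * ψ y := setIntegral_le_integral (hψi.const_mul _)
          (.of_forall fun y => mul_nonneg (hK0 i) (hρ0 k _))
      _ = K i := by rw [integral_const_mul, hψ1, mul_one]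
  have hlip : ∀ k, LipschitzWith (∑ i, K i).toNNReal (φ k) := by
    intro k
    refine lipschitzWith_of_nnnorm_fderiv_le (𝕜 := ℝ) (fun x => (hder k x).differentiableAt) fun x => ?_
    rw [(hder k x).fderiv, ← NNReal.coe_le_coe, coe_nnnorm,
      Real.coe_toNNReal _ (sum_nonneg fun i _ => hK0 i)]
    refine ContinuousLinearMap.opNorm_le_bound _ (sum_nonneg fun i _ => hK0 i) fun u => ?_
    conv_lhs => rw [← sum_smul_basisVec u]
    rw [map_sum, sum_mul]
    refine (norm_sum_le _ _).trans (sum_le_sum fun i _ => ?_)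
    rw [map_smul, norm_smul, mul_comm]
    exact mul_le_mul (hDi k x i) (PiLp.norm_apply_le u i) (norm_nonneg _) (hK0 i)
  have hlim : ∀ x, ContinuousAt v₀ x → Tendsto (fun k => φ k x) atTop (𝓝 (v₀ x)) := by
    intro x hx
    have hr : Tendsto (fun k => (bump n k).rOut) atTop (𝓝 0) := tendsto_one_div_add_atTop_nhds_zero_nat
    exact ContDiffBump.convolution_tendsto_right (φ := bump n) (g := fun _ => v₀) (k := fun _ => x) hr
      (.of_forall fun _ => hv₀i.aestronglyMeasurable) (hx.tendsto.comp tendsto_snd)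
      tendsto_const_nhds
  refine LipschitzOnWith.of_dist_le_mul fun x hx y hy => ?_
  exact le_of_tendsto ((hlim x hx).dist (hlim y hy)) (.of_forall fun k => (hlip k).dist_le_mul x y)

/-- Functions of `H¹₀` that are piecewise polynomial are Lipschitz. -/
theorem MemH10.exists_lipschitz_rep (hΩ : IsLipschitzDomain Ω) (hP : IsPartition Ω P) {v : E n → ℝ}
    (hv : MemH10 Ω v) (hp : IsPiecewisePoly P m v) :
    ∃ (w : E n → ℝ) (K : NNReal), LipschitzWith K w ∧ (∀ x ∉ Ω, w x = 0) ∧ IsSpline P m w ∧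
      ∀ τ ∈ P, EqOn v w τ.openHull := by
  choose K hK0 hK using fun i => hP.exists_weakPartial_bound hΩ hv.1 hp i
  have hL := hv.lipschitzOnWith_continuityPoints hΩ.isOpen hΩ.isBounded hK0 hK
  obtain ⟨w, hw, he⟩ := hL.extend_real
  have key : ∀ {U : Set (E n)} {g : E n → ℝ}, IsOpen U → Continuous g → EqOn (Ω.indicator v) g U →
      EqOn w g U := fun hU hg h x hx => by
    rw [← he (hg.continuousAt.congr (h.eventuallyEq_of_mem (hU.mem_nhds hx)).symm), h hx]
  have hin : ∀ τ ∈ P, EqOn v w τ.openHull := by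
    intro τ hτ
    obtain ⟨p, hpp, hpe⟩ := hp.exists_isPoly hτ
    exact hpe.trans (key isOpen_interior hpp.continuous fun y hy => by
      rw [indicator_of_mem (hP.openHull_subset hΩ hτ hy), hpe hy]).symm
  have hout := key (g := fun _ => 0) isClosed_closure.isOpen_compl continuous_const fun y hy =>
    indicator_of_notMem (fun h => hy (subset_closure h)) _
  refine ⟨w, _, hw, fun x hx => ?_, fun τ hτ => ?_, hin⟩
  · exact closure_minimal hout (isClosed_singleton.preimage hw.continuous) (hΩ.closure_subset_closure_compl hx)
  · obtain ⟨p, hpp, hpe⟩ := hp.exists_isPoly hτ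
    refine ⟨p, hpp, ?_⟩
    rw [← closure_openHull (hP.nondegenerate τ hτ)]
    exact EqOn.closure (fun x hx => (hin τ hτ hx).symm.trans (hpe hx)) hw.continuous
      hpp.continuous

/-- A piecewise polynomial function that is continuous in a Lipschitz domain extends continuously to
the boundary. -/
theorem IsPiecewisePoly.exists_spline (hΩ : IsLipschitzDomain Ω) (hP : IsPartition Ω P) {q : E n → ℝ}
    (hq : ContinuousOn q Ω) (hp : IsPiecewisePoly P m q) : ∃ g, IsSpline P m g ∧ EqOn g q Ω := by
  classical
  choose! π hπ hπe using fun τ => fun hτ : τ ∈ P => hp.exists_isPoly hτ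
  have hcont : ∀ τ ∈ P, Continuous (π τ) := fun τ hτ => (hπ τ hτ).continuous
  have hne : ∀ τ ∈ P, ∀ x ∈ τ.closed, (𝓝[τ.openHull] x).NeBot := fun τ hτ x hx =>
    mem_closure_iff_nhdsWithin_neBot.1 (closure_openHull (hP.nondegenerate τ hτ) ▸ hx)
  have h1 : ∀ τ ∈ P, ∀ x ∈ τ.closed, x ∈ Ω → q x = π τ x := by
    intro τ hτ x hx hxΩ
    have := hne τ hτ x hx
    have e1 : Tendsto q (𝓝[τ.openHull] x) (𝓝 (q x)) :=
      (hq.continuousAt (hΩ.isOpen.mem_nhds hxΩ)).tendsto.mono_left nhdsWithin_le_nhds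
    have e2 : Tendsto (π τ) (𝓝[τ.openHull] x) (𝓝 (π τ x)) :=
      ((hcont τ hτ).tendsto x).mono_left nhdsWithin_le_nhds
    refine tendsto_nhds_unique (e1.congr' ?_) e2
    filter_upwards [self_mem_nhdsWithin] with y hy using hπe τ hτ hy
  choose! K hK using fun τ => fun hτ : τ ∈ P =>
    LipOn.of_contDiff (hπ τ hτ).contDiff (isCompact_closed (τ := τ))
  set M := ∑ τ ∈ P, K τ
  have hseg : ∀ y z : E n, segment ℝ y z ⊆ Ω → dist (q y) (q z) ≤ M * dist y z := by
    intro y z hyz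
    have hcl : IsClosed (segment ℝ y z) := by
      rw [segment_eq_image_lineMap]
      exact (isCompact_Icc.image (by fun_prop)).isClosed
    refine dist_le_of_segment_subset (s := P) (D := fun τ => τ.closed ∩ segment ℝ y z)
      (fun τ _ => isClosed_closed.inter hcl) (fun τ hτ a ha b hb => ?_) fun a ha => ?_
    · rw [h1 τ hτ a ha.1 (hyz ha.2), h1 τ hτ b hb.1 (hyz hb.2)]
      exact ((hK τ hτ).weaken (single_le_sum (f := K) (fun _ _ => bot_le) hτ)) ha.1 hb.1
    · obtain ⟨τ, hτ, haτ⟩ := hP.exists_mem (subset_closure (hyz ha))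
      exact mem_biUnion hτ ⟨haτ, ha⟩
  obtain ⟨r, hr, L, hL, hpath⟩ := hΩ.exists_path
  have hdist : ∀ y ∈ Ω, ∀ z ∈ Ω, dist y z < r → dist (q y) (q z) ≤ M * (2 * L + 1) * dist y z := by
    intro y hy z hz hyz
    obtain ⟨v, hv, s1, s2, s3⟩ := hpath y hy z hz hyz
    have e1 := hseg _ _ s1
    have e2 := hseg _ _ s2
    have e3 := hseg _ _ s3
    rw [dist_self_add_right] at e1
    rw [dist_add_right] at e2
    rw [dist_self_add_left] at e3
    have hM : (0 : ℝ) ≤ M := M.2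
    have e4 := mul_le_mul_of_nonneg_left hv hM
    have e5 := dist_triangle4 (q y) (q (y + v)) (q (z + v)) (q z)
    linarith
  have h2 : ∀ τ ∈ P, ∀ σ ∈ P, ∀ x ∈ τ.closed, x ∈ σ.closed → π τ x = π σ x := by
    intro τ hτ σ hσ x hx hx'
    have := hne τ hτ x hx
    have := hne σ hσ x hx'
    rw [← dist_le_zero]
    have e1 : Tendsto (fun p : E n × E n => dist (π τ p.1) (π σ p.2))
        (𝓝[τ.openHull] x ×ˢ 𝓝[σ.openHull] x) (𝓝 (dist (π τ x) (π σ x))) :=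
      ((((hcont τ hτ).tendsto x).mono_left nhdsWithin_le_nhds).comp tendsto_fst).dist
        ((((hcont σ hσ).tendsto x).mono_left nhdsWithin_le_nhds).comp tendsto_snd)
    have e2 : Tendsto (fun p : E n × E n => dist p.1 p.2)
        (𝓝[τ.openHull] x ×ˢ 𝓝[σ.openHull] x) (𝓝 (dist x x)) :=
      ((tendsto_id.mono_left nhdsWithin_le_nhds).comp tendsto_fst).dist
        ((tendsto_id.mono_left nhdsWithin_le_nhds).comp tendsto_snd)
    rw [dist_self] at e2
    have e3 := e2.const_mul (M * (2 * L + 1))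
    rw [mul_zero] at e3
    refine le_of_tendsto_of_tendsto e1 e3 ?_
    filter_upwards [e2.eventually (gt_mem_nhds hr), prod_mem_prod self_mem_nhdsWithin
      self_mem_nhdsWithin] with p hp hp'
    rw [← hπe τ hτ hp'.1, ← hπe σ hσ hp'.2]
    exact hdist _ (hP.openHull_subset hΩ hτ hp'.1) _ (hP.openHull_subset hΩ hσ hp'.2) hp
  refine ⟨glue P π, fun τ hτ => ⟨π τ, hπ τ hτ, fun x hx => glue_eq h2 hτ hx⟩, fun x hx => ?_⟩
  obtain ⟨τ, hτ, hxτ⟩ := hP.exists_mem (subset_closure hx)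
  rw [glue_eq h2 hτ hxτ, h1 τ hτ x hxτ hx]

theorem IsSpline.exists_lipschitzWith {g : E n → ℝ} (h : IsSpline P m g) (hP : IsPartition Ω P)
    (hΩ : IsOpen Ω) (h0 : ∀ x ∉ Ω, g x = 0) : ∃ K, LipschitzWith K g :=
  hP.exists_lipschitzWith hΩ (fun _ hτ => h.lipOn hτ) h0

theorem IsSpline.continuousOn {g : E n → ℝ} (h : IsSpline P m g) (hP : IsPartition Ω P) :
    ContinuousOn g (closure Ω) := by
  have := (locallyFinite_of_finite fun τ : P => τ.1.closed).continuousOn_iUnion (g := g)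
    (fun _ => isClosed_closed) fun τ => by
      obtain ⟨K, hK⟩ := h.lipOn τ.2
      exact hK.continuousOn
  rwa [iUnion_subtype, ← hP.cover] at this

end Representatives

/-! ### Quasi-interpolation -/

section QuasiInterpolation

open TaggedSimplex

variable {n m : ℕ} {Ω : Set (E n)} {P S : Finset (TaggedSimplex n)} {τ σ : TaggedSimplex n} {κ : ℝ}

/-- Interpolation is stable, also modulo constants. -/
theorem exists_lagrangeInterp_bound (n : ℕ) (hm : m ≠ 0) :
    ∃ C : ℝ, 0 ≤ C ∧ ∀ (b : Simplex n) (c : E n → ℝ) (M : ℝ), ∀ x ∈ simplex b,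
      (lagrangeInterp b m c x - M) ^ 2 ≤ C * ∑ α ∈ multiIndex n m, (c (node b m α) - M) ^ 2 ∧
      ‖fderiv ℝ (lagrangeInterp b m c) x‖ ^ 2 ≤
        C * (∑ i, ‖baryGrad b i‖) ^ 2 * ∑ α ∈ multiIndex n m, (c (node b m α) - M) ^ 2 := by
  obtain ⟨A, hA0, hA⟩ := exists_lagrange_bound n m
  refine ⟨A ^ 2 * (multiIndex n m).card, by positivity, fun b c M x hx => ?_⟩
  have hfun : lagrangeInterp b m c =
      fun x => M + ∑ α ∈ multiIndex n m, (c (node b m α) - M) * lagrange m α (coords b x) := by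
    funext x
    have h1 := lagrange_reproduction b hm (IsPoly.const M m) x
    rw [lagrangeInterp]
    simp_rw [sub_mul, sum_sub_distrib]
    linarith
  have hsq : (∑ α ∈ multiIndex n m, |c (node b m α) - M|) ^ 2 ≤
      (multiIndex n m).card * ∑ α ∈ multiIndex n m, (c (node b m α) - M) ^ 2 := by
    have := sq_sum_le_card_mul_sum_sq (s := multiIndex n m) (f := fun α => |c (node b m α) - M|)
    simpa only [sq_abs] using this
  constructor
  · have h1 : |lagrangeInterp b m c x - M| ≤ A * ∑ α ∈ multiIndex n m, |c (node b m α) - M| := by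
      rw [hfun, add_sub_cancel_left, mul_sum]
      refine (Finset.abs_sum_le_sum_abs _ _).trans (sum_le_sum fun α hα => ?_)
      rw [abs_mul, mul_comm]
      exact mul_le_mul_of_nonneg_right (hA b α hα x hx).1 (abs_nonneg _)
    calc (lagrangeInterp b m c x - M) ^ 2 = |lagrangeInterp b m c x - M| ^ 2 := (sq_abs _).symm
      _ ≤ (A * ∑ α ∈ multiIndex n m, |c (node b m α) - M|) ^ 2 := pow_le_pow_left₀ (abs_nonneg _) h1 2
      _ = A ^ 2 * (∑ α ∈ multiIndex n m, |c (node b m α) - M|) ^ 2 := by ring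
      _ ≤ A ^ 2 * ((multiIndex n m).card * ∑ α ∈ multiIndex n m, (c (node b m α) - M) ^ 2) := by gcongr
      _ = _ := by ring
  · set B := ∑ i, ‖baryGrad b i‖
    have hB : 0 ≤ B := sum_nonneg fun i _ => norm_nonneg _
    have hd : ∀ α, DifferentiableAt ℝ (fun x => lagrange m α (coords b x)) x := fun α =>
      ((contDiff_lagrange (k := 1) α).comp (contDiff_coords b)).differentiable one_ne_zero x
    have h1 : ‖fderiv ℝ (lagrangeInterp b m c) x‖ ≤ A * B * ∑ α ∈ multiIndex n m, |c (node b m α) - M| := by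
      rw [hfun, fderiv_const_add, fderiv_fun_sum fun α _ => (hd α).const_mul _, mul_sum]
      refine (norm_sum_le _ _).trans (sum_le_sum fun α hα => ?_)
      rw [fderiv_const_mul (hd α), norm_smul, Real.norm_eq_abs, mul_comm]
      exact mul_le_mul_of_nonneg_right (hA b α hα x hx).2 (abs_nonneg _)
    calc ‖fderiv ℝ (lagrangeInterp b m c) x‖ ^ 2
        ≤ (A * B * ∑ α ∈ multiIndex n m, |c (node b m α) - M|) ^ 2 := pow_le_pow_left₀ (norm_nonneg _) h1 2
      _ = A ^ 2 * B ^ 2 * (∑ α ∈ multiIndex n m, |c (node b m α) - M|) ^ 2 := by ring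
      _ ≤ A ^ 2 * B ^ 2 * ((multiIndex n m).card * ∑ α ∈ multiIndex n m, (c (node b m α) - M) ^ 2) := by gcongr
      _ = _ := by ring

/-- Pointwise inverse estimates. -/
theorem exists_sq_le_integral (n : ℕ) (hm : m ≠ 0) :
    ∃ C : ℝ, 0 ≤ C ∧ ∀ (b : Simplex n) (p : E n → ℝ), IsPoly m p → ∀ x ∈ simplex b,
      volume.real (simplex b) * p x ^ 2 ≤ C * ∫ y in simplex b, p y ^ 2 ∧
      volume.real (simplex b) * ‖fderiv ℝ p x‖ ^ 2 ≤
        C * (∑ i, ‖baryGrad b i‖) ^ 2 * ∫ y in simplex b, p y ^ 2 := by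
  obtain ⟨A, hA0, hA⟩ := exists_lagrangeInterp_bound n hm
  obtain ⟨B, hB0, hB⟩ := exists_sum_sq_node_le n hm
  refine ⟨A * B, by positivity, fun b p hp x hx => ?_⟩
  have hfun : lagrangeInterp b m p = p := funext fun x => lagrangeInterp_eq_self b hm hp (fun _ _ => rfl) x
  obtain ⟨h1, h2⟩ := hA b p 0 x hx
  rw [hfun] at h1 h2
  simp only [sub_zero] at h1 h2
  have h3 := hB b p hp
  have hv := (volume_simplex_pos b).le
  constructor
  · calc volume.real (simplex b) * p x ^ 2
        ≤ volume.real (simplex b) * (A * ∑ α ∈ multiIndex n m, p (node b m α) ^ 2) := by gcongr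
      _ = A * ((∑ α ∈ multiIndex n m, p (node b m α) ^ 2) * volume.real (simplex b)) := by ring
      _ ≤ A * (B * ∫ y in simplex b, p y ^ 2) := by gcongr
      _ = _ := by ring
  · calc volume.real (simplex b) * ‖fderiv ℝ p x‖ ^ 2
        ≤ volume.real (simplex b) *
          (A * (∑ i, ‖baryGrad b i‖) ^ 2 * ∑ α ∈ multiIndex n m, p (node b m α) ^ 2) := by gcongr
      _ = A * (∑ i, ‖baryGrad b i‖) ^ 2 *
          ((∑ α ∈ multiIndex n m, p (node b m α) ^ 2) * volume.real (simplex b)) := by ring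
      _ ≤ A * (∑ i, ‖baryGrad b i‖) ^ 2 * (B * ∫ y in simplex b, p y ^ 2) := by gcongr
      _ = _ := by ring

open Classical in
/-- The simplices that share a vertex with `τ`. -/
def patch (P : Finset (TaggedSimplex n)) (τ : TaggedSimplex n) : Finset (TaggedSimplex n) :=
  P.filter fun σ => (range τ.vert ∩ range σ.vert).Nonempty

theorem mem_patch : σ ∈ patch P τ ↔ σ ∈ P ∧ (range τ.vert ∩ range σ.vert).Nonempty := by
  simp [patch]

theorem IsConforming.mem_patch (hc : IsConforming P) (hτ : τ ∈ P) (hσ : σ ∈ P) {x : E n}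
    (h1 : x ∈ τ.closed) (h2 : x ∈ σ.closed) : σ ∈ patch P τ := by
  have hx : x ∈ convexHull ℝ (range τ.vert ∩ range σ.vert) := hc τ hτ σ hσ ▸ ⟨h1, h2⟩
  exact Stokes.mem_patch.2 ⟨hσ, convexHull_nonempty_iff.1 ⟨x, hx⟩⟩

theorem IsMesh.card_patch_le (hn : n ≠ 0) (h : IsMesh Ω κ P) (τ : TaggedSimplex n) :
    ((patch P τ).card : ℝ) ≤ (n + 1) * (κ ^ n * volume.real (closedBall (0 : E n) 1)) := by
  classical
  have h1 : patch P τ ⊆ Finset.univ.biUnion fun j => P.filter fun σ => τ.vert j ∈ σ.closed := by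
    intro σ hσ
    obtain ⟨hσP, _, ⟨j, rfl⟩, hj⟩ := mem_patch.1 hσ
    exact Finset.mem_biUnion.2 ⟨j, Finset.mem_univ _, mem_filter.2 ⟨hσP, subset_convexHull ℝ _ hj⟩⟩
  calc ((patch P τ).card : ℝ) ≤ ∑ j, ((P.filter fun σ => τ.vert j ∈ σ.closed).card : ℝ) := by
        exact_mod_cast (Finset.card_le_card h1).trans Finset.card_biUnion_le
    _ ≤ ∑ _j : Fin (n + 1), κ ^ n * volume.real (closedBall (0 : E n) 1) :=
        sum_le_sum fun j _ => h.card_star_le hn _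
    _ = _ := by simp

theorem IsMesh.sum_patch_le (hn : n ≠ 0) (h : IsMesh Ω κ P) {F : TaggedSimplex n → ℝ} (hF : ∀ σ, 0 ≤ F σ) :
    ∑ τ ∈ P, ∑ σ ∈ patch P τ, F σ ≤
      (n + 1) * (κ ^ n * volume.real (closedBall (0 : E n) 1)) * ∑ σ ∈ P, F σ := by
  classical
  have h1 : ∑ τ ∈ P, ∑ σ ∈ patch P τ, F σ = ∑ σ ∈ P, ∑ τ ∈ patch P σ, F σ := by
    refine Finset.sum_comm' fun τ σ => ?_
    simp only [Stokes.mem_patch, inter_comm (range τ.vert)]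
    tauto
  rw [h1, mul_sum]
  refine sum_le_sum fun σ _ => ?_
  rw [sum_const, nsmul_eq_mul]
  exact mul_le_mul_of_nonneg_right (h.card_patch_le hn σ) (hF σ)

/-- The Dirichlet energy over the simplices that share a vertex with `τ`. -/
def patchEnergy (P : Finset (TaggedSimplex n)) (τ : TaggedSimplex n) (w : E n → ℝ) : ℝ :=
  ∑ σ ∈ patch P τ, ∫ y in σ.closed, ‖fderiv ℝ w y‖ ^ 2

theorem starEnergy_le_patchEnergy {x : E n} (hx : x ∈ range τ.vert) (w : E n → ℝ) :
    starEnergy P x w ≤ patchEnergy P τ w := by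
  classical
  refine Finset.sum_le_sum_of_subset_of_nonneg (fun σ hσ => ?_) fun _ _ _ => integral_sq_nonneg _
  obtain ⟨h1, h2⟩ := mem_filter.1 hσ
  exact mem_patch.2 ⟨h1, x, hx, h2⟩

open Classical in
/-- Nodal values of the quasi-interpolant of `w`: the value of `w` at the nodes of the simplices of
`S`, zero at the other nodes off `Ω`, and else the mean of `w` over some simplex at the node. -/
def quasiNodal (Ω : Set (E n)) (P S : Finset (TaggedSimplex n)) (w : E n → ℝ) (x : E n) : ℝ :=
  if ∃ T ∈ S, x ∈ T.closed then w x
  else if h : x ∈ Ω ∧ ∃ T ∈ P, x ∈ T.closed then meanOn h.2.choose.closed w else 0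

theorem quasiNodal_cases (Ω : Set (E n)) (hτ : τ ∈ P) (w : E n → ℝ) {x : E n} (hx : x ∈ τ.closed) :
    (∃ T ∈ S, x ∈ T.closed ∧ quasiNodal Ω P S w x = w x) ∨
      (x ∉ Ω ∧ quasiNodal Ω P S w x = 0) ∨
      ∃ T ∈ P, x ∈ T.closed ∧ quasiNodal Ω P S w x = meanOn T.closed w := by
  by_cases h1 : ∃ T ∈ S, x ∈ T.closed
  · obtain ⟨T, hT, hxT⟩ := h1
    exact Or.inl ⟨T, hT, hxT, if_pos ⟨T, hT, hxT⟩⟩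
  · by_cases h2 : x ∈ Ω
    · have h3 : x ∈ Ω ∧ ∃ T ∈ P, x ∈ T.closed := ⟨h2, τ, hτ, hx⟩
      refine Or.inr (Or.inr ⟨h3.2.choose, h3.2.choose_spec.1, h3.2.choose_spec.2, ?_⟩)
      rw [quasiNodal, if_neg h1, dif_pos h3]
    · refine Or.inr (Or.inl ⟨h2, ?_⟩)
      rw [quasiNodal, if_neg h1, dif_neg fun h => h2 h.1]

theorem IsConforming.interp_quasiNodal_eq (hc : IsConforming P) (hP : IsPartition Ω P) (hm : m ≠ 0)
    (hS : S ⊆ P) (Ω' : Set (E n)) {w : E n → ℝ} (hτ : τ ∈ S) (hw : ∃ p, IsPoly m p ∧ EqOn w p τ.closed) :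
    EqOn (interp P m (quasiNodal Ω' P S w)) w τ.closed := by
  intro x hx
  obtain ⟨p, hp, he⟩ := hw
  have ht := hP.nondegenerate τ (hS hτ)
  rw [hc.eqOn_interp hP hm _ (hS hτ) hx, he hx]
  refine lagrangeInterp_eq_self _ hm hp (fun α hα => ?_) x
  have hmem := node_mem_closed ht hm hα
  rw [← he hmem, quasiNodal, if_pos ⟨τ, hτ, hmem⟩]

theorem IsMesh.sum_norm_baryGrad_le (h : IsMesh Ω κ P) (hτ : τ ∈ P) :
    ∑ i, ‖baryGrad (τ.basis (h.nondegenerate τ hτ)) i‖ ≤ (n + 1) * κ / τ.size := by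
  calc _ ≤ ∑ _i : Fin (n + 1), κ / τ.size := sum_le_sum fun i _ => h.norm_baryGrad_le hτ i
    _ = _ := by simp; ring

/-- The nodal values of the quasi-interpolant differ from the local mean by local energies. -/
theorem exists_quasiNodal_sub_meanOn_le (hΩ : IsLipschitzDomain Ω) (hn : 1 < n) (hκ : 1 ≤ κ) (hm : m ≠ 0) :
    ∃ C, 0 ≤ C ∧ ∀ P, IsMesh Ω κ P → ∀ S ⊆ P, ∀ (w : E n → ℝ) (K : NNReal), LipschitzWith K w →
      (∀ x ∉ Ω, w x = 0) → (∀ τ ∈ S, ∃ p, IsPoly m p ∧ EqOn w p τ.closed) →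
      ∀ τ ∈ P, ∀ x ∈ τ.closed,
        τ.size ^ n * (quasiNodal Ω P S w x - meanOn τ.closed w) ^ 2 ≤
          C * τ.size ^ 2 * patchEnergy P τ w := by
  have : NeZero n := ⟨by omega⟩
  obtain ⟨M, hM1, hM⟩ := IsMesh.exists_size_le hΩ hn hκ
  obtain ⟨A, hA0, hA⟩ := IsMesh.exists_star_poincare hΩ hn hκ
  obtain ⟨B, hB0, hB⟩ := exists_sq_le_integral n hm
  set D := M ^ n * (B * (κ * M) ^ 2 * 2 ^ n)
  have hD0 : 0 ≤ D := by positivity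
  refine ⟨2 * (D + A), by positivity, fun P h S hS w K hw hw0 hpoly τ hτ x hx => ?_⟩
  have ht := h.nondegenerate τ hτ
  have hs := h.size_pos hτ
  have hG0 : 0 ≤ patchEnergy P τ w := sum_nonneg fun _ _ => integral_sq_nonneg _
  have hA' : A * τ.size ^ 2 * patchEnergy P τ w ≤ 2 * (D + A) * τ.size ^ 2 * patchEnergy P τ w := by
    gcongr; linarith
  -- the difference of two means
  have hmean : ∀ T ∈ P, x ∈ T.closed → τ.size ^ n * (meanOn τ.closed w - meanOn T.closed w) ^ 2 ≤
      A * τ.size ^ 2 * patchEnergy P τ w := by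
    intro T hT hxT
    obtain ⟨-, z, hz, hz'⟩ := Stokes.mem_patch.1 (h.conforming.mem_patch hτ hT hx hxT)
    refine (hA P h τ hτ T hT z hz hz' w K hw hw0).1.trans ?_
    gcongr
    exact starEnergy_le_patchEnergy hz w
  rcases quasiNodal_cases (S := S) Ω hτ w hx with ⟨T, hT, hxT, he⟩ | ⟨hxΩ, he⟩ | ⟨T, hT, hxT, he⟩
  · rw [he]
    have hTP := hS hT
    obtain ⟨-, z, hz, hz'⟩ := Stokes.mem_patch.1 (h.conforming.mem_patch hτ hTP hx hxT)
    have hsT := h.size_pos hTP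
    have h1 : τ.size ≤ M * T.size := hM P h hTP hτ hz' hz
    have h2 : T.size ≤ M * τ.size := hM P h hτ hTP hz hz'
    obtain ⟨p, hp, hpe⟩ := hpoly T hT
    have hTn := h.nondegenerate T hTP
    have h3 := (hB (T.basis hTn) _ (hp.sub (IsPoly.const (meanOn T.closed w) m)) x
      (T.simplex_basis hTn ▸ hxT)).1
    rw [T.simplex_basis, ← IsMesh.size_pow (by omega)] at h3
    have h4 : ∫ y in T.closed, (p y - meanOn T.closed w) ^ 2 = ∫ y in T.closed, (w y - meanOn T.closed w) ^ 2 :=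
      setIntegral_congr_fun isClosed_closed.measurableSet fun y hy => by
        simp only [hpe hy]
    have h5 : ∫ y in T.closed, (w y - meanOn T.closed w) ^ 2 ≤ (κ * T.size) ^ 2 * 2 ^ n * patchEnergy P τ w := by
      refine (h.poincare_le hTP hw).trans ?_
      gcongr
      exact (le_starEnergy hTP hz' w).trans (starEnergy_le_patchEnergy hz w)
    have h6 : τ.size ^ n * (w x - meanOn T.closed w) ^ 2 ≤ D * τ.size ^ 2 * patchEnergy P τ w := by
      calc τ.size ^ n * (w x - meanOn T.closed w) ^ 2
          ≤ (M * T.size) ^ n * (w x - meanOn T.closed w) ^ 2 := by gcongr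
        _ = M ^ n * (T.size ^ n * (p x - meanOn T.closed w) ^ 2) := by rw [hpe hxT]; ring
        _ ≤ M ^ n * (B * ((κ * T.size) ^ 2 * 2 ^ n * patchEnergy P τ w)) := by
          refine mul_le_mul_of_nonneg_left (h3.trans ?_) (by positivity)
          rw [h4]
          exact mul_le_mul_of_nonneg_left h5 hB0
        _ ≤ M ^ n * (B * ((κ * (M * τ.size)) ^ 2 * 2 ^ n * patchEnergy P τ w)) := by gcongr
        _ = _ := by ring
    have h7 := hmean T hTP hxT
    have h8 : (w x - meanOn τ.closed w) ^ 2 ≤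
        2 * (w x - meanOn T.closed w) ^ 2 + 2 * (meanOn τ.closed w - meanOn T.closed w) ^ 2 := by
      nlinarith [sq_nonneg (w x - meanOn T.closed w + (meanOn τ.closed w - meanOn T.closed w))]
    calc τ.size ^ n * (w x - meanOn τ.closed w) ^ 2
        ≤ τ.size ^ n * (2 * (w x - meanOn T.closed w) ^ 2 +
            2 * (meanOn τ.closed w - meanOn T.closed w) ^ 2) := by gcongr
      _ = 2 * (τ.size ^ n * (w x - meanOn T.closed w) ^ 2) +
            2 * (τ.size ^ n * (meanOn τ.closed w - meanOn T.closed w) ^ 2) := by ring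
      _ ≤ 2 * (D * τ.size ^ 2 * patchEnergy P τ w) + 2 * (A * τ.size ^ 2 * patchEnergy P τ w) := by
        linarith
      _ = _ := by ring
  · -- the vertices of the carrier of a node off `Ω` are off `Ω` too
    obtain ⟨i, hi⟩ : ∃ i, 0 < τ.bary (τ.vert i) x := by
      by_contra! hcon
      have := sum_bary ht x
      have h2 : ∑ i, τ.bary (τ.vert i) x ≤ 0 := Finset.sum_nonpos fun i _ => hcon i
      linarith
    have hz : τ.vert i ∉ Ω := by
      intro hzΩ
      refine hxΩ (h.conforming.mem_of_face h.toIsPartition hΩ hτ (vert_mem_closed i) hx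
        (fun z hz => ?_) hzΩ)
      rw [bary_apply_vertex ht z (mem_range_self i)] at hz
      split_ifs at hz with hzi
      · rwa [hzi]
      · exact absurd hz (lt_irrefl _)
    rw [he, zero_sub, neg_sq]
    refine (((hA P h τ hτ τ hτ _ (mem_range_self i) (mem_range_self i) w K hw hw0).2 hz).trans ?_).trans hA'
    gcongr
    exact starEnergy_le_patchEnergy (mem_range_self i) w
  · rw [he, ← neg_sub, neg_sq]
    exact (hmean T hT hxT).trans hA'

/-- The quasi-interpolant of a velocity component. -/
theorem exists_velocity_quasiInterp (hΩ : IsLipschitzDomain Ω) (hn : 1 < n) (hκ : 1 ≤ κ) (hm : m ≠ 0) :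
    ∃ C, 0 ≤ C ∧ ∀ P, IsMesh Ω κ P → ∀ S ⊆ P, ∀ (w : E n → ℝ) (K : NNReal), LipschitzWith K w →
      (∀ x ∉ Ω, w x = 0) → (∀ τ ∈ S, ∃ p, IsPoly m p ∧ EqOn w p τ.closed) →
      ∃ g, IsSpline P m g ∧ (∀ x ∉ Ω, g x = 0) ∧ (∀ τ ∈ S, EqOn g w τ.closed) ∧
        ∑ τ ∈ P, ((τ.size ^ 2)⁻¹ * (∫ x in τ.closed, (w x - g x) ^ 2) +
          ∫ x in τ.closed, ‖fderiv ℝ (fun x => w x - g x) x‖ ^ 2) ≤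
        C * ∑ τ ∈ P, ∫ x in τ.closed, ‖fderiv ℝ w x‖ ^ 2 := by
  have : NeZero n := ⟨by omega⟩
  obtain ⟨A, hA0, hA⟩ := exists_quasiNodal_sub_meanOn_le hΩ hn hκ hm
  obtain ⟨B, hB0, hB⟩ := exists_lagrangeInterp_bound n hm
  set R := ((multiIndex n m).card : ℝ) * A
  have hR0 : 0 ≤ R := by positivity
  set L := (n + 1) * (κ ^ n * volume.real (closedBall (0 : E n) 1))
  have hL0 : 0 ≤ L := by positivity
  set C₁ := 2 * (κ ^ 2 * 2 ^ n) + 2 * (B * R)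
  set C₂ := 2 + 2 * (B * ((n + 1) * κ) ^ 2 * R)
  have hC₁ : 0 ≤ C₁ := by positivity
  have hC₂ : 0 ≤ C₂ := by positivity
  refine ⟨(C₁ + C₂) * L, by positivity, fun P h S hS w K hw hw0 hpoly => ?_⟩
  have hc := h.conforming
  set c := quasiNodal Ω P S w
  have hc0 : ∀ x ∉ Ω, c x = 0 := by
    intro x hx
    simp only [c, quasiNodal]
    split_ifs with h1 h2
    · exact hw0 x hx
    · exact absurd h2.1 hx
    · rfl
  refine ⟨interp P m c, hc.isSpline_interp h.toIsPartition hm c, fun x hx =>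
    hc.interp_eq_zero h.toIsPartition hΩ hm hc0 hx, fun τ hτ =>
    hc.interp_quasiNodal_eq h.toIsPartition hm hS Ω hτ (hpoly τ hτ), ?_⟩
  have hlocal : ∀ τ ∈ P, (τ.size ^ 2)⁻¹ * (∫ x in τ.closed, (w x - interp P m c x) ^ 2) +
      (∫ x in τ.closed, ‖fderiv ℝ (fun x => w x - interp P m c x) x‖ ^ 2) ≤
      (C₁ + C₂) * patchEnergy P τ w := by
    intro τ hτ
    have ht := h.nondegenerate τ hτ
    have hs := h.size_pos hτ
    have hcl := isCompact_closed (τ := τ)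
    have hms := hcl.measurableSet
    set G := patchEnergy P τ w
    set M := meanOn τ.closed w
    set b := τ.basis ht with hb
    have hbs : simplex b = τ.closed := τ.simplex_basis ht
    set q := lagrangeInterp b m c
    have hqp : IsPoly m q := isPoly_lagrangeInterp b c
    have hgq : EqOn (interp P m c) q τ.closed := hc.eqOn_interp h.toIsPartition hm c hτ
    have hvol : volume.real τ.closed = τ.size ^ n := (IsMesh.size_pow (by omega) τ).symm
    set Y := ∑ α ∈ multiIndex n m, (c (node b m α) - M) ^ 2
    have hY : τ.size ^ n * Y ≤ R * τ.size ^ 2 * G := by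
      calc τ.size ^ n * Y = ∑ α ∈ multiIndex n m, τ.size ^ n * (c (node b m α) - M) ^ 2 := mul_sum ..
        _ ≤ ∑ _α ∈ multiIndex n m, A * τ.size ^ 2 * G := sum_le_sum fun α hα =>
            hA P h S hS w K hw hw0 hpoly τ hτ _ (node_mem_closed ht hm hα)
        _ = _ := by rw [sum_const, nsmul_eq_mul]; ring
    have hEτ : ∫ x in τ.closed, ‖fderiv ℝ w x‖ ^ 2 ≤ G :=
      (le_starEnergy hτ (mem_range_self 0) w).trans (starEnergy_le_patchEnergy (mem_range_self 0) w)
    have hqc : Continuous q := hqp.continuous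
    have hint : ∀ f : E n → ℝ, Continuous f → IntegrableOn f τ.closed := fun f hf =>
      hf.continuousOn.integrableOn_compact hcl
    have hwc := hw.continuous
    have h1 : ∫ x in τ.closed, (w x - interp P m c x) ^ 2 ≤ C₁ * τ.size ^ 2 * G := by
      have e1 : ∫ x in τ.closed, (w x - M) ^ 2 ≤ (κ * τ.size) ^ 2 * 2 ^ n * G := by
        refine (h.poincare_le hτ hw).trans ?_
        gcongr
      calc ∫ x in τ.closed, (w x - interp P m c x) ^ 2
          ≤ ∫ x in τ.closed, (2 * (w x - M) ^ 2 + 2 * (B * Y)) := by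
            have e : ∫ x in τ.closed, (w x - interp P m c x) ^ 2 = ∫ x in τ.closed, (w x - q x) ^ 2 :=
              setIntegral_congr_fun hms fun x hx => by simp only [hgq hx]
            rw [e]
            refine setIntegral_mono_on (hint _ (by fun_prop)) (hint _ (by fun_prop)) hms fun x hx => ?_
            have := (hB b c M x (hbs ▸ hx)).1
            have e : (w x - q x) ^ 2 ≤ 2 * (w x - M) ^ 2 + 2 * (q x - M) ^ 2 := by
              nlinarith [sq_nonneg (w x - M + (q x - M))]
            linarith
        _ = 2 * (∫ x in τ.closed, (w x - M) ^ 2) + 2 * B * (τ.size ^ n * Y) := by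
            rw [integral_add (hint _ (by fun_prop)) (hint _ (by fun_prop)), integral_const_mul,
              setIntegral_const, hvol, smul_eq_mul]
            ring
        _ ≤ 2 * ((κ * τ.size) ^ 2 * 2 ^ n * G) + 2 * B * (R * τ.size ^ 2 * G) := by gcongr
        _ = _ := by ring
    have h2 : ∫ x in τ.closed, ‖fderiv ℝ (fun x => w x - interp P m c x) x‖ ^ 2 ≤ C₂ * G := by
      have hbd := h.sum_norm_baryGrad_le hτ
      have hY0 : 0 ≤ Y := sum_nonneg fun _ _ => sq_nonneg _
      have hwi : IntegrableOn (fun x => ‖fderiv ℝ w x‖ ^ 2) τ.closed :=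
        (memLp_fderiv hw hcl.measure_lt_top.ne).norm.integrable_sq
      have hdiff : ∀ᵐ x ∂volume.restrict τ.closed, ‖fderiv ℝ (fun x => w x - interp P m c x) x‖ ^ 2 ≤
          2 * ‖fderiv ℝ w x‖ ^ 2 + 2 * (B * ((n + 1) * κ / τ.size) ^ 2 * Y) := by
        have hin := ae_simplex_mem_interior b
        rw [hbs] at hin
        filter_upwards [hin, ae_restrict_of_ae hw.ae_differentiableAt] with x hx hdx
        have hxc : x ∈ τ.closed := interior_subset hx
        have e1 : fderiv ℝ (fun x => w x - interp P m c x) x = fderiv ℝ (fun x => w x - q x) x :=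
          fderiv_congr_interior (fun y hy => by simp only [hgq hy]) hx
        rw [e1, fderiv_fun_sub hdx ((hqp.contDiff (k := 1)).differentiable one_ne_zero x)]
        have e2 : ‖fderiv ℝ q x‖ ^ 2 ≤ B * ((n + 1) * κ / τ.size) ^ 2 * Y := by
          refine ((hB b c M x (hbs ▸ hxc)).2).trans ?_
          have : 0 ≤ ∑ i, ‖baryGrad b i‖ := sum_nonneg fun i _ => norm_nonneg _
          gcongr
        have e3 : ‖fderiv ℝ w x - fderiv ℝ q x‖ ^ 2 ≤ (‖fderiv ℝ w x‖ + ‖fderiv ℝ q x‖) ^ 2 :=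
          pow_le_pow_left₀ (norm_nonneg _) (norm_sub_le _ _) 2
        nlinarith [sq_nonneg (‖fderiv ℝ w x‖ - ‖fderiv ℝ q x‖)]
      calc ∫ x in τ.closed, ‖fderiv ℝ (fun x => w x - interp P m c x) x‖ ^ 2
          ≤ ∫ x in τ.closed, (2 * ‖fderiv ℝ w x‖ ^ 2 + 2 * (B * ((n + 1) * κ / τ.size) ^ 2 * Y)) :=
            integral_mono_of_nonneg (.of_forall fun x => sq_nonneg _)
              ((hwi.const_mul 2).add (integrable_const _)) hdiff
        _ = 2 * (∫ x in τ.closed, ‖fderiv ℝ w x‖ ^ 2) +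
            2 * (B * ((n + 1) * κ / τ.size) ^ 2) * (τ.size ^ n * Y) := by
            rw [integral_add (hwi.const_mul 2) (integrable_const _), integral_const_mul,
              setIntegral_const, hvol, smul_eq_mul]
            ring
        _ ≤ 2 * G + 2 * (B * ((n + 1) * κ / τ.size) ^ 2) * (R * τ.size ^ 2 * G) := by gcongr
        _ = _ := by
            simp only [C₂]
            field_simp
    calc _ ≤ (τ.size ^ 2)⁻¹ * (C₁ * τ.size ^ 2 * G) + C₂ * G := by gcongr
      _ = _ := by field_simp
  calc _ ≤ ∑ τ ∈ P, (C₁ + C₂) * patchEnergy P τ w := sum_le_sum hlocal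
    _ = (C₁ + C₂) * ∑ τ ∈ P, patchEnergy P τ w := by rw [mul_sum]
    _ ≤ (C₁ + C₂) * (L * ∑ τ ∈ P, ∫ x in τ.closed, ‖fderiv ℝ w x‖ ^ 2) := by
        refine mul_le_mul_of_nonneg_left ?_ (by positivity)
        exact h.sum_patch_le (by omega) (F := fun σ => ∫ x in σ.closed, ‖fderiv ℝ w x‖ ^ 2)
          fun σ => integral_sq_nonneg _
    _ = _ := by ring

/-- The quasi-interpolant of a pressure is stable in `L²`. -/
theorem exists_pressure_quasiInterp (hΩ : IsLipschitzDomain Ω) (hn : 1 < n) (hκ : 1 ≤ κ) (hm : m ≠ 0) :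
    ∃ C, 0 ≤ C ∧ ∀ P, IsMesh Ω κ P → ∀ S ⊆ P, ∀ w : E n → ℝ, ContinuousOn w (closure Ω) →
      (∀ τ ∈ S, ∃ p, IsPoly m p ∧ EqOn w p τ.closed) →
      ∃ g, IsSpline P m g ∧ (∀ τ ∈ S, EqOn g w τ.closed) ∧
        ∑ τ ∈ P, ∫ x in τ.closed, g x ^ 2 ≤ C * ∑ τ ∈ P, ∫ x in τ.closed, w x ^ 2 := by
  have : NeZero n := ⟨by omega⟩
  obtain ⟨M, hM1, hM⟩ := IsMesh.exists_size_le hΩ hn hκ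
  obtain ⟨A, hA0, hA⟩ := exists_sq_le_integral n hm
  obtain ⟨B, hB0, hB⟩ := exists_lagrangeInterp_bound n hm
  set L := (n + 1) * (κ ^ n * volume.real (closedBall (0 : E n) 1))
  have hL0 : 0 ≤ L := by positivity
  set D := M ^ n * (A + 1)
  have hD0 : 0 ≤ D := by positivity
  refine ⟨B * ((multiIndex n m).card * D) * L, by positivity, fun P h S hS w hw hpoly => ?_⟩
  have hc := h.conforming
  set c := quasiNodal univ P S w
  refine ⟨interp P m c, hc.isSpline_interp h.toIsPartition hm c, fun τ hτ =>
    hc.interp_quasiNodal_eq h.toIsPartition hm hS univ hτ (hpoly τ hτ), ?_⟩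
  have hnode : ∀ τ ∈ P, ∀ x ∈ τ.closed, τ.size ^ n * c x ^ 2 ≤ D * ∑ σ ∈ patch P τ, ∫ y in σ.closed, w y ^ 2 := by
    intro τ hτ x hx
    have hs := h.size_pos hτ
    -- it is enough to bound the value by the norm over one neighbour
    have key : ∀ T ∈ P, x ∈ T.closed → T.size ^ n * c x ^ 2 ≤ (A + 1) * ∫ y in T.closed, w y ^ 2 →
        τ.size ^ n * c x ^ 2 ≤ D * ∑ σ ∈ patch P τ, ∫ y in σ.closed, w y ^ 2 := by
      intro T hT hxT hle
      have hTp := hc.mem_patch hτ hT hx hxT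
      obtain ⟨-, z, hz, hz'⟩ := Stokes.mem_patch.1 hTp
      have hsT := h.size_pos hT
      have h1 : τ.size ≤ M * T.size := hM P h hT hτ hz' hz
      calc τ.size ^ n * c x ^ 2 ≤ (M * T.size) ^ n * c x ^ 2 := by gcongr
        _ = M ^ n * (T.size ^ n * c x ^ 2) := by ring
        _ ≤ M ^ n * ((A + 1) * ∫ y in T.closed, w y ^ 2) := by gcongr
        _ = D * ∫ y in T.closed, w y ^ 2 := by ring
        _ ≤ _ := mul_le_mul_of_nonneg_left (single_le_sum
            (f := fun σ : TaggedSimplex n => ∫ y in σ.closed, w y ^ 2)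
            (fun _ _ => integral_sq_nonneg _) hTp) hD0
    rcases quasiNodal_cases (S := S) univ hτ w hx with ⟨T, hT, hxT, he⟩ | ⟨hx', -⟩ | ⟨T, hT, hxT, he⟩
    · refine key T (hS hT) hxT ?_
      obtain ⟨p, hp, hpe⟩ := hpoly T hT
      have hTn := h.nondegenerate T (hS hT)
      have h3 := (hA (T.basis hTn) p hp x (T.simplex_basis hTn ▸ hxT)).1
      rw [T.simplex_basis, ← IsMesh.size_pow (by omega)] at h3
      have h4 : ∫ y in T.closed, p y ^ 2 = ∫ y in T.closed, w y ^ 2 :=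
        setIntegral_congr_fun isClosed_closed.measurableSet fun y hy => by
          simp only [hpe hy]
      have h5 : 0 ≤ ∫ y in T.closed, w y ^ 2 := integral_sq_nonneg _
      simp only [c]
      rw [he, hpe hxT, ← h4] at *
      linarith
    · exact absurd (mem_univ x) hx'
    · refine key T hT hxT ?_
      have hTn := h.nondegenerate T hT
      have hcl := isCompact_closed (τ := T)
      have hv : 0 < volume.real T.closed := T.simplex_basis hTn ▸ volume_simplex_pos (T.basis hTn)
      have h3 := sq_integral_le (μ := volume.restrict T.closed)
        (continuousOn_memLp hcl (hw.mono (h.closed_subset hT)))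
      rw [measureReal_restrict_apply MeasurableSet.univ, univ_inter] at h3
      have h5 : 0 ≤ ∫ y in T.closed, w y ^ 2 := integral_sq_nonneg _
      simp only [c]
      rw [he, IsMesh.size_pow (by omega), meanOn]
      calc volume.real T.closed * ((volume.real T.closed)⁻¹ * ∫ y in T.closed, w y) ^ 2
          = (volume.real T.closed)⁻¹ * (∫ y in T.closed, w y) ^ 2 := by field_simp
        _ ≤ (volume.real T.closed)⁻¹ * (volume.real T.closed * ∫ y in T.closed, w y ^ 2) := by gcongr
        _ = ∫ y in T.closed, w y ^ 2 := by field_simp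
        _ ≤ _ := by nlinarith
  have hlocal : ∀ τ ∈ P, ∫ x in τ.closed, interp P m c x ^ 2 ≤
      B * ((multiIndex n m).card * D) * ∑ σ ∈ patch P τ, ∫ y in σ.closed, w y ^ 2 := by
    intro τ hτ
    have ht := h.nondegenerate τ hτ
    have hcl := isCompact_closed (τ := τ)
    set b := τ.basis ht with hb
    have hbs : simplex b = τ.closed := τ.simplex_basis ht
    have hgq : EqOn (interp P m c) (lagrangeInterp b m c) τ.closed := hc.eqOn_interp h.toIsPartition hm c hτ
    have hqc : Continuous (lagrangeInterp b m c) := (isPoly_lagrangeInterp b c).continuous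
    calc ∫ x in τ.closed, interp P m c x ^ 2
        ≤ ∫ _x in τ.closed, B * ∑ α ∈ multiIndex n m, c (node b m α) ^ 2 := by
          have e : ∫ x in τ.closed, interp P m c x ^ 2 = ∫ x in τ.closed, lagrangeInterp b m c x ^ 2 :=
            setIntegral_congr_fun hcl.measurableSet fun x hx => by simp only [hgq hx]
          rw [e]
          refine setIntegral_mono_on ((hqc.pow 2).continuousOn.integrableOn_compact hcl)
            (continuousOn_const.integrableOn_compact hcl) hcl.measurableSet fun x hx => ?_
          simpa using (hB b c 0 x (hbs ▸ hx)).1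
      _ = B * ∑ α ∈ multiIndex n m, τ.size ^ n * c (node b m α) ^ 2 := by
          rw [setIntegral_const, smul_eq_mul, ← IsMesh.size_pow (by omega), ← mul_sum]
          ring
      _ ≤ B * ∑ _α ∈ multiIndex n m, D * ∑ σ ∈ patch P τ, ∫ y in σ.closed, w y ^ 2 := by
          refine mul_le_mul_of_nonneg_left (sum_le_sum fun α hα => ?_) hB0
          exact hnode τ hτ _ (node_mem_closed ht hm hα)
      _ = _ := by rw [sum_const, nsmul_eq_mul]; ring
  calc _ ≤ ∑ τ ∈ P, B * ((multiIndex n m).card * D) * ∑ σ ∈ patch P τ, ∫ y in σ.closed, w y ^ 2 :=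
        sum_le_sum hlocal
    _ = B * ((multiIndex n m).card * D) * ∑ τ ∈ P, ∑ σ ∈ patch P τ, ∫ y in σ.closed, w y ^ 2 := by
        rw [mul_sum]
    _ ≤ B * ((multiIndex n m).card * D) * (L * ∑ τ ∈ P, ∫ x in τ.closed, w x ^ 2) := by
        refine mul_le_mul_of_nonneg_left ?_ (by positivity)
        exact h.sum_patch_le (by omega) (F := fun σ => ∫ x in σ.closed, w x ^ 2)
          fun σ => integral_sq_nonneg _
    _ = _ := by ring

end QuasiInterpolation

/-! ### Derivatives of polynomials -/

section Derivatives

variable {n m : ℕ}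

theorem fderiv_eval_basisVec (r : MvPolynomial (Fin n) ℝ) (i : Fin n) (x : E n) :
    fderiv ℝ (fun x : E n => MvPolynomial.eval (fun i => x i) r) x (basisVec i) =
      MvPolynomial.eval (fun i => x i) (MvPolynomial.pderiv i r) := by
  have hd : ∀ r : MvPolynomial (Fin n) ℝ,
      DifferentiableAt ℝ (fun x : E n => MvPolynomial.eval (fun i => x i) r) x := fun r =>
    (IsPoly.contDiff (m := r.totalDegree) (k := 1) ⟨r, le_rfl, fun _ => rfl⟩).differentiable
      one_ne_zero x
  induction r using MvPolynomial.induction_on with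
  | C a => simp
  | add p q hp hq =>
    simp only [map_add] at *
    rw [fderiv_fun_add (hd p) (hd q), _root_.add_apply, hp, hq]
  | mul_X p j hp =>
    have hX : HasFDerivAt (fun x : E n => x j) (EuclideanSpace.proj (𝕜 := ℝ) j) x :=
      (EuclideanSpace.proj (𝕜 := ℝ) j).hasFDerivAt
    simp only [map_mul, MvPolynomial.eval_X]
    rw [fderiv_fun_mul (hd p) hX.differentiableAt, hX.fderiv, Derivation.leibniz, MvPolynomial.pderiv_X]
    simp only [_root_.add_apply, _root_.smul_apply, hp, smul_eq_mul, map_add, map_mul,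
      MvPolynomial.eval_X]
    rcases eq_or_ne i j with rfl | hij
    · simp [basisVec]
    · simp [basisVec, hij.symm]

theorem totalDegree_pderiv_le (r : MvPolynomial (Fin n) ℝ) (i : Fin n) :
    (MvPolynomial.pderiv i r).totalDegree ≤ r.totalDegree - 1 := by
  conv_lhs => rw [r.as_sum, map_sum]
  refine MvPolynomial.totalDegree_finsetSum_le fun s hs => ?_
  rw [MvPolynomial.pderiv_monomial]
  by_cases h0 : s i = 0
  · simp [h0]
  · refine (MvPolynomial.totalDegree_monomial_le _ _).trans ?_
    have h1 := MvPolynomial.le_totalDegree hs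
    have h2 : Finsupp.single i 1 ≤ s := by
      rw [Finsupp.single_le_iff]; omega
    have h3 : s.sum (fun _ e => e) = (s - Finsupp.single i 1).sum (fun _ => id) + 1 := by
      conv_lhs => rw [← tsub_add_cancel_of_le h2, Finsupp.sum_add_index' (fun _ => rfl) fun _ _ _ => rfl,
        Finsupp.sum_single_index rfl]
      rfl
    omega

theorem IsPoly.partialDeriv {p : E n → ℝ} (hp : IsPoly m p) (i : Fin n) :
    IsPoly (m - 1) (Stokes.partialDeriv i p) := by
  obtain ⟨r, h1, h2⟩ := hp
  refine ⟨MvPolynomial.pderiv i r, (totalDegree_pderiv_le r i).trans (Nat.sub_le_sub_right h1 1), fun x => ?_⟩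
  rw [Stokes.partialDeriv, funext h2, fderiv_eval_basisVec]

end Derivatives

/-! ### The discrete problem in terms of continuous representatives -/

section Fields

variable {n d m : ℕ} {Ω : Set (E n)} {P : Finset (TaggedSimplex n)} {τ : TaggedSimplex n}

/-- Lipschitz vector fields, given by their components, that vanish off `Ω`. -/
structure IsField (Ω : Set (E n)) (z : Fin n → E n → ℝ) : Prop where
  lip : ∀ k, ∃ K, LipschitzWith K (z k)
  zero : ∀ k, ∀ x ∉ Ω, z k x = 0

/-- `∫_Ω ∑ ∂ᵢ wₖ ∂ᵢ zₖ` with classical derivatives. -/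
def dirichlet (Ω : Set (E n)) (w z : Fin n → E n → ℝ) : ℝ :=
  ∫ x in Ω, ∑ i, ∑ k, partialDeriv i (w k) x * partialDeriv i (z k) x

/-- `∫_Ω q ∑ ∂ᵢ zᵢ` with classical derivatives. -/
def divForm (Ω : Set (E n)) (z : Fin n → E n → ℝ) (q : E n → ℝ) : ℝ :=
  ∫ x in Ω, q x * ∑ i, partialDeriv i (z i) x

/-- The Dirichlet energy of a field. -/
def energy (Ω : Set (E n)) (z : Fin n → E n → ℝ) : ℝ := ∑ k, ∫ x in Ω, ‖fderiv ℝ (z k) x‖ ^ 2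

theorem energy_nonneg (Ω : Set (E n)) (z : Fin n → E n → ℝ) : 0 ≤ energy Ω z :=
  sum_nonneg fun _ _ => integral_sq_nonneg _

theorem IsPartition.ae_eq_of_eqOn (hP : IsPartition Ω P) (hΩ : IsOpen Ω) {v w : E n → ℝ}
    (h : ∀ τ ∈ P, EqOn v w τ.openHull) : v =ᵐ[volume.restrict Ω] w := by
  filter_upwards [hP.ae_mem_openHull hΩ] with x ⟨τ, hτ, hx⟩ using h τ hτ hx

theorem VP.exists_field (hΩ : IsLipschitzDomain Ω) (hP : IsPartition Ω P) {u : E n → E n}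
    (hu : u ∈ VP Ω P d) : ∃ w, IsField Ω w ∧ (∀ k, IsSpline P d (w k)) ∧
      ∀ k, ∀ τ ∈ P, EqOn (fun x => u x k) (w k) τ.openHull := by
  choose w K hw h0 hs he using fun k => (hu.1 k).exists_lipschitz_rep hΩ hP (hu.2 k)
  exact ⟨w, ⟨fun k => ⟨K k, hw k⟩, h0⟩, hs, he⟩

theorem IsField.mem_VP (hΩ : IsLipschitzDomain Ω) {z : Fin n → E n → ℝ} (hz : IsField Ω z)
    (hs : ∀ k, IsSpline P d (z k)) : (fun x => WithLp.toLp 2 fun k => z k x) ∈ VP Ω P d :=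
  ⟨fun k => by
    obtain ⟨K, hK⟩ := hz.lip k
    exact hK.memH10 hΩ.isOpen hΩ.isBounded (hz.zero k), fun k => (hs k).isPiecewisePoly⟩

theorem IsField.ae_weakPartial_eq (hΩ : IsOpen Ω) {v : E n → E n} {z : Fin n → E n → ℝ} (hz : IsField Ω z)
    (hv : ∀ k, (fun x => v x k) =ᵐ[volume.restrict Ω] z k) : ∀ᵐ x ∂volume.restrict Ω,
      ∀ i k, weakPartial Ω i (fun x => v x k) x = partialDeriv i (z k) x := by
  rw [ae_all_iff]; intro i
  rw [ae_all_iff]; intro k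
  obtain ⟨K, hK⟩ := hz.lip k
  exact weakPartial_ae_eq_fderiv hΩ hK (hv k) i

theorem a_eq_dirichlet (hΩ : IsOpen Ω) {u v : E n → E n} {w z : Fin n → E n → ℝ} (hw : IsField Ω w)
    (hz : IsField Ω z) (hu : ∀ k, (fun x => u x k) =ᵐ[volume.restrict Ω] w k)
    (hv : ∀ k, (fun x => v x k) =ᵐ[volume.restrict Ω] z k) : a Ω u v = dirichlet Ω w z := by
  refine integral_congr_ae ?_
  filter_upwards [hw.ae_weakPartial_eq hΩ hu, hz.ae_weakPartial_eq hΩ hv] with x h1 h2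
  simp only [h1, h2]

theorem b_eq_divForm (hΩ : IsOpen Ω) {v : E n → E n} {z : Fin n → E n → ℝ} {q g : E n → ℝ}
    (hz : IsField Ω z) (hv : ∀ k, (fun x => v x k) =ᵐ[volume.restrict Ω] z k)
    (hq : q =ᵐ[volume.restrict Ω] g) : b Ω v q = divForm Ω z g := by
  refine integral_congr_ae ?_
  filter_upwards [hz.ae_weakPartial_eq hΩ hv, hq] with x h2 hq
  simp only [h2, hq]

theorem normSqV_eq (hΩ : IsOpen Ω) (hb : IsBounded Ω) {v : E n → E n} {z : Fin n → E n → ℝ}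
    (hz : IsField Ω z) (hv : ∀ k, (fun x => v x k) =ᵐ[volume.restrict Ω] z k) :
    normSqV Ω v = (∑ k, ∫ x in Ω, z k x ^ 2) + energy Ω z := by
  rw [normSqV, energy, ← sum_add_distrib]
  refine sum_congr rfl fun k _ => ?_
  obtain ⟨K, hK⟩ := hz.lip k
  exact normSqH1_eq hΩ hb hK (hv k)

theorem IsField.memLp_partialDeriv (hb : IsBounded Ω) {z : Fin n → E n → ℝ} (hz : IsField Ω z)
    (i k : Fin n) : MemLp (partialDeriv i (z k)) 2 (volume.restrict Ω) := by
  obtain ⟨K, hK⟩ := hz.lip k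
  exact hK.memLp_fderiv_apply hb _

theorem IsField.memLp_divergence (hb : IsBounded Ω) {z : Fin n → E n → ℝ} (hz : IsField Ω z) :
    MemLp (fun x => ∑ i, partialDeriv i (z i) x) 2 (volume.restrict Ω) :=
  memLp_finsetSum _ fun i _ => hz.memLp_partialDeriv hb i i

/-- The divergence of a field has mean zero. -/
theorem IsField.integral_divergence (hΩ : IsOpen Ω) (hb : IsBounded Ω) {z : Fin n → E n → ℝ}
    (hz : IsField Ω z) : ∫ x in Ω, ∑ i, partialDeriv i (z i) x = 0 := by
  rw [integral_finsetSum _ fun i _ => ?_]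
  · refine sum_eq_zero fun i _ => ?_
    obtain ⟨K, hK⟩ := hz.lip i
    have h1 := (hK.memH10 hΩ hb (hz.zero i)).integral_eq_zero hΩ hb (φ := fun _ => 1) contDiff_const i
    rw [← h1]
    refine integral_congr_ae ?_
    filter_upwards [weakPartial_ae_eq_fderiv hΩ hK (ae_eq_refl _) i] with x hx
    rw [hx]
    simp [partialDeriv]
  · have := hb.isFiniteMeasure
    exact (hz.memLp_partialDeriv hb i i).integrable one_le_two

/-- The Galerkin equations for the continuous representatives `w`, `π` of `u`, `p`. -/
structure GalerkinRep (Ω : Set (E n)) (d : ℕ) (f : E n → E n) (P : Finset (TaggedSimplex n))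
    (u : E n → E n) (p : E n → ℝ) (w : Fin n → E n → ℝ) (π : E n → ℝ) : Prop where
  field : IsField Ω w
  spline : ∀ k, IsSpline P d (w k)
  eqOn : ∀ k, ∀ τ ∈ P, EqOn (fun x => u x k) (w k) τ.openHull
  spline' : IsSpline P (d - 1) π
  eqOn' : EqOn p π Ω
  mean : ∫ x in Ω, π x = 0
  momentum : ∀ z, IsField Ω z → (∀ k, IsSpline P d (z k)) →
    dirichlet Ω w z - divForm Ω z π = ∫ x in Ω, ∑ k, f x k * z k x
  continuity : ∀ q, IsSpline P (d - 1) q → divForm Ω w q = 0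

theorem divForm_sub_const (hΩ : IsOpen Ω) (hb : IsBounded Ω) {z : Fin n → E n → ℝ}
    (hz : IsField Ω z) {q : E n → ℝ} (hq : MemLp q 2 (volume.restrict Ω)) (M : ℝ) :
    divForm Ω z (fun x => q x - M) = divForm Ω z q := by
  have := hb.isFiniteMeasure
  have hd := hz.memLp_divergence hb
  rw [divForm]
  simp only [sub_mul]
  have h1 : Integrable (fun x => q x * ∑ i, partialDeriv i (z i) x) (volume.restrict Ω) := hq.integrable_mul hd
  rw [integral_sub h1 ((hd.integrable one_le_two).const_mul M),
    integral_const_mul, hz.integral_divergence hΩ hb, mul_zero, sub_zero]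
  rfl

theorem IsSpline.sub_const {g : E n → ℝ} (hg : IsSpline P m g) (M : ℝ) : IsSpline P m fun x => g x - M := by
  intro τ hτ
  obtain ⟨p, hp, he⟩ := hg τ hτ
  exact ⟨_, hp.sub (IsPoly.const M m), fun x hx => by simp only [he hx]⟩

theorem IsSpline.sub_mean_mem_QP (hΩ : IsLipschitzDomain Ω) (hP : IsPartition Ω P) {q : E n → ℝ}
    (hq : IsSpline P (d - 1) q) : (fun x => q x - (volume.real Ω)⁻¹ * ∫ x in Ω, q x) ∈ QP Ω P d := by
  have := hΩ.isBounded.isFiniteMeasure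
  have hc := hq.continuousOn hP
  have hm := memLp_of_continuousOn_closure hΩ.isBounded hc
  have hv : volume.real Ω ≠ 0 := by
    have := hΩ.isOpen.measure_pos volume hΩ.isConnected.nonempty
    exact (ENNReal.toReal_pos this.ne' hΩ.isBounded.measure_lt_top.ne).ne'
  refine ⟨⟨hm.sub (memLp_const _), ?_⟩, (hc.mono subset_closure).sub continuousOn_const,
    (hq.sub_const _).isPiecewisePoly⟩
  rw [integral_sub (hm.integrable one_le_two) (integrable_const _), setIntegral_const, smul_eq_mul]
  field_simp
  ring

theorem IsGalerkin.exists_rep (hΩ : IsLipschitzDomain Ω) (hP : IsPartition Ω P) {f u : E n → E n} {p : E n → ℝ}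
    (h : IsGalerkin Ω d f P u p) : ∃ w π, GalerkinRep Ω d f P u p w π := by
  obtain ⟨w, hw, hws, hwe⟩ := VP.exists_field hΩ hP h.mem_VP
  obtain ⟨π, hπ, hπe⟩ := h.mem_QP.2.2.exists_spline hΩ hP h.mem_QP.2.1
  have hO := hΩ.isOpen
  have hpπ : p =ᵐ[volume.restrict Ω] π := by
    filter_upwards [ae_restrict_mem hO.measurableSet] with x hx using (hπe hx).symm
  have hua : ∀ k, (fun x => u x k) =ᵐ[volume.restrict Ω] w k := fun k => hP.ae_eq_of_eqOn hO (hwe k)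
  have hzero : (fun _ => 0 : E n → ℝ) ∈ QP Ω P d :=
    ⟨⟨by simp, by simp⟩, continuousOn_const, fun τ _ => ⟨0, by simp, by simp⟩⟩
  have hb0 : b Ω u (fun _ => 0) = 0 := by simp [b]
  refine ⟨w, π, hw, hws, hwe, hπ, hπe.symm, ?_, fun z hz hzs => ?_, fun q hq => ?_⟩
  · rw [← integral_congr_ae hpπ]
    exact h.mem_QP.1.2
  · have h1 := h.eq _ (hz.mem_VP hΩ hzs) _ hzero
    rw [hb0, sub_zero, a_eq_dirichlet hO hw hz hua fun k => ae_eq_refl _,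
      b_eq_divForm hO hz (fun k => ae_eq_refl _) hpπ] at h1
    rw [h1]
    simp only [PiLp.inner_apply]
    simp [mul_comm]
  · have h1 := h.eq u h.mem_VP _ (hq.sub_mean_mem_QP hΩ hP)
    have h2 := h.eq u h.mem_VP _ hzero
    rw [hb0] at h2
    have h3 := b_eq_divForm (q := fun x => q x - (volume.real Ω)⁻¹ * ∫ x in Ω, q x) hO hw hua
      (ae_eq_refl _)
    rw [h3, divForm_sub_const hO hΩ.isBounded hw
      (memLp_of_continuousOn_closure hΩ.isBounded (hq.continuousOn hP))] at h1
    linarith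

end Fields

/-! ### The discrete functions on a single simplex -/

section Local

variable {n d m : ℕ} {Ω : Set (E n)} {P : Finset (TaggedSimplex n)} {τ : TaggedSimplex n} {κ : ℝ}

open TaggedSimplex

theorem IsPartition.integral_eq_sum (hP : IsPartition Ω P) (hΩ : IsLipschitzDomain Ω) {F : E n → ℝ}
    (hF : IntegrableOn F Ω) : ∫ x in Ω, F x = ∑ τ ∈ P, ∫ x in τ.closed, F x := by
  have h1 : (⋃ τ ∈ P, τ.openHull) =ᵐ[volume] Ω := by
    refine Filter.EventuallyLE.antisymm (.of_forall fun x hx => ?_) ?_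
    · obtain ⟨τ, hτ, h⟩ := mem_iUnion₂.1 hx
      exact hP.openHull_subset hΩ hτ h
    filter_upwards [(ae_restrict_iff' hΩ.isOpen.measurableSet).1 (hP.ae_mem_openHull hΩ.isOpen)] with x hx hxΩ
    obtain ⟨τ, hτ, h⟩ := hx hxΩ
    exact mem_biUnion hτ h
  rw [← setIntegral_congr_set h1, integral_biUnion_finset (s := fun τ => τ.openHull) P (fun τ _ => isOpen_interior.measurableSet)
    (fun τ hτ σ hσ h => hP.disjoint τ hτ σ hσ h) fun τ hτ => hF.mono_set (hP.openHull_subset hΩ hτ)]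
  refine sum_congr rfl fun τ hτ => setIntegral_congr_set ?_
  exact interior_ae_eq_simplex (τ.basis (hP.nondegenerate τ hτ))

theorem setIntegral_openHull (h : AffineIndependent ℝ τ.vert) (F : E n → ℝ) :
    ∫ x in τ.openHull, F x = ∫ x in τ.closed, F x :=
  setIntegral_congr_set (interior_ae_eq_simplex (τ.basis h))

theorem traceFrom_eq {F : Type*} [TopologicalSpace F] [T2Space F] (h : AffineIndependent ℝ τ.vert)
    {g G : E n → F} (hg : EqOn g G τ.openHull) (hG : Continuous G) {x : E n} (hx : x ∈ τ.closed) :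
    τ.traceFrom g x = G x := by
  refine extendFrom_eq (by rwa [closure_openHull h]) ?_
  refine (hG.continuousAt.tendsto.mono_left nhdsWithin_le_nhds).congr' ?_
  filter_upwards [self_mem_nhdsWithin] with y hy using (hg hy).symm

theorem eventuallyEq_toLp {u : E n → E n} {q : Fin n → E n → ℝ}
    (hu : ∀ k, EqOn (fun x => u x k) (q k) τ.openHull) {x : E n} (hx : x ∈ τ.openHull) :
    u =ᶠ[𝓝 x] fun y => WithLp.toLp 2 fun k => q k y := by
  filter_upwards [isOpen_interior.mem_nhds hx] with y hy
  ext k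
  exact hu k hy

theorem contDiff_toLp {N : WithTop ℕ∞} {q : Fin n → E n → ℝ} (hq : ∀ k, IsPoly m (q k)) :
    ContDiff ℝ N fun y => (WithLp.toLp 2 fun k => q k y : E n) :=
  contDiff_euclidean.2 fun k => (hq k).contDiff

theorem fderiv_toLp_apply {q : Fin n → E n → ℝ} (hq : ∀ k, IsPoly m (q k)) (x v : E n) (k : Fin n) :
    fderiv ℝ (fun y => (WithLp.toLp 2 fun k => q k y : E n)) x v k = fderiv ℝ (q k) x v := by
  have h1 : DifferentiableAt ℝ (fun y => (WithLp.toLp 2 fun k => q k y : E n)) x :=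
    (contDiff_toLp (N := 1) hq).differentiable one_ne_zero x
  have h2 := ((EuclideanSpace.proj (𝕜 := ℝ) k).hasFDerivAt (x := _)).comp x h1.hasFDerivAt
  have h3 : fderiv ℝ (q k) x = _ := h2.fderiv
  rw [h3]
  rfl

theorem divergence_eqOn {u : E n → E n} {q : Fin n → E n → ℝ} (hq : ∀ k, IsPoly m (q k))
    (hu : ∀ k, EqOn (fun x => u x k) (q k) τ.openHull) :
    EqOn (divergence u) (fun x => ∑ i, partialDeriv i (q i) x) τ.openHull := fun x hx => by
  simp only [divergence, partialDeriv]
  rw [(eventuallyEq_toLp hu hx).fderiv_eq]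
  exact sum_congr rfl fun i _ => fderiv_toLp_apply hq x _ i

theorem isPoly_divergence {q : Fin n → E n → ℝ} (hq : ∀ k, IsPoly d (q k)) :
    IsPoly (d - 1) fun x => ∑ i, partialDeriv i (q i) x :=
  IsPoly.sum _ fun i _ => (hq i).partialDeriv i

theorem partialDeriv_congr_interior {w q : E n → ℝ} (h : EqOn w q τ.closed) {x : E n} (hx : x ∈ τ.openHull)
    (i : Fin n) : partialDeriv i w x = partialDeriv i q x := by
  rw [partialDeriv, partialDeriv, fderiv_congr_interior h hx]

theorem frontier_openHull (h : AffineIndependent ℝ τ.vert) :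
    frontier τ.openHull = ⋃ i, facetOf (τ.basis h) i := by
  rw [← frontier_simplex, simplex_basis, frontier, closure_openHull h, frontier,
    isClosed_closed.closure_eq, openHull, interior_interior]

theorem ae_mem_openHull_closed (h : AffineIndependent ℝ τ.vert) :
    ∀ᵐ x ∂volume.restrict τ.closed, x ∈ τ.openHull := by
  rw [← simplex_basis τ h, ← Measure.restrict_congr_set (interior_ae_eq_simplex (τ.basis h))]
  simpa only [openHull, ← simplex_basis τ h] using ae_restrict_mem isOpen_interior.measurableSet

end Local

section Frontier

variable {n m : ℕ} [NeZero n] {Ω : Set (E n)} {P : Finset (TaggedSimplex n)} {τ : TaggedSimplex n} {κ : ℝ}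

open TaggedSimplex

theorem integrableOn_frontier_openHull (h : AffineIndependent ℝ τ.vert) {g : E n → ℝ} (hg : Continuous g) :
    IntegrableOn g (frontier τ.openHull) (surface n) := by
  rw [frontier_openHull h]
  exact integrableOn_finite_iUnion.2 fun i => continuousOn_integrableOn_facetOf _ i hg.continuousOn

theorem integral_frontier_le (h : AffineIndependent ℝ τ.vert) {g : E n → ℝ} (hg : Continuous g)
    (h0 : ∀ x, 0 ≤ g x) : ∫ x in frontier τ.openHull, g x ∂surface n ≤
      ∑ i, ∫ x in facetOf (τ.basis h) i, g x ∂surface n := by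
  have hi : ∀ i, IntegrableOn g (facetOf (τ.basis h) i) (surface n) := fun i =>
    continuousOn_integrableOn_facetOf _ i hg.continuousOn
  rw [frontier_openHull h, ← integral_finsetSum_measure fun i _ => hi i]
  refine integral_mono_measure ?_ (.of_forall h0) (integrable_finsetSum_measure.2 fun i _ => hi i)
  rw [← Measure.sum_fintype]
  exact Measure.restrict_iUnion_le

theorem sum_integral_facetOf_le (h : AffineIndependent ℝ τ.vert) {g : E n → ℝ} (hg : Continuous g)
    (h0 : ∀ x, 0 ≤ g x) : ∑ i, ∫ x in facetOf (τ.basis h) i, g x ∂surface n ≤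
      (n + 1) * ∫ x in frontier τ.openHull, g x ∂surface n := by
  have h1 : ∀ i ∈ Finset.univ, ∫ x in facetOf (τ.basis h) i, g x ∂surface n ≤
      ∫ x in frontier τ.openHull, g x ∂surface n := fun i _ =>
    setIntegral_mono_set (integrableOn_frontier_openHull h hg) (.of_forall h0)
      (LE.le.eventuallyLE (by rw [frontier_openHull h]; exact subset_iUnion (facetOf (τ.basis h)) i))
  refine (Finset.sum_le_card_nsmul _ _ _ h1).trans_eq ?_
  simp

namespace IsMesh

theorem size_le_height (h : IsMesh Ω κ P) (hτ : τ ∈ P) (i : Fin (n + 1)) :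
    τ.size ≤ κ * height (τ.basis (h.nondegenerate τ hτ)) i := by
  rw [height, ← div_eq_mul_inv, le_div_iff₀ (norm_baryGrad_pos _ i), mul_comm]
  exact (h.regular τ hτ).2 _ rfl i

theorem height_le_size (h : IsMesh Ω κ P) (hτ : τ ∈ P) (i : Fin (n + 1)) :
    height (τ.basis (h.nondegenerate τ hτ)) i ≤ κ * τ.size := by
  set b := τ.basis (h.nondegenerate τ hτ)
  obtain ⟨j, hj⟩ := exists_index_ne i
  have h1 := inner_baryGrad_vertex_sub b i i j
  rw [if_pos rfl, if_neg hj.symm, sub_zero] at h1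
  have h2 := real_inner_le_norm (baryGrad b i) (b i - b j)
  have h3 := (h.regular τ hτ).1 i j
  rw [dist_eq_norm] at h3
  rw [h1] at h2
  rw [height, inv_le_iff_one_le_mul₀ (norm_baryGrad_pos b i), mul_comm]
  refine h2.trans (mul_le_mul_of_nonneg_left h3 (norm_nonneg _))

end IsMesh

/-- The discrete trace inequality on the boundary of a simplex. -/
theorem exists_boundary_le_integral (hκ : 1 ≤ κ) (hm : m ≠ 0) : ∃ A : ℝ, 0 ≤ A ∧
    ∀ (P : Finset (TaggedSimplex n)) (h : IsMesh Ω κ P) (τ) (hτ : τ ∈ P) (g : E n → ℝ), IsPoly m g →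
      τ.size * ∑ i, ∫ x in facetOf (τ.basis (h.nondegenerate τ hτ)) i, g x ^ 2 ∂surface n ≤
        A * ∫ x in τ.closed, g x ^ 2 := by
  obtain ⟨C, hC0, hC⟩ := exists_sq_le_integral n hm
  refine ⟨(n + 1) * (κ * (n + 1 + κ ^ 2 * (C * ((n + 1) * κ) ^ 2))), by positivity,
    fun P h τ hτ g hg => ?_⟩
  set b := τ.basis (h.nondegenerate τ hτ) with hb
  have hs := h.size_pos hτ
  have hbs : simplex b = τ.closed := simplex_basis τ _
  rw [← hbs]
  set J := ∫ x in simplex b, g x ^ 2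
  have hJ : 0 ≤ J := integral_sq_nonneg _
  have hvol := volume_simplex_pos b
  have hgrad : (∫ x in simplex b, ‖fderiv ℝ g x‖ ^ 2) ≤ C * ((n + 1) * κ / τ.size) ^ 2 * J := by
    have h1 : ∀ x ∈ simplex b, ‖‖fderiv ℝ g x‖ ^ 2‖ ≤ C * ((n + 1) * κ / τ.size) ^ 2 * J / volume.real (simplex b) := by
      intro x hx
      rw [Real.norm_of_nonneg (by positivity), le_div_iff₀ hvol, mul_comm]
      refine ((hC b g hg x hx).2).trans ?_
      have h2 := h.sum_norm_baryGrad_le hτ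
      gcongr
    refine (le_abs_self _).trans ((norm_setIntegral_le_of_norm_le_const (isCompact_simplex b).measure_lt_top h1).trans_eq ?_)
    field_simp
  have key : ∀ i ∈ Finset.univ, τ.size * ∫ x in facetOf b i, g x ^ 2 ∂surface n ≤
      κ * (n + 1 + κ ^ 2 * (C * ((n + 1) * κ) ^ 2)) * J := by
    intro i _
    have hF : 0 ≤ ∫ x in facetOf b i, g x ^ 2 ∂surface n := integral_sq_nonneg _
    have h1 := trace_inequality b i (LipOn.of_contDiff hg.contDiff (isCompact_simplex b))
      (D := κ * τ.size) fun x hx => by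
        rw [← dist_eq_norm]
        exact h.dist_le hτ (hbs ▸ hx) (vert_mem_closed i)
    calc τ.size * ∫ x in facetOf b i, g x ^ 2 ∂surface n
        ≤ κ * (height b i * ∫ x in facetOf b i, g x ^ 2 ∂surface n) := by
          rw [← mul_assoc]
          exact mul_le_mul_of_nonneg_right (h.size_le_height hτ i) hF
      _ ≤ κ * ((n + 1) * J + (κ * τ.size) ^ 2 * (C * ((n + 1) * κ / τ.size) ^ 2 * J)) := by
          refine mul_le_mul_of_nonneg_left (h1.trans ?_) (by linarith)
          gcongr
      _ = _ := by field_simp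
  rw [mul_sum]
  refine (Finset.sum_le_card_nsmul _ _ _ key).trans_eq ?_
  simp only [Finset.card_univ, Fintype.card_fin, nsmul_eq_mul]
  push_cast
  ring

/-- The discrete divergence is orthogonal to all pressures; testing it with its own interpolant at
the interior nodes of `τ` controls it by its values at the boundary nodes. -/
theorem exists_integral_divergence_le (hΩ : IsLipschitzDomain Ω) (hκ : 1 ≤ κ) {d : ℕ} (hd : 2 ≤ d) :
    ∃ B : ℝ, 0 ≤ B ∧ ∀ (P : Finset (TaggedSimplex n)) (h : IsMesh Ω κ P) (f u : E n → E n) (p : E n → ℝ)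
      (w : Fin n → E n → ℝ) (π : E n → ℝ), GalerkinRep Ω d f P u p w π → ∀ (τ) (hτ : τ ∈ P) (g : E n → ℝ),
      IsPoly (d - 1) g → EqOn (fun x => ∑ i, partialDeriv i (w i) x) g τ.openHull →
      ∫ x in τ.closed, g x ^ 2 ≤
        B * (τ.size * ∑ i, ∫ x in facetOf (τ.basis (h.nondegenerate τ hτ)) i, g x ^ 2 ∂surface n) := by
  have hm : d - 1 ≠ 0 := by omega
  obtain ⟨A, hA0, hA⟩ := exists_lagrangeInterp_bound n hm
  obtain ⟨C, hC0, hC⟩ := exists_sum_sq_node_facet_le n hm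
  refine ⟨A * (C * κ), by positivity, fun P h f u p w π hG τ hτ g hg hgw => ?_⟩
  classical
  have ht := h.nondegenerate τ hτ
  set b := τ.basis ht with hb
  have hbs : simplex b = τ.closed := simplex_basis τ _
  set c : E n → ℝ := fun y => if y ∈ τ.openHull then g y else 0 with hc
  set G := interp P (d - 1) c with hGdef
  have hGs : IsSpline P (d - 1) G := h.conforming.isSpline_interp h.toIsPartition hm c
  have hGτ : EqOn G (lagrangeInterp b (d - 1) c) τ.closed := h.conforming.eqOn_interp h.toIsPartition hm c hτ
  have hGσ : ∀ σ ∈ P, σ ≠ τ → ∀ x ∈ σ.closed, G x = 0 := by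
    intro σ hσ hne x hx
    rw [hGdef, h.conforming.eqOn_interp h.toIsPartition hm c hσ hx]
    refine sum_eq_zero fun α hα => ?_
    have h1 : node (σ.basis (h.nondegenerate σ hσ)) (d - 1) α ∉ τ.openHull := by
      have h2 : Disjoint τ.openHull σ.closed := by
        rw [← closure_openHull (h.nondegenerate σ hσ)]
        exact (h.disjoint τ hτ σ hσ hne.symm).closure_right isOpen_interior
      exact fun h3 => h2.notMem_of_mem_left h3 (node_mem_closed _ hm hα)
    simp only [hc, if_neg h1, zero_mul]
  set g₀ := lagrangeInterp b (d - 1) c with hg₀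
  have hg₀p : IsPoly (d - 1) g₀ := isPoly_lagrangeInterp b c
  -- the interior interpolant is an admissible pressure supported on `τ`
  have horth : ∫ x in τ.closed, g x * g₀ x = 0 := by
    have h1 := hG.continuity G hGs
    have hint : IntegrableOn (fun x => G x * ∑ i, partialDeriv i (w i) x) Ω :=
      (memLp_of_continuousOn_closure hΩ.isBounded (hGs.continuousOn h.toIsPartition)).integrable_mul
        (hG.field.memLp_divergence hΩ.isBounded)
    rw [divForm, h.integral_eq_sum hΩ hint, Finset.sum_eq_single τ
      (fun σ hσ hne => setIntegral_eq_zero_of_forall_eq_zero fun x hx => by rw [hGσ σ hσ hne x hx, zero_mul])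
      (fun h => (h hτ).elim)] at h1
    rw [← h1]
    refine integral_congr_ae ?_
    filter_upwards [ae_mem_openHull_closed ht] with x hx
    have h2 : ∑ i, partialDeriv i (w i) x = g x := hgw hx
    rw [h2, hGτ (openHull_subset_closed hx), mul_comm]
  have hcont : ∀ {q : E n → ℝ}, IsPoly (d - 1) q → Continuous q := fun hq => hq.continuous
  have hg1 := hcont hg
  have hg2 := hcont hg₀p
  have hint : ∀ {q : E n → ℝ}, Continuous q → IntegrableOn q τ.closed := fun hq =>
    hq.continuousOn.integrableOn_compact isCompact_closed
  have h1 : ∫ x in τ.closed, g x ^ 2 ≤ ∫ x in τ.closed, (g x - g₀ x) ^ 2 := by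
    have h2 : ∫ x in τ.closed, (g x - g₀ x) ^ 2 =
        ∫ x in τ.closed, (g x ^ 2 - 2 * (g x * g₀ x) + g₀ x ^ 2) := by
      congr 1; funext x; ring
    rw [h2, integral_add (hint (by fun_prop)) (hint (by fun_prop)), integral_sub (hint (by fun_prop))
      (hint (by fun_prop)), integral_const_mul, horth]
    have : 0 ≤ ∫ x in τ.closed, g₀ x ^ 2 := integral_sq_nonneg _
    linarith
  have h2 : ∀ x ∈ τ.closed, ‖(g x - g₀ x) ^ 2‖ ≤
      A * ∑ i, ∑ α ∈ multiIndex n (d - 1) with α i = 0, g (node b (d - 1) α) ^ 2 := by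
    intro x hx
    have h3 := (hA b (fun y => g y - c y) 0 x (hbs ▸ hx)).1
    have h4 : lagrangeInterp b (d - 1) (fun y => g y - c y) x = g x - g₀ x := by
      rw [lagrange_reproduction b hm hg x, hg₀, lagrangeInterp, lagrangeInterp, ← sum_sub_distrib]
      exact sum_congr rfl fun α _ => by ring
    simp only [h4, sub_zero] at h3
    rw [Real.norm_of_nonneg (sq_nonneg _)]
    refine h3.trans (mul_le_mul_of_nonneg_left ?_ hA0)
    have h5 : ∑ i, ∑ α ∈ multiIndex n (d - 1) with α i = 0, g (node b (d - 1) α) ^ 2 =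
        ∑ α ∈ multiIndex n (d - 1), ∑ i, if α i = 0 then g (node b (d - 1) α) ^ 2 else 0 := by
      rw [sum_comm]
      exact sum_congr rfl fun i _ => Finset.sum_filter _ _
    rw [h5]
    refine sum_le_sum fun α hα => ?_
    by_cases hin : node b (d - 1) α ∈ τ.openHull
    · simp only [hc, if_pos hin, sub_self]
      rw [zero_pow two_ne_zero]
      exact sum_nonneg fun i _ => by split_ifs <;> positivity
    · simp only [hc, if_neg hin, sub_zero]
      -- a node off the interior has a vanishing barycentric coordinate
      have h6 : ∃ i, α i = 0 := by
        by_contra! hne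
        refine hin ((mem_openHull_iff ht).2 fun i => ?_)
        rw [bary_node ht hm hα]
        have := Nat.pos_of_ne_zero (hne i)
        have := Nat.pos_of_ne_zero hm
        positivity
      obtain ⟨i, hi⟩ := h6
      have h7 := single_le_sum (f := fun i => if α i = 0 then g (node b (d - 1) α) ^ 2 else 0)
        (fun i _ => by positivity) (Finset.mem_univ i)
      simpa only [if_pos hi] using h7
  have h3 := (le_abs_self _).trans
    (norm_setIntegral_le_of_norm_le_const ((isCompact_closed (τ := τ)).measure_lt_top (μ := volume)) h2)
  refine h1.trans (h3.trans ?_)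
  rw [mul_assoc, mul_assoc, mul_assoc]
  refine mul_le_mul_of_nonneg_left ?_ hA0
  rw [sum_mul, mul_sum, mul_sum, mul_sum]
  refine sum_le_sum fun i _ => ?_
  have h8 := hC b i g hg
  rw [hbs] at h8
  refine h8.trans (mul_le_mul_of_nonneg_left ?_ hC0)
  rw [← mul_assoc]
  exact mul_le_mul_of_nonneg_right (h.height_le_size hτ i) (integral_sq_nonneg _)

/-- The two estimators for the divergence are equivalent on each simplex. -/
theorem exists_eta_equivalence (hΩ : IsLipschitzDomain Ω) (hκ : 1 ≤ κ) {d : ℕ} (hd : 2 ≤ d) :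
    ∃ A : ℝ, 0 ≤ A ∧ ∀ (P : Finset (TaggedSimplex n)), IsMesh Ω κ P → ∀ (f u : E n → E n) (p : E n → ℝ),
      IsGalerkin Ω d f P u p → ∀ τ ∈ P,
      ∫ x in τ.openHull, divergence u x ^ 2 ≤
        A * (τ.size * ∫ x in frontier τ.openHull, τ.traceFrom (divergence u) x ^ 2 ∂surface n) ∧
      τ.size * ∫ x in frontier τ.openHull, τ.traceFrom (divergence u) x ^ 2 ∂surface n ≤
        A * ∫ x in τ.openHull, divergence u x ^ 2 := by
  have hm : d - 1 ≠ 0 := by omega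
  obtain ⟨A, hA0, hA⟩ := exists_boundary_le_integral (n := n) (Ω := Ω) hκ hm
  obtain ⟨B, hB0, hB⟩ := exists_integral_divergence_le (n := n) hΩ hκ hd
  refine ⟨A + B * (n + 1), by positivity, fun P h f u p hu τ hτ => ?_⟩
  obtain ⟨w, π, hG⟩ := hu.exists_rep hΩ h.toIsPartition
  have ht := h.nondegenerate τ hτ
  choose q hq hwq using fun k => hG.spline k τ hτ
  have huq : ∀ k, EqOn (fun x => u x k) (q k) τ.openHull := fun k =>
    (hG.eqOn k τ hτ).trans ((hwq k).mono openHull_subset_closed)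
  set g : E n → ℝ := fun x => ∑ i, partialDeriv i (q i) x with hg
  have hgp : IsPoly (d - 1) g := isPoly_divergence hq
  have hgc : Continuous g := hgp.continuous
  have hdiv : EqOn (divergence u) g τ.openHull := divergence_eqOn hq huq
  have hgw : EqOn (fun x => ∑ i, partialDeriv i (w i) x) g τ.openHull := fun x hx =>
    sum_congr rfl fun i _ => partialDeriv_congr_interior (hwq i) hx i
  have e1 : ∫ x in τ.openHull, divergence u x ^ 2 = ∫ x in τ.closed, g x ^ 2 := by
    rw [← setIntegral_openHull ht]
    exact setIntegral_congr_fun isOpen_interior.measurableSet fun x hx => by simp only [hdiv hx]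
  have e2 : ∫ x in frontier τ.openHull, τ.traceFrom (divergence u) x ^ 2 ∂surface n =
      ∫ x in frontier τ.openHull, g x ^ 2 ∂surface n := by
    refine setIntegral_congr_fun isClosed_frontier.measurableSet fun x hx => ?_
    have hx' : x ∈ τ.closed := closure_openHull ht ▸ frontier_subset_closure hx
    simp only [traceFrom_eq ht hdiv hgc hx']
  rw [e1, e2]
  have hs := (h.size_pos hτ).le
  have h0 : ∀ x, 0 ≤ g x ^ 2 := fun _ => sq_nonneg _
  have h1 := integral_frontier_le ht (g := fun x => g x ^ 2) (hgc.pow 2) h0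
  have h2 := sum_integral_facetOf_le ht (g := fun x => g x ^ 2) (hgc.pow 2) h0
  have h3 : 0 ≤ ∫ x in frontier τ.openHull, g x ^ 2 ∂surface n := integral_nonneg h0
  have h4 : 0 ≤ ∫ x in τ.closed, g x ^ 2 := integral_nonneg h0
  constructor
  · calc ∫ x in τ.closed, g x ^ 2
        ≤ B * (τ.size * ∑ i, ∫ x in facetOf (τ.basis ht) i, g x ^ 2 ∂surface n) :=
          hB P h f u p w π hG τ hτ g hgp hgw
      _ ≤ B * (τ.size * ((n + 1) * ∫ x in frontier τ.openHull, g x ^ 2 ∂surface n)) := by gcongr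
      _ = B * (n + 1) * (τ.size * ∫ x in frontier τ.openHull, g x ^ 2 ∂surface n) := by ring
      _ ≤ _ := by gcongr; linarith
  · calc τ.size * ∫ x in frontier τ.openHull, g x ^ 2 ∂surface n
        ≤ τ.size * ∑ i, ∫ x in facetOf (τ.basis ht) i, g x ^ 2 ∂surface n := by gcongr
      _ ≤ A * ∫ x in τ.closed, g x ^ 2 := hA P h τ hτ g hgp
      _ ≤ _ := by gcongr; nlinarith

end Frontier

/-! ### Integration by parts on a simplex -/

section Green

variable {n m : ℕ} {τ : TaggedSimplex n}

open TaggedSimplex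

theorem laplacian_toLp {q : Fin n → E n → ℝ} (hq : ∀ k, IsPoly m (q k)) (x : E n) (k : Fin n) :
    Laplacian.laplacian (fun y => (WithLp.toLp 2 fun k => q k y : E n)) x k =
      ∑ i, partialDeriv i (partialDeriv i (q k)) x := by
  have h1 : ContDiffAt ℝ 2 (fun y => (WithLp.toLp 2 fun k => q k y : E n)) x :=
    (contDiff_toLp hq).contDiffAt
  have h2 : Laplacian.laplacian (q k) x = _ :=
    h1.laplacian_CLM_comp_left (l := (EuclideanSpace.proj k : E n →L[ℝ] ℝ))
  have h3 : Laplacian.laplacian (q k) x = Laplacian.laplacian (fun y => (WithLp.toLp 2 fun k => q k y : E n)) x k := h2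
  rw [← h3, InnerProductSpace.laplacian_eq_iteratedFDeriv_orthonormalBasis (q k)
    (EuclideanSpace.basisFun (Fin n) ℝ)]
  refine sum_congr rfl fun i _ => ?_
  have h4 : DifferentiableAt ℝ (fderiv ℝ (q k)) x :=
    (((hq k).contDiff (k := 2)).fderiv_right (m := 1) (by norm_num)).differentiable one_ne_zero x
  rw [iteratedFDeriv_two_apply]
  have h5 : partialDeriv i (partialDeriv i (q k)) x =
      fderiv ℝ (fun y => fderiv ℝ (q k) y (basisVec i)) x (basisVec i) := rfl
  rw [h5, fderiv_clm_apply h4 (differentiableAt_const _)]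
  simp [basisVec]

theorem laplacian_eqOn {u : E n → E n} {q : Fin n → E n → ℝ} (hq : ∀ k, IsPoly m (q k))
    (hu : ∀ k, EqOn (fun x => u x k) (q k) τ.openHull) {x : E n} (hx : x ∈ τ.openHull) (k : Fin n) :
    Laplacian.laplacian u x k = ∑ i, partialDeriv i (partialDeriv i (q k)) x := by
  rw [← laplacian_toLp hq x k, (InnerProductSpace.laplacian_congr_nhds (eventuallyEq_toLp hu hx)).eq_of_nhds]

theorem gradient_eqOn {p ρ : E n → ℝ} (hp : EqOn p ρ τ.openHull) {x : E n} (hx : x ∈ τ.openHull) (k : Fin n) :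
    gradient p x k = partialDeriv k ρ x := by
  rw [gradient, (hp.eventuallyEq_of_mem (isOpen_interior.mem_nhds hx)).fderiv_eq, partialDeriv,
    ← InnerProductSpace.toDual_symm_apply (𝕜 := ℝ), basisVec, EuclideanSpace.inner_single_right]
  simp

variable [NeZero n] (b : Simplex n)

theorem IsPoly.lipOn {p : E n → ℝ} (hp : IsPoly m p) : LipOn p (simplex b) :=
  LipOn.of_contDiff hp.contDiff (isCompact_simplex b)

theorem LipOn.integrable_mul_partialDeriv {q y : E n → ℝ} (hq : LipOn q (simplex b)) (hy : LipOn y (simplex b))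
    (i : Fin n) : IntegrableOn (fun x => q x * partialDeriv i y x) (simplex b) :=
  (continuousOn_memLp (isCompact_simplex b) hq.continuousOn).integrable_mul
    ((ContinuousLinearMap.apply ℝ ℝ (basisVec i : E n)).comp_memLp' (hy.memLp_fderiv b))

theorem ae_partialDeriv_mul {q y : E n → ℝ} (hq : LipOn q (simplex b)) (hy : LipOn y (simplex b)) :
    ∀ᵐ x ∂volume.restrict (simplex b), ∀ i, partialDeriv i (fun x => q x * y x) x =
      q x * partialDeriv i y x + partialDeriv i q x * y x := by
  filter_upwards [hq.ae_restrict_differentiableAt b, hy.ae_restrict_differentiableAt b] with x h1 h2 i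
  rw [partialDeriv, fderiv_fun_mul h1 h2]
  simp [partialDeriv, mul_comm]

theorem integral_partialDeriv_mul {q y : E n → ℝ} (hq : IsPoly m q) (hy : LipOn y (simplex b)) (i : Fin n) :
    ∫ x in simplex b, q x * partialDeriv i y x =
      (∑ j, ⟪normal b j, basisVec i⟫_ℝ * ∫ x in facetOf b j, q x * y x ∂surface n) -
        ∫ x in simplex b, partialDeriv i q x * y x := by
  have hql := hq.lipOn b
  rw [← divergence_theorem b (hql.mul (isCompact_simplex b) hy) (basisVec i), eq_sub_iff_add_eq, ← integral_add
    (hql.integrable_mul_partialDeriv b hy i)]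
  · refine integral_congr_ae ?_
    filter_upwards [ae_partialDeriv_mul b hql hy] with x hx using (hx i).symm
  · exact ((hq.partialDeriv i).continuous.continuousOn.mul hy.continuousOn).integrableOn_compact (isCompact_simplex b)

/-- Green's formula on a simplex. -/
theorem green_formula {q y : E n → ℝ} (hq : IsPoly m q) (hy : LipOn y (simplex b)) :
    ∫ x in simplex b, ∑ i, partialDeriv i q x * partialDeriv i y x =
      (∑ j, ∫ x in facetOf b j, fderiv ℝ q x (normal b j) * y x ∂surface n) -
        ∫ x in simplex b, (∑ i, partialDeriv i (partialDeriv i q) x) * y x := by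
  have hp := fun i => hq.partialDeriv i
  have hc : ∀ {r : E n → ℝ}, Continuous r → ContinuousOn (fun x => r x * y x) (simplex b) := fun hr =>
    hr.continuousOn.mul hy.continuousOn
  rw [integral_finsetSum _ fun i _ => ((hp i).lipOn b).integrable_mul_partialDeriv b hy i,
    sum_congr rfl fun i _ => integral_partialDeriv_mul b (hp i) hy i, sum_sub_distrib, sum_comm]
  congr 1
  · refine sum_congr rfl fun j _ => ?_
    rw [sum_congr rfl fun i _ => (integral_const_mul _ _).symm, ← integral_finsetSum _ fun i _ =>
      (continuousOn_integrableOn_facetOf b j ((hc (hp i).continuous).mono (facetOf_subset b j))).const_mul _]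
    congr 1
    funext x
    conv_rhs => rw [← sum_smul_basisVec (normal b j)]
    simp [sum_mul, basisVec, partialDeriv, EuclideanSpace.inner_single_right, mul_assoc]
  · rw [← integral_finsetSum _ fun i _ =>
      (hc ((hp i).partialDeriv i).continuous).integrableOn_compact (isCompact_simplex b)]
    simp only [sum_mul]

end Green

/-! ### Facets -/

section Facets

variable {n : ℕ} {τ : TaggedSimplex n}

namespace TaggedSimplex

open Classical in
/-- The facet opposite to the `j`-th vertex. -/
def facet (τ : TaggedSimplex n) (j : Fin (n + 1)) : Finset (E n) := (Finset.univ.erase j).image τ.vert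

theorem mem_facets {e : Finset (E n)} : e ∈ τ.facets ↔ ∃ j, τ.facet j = e := by
  simp [facets, facet]

theorem facetHull_facet (h : AffineIndependent ℝ τ.vert) (j : Fin (n + 1)) :
    facetHull (τ.facet j) = facetOf (τ.basis h) j := by
  classical
  simp only [facetHull, facet, facetOf, Finset.coe_image, Finset.coe_erase, Finset.coe_univ, coe_basis]
  rw [Set.compl_eq_univ_sdiff]

theorem facetHull_subset {e : Finset (E n)} (he : e ∈ τ.facets) : facetHull e ⊆ τ.closed := by
  obtain ⟨j, rfl⟩ := mem_facets.1 he
  refine convexHull_mono fun x hx => ?_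
  simp only [facet, Finset.coe_image] at hx
  exact image_subset_range _ _ hx

theorem facet_injective (h : AffineIndependent ℝ τ.vert) : Function.Injective τ.facet := by
  classical
  intro i j hij
  have h1 := Finset.image_injective h.injective hij
  by_contra hne
  have : j ∈ Finset.univ.erase i := Finset.mem_erase.2 ⟨Ne.symm hne, Finset.mem_univ _⟩
  rw [h1] at this
  exact Finset.notMem_erase _ _ this

theorem sum_facets (h : AffineIndependent ℝ τ.vert) (φ : Finset (E n) → ℝ) :
    ∑ e ∈ τ.facets, φ e = ∑ j, φ (τ.facet j) := by
  classical
  exact Finset.sum_image (f := φ) fun i _ j _ hij => facet_injective h hij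

theorem outwardNormal_facet (hn : 1 < n) (h : AffineIndependent ℝ τ.vert) (j : Fin (n + 1)) :
    τ.outwardNormal (τ.facet j) = normal (τ.basis h) j := by
  have : NeZero n := ⟨by omega⟩
  set b := τ.basis h with hb
  have hbv : ∀ i, b i = τ.vert i := fun i => congrFun (τ.coe_basis h) i
  have hmem : ∀ i ≠ j, τ.vert i ∈ τ.facet j := fun i hi => by
    classical
    exact Finset.mem_image_of_mem _ (Finset.mem_erase.2 ⟨hi, Finset.mem_univ _⟩)
  have hex : ∃ ν : E n, ‖ν‖ = 1 ∧ ∀ x ∈ τ.facet j, ∀ i, ⟪ν, τ.vert i - x⟫_ℝ ≤ 0 := by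
    refine ⟨normal b j, norm_normal b j, fun x hx i => ?_⟩
    obtain ⟨l, hl, rfl⟩ := Finset.mem_image.1 hx
    rw [← hbv, ← hbv, normal, inner_neg_left, inner_smul_left, inner_baryGrad_vertex_sub,
      if_neg (Finset.ne_of_mem_erase hl).symm]
    split_ifs <;> simp
  rw [outwardNormal, dif_pos hex]
  obtain ⟨h1, h2⟩ := hex.choose_spec
  set ν := hex.choose
  have : Nontrivial (Fin (n + 1)) := Fin.nontrivial_iff_two_le.2 (by omega)
  obtain ⟨l, hl⟩ := exists_ne j
  set s := ⟪ν, b j - b l⟫_ℝ with hs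
  have hs0 : s ≤ 0 := by rw [hs, hbv, hbv]; exact h2 _ (hmem l hl) j
  have h3 : ∀ i ≠ j, ⟪ν, b i - b l⟫_ℝ = 0 := by
    intro i hi
    have h4 := h2 _ (hmem l hl) i
    have h5 := h2 _ (hmem i hi) l
    rw [hbv, hbv]
    rw [← neg_sub, inner_neg_right] at h5
    linarith
  -- the normal direction is determined by its values on the edges
  have h4 : ν = s • baryGrad b j := by
    refine ext_inner_right ℝ fun v => ?_
    have h5 : ∑ i, ⟪baryGrad b i, v⟫_ℝ • (b i - b l) = v := by
      simp_rw [smul_sub]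
      rw [sum_sub_distrib, sum_inner_baryGrad_smul, ← sum_smul, ← sum_inner, sum_baryGrad]
      simp
    conv_lhs => rw [← h5]
    rw [inner_sum, Finset.sum_eq_single j (fun i _ hi => by rw [inner_smul_right, h3 i hi, mul_zero])
      fun h => (h (Finset.mem_univ _)).elim, inner_smul_right, inner_smul_left, mul_comm]
    rfl
  have h5 := norm_baryGrad_pos b j
  have h6 : -s * ‖baryGrad b j‖ = 1 := by
    rw [← h1, h4, norm_smul, Real.norm_of_nonpos hs0]
  rw [h4, normal, ← neg_smul, ← eq_inv_of_mul_eq_one_left h6, neg_neg]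

end TaggedSimplex

end Facets

/-! ### The residual -/

section Residual

variable {n d m : ℕ} {Ω : Set (E n)} {P R : Finset (TaggedSimplex n)} {τ : TaggedSimplex n} {κ : ℝ}
  {f u : E n → E n} {p : E n → ℝ} {w z : Fin n → E n → ℝ} {π : E n → ℝ}

open TaggedSimplex

theorem sq_integral_inner_le {X : Type*} [MeasurableSpace X] {μ : Measure X} {f g : X → E n}
    (hf : MemLp f 2 μ) (hg : MemLp g 2 μ) :
    (∫ x, ⟪f x, g x⟫_ℝ ∂μ) ^ 2 ≤ (∫ x, ‖f x‖ ^ 2 ∂μ) * ∫ x, ‖g x‖ ^ 2 ∂μ := by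
  refine le_trans ?_ (sq_integral_mul_le hf.norm hg.norm)
  rw [← sq_abs (∫ x, ⟪f x, g x⟫_ℝ ∂μ)]
  refine pow_le_pow_left₀ (abs_nonneg _) ?_ 2
  exact norm_integral_le_of_norm_le (hf.norm.integrable_mul hg.norm)
    (.of_forall fun x => norm_inner_le_norm (𝕜 := ℝ) _ _)

theorem integral_add_add_sub {X : Type*} [MeasurableSpace X] {μ : Measure X} {F L B Y : X → ℝ}
    (hF : Integrable F μ) (hL : Integrable L μ) (hB : Integrable B μ) (hY : Integrable Y μ) :
    ∫ x, (F x + L x + B x - Y x) ∂μ = ∫ x, F x ∂μ + ∫ x, L x ∂μ + ∫ x, B x ∂μ - ∫ x, Y x ∂μ := by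
  rw [integral_sub (f := fun x => F x + L x + B x) ((hF.add hL).add hB) hY,
    integral_add (f := fun x => F x + L x) (hF.add hL) hB, integral_add hF hL]

/-- The vector field with components `z`. -/
def vec (z : Fin n → E n → ℝ) (x : E n) : E n := WithLp.toLp 2 fun k => z k x

theorem IsField.continuous (hz : IsField Ω z) (k : Fin n) : Continuous (z k) := by
  obtain ⟨K, hK⟩ := hz.lip k
  exact hK.continuous

theorem IsField.continuous_vec (hz : IsField Ω z) : Continuous (vec z) :=
  (PiLp.continuous_toLp 2 _).comp (continuous_pi hz.continuous)

theorem IsField.lipOn (hz : IsField Ω z) (k : Fin n) (T : Set (E n)) : LipOn (z k) T := by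
  obtain ⟨K, hK⟩ := hz.lip k
  exact ⟨K, hK.lipschitzOnWith⟩

theorem norm_vec_sq (z : Fin n → E n → ℝ) (x : E n) : ‖vec z x‖ ^ 2 = ∑ k, z k x ^ 2 := by
  rw [EuclideanSpace.norm_sq_eq]
  exact sum_congr rfl fun k _ => by rw [Real.norm_eq_abs, sq_abs]; rfl

theorem inner_vec (v : E n) (x : E n) : ⟪v, vec z x⟫_ℝ = ∑ k, v k * z k x := by
  rw [PiLp.inner_apply]
  exact sum_congr rfl fun k _ => mul_comm _ _

theorem restrict_openHull (h : AffineIndependent ℝ τ.vert) :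
    (volume : Measure (E n)).restrict τ.openHull = volume.restrict τ.closed :=
  Measure.restrict_congr_set (interior_ae_eq_simplex (τ.basis h))

theorem IsPartition.restrict_closed_le (hP : IsPartition Ω P) (hΩ : IsLipschitzDomain Ω) (hτ : τ ∈ P) :
    (volume : Measure (E n)).restrict τ.closed ≤ volume.restrict Ω := by
  rw [← restrict_openHull (hP.nondegenerate τ hτ)]
  exact Measure.restrict_mono (hP.openHull_subset hΩ hτ) le_rfl

theorem fderiv_eqOn {q : Fin n → E n → ℝ}
    (hu : ∀ k, EqOn (fun x => u x k) (q k) τ.openHull) :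
    EqOn (fderiv ℝ u) (fderiv ℝ (vec q)) τ.openHull := fun _ hx =>
  (eventuallyEq_toLp hu hx).fderiv_eq

/-- The flux of `u` out of `τ` through the facet `e`, tested with the field `z`. -/
def flux (u : E n → E n) (z : Fin n → E n → ℝ) (τ : TaggedSimplex n) (e : Finset (E n)) : ℝ :=
  ∫ x in facetHull e, ⟪τ.traceFrom (fderiv ℝ u) x (τ.outwardNormal e), vec z x⟫_ℝ ∂surface n

theorem GalerkinRep.exists_poly (hG : GalerkinRep Ω d f P u p w π) (hτ : τ ∈ P) :
    ∃ q : Fin n → E n → ℝ, (∀ k, IsPoly d (q k)) ∧ (∀ k, EqOn (w k) (q k) τ.closed) ∧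
      ∀ k, EqOn (fun x => u x k) (q k) τ.openHull := by
  choose q hq hwq using fun k => hG.spline k τ hτ
  exact ⟨q, hq, hwq, fun k => (hG.eqOn k τ hτ).trans ((hwq k).mono openHull_subset_closed)⟩

theorem GalerkinRep.exists_pressure_poly (hG : GalerkinRep Ω d f P u p w π) (hP : IsPartition Ω P)
    (hΩ : IsLipschitzDomain Ω) (hτ : τ ∈ P) :
    ∃ ρ : E n → ℝ, IsPoly (d - 1) ρ ∧ EqOn π ρ τ.closed ∧ EqOn p ρ τ.openHull := by
  obtain ⟨ρ, hρ, hπρ⟩ := hG.spline' τ hτ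
  exact ⟨ρ, hρ, hπρ, (hG.eqOn'.mono (hP.openHull_subset hΩ hτ)).trans (hπρ.mono openHull_subset_closed)⟩

theorem GalerkinRep.exists_trace (hG : GalerkinRep Ω d f P u p w π) (hP : IsPartition Ω P) (hτ : τ ∈ P)
    (v : E n) : ∃ g : E n → E n, Continuous g ∧ EqOn (fun x => τ.traceFrom (fderiv ℝ u) x v) g τ.closed := by
  obtain ⟨q, hq, -, hu⟩ := hG.exists_poly hτ
  have hc : Continuous (fderiv ℝ (vec q)) := (contDiff_toLp (N := 1) hq).continuous_fderiv one_ne_zero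
  exact ⟨fun x => fderiv ℝ (vec q) x v, hc.clm_apply continuous_const, fun x hx => by
    simp only [traceFrom_eq (hP.nondegenerate τ hτ) (fderiv_eqOn hu) hc hx]⟩

variable [NeZero n]

theorem GalerkinRep.memLp_residual (hG : GalerkinRep Ω d f P u p w π) (hP : IsPartition Ω P)
    (hΩ : IsLipschitzDomain Ω) (hf : MemLp f 2 (volume.restrict Ω)) (hτ : τ ∈ P) :
    MemLp (fun x => f x + Laplacian.laplacian u x - gradient p x) 2 (volume.restrict τ.closed) := by
  obtain ⟨q, hq, -, hu⟩ := hG.exists_poly hτ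
  obtain ⟨ρ, hρ, hπρ, hpρ⟩ := hG.exists_pressure_poly hP hΩ hτ
  have ht := hP.nondegenerate τ hτ
  set g : E n → E n := vec fun k x => (∑ i, partialDeriv i (partialDeriv i (q k)) x) - partialDeriv k ρ x
  have hg : Continuous g := by
    refine (PiLp.continuous_toLp 2 _).comp (continuous_pi fun k => ?_)
    exact (continuous_finsetSum _ fun i _ => (((hq k).partialDeriv i).partialDeriv i).continuous).sub
      (hρ.partialDeriv k).continuous
  refine (memLp_congr_ae ?_).2 ((hf.mono_measure (hP.restrict_closed_le hΩ hτ)).add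
    (memLp_of_continuousOn isCompact_closed hg.continuousOn))
  filter_upwards [ae_mem_openHull_closed ht] with x hx
  ext k
  simp only [PiLp.add_apply, PiLp.sub_apply, Pi.add_apply, laplacian_eqOn hq hu hx, gradient_eqOn hpρ hx]
  simp only [g, vec]
  ring

/-- Integration by parts on a single simplex. -/
theorem GalerkinRep.element_identity (hn : 1 < n) (hG : GalerkinRep Ω d f P u p w π) (hP : IsPartition Ω P)
    (hΩ : IsLipschitzDomain Ω) (hf : MemLp f 2 (volume.restrict Ω)) (hz : IsField Ω z) (hτ : τ ∈ P) :
    (∫ x in τ.closed, ∑ k, f x k * z k x) -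
        (∫ x in τ.closed, ∑ i, ∑ k, partialDeriv i (w k) x * partialDeriv i (z k) x) +
        (∫ x in τ.closed, π x * ∑ i, partialDeriv i (z i) x) =
      (∫ x in τ.closed, ⟪f x + Laplacian.laplacian u x - gradient p x, vec z x⟫_ℝ) -
        (∑ e ∈ τ.facets, flux u z τ e) +
        ∫ x in τ.closed, ∑ i, partialDeriv i (fun y => π y * z i y) x := by
  obtain ⟨q, hq, hwq, hu⟩ := hG.exists_poly hτ
  obtain ⟨ρ, hρ, hπρ, hpρ⟩ := hG.exists_pressure_poly hP hΩ hτ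
  have ht := hP.nondegenerate τ hτ
  set b := τ.basis ht
  have hbs : simplex b = τ.closed := simplex_basis τ _
  have hzl := fun k => hz.lipOn k (simplex b)
  have hπl : LipOn π (simplex b) := hbs ▸ hG.spline'.lipOn hτ
  have hint : ∀ {g : E n → ℝ}, ContinuousOn g τ.closed → IntegrableOn g τ.closed := fun h =>
    h.integrableOn_compact isCompact_closed
  have hLc : ∀ k, Continuous fun x => (∑ i, partialDeriv i (partialDeriv i (q k)) x) * z k x := fun k =>
    (continuous_finsetSum _ fun i _ => (((hq k).partialDeriv i).partialDeriv i).continuous).mul (hz.continuous k)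
  have hF : IntegrableOn (fun x => ∑ k, f x k * z k x) τ.closed := integrable_finsetSum _ fun k _ =>
    (((EuclideanSpace.proj (𝕜 := ℝ) k : E n →L[ℝ] ℝ).comp_memLp' (hf.mono_measure
      (hP.restrict_closed_le hΩ hτ))).integrable_mul
      (continuousOn_memLp isCompact_closed (hz.continuous k).continuousOn))
  have hB : IntegrableOn (fun x => π x * ∑ i, partialDeriv i (z i) x) τ.closed := by
    simp only [mul_sum]
    exact integrable_finsetSum _ fun i _ => hbs ▸ hπl.integrable_mul_partialDeriv b (hzl i) i
  have hY : IntegrableOn (fun x => ∑ i, partialDeriv i (fun y => π y * z i y) x) τ.closed :=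
    integrable_finsetSum _ fun i _ => by
      have h1 := (LipOn.mul (isCompact_simplex b) hπl (hzl i)).memLp_fderiv b
      rw [hbs] at h1
      exact ((ContinuousLinearMap.apply ℝ ℝ (basisVec i : E n)).comp_memLp' h1).integrable one_le_two
  have e1 : ∫ x in τ.closed, ⟪f x + Laplacian.laplacian u x - gradient p x, vec z x⟫_ℝ =
      (∫ x in τ.closed, ∑ k, f x k * z k x) +
        (∫ x in τ.closed, ∑ k, (∑ i, partialDeriv i (partialDeriv i (q k)) x) * z k x) +
        (∫ x in τ.closed, π x * ∑ i, partialDeriv i (z i) x) -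
        ∫ x in τ.closed, ∑ i, partialDeriv i (fun y => π y * z i y) x := by
    rw [← integral_add_add_sub hF (hint (continuous_finsetSum _ fun k _ => hLc k).continuousOn) hB hY]
    refine integral_congr_ae ?_
    have h1 : ∀ᵐ x ∂volume.restrict τ.closed, ∀ k i, partialDeriv i (fun x => π x * z k x) x =
        π x * partialDeriv i (z k) x + partialDeriv i π x * z k x := by
      rw [ae_all_iff, ← hbs]
      exact fun k => ae_partialDeriv_mul b hπl (hzl k)
    filter_upwards [ae_mem_openHull_closed ht, h1] with x hx h1
    rw [inner_vec]
    simp only [PiLp.add_apply, PiLp.sub_apply, laplacian_eqOn hq hu hx, gradient_eqOn hpρ hx, h1,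
      partialDeriv_congr_interior hπρ hx, mul_sum, ← sum_add_distrib, ← sum_sub_distrib]
    exact sum_congr rfl fun k _ => by ring
  have e2 : ∫ x in τ.closed, ∑ i, ∑ k, partialDeriv i (w k) x * partialDeriv i (z k) x =
      (∑ e ∈ τ.facets, flux u z τ e) -
        ∫ x in τ.closed, ∑ k, (∑ i, partialDeriv i (partialDeriv i (q k)) x) * z k x := by
    have h1 : ∫ x in τ.closed, ∑ i, ∑ k, partialDeriv i (w k) x * partialDeriv i (z k) x =
        ∫ x in τ.closed, ∑ k, ∑ i, partialDeriv i (q k) x * partialDeriv i (z k) x := by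
      refine integral_congr_ae ?_
      filter_upwards [ae_mem_openHull_closed ht] with x hx
      rw [sum_comm]
      exact sum_congr rfl fun k _ => sum_congr rfl fun i _ => by
        rw [partialDeriv_congr_interior (hwq k) hx]
    rw [h1, ← hbs, integral_finsetSum _ fun k _ => integrable_finsetSum _ fun i _ =>
      (((hq k).partialDeriv i).lipOn b).integrable_mul_partialDeriv b (hzl k) i,
      sum_congr rfl fun k _ => green_formula b (hq k) (hzl k), sum_sub_distrib, sum_comm,
      sum_facets ht]
    have hdc : ∀ k (v : E n), Continuous fun x => fderiv ℝ (q k) x v := fun k v =>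
      (((hq k).contDiff (k := 1)).continuous_fderiv one_ne_zero).clm_apply continuous_const
    congr 1
    · refine sum_congr rfl fun j _ => ?_
      rw [flux, outwardNormal_facet hn ht, facetHull_facet ht,
        ← integral_finsetSum (f := fun k x => fderiv ℝ (q k) x (normal b j) * z k x) _
        fun k _ => continuousOn_integrableOn_facetOf b j ((hdc k _).mul (hz.continuous k)).continuousOn]
      refine setIntegral_congr_fun (isCompact_facetOf b j).measurableSet fun x hx => ?_
      have hx' : x ∈ τ.closed := hbs ▸ facetOf_subset b j hx
      have hc : Continuous (fderiv ℝ (vec q)) := (contDiff_toLp (N := 1) hq).continuous_fderiv one_ne_zero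
      simp only [traceFrom_eq ht (fderiv_eqOn hu) hc hx', inner_vec]
      exact sum_congr rfl fun k _ => by rw [← fderiv_toLp_apply hq]; rfl
    · exact (integral_finsetSum _ fun k _ => hbs ▸ hint (hLc k).continuousOn).symm
  rw [e1, e2]
  ring

/-- The products of the pressure with the components of a field form a field, whose divergence has
mean zero; this removes the pressure from the interelement terms. -/
theorem GalerkinRep.isField_mul (hG : GalerkinRep Ω d f P u p w π) (hP : IsPartition Ω P)
    (hΩ : IsLipschitzDomain Ω) (hz : IsField Ω z) : IsField Ω fun i x => π x * z i x where
  lip i := hP.exists_lipschitzWith hΩ.isOpen (fun τ hτ =>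
      (hG.spline'.lipOn hτ).mul isCompact_closed (hz.lipOn i _)) fun x hx => by rw [hz.zero i x hx, mul_zero]
  zero i x hx := by rw [hz.zero i x hx, mul_zero]

theorem GalerkinRep.residual_identity (hn : 1 < n) (hG : GalerkinRep Ω d f P u p w π) (hP : IsPartition Ω P)
    (hΩ : IsLipschitzDomain Ω) (hf : MemLp f 2 (volume.restrict Ω)) (hz : IsField Ω z) :
    (∫ x in Ω, ∑ k, f x k * z k x) - dirichlet Ω w z + divForm Ω z π =
      ∑ τ ∈ P, ((∫ x in τ.closed, ⟪f x + Laplacian.laplacian u x - gradient p x, vec z x⟫_ℝ) -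
        ∑ e ∈ τ.facets, flux u z τ e) := by
  have hb := hΩ.isBounded
  have hF : IntegrableOn (fun x => ∑ k, f x k * z k x) Ω := integrable_finsetSum _ fun k _ =>
    ((EuclideanSpace.proj (𝕜 := ℝ) k : E n →L[ℝ] ℝ).comp_memLp' hf).integrable_mul
      (memLp_of_continuousOn_closure hb (hz.continuous k).continuousOn)
  have hD : IntegrableOn (fun x => ∑ i, ∑ k, partialDeriv i (w k) x * partialDeriv i (z k) x) Ω :=
    integrable_finsetSum _ fun i _ => integrable_finsetSum _ fun k _ =>
      (hG.field.memLp_partialDeriv hb i k).integrable_mul (hz.memLp_partialDeriv hb i k)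
  have hB : IntegrableOn (fun x => π x * ∑ i, partialDeriv i (z i) x) Ω :=
    (memLp_of_continuousOn_closure hb (hG.spline'.continuousOn hP)).integrable_mul
      (hz.memLp_divergence hb)
  have hy := hG.isField_mul hP hΩ hz
  have hY := hy.integral_divergence hΩ.isOpen hb
  have := hb.isFiniteMeasure
  rw [hP.integral_eq_sum hΩ ((hy.memLp_divergence hb).integrable one_le_two)] at hY
  rw [dirichlet, divForm, hP.integral_eq_sum hΩ hF, hP.integral_eq_sum hΩ hD, hP.integral_eq_sum hΩ hB,
    ← sum_sub_distrib, ← sum_add_distrib,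
    sum_congr rfl fun τ hτ => hG.element_identity hn hP hΩ hf hz hτ, sum_add_distrib, hY, add_zero]

open Classical in
/-- If the field vanishes outside the simplices of `R`, only the facets between two simplices of `R`
contribute. -/
theorem GalerkinRep.residual_eq (hn : 1 < n) (hG : GalerkinRep Ω d f P u p w π) (hP : IsPartition Ω P)
    (hc : IsConforming P) (hΩ : IsLipschitzDomain Ω) (hf : MemLp f 2 (volume.restrict Ω)) (hz : IsField Ω z)
    (hR : R ⊆ P) (hzR : ∀ τ ∈ P, τ ∉ R → ∀ k, ∀ x ∈ τ.closed, z k x = 0) :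
    (∫ x in Ω, ∑ k, f x k * z k x) - dirichlet Ω w z + divForm Ω z π =
      (∑ τ ∈ R, ∫ x in τ.closed, ⟪f x + Laplacian.laplacian u x - gradient p x, vec z x⟫_ℝ) -
        ∑ e ∈ interiorFacets R, ∫ x in facetHull e, ⟪normalJump P u e x, vec z x⟫_ℝ ∂surface n := by
  have hvec : ∀ x, (∀ k, z k x = 0) → vec z x = 0 := fun x hx => by ext k; exact hx k
  have hfl0 : ∀ (τ : TaggedSimplex n) e, (∀ x ∈ facetHull e, ∀ k, z k x = 0) → flux u z τ e = 0 := fun τ e h =>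
    setIntegral_eq_zero_of_forall_eq_zero fun x hx => by rw [hvec x (h x hx), inner_zero_right]
  rw [hG.residual_identity hn hP hΩ hf hz, ← sum_subset hR, sum_sub_distrib]
  · congr 1
    have h1 : ∑ τ ∈ R, ∑ e ∈ τ.facets, flux u z τ e =
        ∑ e ∈ R.biUnion TaggedSimplex.facets, ∑ τ ∈ R with e ∈ τ.facets, flux u z τ e := by
      refine Finset.sum_comm' fun τ e => ?_
      simp only [Finset.mem_biUnion, mem_filter]
      exact ⟨fun h => ⟨h, τ, h⟩, fun h => h.1⟩
    have hsub : interiorFacets R ⊆ R.biUnion TaggedSimplex.facets := Finset.filter_subset _ _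
    rw [h1, ← sum_subset hsub]
    · refine sum_congr rfl fun e he => ?_
      obtain ⟨σ, hσ, -, -, -, hσe, -⟩ := (mem_filter.1 he).2
      have h2 : ∑ τ ∈ R with e ∈ τ.facets, flux u z τ e = ∑ τ ∈ P with e ∈ τ.facets, flux u z τ e := by
        refine sum_subset (Finset.filter_subset_filter _ hR) fun τ hτ hτR => hfl0 τ e fun x hx k => ?_
        rw [mem_filter] at hτ hτR
        exact hzR τ hτ.1 (fun h => hτR ⟨h, hτ.2⟩) k x (facetHull_subset hτ.2 hx)
      rw [h2]
      simp only [flux]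
      rw [← integral_finsetSum]
      · refine integral_congr_ae (.of_forall fun x => ?_)
        simp only [normalJump, sum_inner]
      · intro τ hτ
        rw [mem_filter] at hτ
        obtain ⟨j, rfl⟩ := mem_facets.1 hτ.2
        obtain ⟨g, hg, he⟩ := hG.exists_trace hP hτ.1 (τ.outwardNormal (τ.facet j))
        have ht := hP.nondegenerate τ hτ.1
        rw [facetHull_facet ht]
        refine continuousOn_integrableOn_facetOf (τ.basis ht) j
          ((hg.inner hz.continuous_vec).continuousOn.congr fun x hx => ?_)
        have h3 := he (simplex_basis τ ht ▸ facetOf_subset _ j hx)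
        simp only at h3 ⊢
        rw [h3]
    · -- a facet of only one simplex of `R` lies on the boundary or in a simplex outside `R`
      intro e he hne
      refine sum_eq_zero fun τ hτ => hfl0 τ e fun x hx k => ?_
      rw [mem_filter] at hτ
      obtain ⟨hτR, hτe⟩ := hτ
      obtain ⟨j, rfl⟩ := mem_facets.1 hτe
      by_cases hσ : ∀ σ ∈ P, τ.facet j ∈ σ.facets → σ = τ
      · refine hz.zero k x (hc.facet_subset_compl hP hΩ (hR hτR) j hσ ?_)
        rwa [facetHull_facet (hP.nondegenerate τ (hR hτR))] at hx
      · push Not at hσ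
        obtain ⟨σ, hσ, hσe, hne'⟩ := hσ
        refine hzR σ hσ (fun h => hne ?_) k x (facetHull_subset hσe hx)
        exact mem_filter.2 ⟨he, τ, hτR, σ, h, hne'.symm, hτe, hσe⟩
  · intro τ hτ hτR
    have h0 := hzR τ hτ hτR
    rw [sum_eq_zero fun e he => hfl0 τ e fun x hx k => h0 k x (facetHull_subset he hx), sub_zero]
    exact setIntegral_eq_zero_of_forall_eq_zero fun x hx => by
      rw [hvec x fun k => h0 k x hx, inner_zero_right]

theorem IsMesh.size_le_facetSize (hn : 1 < n) (h : IsMesh Ω κ P) (hτ : τ ∈ P) (j : Fin (n + 1)) :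
    τ.size ≤ κ * facetSize (τ.facet j) := by
  have ht := h.nondegenerate τ hτ
  have h1 := height_mul_surface (τ.basis ht) j
  have h2 := h.height_le_size hτ j
  have hs := h.size_pos hτ
  have hκ := h.one_le
  rw [simplex_basis, ← IsMesh.size_pow (by omega) τ] at h1
  rw [facetSize, facetHull_facet ht]
  set S := (surface n).real (facetOf (τ.basis ht) j)
  have hS : 0 ≤ S := measureReal_nonneg
  obtain ⟨k, rfl⟩ : ∃ k, n = k + 1 := ⟨n - 1, by omega⟩
  have hk : k ≠ 0 := by omega
  have h3 : (τ.size / κ) ^ k ≤ S := by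
    have h4 : ((k + 1 : ℕ) : ℝ) * τ.size ^ (k + 1) ≤ κ * τ.size * S := h1 ▸ mul_le_mul_of_nonneg_right h2 hS
    have h5 : τ.size ^ k ≤ κ * S := by
      have h6 : (1 : ℝ) ≤ ((k + 1 : ℕ) : ℝ) := by exact_mod_cast Nat.le_add_left 1 k
      have h7 : 1 * τ.size ^ (k + 1) ≤ ((k + 1 : ℕ) : ℝ) * τ.size ^ (k + 1) :=
        mul_le_mul_of_nonneg_right h6 (by positivity)
      refine le_of_mul_le_mul_right ?_ hs
      calc τ.size ^ k * τ.size = 1 * τ.size ^ (k + 1) := by ring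
        _ ≤ κ * τ.size * S := h7.trans h4
        _ = _ := by ring
    rw [div_pow, div_le_iff₀ (by positivity), mul_comm]
    exact h5.trans (mul_le_mul_of_nonneg_right (le_self_pow₀ hκ hk) hS)
  have h4 : τ.size / κ ≤ S ^ (k : ℝ)⁻¹ := by
    rw [← Real.pow_rpow_inv_natCast (by positivity : 0 ≤ τ.size / κ) hk]
    exact Real.rpow_le_rpow (by positivity) h3 (by positivity)
  rw [div_le_iff₀ (by linarith), mul_comm] at h4
  simpa using h4

theorem IsMesh.facetSize_pos (hn : 1 < n) (h : IsMesh Ω κ P) (hτ : τ ∈ P) (j : Fin (n + 1)) :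
    0 < facetSize (τ.facet j) :=
  (mul_pos_iff_of_pos_left (one_pos.trans_le h.one_le)).1
    ((h.size_pos hτ).trans_le (h.size_le_facetSize hn hτ j))

end Residual

/-! ### Bounds for the residual -/

section Estimates

variable {n d m : ℕ} {Ω : Set (E n)} {P R : Finset (TaggedSimplex n)} {τ : TaggedSimplex n} {κ : ℝ}
  {f u : E n → E n} {p : E n → ℝ} {w z : Fin n → E n → ℝ} {π : E n → ℝ}

open TaggedSimplex

/-- The local quantity that bounds the tests of the residual on `τ` and on its boundary. -/
def localEnergy (z : Fin n → E n → ℝ) (τ : TaggedSimplex n) : ℝ :=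
  ∑ k, ((τ.size ^ 2)⁻¹ * (∫ x in τ.closed, z k x ^ 2) + ∫ x in τ.closed, ‖fderiv ℝ (z k) x‖ ^ 2)

theorem localEnergy_nonneg (z : Fin n → E n → ℝ) (τ : TaggedSimplex n) : 0 ≤ localEnergy z τ :=
  sum_nonneg fun k _ => by
    have h1 : 0 ≤ ∫ x in τ.closed, z k x ^ 2 := integral_sq_nonneg _
    have h2 : 0 ≤ ∫ x in τ.closed, ‖fderiv ℝ (z k) x‖ ^ 2 := integral_sq_nonneg _
    positivity

theorem integral_vec_le_localEnergy (hz : IsField Ω z) (τ : TaggedSimplex n) :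
    (τ.size ^ 2)⁻¹ * ∫ x in τ.closed, ‖vec z x‖ ^ 2 ≤ localEnergy z τ := by
  simp only [norm_vec_sq]
  rw [integral_finsetSum (f := fun k x => z k x ^ 2) _
    fun k _ => ((hz.continuous k).pow 2).continuousOn.integrableOn_compact isCompact_closed,
    mul_sum]
  exact sum_le_sum fun k _ => le_add_of_nonneg_right (integral_sq_nonneg _)

variable [NeZero n]

theorem IsMesh.facet_le_localEnergy (hn : 1 < n) (h : IsMesh Ω κ P) (hz : IsField Ω z) (hτ : τ ∈ P)
    (j : Fin (n + 1)) : (facetSize (τ.facet j))⁻¹ * ∫ x in facetHull (τ.facet j), ‖vec z x‖ ^ 2 ∂surface n ≤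
      κ ^ 2 * (n + 1 + κ ^ 2) * localEnergy z τ := by
  have ht := h.nondegenerate τ hτ
  set b := τ.basis ht
  have hbs : simplex b = τ.closed := simplex_basis τ ht
  have hs := h.size_pos hτ
  have hκ := h.one_le
  have h1 := h.size_le_facetSize hn hτ j
  have hfs := h.facetSize_pos hn hτ j
  simp only [norm_vec_sq]
  rw [facetHull_facet ht, integral_finsetSum (f := fun k x => z k x ^ 2) _ fun k _ =>
    continuousOn_integrableOn_facetOf b j ((hz.continuous k).pow 2).continuousOn, mul_sum, localEnergy,
    mul_sum]
  refine sum_le_sum fun k _ => ?_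
  have h2 := trace_inequality b j (hz.lipOn k _) (D := κ * τ.size) fun x hx => by
    rw [← dist_eq_norm]
    exact h.dist_le hτ (hbs ▸ hx) (vert_mem_closed j)
  rw [hbs] at h2
  have h3 := h.size_le_height hτ j
  set F := ∫ x in facetOf b j, z k x ^ 2 ∂surface n
  set I := ∫ x in τ.closed, z k x ^ 2
  set J := ∫ x in τ.closed, ‖fderiv ℝ (z k) x‖ ^ 2
  have hF : 0 ≤ F := integral_sq_nonneg _
  have hI : 0 ≤ I := integral_sq_nonneg _
  have hJ : 0 ≤ J := integral_sq_nonneg _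
  have h4 : (facetSize (τ.facet j))⁻¹ ≤ κ / τ.size := by
    rw [inv_le_iff_one_le_mul₀ hfs, div_mul_eq_mul_div, one_le_div hs]
    exact h1
  have h5 : F ≤ κ / τ.size * ((n + 1) * I + (κ * τ.size) ^ 2 * J) := by
    rw [div_mul_eq_mul_div, le_div_iff₀ hs]
    calc F * τ.size ≤ F * (κ * height b j) := mul_le_mul_of_nonneg_left h3 hF
      _ = κ * (height b j * F) := by ring
      _ ≤ _ := mul_le_mul_of_nonneg_left h2 (by linarith)
  calc (facetSize (τ.facet j))⁻¹ * F ≤ κ / τ.size * (κ / τ.size * ((n + 1) * I + (κ * τ.size) ^ 2 * J)) :=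
        mul_le_mul h4 h5 hF (by positivity)
    _ = κ ^ 2 * ((n + 1) * ((τ.size ^ 2)⁻¹ * I) + κ ^ 2 * J) := by field_simp
    _ ≤ κ ^ 2 * ((n + 1 + κ ^ 2) * ((τ.size ^ 2)⁻¹ * I) + (n + 1 + κ ^ 2) * J) :=
        mul_le_mul_of_nonneg_left (add_le_add
          (mul_le_mul_of_nonneg_right (le_add_of_nonneg_right (sq_nonneg κ)) (by positivity))
          (mul_le_mul_of_nonneg_right (le_add_of_nonneg_left (by positivity)) hJ)) (sq_nonneg κ)
    _ = _ := by ring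

theorem sum_interiorFacets_le (hn : 1 < n) (h : IsMesh Ω κ P) (hz : IsField Ω z) (hR : R ⊆ P) :
    ∑ e ∈ interiorFacets R, (facetSize e)⁻¹ * ∫ x in facetHull e, ‖vec z x‖ ^ 2 ∂surface n ≤
      (n + 1) * (κ ^ 2 * (n + 1 + κ ^ 2)) * ∑ τ ∈ P, localEnergy z τ := by
  classical
  set A := κ ^ 2 * (n + 1 + κ ^ 2)
  have hA : 0 ≤ A := by positivity
  have h0 : ∀ τ e, 0 ≤ if e ∈ τ.facets then A * localEnergy z τ else 0 := fun τ e => by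
    split_ifs
    · exact mul_nonneg hA (localEnergy_nonneg z τ)
    · exact le_rfl
  calc ∑ e ∈ interiorFacets R, (facetSize e)⁻¹ * ∫ x in facetHull e, ‖vec z x‖ ^ 2 ∂surface n
      ≤ ∑ e ∈ interiorFacets R, ∑ τ ∈ P, if e ∈ τ.facets then A * localEnergy z τ else 0 := by
        refine sum_le_sum fun e he => ?_
        obtain ⟨τ, hτ, -, -, -, hτe, -⟩ := (mem_filter.1 he).2
        have h1 := single_le_sum (f := fun τ => if e ∈ τ.facets then A * localEnergy z τ else 0)
          (fun τ _ => h0 τ e) (hR hτ)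
        refine le_trans ?_ h1
        simp only [if_pos hτe]
        obtain ⟨j, rfl⟩ := mem_facets.1 hτe
        exact h.facet_le_localEnergy hn hz (hR hτ) j
    _ = ∑ τ ∈ P, ∑ e ∈ interiorFacets R, if e ∈ τ.facets then A * localEnergy z τ else 0 := sum_comm
    _ ≤ ∑ τ ∈ P, (n + 1) * (A * localEnergy z τ) := by
        refine sum_le_sum fun τ _ => ?_
        rw [← Finset.sum_filter, sum_const, nsmul_eq_mul]
        refine mul_le_mul_of_nonneg_right ?_ (mul_nonneg hA (localEnergy_nonneg z τ))
        have h2 : ((interiorFacets R).filter (· ∈ τ.facets)).card ≤ n + 1 :=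
          (Finset.card_le_card fun e he => (mem_filter.1 he).2).trans
            (Finset.card_image_le.trans (by simp))
        exact_mod_cast h2
    _ = _ := by rw [mul_sum]; exact sum_congr rfl fun τ _ => by ring

theorem GalerkinRep.memLp_normalJump (hG : GalerkinRep Ω d f P u p w π) (hP : IsPartition Ω P) (e : Finset (E n)) :
    MemLp (normalJump P u e) 2 ((surface n).restrict (facetHull e)) := by
  classical
  refine memLp_finsetSum _ fun τ hτ => ?_
  obtain ⟨hτP, hτe⟩ := mem_filter.1 hτ
  obtain ⟨j, rfl⟩ := mem_facets.1 hτe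
  obtain ⟨g, hg, he⟩ := hG.exists_trace hP hτP (τ.outwardNormal (τ.facet j))
  have ht := hP.nondegenerate τ hτP
  have hfin := isFiniteMeasure_surface_facetOf (τ.basis ht) j
  rw [facetHull_facet ht]
  exact memLp_of_continuousOn (isCompact_facetOf _ j) (hg.continuousOn.congr fun x hx =>
    he (simplex_basis τ ht ▸ facetOf_subset _ j hx))

theorem eta0_nonneg (f u : E n → E n) (p : E n → ℝ) (P R : Finset (TaggedSimplex n)) : 0 ≤ eta0 f u p P R :=
  add_nonneg
    (sum_nonneg fun _ _ => mul_nonneg (sq_nonneg _) (integral_sq_nonneg _))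
    (sum_nonneg fun _ _ => mul_nonneg (Real.rpow_nonneg measureReal_nonneg _)
      (integral_sq_nonneg _))

/-- The residual is bounded on the fields that vanish outside the simplices of `R`. -/
theorem GalerkinRep.sq_residual_le (hn : 1 < n) (hG : GalerkinRep Ω d f P u p w π) (h : IsMesh Ω κ P)
    (hΩ : IsLipschitzDomain Ω) (hf : MemLp f 2 (volume.restrict Ω)) (hz : IsField Ω z)
    (hR : R ⊆ P) (hzR : ∀ τ ∈ P, τ ∉ R → ∀ k, ∀ x ∈ τ.closed, z k x = 0) :
    ((∫ x in Ω, ∑ k, f x k * z k x) - dirichlet Ω w z + divForm Ω z π) ^ 2 ≤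
      (2 + 2 * ((n + 1) * (κ ^ 2 * (n + 1 + κ ^ 2)))) * eta0 f u p P R * ∑ τ ∈ P, localEnergy z τ := by
  classical
  have hP := h.toIsPartition
  rw [hG.residual_eq hn hP h.conforming hΩ hf hz hR hzR]
  set W := ∑ τ ∈ P, localEnergy z τ
  set B := (n + 1) * (κ ^ 2 * (n + 1 + κ ^ 2))
  have hB : 0 ≤ B := by positivity
  have hW : 0 ≤ W := sum_nonneg fun τ _ => localEnergy_nonneg z τ
  have hfs : ∀ e : Finset (E n), 0 ≤ facetSize e := fun e => Real.rpow_nonneg measureReal_nonneg _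
  have h1 := Finset.sum_sq_le_sum_mul_sum_of_sq_le_mul R
    (r := fun τ => ∫ x in τ.closed, ⟪f x + Laplacian.laplacian u x - gradient p x, vec z x⟫_ℝ)
    (f := fun τ => τ.size ^ 2 * ∫ x in τ.openHull, ‖f x + Laplacian.laplacian u x - gradient p x‖ ^ 2)
    (g := fun τ => (τ.size ^ 2)⁻¹ * ∫ x in τ.closed, ‖vec z x‖ ^ 2)
    (fun τ _ => mul_nonneg (sq_nonneg _) (integral_sq_nonneg _))
    (fun τ _ => mul_nonneg (by positivity) (integral_sq_nonneg _)) fun τ hτ => by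
      have hs := (h.size_pos (hR hτ)).ne'
      rw [setIntegral_openHull (h.nondegenerate τ (hR hτ))]
      refine (sq_integral_inner_le (hG.memLp_residual hP hΩ hf (hR hτ))
        (memLp_of_continuousOn isCompact_closed hz.continuous_vec.continuousOn)).trans_eq ?_
      field_simp
  have h2 := Finset.sum_sq_le_sum_mul_sum_of_sq_le_mul (interiorFacets R)
    (r := fun e => ∫ x in facetHull e, ⟪normalJump P u e x, vec z x⟫_ℝ ∂surface n)
    (f := fun e => facetSize e * ∫ x in facetHull e, ‖normalJump P u e x‖ ^ 2 ∂surface n)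
    (g := fun e => (facetSize e)⁻¹ * ∫ x in facetHull e, ‖vec z x‖ ^ 2 ∂surface n)
    (fun e _ => mul_nonneg (hfs e) (integral_sq_nonneg _))
    (fun e _ => mul_nonneg (inv_nonneg.2 (hfs e)) (integral_sq_nonneg _)) fun e he => by
      obtain ⟨τ, hτ, -, -, -, hτe, -⟩ := (mem_filter.1 he).2
      obtain ⟨j, rfl⟩ := mem_facets.1 hτe
      have ht := h.nondegenerate τ (hR hτ)
      have hs := (h.facetSize_pos hn (hR hτ) j).ne'
      have h3 := hG.memLp_normalJump hP (τ.facet j)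
      rw [facetHull_facet ht] at h3 ⊢
      have := isFiniteMeasure_surface_facetOf (τ.basis ht) j
      refine (sq_integral_inner_le h3
        (memLp_of_continuousOn (isCompact_facetOf _ j) hz.continuous_vec.continuousOn)).trans_eq ?_
      field_simp
  have h3 : ∑ τ ∈ R, (τ.size ^ 2)⁻¹ * ∫ x in τ.closed, ‖vec z x‖ ^ 2 ≤ W :=
    (sum_le_sum fun τ _ => integral_vec_le_localEnergy hz τ).trans
      (Finset.sum_le_sum_of_subset_of_nonneg hR fun τ _ _ => localEnergy_nonneg z τ)
  have h4 := sum_interiorFacets_le hn h hz hR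
  rw [eta0]
  set a₁ := ∑ τ ∈ R, τ.size ^ 2 * ∫ x in τ.openHull, ‖f x + Laplacian.laplacian u x - gradient p x‖ ^ 2
  set a₂ := ∑ e ∈ interiorFacets R, facetSize e * ∫ x in facetHull e, ‖normalJump P u e x‖ ^ 2 ∂surface n
  have ha₁ : 0 ≤ a₁ := sum_nonneg fun _ _ => mul_nonneg (sq_nonneg _) (integral_sq_nonneg _)
  have ha₂ : 0 ≤ a₂ := sum_nonneg fun e _ => mul_nonneg (hfs e) (integral_sq_nonneg _)
  have h5 := h1.trans (mul_le_mul_of_nonneg_left h3 ha₁)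
  have h6 := h2.trans (mul_le_mul_of_nonneg_left h4 ha₂)
  set s := ∑ τ ∈ R, ∫ x in τ.closed, ⟪f x + Laplacian.laplacian u x - gradient p x, vec z x⟫_ℝ
  set t := ∑ e ∈ interiorFacets R, ∫ x in facetHull e, ⟪normalJump P u e x, vec z x⟫_ℝ ∂surface n
  calc (s - t) ^ 2 ≤ 2 * s ^ 2 + 2 * t ^ 2 := by nlinarith [sq_nonneg (s + t)]
    _ ≤ 2 * (a₁ * W) + 2 * (a₂ * (B * W)) := by gcongr
    _ ≤ _ := by nlinarith [mul_nonneg ha₂ hW, mul_nonneg (mul_nonneg hB ha₁) hW]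

end Estimates

/-! ### Reliability -/

section Reliability

variable {n d m : ℕ} {Ω : Set (E n)} {P P' R : Finset (TaggedSimplex n)} {τ : TaggedSimplex n} {κ : ℝ}
  {f u : E n → E n} {p : E n → ℝ} {w y z : Fin n → E n → ℝ} {π : E n → ℝ}

open TaggedSimplex

theorem IsField.sub (hz : IsField Ω z) (hy : IsField Ω y) : IsField Ω fun k x => z k x - y k x where
  lip k := by
    obtain ⟨K, hK⟩ := hz.lip k
    obtain ⟨L, hL⟩ := hy.lip k
    exact ⟨K + L, hK.sub hL⟩
  zero k x hx := by rw [hz.zero k x hx, hy.zero k x hx, sub_zero]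

theorem IsField.ae_partialDeriv_sub (hz : IsField Ω z) (hy : IsField Ω y) :
    ∀ᵐ x ∂volume.restrict Ω, ∀ i k, partialDeriv i (fun x => z k x - y k x) x =
      partialDeriv i (z k) x - partialDeriv i (y k) x := by
  have h : ∀ {z : Fin n → E n → ℝ}, IsField Ω z → ∀ᵐ x ∂volume.restrict Ω, ∀ k, DifferentiableAt ℝ (z k) x := by
    intro z hz
    rw [ae_all_iff]
    intro k
    obtain ⟨K, hK⟩ := hz.lip k
    exact ae_restrict_of_ae hK.ae_differentiableAt
  filter_upwards [h hz, h hy] with x h1 h2 i k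
  rw [partialDeriv, fderiv_fun_sub (h1 k) (h2 k)]
  rfl

theorem IsSpline.sub {g q : E n → ℝ} (hg : IsSpline P m g) (hq : IsSpline P m q) :
    IsSpline P m fun x => g x - q x := by
  intro τ hτ
  obtain ⟨r, hr, h1⟩ := hg τ hτ
  obtain ⟨s, hs, h2⟩ := hq τ hτ
  exact ⟨_, hr.sub hs, fun x hx => by simp only [h1 hx, h2 hx]⟩

theorem IsSpline.of_refines (hn : n ≠ 0) (hP : IsPartition Ω P) (hP' : IsPartition Ω P') (h : Refines P P')
    {g : E n → ℝ} (hg : IsSpline P m g) : IsSpline P' m g := by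
  intro σ hσ
  obtain ⟨τ, hτ, hs⟩ := h.exists_ancestor hn hP σ hσ
  obtain ⟨r, hr, h1⟩ := hg τ hτ
  refine ⟨r, hr, fun x hx => h1 ?_⟩
  rw [← closure_openHull (hP.nondegenerate τ hτ)]
  rw [← closure_openHull (hP'.nondegenerate σ hσ)] at hx
  exact closure_mono hs hx

theorem IsField.integrableOn_mul (hb : IsBounded Ω) (hw : IsField Ω w) (hz : IsField Ω z) (i k : Fin n) :
    IntegrableOn (fun x => partialDeriv i (w k) x * partialDeriv i (z k) x) Ω :=
  (hw.memLp_partialDeriv hb i k).integrable_mul (hz.memLp_partialDeriv hb i k)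

theorem IsField.integrableOn_mul_divergence (hb : IsBounded Ω) (hz : IsField Ω z) {q : E n → ℝ}
    (hq : MemLp q 2 (volume.restrict Ω)) : IntegrableOn (fun x => q x * ∑ i, partialDeriv i (z i) x) Ω :=
  hq.integrable_mul (hz.memLp_divergence hb)

theorem dirichlet_eq_sum (hb : IsBounded Ω) (hw : IsField Ω w) (hz : IsField Ω z) :
    dirichlet Ω w z = ∑ i, ∑ k, ∫ x in Ω, partialDeriv i (w k) x * partialDeriv i (z k) x := by
  rw [dirichlet, integral_finsetSum _ fun i _ => integrable_finsetSum _ fun k _ => hw.integrableOn_mul hb hz i k]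
  exact sum_congr rfl fun i _ => integral_finsetSum _ fun k _ => hw.integrableOn_mul hb hz i k

theorem energy_eq_dirichlet (hb : IsBounded Ω) (hz : IsField Ω z) :
    energy Ω z = dirichlet Ω z z := by
  rw [dirichlet_eq_sum hb hz hz, sum_comm, energy]
  refine sum_congr rfl fun k _ => ?_
  rw [← integral_finsetSum _ fun i _ => hz.integrableOn_mul hb hz i k]
  refine integral_congr_ae (.of_forall fun x => ?_)
  simp only [← sum_sq_apply_basisVec]
  simp only [partialDeriv, sq]

theorem sq_dirichlet_le (hb : IsBounded Ω) (hw : IsField Ω w) (hz : IsField Ω z) :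
    dirichlet Ω w z ^ 2 ≤ energy Ω w * energy Ω z := by
  rw [energy_eq_dirichlet hb hw, energy_eq_dirichlet hb hz, dirichlet_eq_sum hb hw hz, dirichlet_eq_sum hb hw hw,
    dirichlet_eq_sum hb hz hz]
  simp only [← Fintype.sum_prod_type']
  refine Finset.sum_sq_le_sum_mul_sum_of_sq_le_mul _ (fun _ _ => integral_nonneg fun _ => mul_self_nonneg _)
    (fun _ _ => integral_nonneg fun _ => mul_self_nonneg _) fun ik _ => ?_
  have := sq_integral_mul_le (hw.memLp_partialDeriv hb ik.1 ik.2) (hz.memLp_partialDeriv hb ik.1 ik.2)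
  simpa only [sq] using this

theorem dirichlet_sub_right (hb : IsBounded Ω) (hw : IsField Ω w) (hz : IsField Ω z) (hy : IsField Ω y) :
    dirichlet Ω w (fun k x => z k x - y k x) = dirichlet Ω w z - dirichlet Ω w y := by
  simp only [dirichlet_eq_sum hb hw (hz.sub hy), dirichlet_eq_sum hb hw hz, dirichlet_eq_sum hb hw hy,
    ← sum_sub_distrib]
  refine sum_congr rfl fun i _ => sum_congr rfl fun k _ => ?_
  rw [← integral_sub (hw.integrableOn_mul hb hz i k) (hw.integrableOn_mul hb hy i k)]
  refine integral_congr_ae ?_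
  filter_upwards [hz.ae_partialDeriv_sub hy] with x hx
  simp only [hx, mul_sub]

theorem dirichlet_comm (w z : Fin n → E n → ℝ) : dirichlet Ω w z = dirichlet Ω z w := by
  simp only [dirichlet, mul_comm]

theorem divForm_sub_left (hb : IsBounded Ω) (hz : IsField Ω z) (hy : IsField Ω y) {q : E n → ℝ}
    (hq : MemLp q 2 (volume.restrict Ω)) :
    divForm Ω (fun k x => z k x - y k x) q = divForm Ω z q - divForm Ω y q := by
  rw [divForm, divForm, divForm, ← integral_sub (hz.integrableOn_mul_divergence hb hq)
    (hy.integrableOn_mul_divergence hb hq)]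
  refine integral_congr_ae ?_
  filter_upwards [hz.ae_partialDeriv_sub hy] with x hx
  simp only [hx, sum_sub_distrib, mul_sub]

theorem divForm_sub_right (hb : IsBounded Ω) (hz : IsField Ω z) {q r : E n → ℝ}
    (hq : MemLp q 2 (volume.restrict Ω)) (hr : MemLp r 2 (volume.restrict Ω)) :
    divForm Ω z (fun x => q x - r x) = divForm Ω z q - divForm Ω z r := by
  rw [divForm, divForm, divForm, ← integral_sub (hz.integrableOn_mul_divergence hb hq)
    (hz.integrableOn_mul_divergence hb hr)]
  simp only [sub_mul]

theorem integral_load_sub (hb : IsBounded Ω) (hf : MemLp f 2 (volume.restrict Ω))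
    (hz : IsField Ω z) (hy : IsField Ω y) :
    ∫ x in Ω, ∑ k, f x k * (z k x - y k x) = (∫ x in Ω, ∑ k, f x k * z k x) - ∫ x in Ω, ∑ k, f x k * y k x := by
  have h : ∀ {z : Fin n → E n → ℝ}, IsField Ω z → IntegrableOn (fun x => ∑ k, f x k * z k x) Ω := fun hz =>
    integrable_finsetSum _ fun k _ => ((EuclideanSpace.proj (𝕜 := ℝ) k : E n →L[ℝ] ℝ).comp_memLp' hf).integrable_mul
      (memLp_of_continuousOn_closure hb (hz.continuous k).continuousOn)
  rw [← integral_sub (h hz) (h hy)]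
  simp only [mul_sub, sum_sub_distrib]

theorem energy_eq_sum (hP : IsPartition Ω P) (hΩ : IsLipschitzDomain Ω) (hz : IsField Ω z) :
    energy Ω z = ∑ k, ∑ τ ∈ P, ∫ x in τ.closed, ‖fderiv ℝ (z k) x‖ ^ 2 :=
  sum_congr rfl fun k _ => by
    obtain ⟨K, hK⟩ := hz.lip k
    exact hP.integral_eq_sum hΩ ((memLp_fderiv hK hΩ.isBounded.measure_lt_top.ne).norm.integrable_sq)

/-- The residual of the coarse solution on fine velocities: the coarse equations allow subtracting a
quasi-interpolant that reproduces the field on the common simplices. -/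
theorem exists_residual_bound (hn : 1 < n) (hΩ : IsLipschitzDomain Ω) (hκ : 1 ≤ κ) (hd : d ≠ 0) :
    ∃ C : ℝ, 0 ≤ C ∧ ∀ P P' : Finset (TaggedSimplex n), IsMesh Ω κ P → ∀ (f u : E n → E n) (p : E n → ℝ)
      (w : Fin n → E n → ℝ) (π : E n → ℝ), GalerkinRep Ω d f P u p w π → MemLp f 2 (volume.restrict Ω) →
      ∀ z, IsField Ω z → (∀ k, IsSpline P' d (z k)) →
      ((∫ x in Ω, ∑ k, f x k * z k x) - dirichlet Ω w z + divForm Ω z π) ^ 2 ≤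
        C * eta0 f u p P (P \ P') * energy Ω z := by
  have : NeZero n := ⟨by omega⟩
  obtain ⟨A, hA0, hA⟩ := exists_velocity_quasiInterp hΩ hn hκ hd
  refine ⟨(2 + 2 * ((n + 1) * (κ ^ 2 * (n + 1 + κ ^ 2)))) * A, by positivity,
    fun P P' h f u p w π hG hf z hz hzs => ?_⟩
  have hP := h.toIsPartition
  have hb := hΩ.isBounded
  have hex : ∀ k, ∃ g, IsSpline P d g ∧ (∀ x ∉ Ω, g x = 0) ∧ (∀ τ ∈ P ∩ P', EqOn g (z k) τ.closed) ∧
      ∑ τ ∈ P, ((τ.size ^ 2)⁻¹ * (∫ x in τ.closed, (z k x - g x) ^ 2) +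
        ∫ x in τ.closed, ‖fderiv ℝ (fun x => z k x - g x) x‖ ^ 2) ≤
      A * ∑ τ ∈ P, ∫ x in τ.closed, ‖fderiv ℝ (z k) x‖ ^ 2 := fun k => by
    obtain ⟨K, hK⟩ := hz.lip k
    exact hA P h (P ∩ P') Finset.inter_subset_left (z k) K hK (hz.zero k) fun τ hτ =>
      hzs k τ (Finset.mem_inter.1 hτ).2
  choose g hgs hg0 hgz hgA using hex
  have hg : IsField Ω g := ⟨fun k => (hgs k).exists_lipschitzWith hP hΩ.isOpen (hg0 k), hg0⟩
  have hπ := memLp_of_continuousOn_closure hb (hG.spline'.continuousOn hP)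
  have h1 := hG.sq_residual_le hn h hΩ hf (hz.sub hg) Finset.sdiff_subset (R := P \ P') fun τ hτ hτR k x hx => by
    have : τ ∈ P ∩ P' := by
      rw [Finset.mem_sdiff, not_and, not_not] at hτR
      exact Finset.mem_inter.2 ⟨hτ, hτR hτ⟩
    rw [hgz k τ this hx, sub_self]
  have h2 := hG.momentum g hg hgs
  rw [integral_load_sub hb hf hz hg, dirichlet_sub_right hb hG.field hz hg,
    divForm_sub_left hb hz hg hπ, ← h2] at h1
  have h3 : ∑ τ ∈ P, localEnergy (fun k x => z k x - g k x) τ ≤ A * energy Ω z := by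
    simp only [localEnergy]
    rw [sum_comm, energy_eq_sum hP hΩ hz, mul_sum]
    exact sum_le_sum fun k _ => hgA k
  have h4 := eta0_nonneg f u p P (P \ P')
  calc _ = ((dirichlet Ω w g - divForm Ω g π) - (dirichlet Ω w g - divForm Ω g π) +
        ((∫ x in Ω, ∑ k, f x k * z k x) - dirichlet Ω w z + divForm Ω z π)) ^ 2 := by ring
    _ ≤ _ := le_trans (le_of_eq (by ring)) (h1.trans (mul_le_mul_of_nonneg_left h3 (by positivity)))
    _ = _ := by ring

/-- The divergence of the coarse velocity on fine pressures. -/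
theorem exists_divForm_bound (hn : 1 < n) (hΩ : IsLipschitzDomain Ω) (hκ : 1 ≤ κ) (hd : 2 ≤ d) :
    ∃ C : ℝ, 0 ≤ C ∧ ∀ P P' : Finset (TaggedSimplex n), IsMesh Ω κ P → ∀ (f u : E n → E n) (p : E n → ℝ)
      (w : Fin n → E n → ℝ) (π : E n → ℝ), GalerkinRep Ω d f P u p w π →
      ∀ q, ContinuousOn q (closure Ω) → IsSpline P' (d - 1) q →
      divForm Ω w q ^ 2 ≤ C * (∑ τ ∈ P \ P', ∫ x in τ.openHull, divergence u x ^ 2) * ∫ x in Ω, q x ^ 2 := by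
  have : NeZero n := ⟨by omega⟩
  obtain ⟨A, hA0, hA⟩ := exists_pressure_quasiInterp (κ := κ) hΩ hn hκ (m := d - 1) (by omega)
  refine ⟨2 + 2 * A, by positivity, fun P P' h f u p w π hG q hq hqs => ?_⟩
  have hP := h.toIsPartition
  have hb := hΩ.isBounded
  obtain ⟨g, hgs, hgq, hgA⟩ := hA P h (P ∩ P') Finset.inter_subset_left q hq fun τ hτ =>
    hqs τ (Finset.mem_inter.1 hτ).2
  have hq2 := memLp_of_continuousOn_closure hb hq
  have hg2 := memLp_of_continuousOn_closure hb (hgs.continuousOn hP)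
  have hdiv := hG.field.memLp_divergence hb
  have hmono : ∀ {r : E n → ℝ} {τ}, τ ∈ P → MemLp r 2 (volume.restrict Ω) → MemLp r 2 (volume.restrict τ.closed) :=
    fun hτ hr => hr.mono_measure (hP.restrict_closed_le hΩ hτ)
  have h1 : divForm Ω w q = ∑ τ ∈ P \ P', ∫ x in τ.closed, (q x - g x) * ∑ i, partialDeriv i (w i) x := by
    have h2 := divForm_sub_right hb hG.field hq2 hg2
    rw [hG.continuity g hgs, sub_zero] at h2
    rw [← h2, divForm, hP.integral_eq_sum hΩ
      (hG.field.integrableOn_mul_divergence hb (q := fun x => q x - g x) (hq2.sub hg2))]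
    refine (sum_subset Finset.sdiff_subset fun τ hτ hτR => ?_).symm
    have hmem : τ ∈ P ∩ P' := by
      rw [Finset.mem_sdiff, not_and, not_not] at hτR
      exact Finset.mem_inter.2 ⟨hτ, hτR hτ⟩
    exact setIntegral_eq_zero_of_forall_eq_zero fun x hx => by rw [hgq τ hmem hx, sub_self, zero_mul]
  have h3 : ∀ τ ∈ P, ∫ x in τ.closed, (∑ i, partialDeriv i (w i) x) ^ 2 = ∫ x in τ.openHull, divergence u x ^ 2 := by
    intro τ hτ
    rw [setIntegral_openHull (h.nondegenerate τ hτ)]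
    obtain ⟨r, hr, hwr, hur⟩ := hG.exists_poly hτ
    refine integral_congr_ae ?_
    filter_upwards [ae_mem_openHull_closed (h.nondegenerate τ hτ)] with x hx
    rw [divergence_eqOn hr hur hx]
    simp only [partialDeriv_congr_interior (hwr _) hx]
  have h4 := Finset.sum_sq_le_sum_mul_sum_of_sq_le_mul (P \ P')
    (r := fun τ => ∫ x in τ.closed, (q x - g x) * ∑ i, partialDeriv i (w i) x)
    (f := fun τ => ∫ x in τ.closed, (q x - g x) ^ 2) (g := fun τ => ∫ x in τ.openHull, divergence u x ^ 2)
    (fun _ _ => integral_sq_nonneg _) (fun _ _ => integral_sq_nonneg _)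
    fun τ hτ => by
      have hτP := Finset.sdiff_subset hτ
      rw [← h3 τ hτP]
      exact sq_integral_mul_le ((hmono hτP hq2).sub (hmono hτP hg2)) (hmono hτP hdiv)
  have h5 : ∑ τ ∈ P \ P', ∫ x in τ.closed, (q x - g x) ^ 2 ≤ (2 + 2 * A) * ∫ x in Ω, q x ^ 2 := by
    have hqe := hP.integral_eq_sum hΩ hq2.integrable_sq
    calc ∑ τ ∈ P \ P', ∫ x in τ.closed, (q x - g x) ^ 2
        ≤ ∑ τ ∈ P, ∫ x in τ.closed, (q x - g x) ^ 2 := Finset.sum_le_sum_of_subset_of_nonneg Finset.sdiff_subset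
          fun _ _ _ => integral_sq_nonneg _
      _ ≤ ∑ τ ∈ P, (2 * (∫ x in τ.closed, q x ^ 2) + 2 * ∫ x in τ.closed, g x ^ 2) := by
          refine sum_le_sum fun τ hτ => ?_
          have h6 := (hmono hτ hq2).integrable_sq
          have h7 := (hmono hτ hg2).integrable_sq
          rw [← integral_const_mul, ← integral_const_mul, ← integral_add (h6.const_mul 2) (h7.const_mul 2)]
          exact integral_mono ((hmono hτ hq2).sub (hmono hτ hg2)).integrable_sq
            ((h6.const_mul 2).add (h7.const_mul 2)) fun x => by
              simp only
              nlinarith [sq_nonneg (q x + g x)]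
      _ ≤ 2 * (∫ x in Ω, q x ^ 2) + 2 * (A * ∫ x in Ω, q x ^ 2) := by
          rw [sum_add_distrib, ← mul_sum, ← mul_sum, hqe]
          linarith
      _ = _ := by ring
  rw [h1]
  refine h4.trans ((mul_le_mul_of_nonneg_right h5 (sum_nonneg fun _ _ => integral_nonneg fun _ =>
    sq_nonneg _)).trans_eq (by ring))

/-- The inf-sup condition bounds a pressure by the functional that it induces on the velocities. -/
theorem InfSupStable.sqrt_le {C M : ℝ} (h : InfSupStable Ω d C P) (hP : IsPartition Ω P)
    (hΩ : IsLipschitzDomain Ω) (hw : IsField Ω w) (hws : ∀ k, IsSpline P d (w k)) {q r : E n → ℝ}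
    (hq : q ∈ QP Ω P d) (hqr : q =ᵐ[volume.restrict Ω] r) (hM : 0 ≤ M)
    (hr : ∀ z, IsField Ω z → (∀ k, IsSpline P d (z k)) → |divForm Ω z r| ≤ M * √(energy Ω z)) :
    √(∫ x in Ω, r x ^ 2) ≤ |C| * M := by
  have h1 : ∀ v : VP Ω P d, |b Ω v q / normV Ω v| ≤ M := by
    rintro ⟨v, hv⟩
    obtain ⟨z, hz, hzs, he⟩ := VP.exists_field hΩ hP hv
    have hva : ∀ k, (fun x => v x k) =ᵐ[volume.restrict Ω] z k := fun k => hP.ae_eq_of_eqOn hΩ.isOpen (he k)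
    have h2 := hr z hz hzs
    rw [← b_eq_divForm hΩ.isOpen hz hva hqr] at h2
    have h3 : √(energy Ω z) ≤ normV Ω v := by
      refine Real.sqrt_le_sqrt ?_
      rw [normSqV_eq hΩ.isOpen hΩ.isBounded hz hva]
      exact le_add_of_nonneg_left (sum_nonneg fun k _ => integral_sq_nonneg _)
    have h4 : |normV Ω v| = normV Ω v := abs_of_nonneg (Real.sqrt_nonneg _)
    rw [abs_div, h4]
    exact div_le_of_le_mul₀ (Real.sqrt_nonneg _) hM (h2.trans (mul_le_mul_of_nonneg_left h3 hM))
  have h2 : |⨆ v : VP Ω P d, b Ω v q / normV Ω v| ≤ M := by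
    refine abs_le.2 ⟨?_, Real.iSup_le (fun v => (abs_le.1 (h1 v)).2) hM⟩
    exact (abs_le.1 (h1 ⟨_, hw.mem_VP hΩ hws⟩)).1.trans
      (le_ciSup (f := fun v : VP Ω P d => b Ω v q / normV Ω v) ⟨M, by
        rintro _ ⟨v, rfl⟩
        exact (abs_le.1 (h1 v)).2⟩ _)
  have h3 := h q hq
  have h4 : normQ Ω q = √(∫ x in Ω, r x ^ 2) := by
    rw [normQ, normSqQ]
    congr 1
    refine integral_congr_ae ?_
    filter_upwards [hqr] with x hx
    rw [hx]
  rw [← h4]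
  exact (h3.trans (le_abs_self _)).trans (by rw [abs_mul]; exact mul_le_mul_of_nonneg_left h2 (abs_nonneg _))

/-- The error equations, tested with the errors of the velocity and of the pressure. -/
theorem exists_reliability (hn : 1 < n) (hΩ : IsLipschitzDomain Ω) (hκ : 1 ≤ κ) (hd : 2 ≤ d) (Cs : ℝ) :
    ∃ C : ℝ, ∀ P P' : Finset (TaggedSimplex n), IsMesh Ω κ P → IsMesh Ω κ P' → Refines P P' →
      InfSupStable Ω d Cs P' → ∀ (f : E n → E n), MemLp f 2 (volume.restrict Ω) →
      ∀ (u u' : E n → E n) (p p' : E n → ℝ), IsGalerkin Ω d f P u p → IsGalerkin Ω d f P' u' p' →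
        normSqV Ω (u' - u) + normSqQ Ω (p' - p) ≤ C * eta1 f u p P (P \ P') := by
  have : NeZero n := ⟨by omega⟩
  have hO := hΩ.isOpen
  have hb := hΩ.isBounded
  obtain ⟨F, hF0, hF⟩ := friedrichs (n := n) hb
  obtain ⟨A, hA0, hA⟩ := exists_residual_bound (d := d) hn hΩ hκ (by omega)
  obtain ⟨B, hB0, hB⟩ := exists_divForm_bound (κ := κ) hn hΩ hκ hd
  set c := |Cs|
  have hc0 : 0 ≤ c := abs_nonneg _
  refine ⟨((F + 1 + 2 * c ^ 2) * (3 * (c ^ 2 + 1)) + 2 * c ^ 2) * (A + B),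
    fun P P' h h' href hstab f hf u u' p p' hu hu' => ?_⟩
  have hP := h.toIsPartition
  have hP' := h'.toIsPartition
  obtain ⟨w, π, hG⟩ := hu.exists_rep hΩ hP
  obtain ⟨w', π', hG'⟩ := hu'.exists_rep hΩ hP'
  set e : Fin n → E n → ℝ := fun k x => w' k x - w k x
  set r : E n → ℝ := fun x => π' x - π x
  have he : IsField Ω e := hG'.field.sub hG.field
  have hn0 : n ≠ 0 := by omega
  have hes : ∀ k, IsSpline P' d (e k) := fun k => (hG'.spline k).sub ((hG.spline k).of_refines hn0 hP hP' href)
  have hrs : IsSpline P' (d - 1) r := hG'.spline'.sub (hG.spline'.of_refines hn0 hP hP' href)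
  have hπ := memLp_of_continuousOn_closure hb (hG.spline'.continuousOn hP)
  have hπ' := memLp_of_continuousOn_closure hb (hG'.spline'.continuousOn hP')
  have hrc := hrs.continuousOn hP'
  have := hb.isFiniteMeasure
  have hrQ : r ∈ QP Ω P' d := by
    refine ⟨⟨hπ'.sub hπ, ?_⟩, hrc.mono subset_closure, hrs.isPiecewisePoly⟩
    rw [integral_sub (hπ'.integrable one_le_two) (hπ.integrable one_le_two), hG.mean, hG'.mean, sub_zero]
  set N := eta0 f u p P (P \ P')
  set D := ∑ τ ∈ P \ P', ∫ x in τ.openHull, divergence u x ^ 2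
  have hN0 : 0 ≤ N := eta0_nonneg _ _ _ _ _
  have hD0 : 0 ≤ D := sum_nonneg fun _ _ => integral_sq_nonneg _
  set H := √(A * N)
  set G := √(B * D)
  have hH2 : H ^ 2 = A * N := Real.sq_sqrt (by positivity)
  have hG2 : G ^ 2 = B * D := Real.sq_sqrt (by positivity)
  set t := √(energy Ω e)
  have ht2 : t ^ 2 = energy Ω e := Real.sq_sqrt (energy_nonneg _ _)
  set s := √(∫ x in Ω, r x ^ 2)
  have hs2 : s ^ 2 = ∫ x in Ω, r x ^ 2 := Real.sq_sqrt (integral_sq_nonneg _)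
  -- the error equations
  have h1 : ∀ z, IsField Ω z → (∀ k, IsSpline P' d (z k)) →
      |dirichlet Ω e z - divForm Ω z r| ≤ H * √(energy Ω z) := by
    intro z hz hzs
    have h2 := hA P P' h f u p w π hG hf z hz hzs
    rw [← hG'.momentum z hz hzs] at h2
    have h3 : dirichlet Ω e z - divForm Ω z r =
        dirichlet Ω w' z - divForm Ω z π' - dirichlet Ω w z + divForm Ω z π := by
      rw [dirichlet_comm, dirichlet_sub_right hb hz hG'.field hG.field, divForm_sub_right hb hz hπ' hπ,
        dirichlet_comm z w', dirichlet_comm z w]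
      ring
    rw [h3, ← Real.sqrt_mul (by positivity)]
    exact Real.abs_le_sqrt h2
  have h2 : |divForm Ω e r| ≤ G * s := by
    rw [← Real.sqrt_mul (by positivity)]
    refine Real.abs_le_sqrt ?_
    have h3 : divForm Ω e r = -divForm Ω w r := by
      rw [divForm_sub_left (q := r) hb hG'.field hG.field (hπ'.sub hπ), hG'.continuity r hrs, zero_sub]
    rw [h3, neg_sq]
    exact hB P P' h f u p w π hG r hrc hrs
  have h3 : s ≤ c * (t + H) := by
    refine hstab.sqrt_le hP' hΩ he hes hrQ (ae_eq_refl _) (by positivity) fun z hz hzs => ?_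
    have h4 := h1 z hz hzs
    have h5 : |dirichlet Ω e z| ≤ t * √(energy Ω z) := by
      rw [← Real.sqrt_mul (energy_nonneg _ _)]
      exact Real.abs_le_sqrt (sq_dirichlet_le hb he hz)
    calc |divForm Ω z r| = |dirichlet Ω e z - (dirichlet Ω e z - divForm Ω z r)| := by rw [sub_sub_cancel]
      _ ≤ |dirichlet Ω e z| + |dirichlet Ω e z - divForm Ω z r| := abs_sub _ _
      _ ≤ _ := by linarith
  have h4 : t ^ 2 ≤ G * s + H * t := by
    have h5 := (abs_le.1 (h1 e he hes)).2
    rw [← energy_eq_dirichlet hb he] at h5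
    have h6 := (abs_le.1 h2).2
    rw [ht2]
    linarith
  have ht0 : 0 ≤ t := Real.sqrt_nonneg _
  have hs0 : 0 ≤ s := Real.sqrt_nonneg _
  have hH0 : 0 ≤ H := Real.sqrt_nonneg _
  have hG0 : 0 ≤ G := Real.sqrt_nonneg _
  have h5 : t ^ 2 ≤ 3 * (c ^ 2 * G ^ 2 + H ^ 2) := by
    have h6 := mul_le_mul_of_nonneg_left h3 hG0
    nlinarith [sq_nonneg (t - (G * c + H)), sq_nonneg (G * c - H)]
  have h6 : s ^ 2 ≤ 2 * c ^ 2 * (t ^ 2 + H ^ 2) := by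
    have h7 := pow_le_pow_left₀ hs0 h3 2
    nlinarith [mul_nonneg (sq_nonneg c) (sq_nonneg (t - H))]
  have h7 : normSqV Ω (u' - u) ≤ (F + 1) * t ^ 2 := by
    have hua : ∀ k, (fun x => (u' - u) x k) =ᵐ[volume.restrict Ω] e k := fun k => by
      filter_upwards [hP'.ae_eq_of_eqOn hO (hG'.eqOn k), hP.ae_eq_of_eqOn hO (hG.eqOn k)] with x h8 h9
      rw [Pi.sub_apply, PiLp.sub_apply, h8, h9]
    rw [normSqV_eq hO hb he hua, ht2, add_mul, one_mul]
    refine add_le_add_left ?_ _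
    rw [energy, mul_sum]
    refine sum_le_sum fun k _ => ?_
    obtain ⟨K, hK⟩ := he.lip k
    exact hF (e k) K hK (he.zero k)
  have h8 : normSqQ Ω (p' - p) = s ^ 2 := by
    rw [hs2, normSqQ]
    refine setIntegral_congr_fun hO.measurableSet fun x hx => ?_
    simp only [Pi.sub_apply, hG.eqOn' hx, hG'.eqOn' hx, r]
  have h9 : G ^ 2 + H ^ 2 ≤ (A + B) * (N + D) := by
    rw [hH2, hG2]
    nlinarith [mul_nonneg hA0 hD0, mul_nonneg hB0 hN0]
  have h10 : c ^ 2 * G ^ 2 + H ^ 2 ≤ (c ^ 2 + 1) * (G ^ 2 + H ^ 2) := by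
    nlinarith [sq_nonneg G, mul_nonneg (sq_nonneg c) (sq_nonneg H)]
  rw [h8, eta1]
  calc normSqV Ω (u' - u) + s ^ 2 ≤ (F + 1) * t ^ 2 + 2 * c ^ 2 * (t ^ 2 + H ^ 2) := add_le_add h7 h6
    _ = (F + 1 + 2 * c ^ 2) * t ^ 2 + 2 * c ^ 2 * H ^ 2 := by ring
    _ ≤ (F + 1 + 2 * c ^ 2) * (3 * ((c ^ 2 + 1) * (G ^ 2 + H ^ 2))) + 2 * c ^ 2 * (G ^ 2 + H ^ 2) := by
        gcongr
        · exact h5.trans (by linarith)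
        · exact le_add_of_nonneg_left (sq_nonneg G)
    _ = ((F + 1 + 2 * c ^ 2) * (3 * (c ^ 2 + 1)) + 2 * c ^ 2) * (G ^ 2 + H ^ 2) := by ring
    _ ≤ ((F + 1 + 2 * c ^ 2) * (3 * (c ^ 2 + 1)) + 2 * c ^ 2) * ((A + B) * (N + D)) := by gcongr
    _ = _ := by ring

end Reliability

end Stokes

end

theorem mainTheorem6 (n d : ℕ) (hn : n = 2 ∨ n = 3) (hd : 2 ≤ d)
    (Ω : Set (Stokes.E n)) (hΩ : Stokes.IsLipschitzDomain Ω)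
    (P₀ : Finset (Stokes.TaggedSimplex n)) (hP₀ : Stokes.IsPartition Ω P₀)
    (hP₀conf : Stokes.IsConforming P₀)
    (hstab : ∃ Cs : ℝ, ∀ P ∈ Stokes.conf P₀, Stokes.InfSupStable Ω d Cs P) :
    (∃ C : ℝ, ∀ f : Stokes.E n → Stokes.E n, MemLp f 2 (volume.restrict Ω) →
      ∀ P ∈ Stokes.conf P₀, ∀ P' ∈ Stokes.conf P₀, Stokes.Refines P P' →
      ∀ (u u' : Stokes.E n → Stokes.E n) (p p' : Stokes.E n → ℝ),
        Stokes.IsGalerkin Ω d f P u p → Stokes.IsGalerkin Ω d f P' u' p' →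
        Stokes.normSqV Ω (u' - u) + Stokes.normSqQ Ω (p' - p)
          ≤ C * Stokes.eta1 f u p P (P \ P')) ∧
    (∃ α β : ℝ, 0 < α ∧ ∀ f : Stokes.E n → Stokes.E n, MemLp f 2 (volume.restrict Ω) →
      ∀ P ∈ Stokes.conf P₀, ∀ (u : Stokes.E n → Stokes.E n) (p : Stokes.E n → ℝ),
        Stokes.IsGalerkin Ω d f P u p → ∀ Q ⊆ P,
          α * Stokes.eta1 f u p P Q ≤ Stokes.eta2 f u p P Q ∧
          Stokes.eta2 f u p P Q ≤ β * Stokes.eta1 f u p P Q) := by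
  have hn1 : 1 < n := by omega
  have : NeZero n := ⟨by omega⟩
  obtain ⟨Cs, hCs⟩ := hstab
  obtain ⟨κ, hκ, hreg⟩ := Stokes.exists_shapeRegular_of_refines hn hP₀
  have hmesh : ∀ P ∈ Stokes.conf P₀, Stokes.IsMesh Ω κ P := fun P hP =>
    { toIsPartition := hP.1.isPartition (by omega) hP₀
      conforming := hP.2
      one_le := hκ
      regular := hreg P hP.1 }
  obtain ⟨C, hC⟩ := Stokes.exists_reliability hn1 hΩ hκ hd Cs
  obtain ⟨A, hA0, hA⟩ := Stokes.exists_eta_equivalence (n := n) hΩ hκ hd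
  refine ⟨⟨C, fun f hf P hP P' hP' href u u' p p' hu hu' =>
    hC P P' (hmesh P hP) (hmesh P' hP') href (hCs P' hP') f hf u u' p p' hu hu'⟩,
    (A + 1)⁻¹, A + 1, by positivity, fun f _ P hP u p hu R hR => ?_⟩
  have h0 := Stokes.eta0_nonneg f u p P R
  have h1 := Finset.sum_le_sum fun τ hτ => (hA P (hmesh P hP) f u p hu τ (hR hτ)).1
  have h2 := Finset.sum_le_sum fun τ hτ => (hA P (hmesh P hP) f u p hu τ (hR hτ)).2
  have h3 : 0 ≤ ∑ τ ∈ R, ∫ x in τ.openHull, Stokes.divergence u x ^ 2 :=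
    Finset.sum_nonneg fun _ _ => integral_nonneg fun _ => sq_nonneg _
  have h4 : 0 ≤ ∑ τ ∈ R, τ.size * ∫ x in frontier τ.openHull, τ.traceFrom (Stokes.divergence u) x ^ 2
      ∂(Stokes.surface n) :=
    Finset.sum_nonneg fun τ _ => mul_nonneg (Real.rpow_nonneg measureReal_nonneg _)
      (integral_nonneg fun _ => sq_nonneg _)
  rw [← Finset.mul_sum] at h1 h2
  rw [Stokes.eta1, Stokes.eta2]
  constructor
  · rw [inv_mul_le_iff₀ (by positivity)]
    nlinarith [mul_nonneg hA0 h0]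
  · nlinarith [mul_nonneg hA0 h0]
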